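/- **Setting.** Let $S$ be a locally Noetherian algebraic space. All stacks are stacks in groupoids over the category $(\mathrm{Aff}/S)$ of affine schemes over $S$ for the étale topology. An *extension pair* is a pair of surjections of Noetherian $\mathcal O_S$-algebras $B'\xrightarrow{q}B\xrightarrow{q_0}B_0$ with nilpotent kernels such that $B_0$ is reduced and $M:=\ker q$ is annihilated by $\ker(q_0q)$; so $M$ is a finite $B_0$-module. For a surjection $M\to N$ put $B'_N:=B'/\ker(M\to N)$. A stack $\mathcal X$ satisfies (S1) (the Schlessinger–Rim condition) if for every extension pair $A'\to A\to A_0$ and every homomorphism $C\to A$ of Noetherian $\mathcal O_S$-algebras with $C\to A_0$ surjective, the functor $\mathcal X(A'\times_AC)\to\mathcal X(A')\times_{\mathcal X(A)}\mathcal X(C)$ is an equivalence. For a reduced Noetherian $\mathcal O_S$-algebra $A_0$, an object $a_0$ of $\mathcal X(A_0)$ and a finite $A_0$-module $M$, let $D_{a_0}(M)$ be the set of isomorphism classes of deformations of $a_0$ over the trivial extension $A_0+M$; by (S1) it is an $A_0$-module. Consider the following conditions, for all reduced $\mathcal O_S$-algebras $A_0$ of finite type, all $a_0\in\mathcal X(A_0)$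 and all finite $A_0$-modules $M$: * (S2) $D_{a_0}(M)$ is a finite $A_0$-module; * (4.1.i) for every étale $A_0\to B_0$ the natural map $D_{a_0}(M)\otimes_{A_0}B_0\to D_{a_0|B_0}(M\otimes_{A_0}B_0)$ is an isomorphism; * (4.1.iii) there is a dense open subset $U\subset\operatorname{Spec}A_0$ such that for every point of finite type $p\in U$ the natural map $D_{a_0}(M)\otimes_{A_0}k(p)\to D_{a_0|k(p)}(M\otimes_{A_0}k(p))$ is an isomorphism. Let $f:\mathcal X\to\mathcal Y$ be a 1-morphism. A *deformation situation over $f$* consists of an extension pair $B'\to B\to B_0$, an object $b$ of $\mathcal X(B)$ and a morphism $f(b)\to y'$ of $\mathcal Y$ over $\operatorname{Spec}B\to\operatorname{Spec}B'$; it is *algebraic* if $B_0$ is an $\mathcal O_S$-algebra of finite type. It can be base changed along homomorphisms $B'\to C'$ (replacing $B,B_0$ by $C'\otimes_{B'}B$, $C'\otimes_{B'}B_0$); each localization $A_0$ of $B_0$ comes from a unique localization $A'$ of $B'$, with $A:=A'\otimes_{B'}B$. Let $\mathfrak a\subset B_0$ be a radical ideal with $\mathfrak aM=0$, and let $R$ be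 the semilocalization of $B_0$ at the generic points of $V(\mathfrak a)$. A *finite type, projective, extending, $\mathfrak a$-generic quotient* is a pair $(A_0,N)$ of a localization $A_0$ of $B_0$ and a quotient $N$ of the $A_0$-module $M\otimes_{B_0}A_0$ such that $\operatorname{Spec}A_0\cap V(\mathfrak a)$ is dense in $V(\mathfrak a)$, $A_0$ is a $B_0$-algebra of finite type, $N$ is a projective $A_0/\mathfrak aA_0$-module, and for the deformation situation restricted to $A'_N\to A\to A_0$ there is a lifting to $\mathcal X$, that is, a morphism $b|_A\to a'$ of $\mathcal X$ over $\operatorname{Spec}A\to\operatorname{Spec}A'_N$ whose image under $f$ is isomorphic to $f(b|_A)\to y'|_{A'_N}$, compatibly with the identity of $f(b|_A)$. Such a pair $(A_0,N)$ is an *$\mathfrak a$-generic extender* if for every finite type, projective, extending, $\mathfrak a$-generic quotient $(C_0,P)$ the quotient $P\otimes_{C_0}R$ of $M\otimes_{B_0}R$ factors through $N\otimes_{A_0}R$. It is * *compatible with étale extensions* if for every étale homomorphism $B'\to B'_{\text{ét}}$, with $B_{\text{ét},0}=B'_{\text{ét}}\otimes_{B'}B_0$, the pair $(A_0\otimes_{B_0}B_{\text{ét},0},\,N\otimes_{B_0}B_{\text{ét},0})$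 is an $\mathfrak aB_{\text{ét},0}$-generic extender for the deformation situation base changed to $B'_{\text{ét}}$; * *compatible with closed points* if for every closed point $y$ of $\operatorname{Spec}A_0$ and every surjection $M\otimes_{B_0}k(y)\to N_y$, the deformation situation restricted to $A'_{N_y}\to A\to A_0$ has a lifting to $\mathcal X$ if and only if $N_y$ is a quotient of $N\otimes_{A_0}k(y)$. We say that $f$ *has compatible generic extenders* if for every algebraic deformation situation over $f$ and every radical ideal $\mathfrak a\subset B_0$ with $\mathfrak aM=0$ there is an $\mathfrak a$-generic extender that is compatible with étale extensions and with closed points. **Proposition.** Let $e:\mathcal W\to\mathcal X$ and $f:\mathcal X\to\mathcal Y$ be 1-morphisms of stacks in groupoids over $(\mathrm{Aff}/S)$. Assume that each of $\mathcal W,\mathcal X,\mathcal Y$ satisfies (S1), (S2), (4.1.i) and (4.1.iii). If $e$ and $f$ have compatible generic extenders, then so does $f\circ e$. -/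

import Mathlib

open CategoryTheory AlgebraicGeometry Opposite
open scoped TensorProduct Pseudofunctor.StrongTrans

universe v w u

namespace ArtinStack

noncomputable section

/-! ### The base and the category of affine schemes over it -/

/-- A locally Noetherian algebraic space: an étale sheaf of sets on schemes whose diagonal is
representable by schemes and which admits an étale surjection from a locally Noetherian scheme. -/
structure IsLocallyNoetherianAlgebraicSpace (S : Scheme.{u}ᵒᵖ ⥤ Type u) : Prop where
  isSheaf : Presheaf.IsSheaf Scheme.etaleTopology S
  diag : yoneda.relativelyRepresentable (Limits.diag S)
  exists_atlas : ∃ (U : Scheme.{u}) (p : yoneda.obj U ⟶ S), IsLocallyNoetherian U ∧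
    MorphismProperty.presheaf (@Etale ⊓ @Surjective) p

/-- An object of `(Aff/S)`: a ring `A` with a morphism `Spec A ⟶ S`, that is, an
`𝒪_S`-algebra `A`. -/
structure AffOver (S : Scheme.{u}ᵒᵖ ⥤ Type u) where
  ring : CommRingCat.{u}
  pt : S.obj (op (Spec ring))

namespace AffOver

variable {S : Scheme.{u}ᵒᵖ ⥤ Type u}

/-- A morphism `Spec B ⟶ Spec A` over `S`: a homomorphism `A ⟶ B` of `𝒪_S`-algebras. -/
@[ext]
structure Hom (V U : AffOver S) where
  toRing : U.ring ⟶ V.ring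
  w : S.map (Spec.map toRing).op U.pt = V.pt

instance : Category (AffOver S) where
  Hom V U := Hom V U
  id U := ⟨𝟙 _, by simp⟩
  comp f g := ⟨g.toRing ≫ f.toRing, by simp [g.w, f.w]⟩

@[ext]
lemma hom_ext {V U : AffOver S} {f g : V ⟶ U} (h : f.toRing = g.toRing) : f = g :=
  Hom.ext h

@[simp] lemma id_toRing (U : AffOver S) : Hom.toRing (𝟙 U) = 𝟙 U.ring := rfl

@[simp] lemma comp_toRing {W V U : AffOver S} (f : W ⟶ V) (g : V ⟶ U) :
    (f ≫ g).toRing = g.toRing ≫ f.toRing := rfl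

/-- The forgetful functor to schemes. -/
def toScheme (S : Scheme.{u}ᵒᵖ ⥤ Type u) : AffOver S ⥤ Scheme.{u} where
  obj U := Spec U.ring
  map f := Spec.map f.toRing
  map_id U := by simp
  map_comp f g := by simp

/-- The étale topology on `(Aff/S)`. -/
def etaleTopology (S : Scheme.{u}ᵒᵖ ⥤ Type u) : GrothendieckTopology (AffOver S) :=
  (Scheme.etalePrecoverage.comap (toScheme S)).toGrothendieck

/-- An algebra over an `𝒪_S`-algebra, as an `𝒪_S`-algebra. -/
abbrev spec (U : AffOver S) {A : Type u} [CommRing A] (φ : U.ring →+* A) : AffOver S :=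
  ⟨.of A, S.map (Spec.map (CommRingCat.ofHom φ)).op U.pt⟩

/-- The structure morphism `Spec A ⟶ U` of an algebra `A` over `U.ring`. -/
def specHom (U : AffOver S) {A : Type u} [CommRing A] (φ : U.ring →+* A) : U.spec φ ⟶ U :=
  ⟨CommRingCat.ofHom φ, rfl⟩

/-- A commutative square of rings gives a morphism over `S`. -/
def specMap {V U : AffOver S} (g : V ⟶ U) {A B : Type u} [CommRing A] [CommRing B]
    (φ : U.ring →+* A) (ψ : V.ring →+* B) (h : A →+* B)
    (comm : h.comp φ = ψ.comp g.toRing.hom) : V.spec ψ ⟶ U.spec φ :=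
  ⟨CommRingCat.ofHom h, by
    have e : CommRingCat.ofHom φ ≫ CommRingCat.ofHom h = g.toRing ≫ CommRingCat.ofHom ψ := by
      ext x; exact congrArg (fun k => k x) comm
    calc S.map (Spec.map (CommRingCat.ofHom h)).op
          (S.map (Spec.map (CommRingCat.ofHom φ)).op U.pt)
        = S.map (Spec.map (CommRingCat.ofHom φ ≫ CommRingCat.ofHom h)).op U.pt := by simp
      _ = S.map (Spec.map (g.toRing ≫ CommRingCat.ofHom ψ)).op U.pt := by rw [e]
      _ = S.map (Spec.map (CommRingCat.ofHom ψ)).op V.pt := by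
        rw [← g.w]; simp⟩

/-- The `𝒪_S`-algebra is of finite type: `Spec A ⟶ S` is (representable and) of finite type. -/
def IsFiniteType (U : AffOver S) : Prop :=
  MorphismProperty.presheaf (@LocallyOfFiniteType ⊓ @QuasiCompact) (yonedaEquiv.symm U.pt)

end AffOver

/-! ### Stacks in groupoids over `(Aff/S)` -/

/-- Pseudofunctors `(Aff/S)ᵒᵖ ⥤ Cat`, i.e. categories fibred over `(Aff/S)` with a
(normalised) cleavage.  Their 1-morphisms are the strong transformations. -/
abbrev Fibred (S : Scheme.{u}ᵒᵖ ⥤ Type u) := Pseudofunctor (LocallyDiscrete (AffOver S)ᵒᵖ) Cat.{v, w}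

/-- Stacks in groupoids over `(Aff/S)` for the étale topology. -/
structure IsStackInGroupoids {S : Scheme.{u}ᵒᵖ ⥤ Type u} (X : Fibred.{v, w} S) : Prop where
  isStack : X.IsStack (AffOver.etaleTopology S)
  isGroupoid : ∀ U, IsGroupoid (X.obj U)

variable {S : Scheme.{u}ᵒᵖ ⥤ Type u}

namespace Fibred

variable (X : Fibred.{v, w} S)

/-- The fibre category over `U`. -/
abbrev Fib (U : AffOver S) := X.obj (.mk (op U))

/-- Restriction along `g : V ⟶ U`. -/
abbrev res {V U : AffOver S} (g : V ⟶ U) : X.Fib U ⥤ X.Fib V :=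
  (X.map g.op.toLoc).toFunctor

/-- The coherence isomorphism `k^* ≅ g^* ⋙ h^*` for `k = h ≫ g`. -/
def resComp {W V U : AffOver S} (h : W ⟶ V) (g : V ⟶ U) (k : W ⟶ U) (hk : h ≫ g = k) :
    X.res k ≅ X.res g ⋙ X.res h :=
  Cat.Hom.toNatIso (X.mapComp' g.op.toLoc h.op.toLoc k.op.toLoc (by subst hk; rfl))

/-- The coherence isomorphism for a commutative square. -/
def resSq {W V V' U : AffOver S} (h : W ⟶ V) (g : V ⟶ U) (h' : W ⟶ V') (g' : V' ⟶ U)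
    (e : h ≫ g = h' ≫ g') : X.res g ⋙ X.res h ≅ X.res g' ⋙ X.res h' :=
  (X.resComp h g (h ≫ g) rfl).symm ≪≫ X.resComp h' g' (h ≫ g) e.symm

/-- The coherence isomorphism `(𝟙)^* ≅ 𝟭`. -/
def resId (U : AffOver S) : X.res (𝟙 U) ≅ 𝟭 (X.Fib U) :=
  Cat.Hom.toNatIso (X.mapId' (𝟙 U : U ⟶ U).op.toLoc (by rfl))


section coherence

variable {X}

lemma resComp_naturality {W V U : AffOver S} (h : W ⟶ V) (g : V ⟶ U) (k : W ⟶ U)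
    (hk : h ≫ g = k) {x y : X.Fib U} (a : x ⟶ y) :
    (X.res k).map a ≫ (X.resComp h g k hk).hom.app y =
      (X.resComp h g k hk).hom.app x ≫ (X.res h).map ((X.res g).map a) :=
  (X.resComp h g k hk).hom.naturality a

lemma resComp_assoc {Z W V U : AffOver S} (l : Z ⟶ W) (h : W ⟶ V) (g : V ⟶ U)
    (lh : Z ⟶ V) (hg : W ⟶ U) (k : Z ⟶ U) (h₁ : l ≫ h = lh) (h₂ : h ≫ g = hg)
    (h₃ : l ≫ hg = k) (h₄ : lh ≫ g = k) (x : X.Fib U) :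
    (X.resComp l hg k h₃).hom.app x ≫ (X.res l).map ((X.resComp h g hg h₂).hom.app x) =
      (X.resComp lh g k h₄).hom.app x ≫ (X.resComp l h lh h₁).hom.app ((X.res g).obj x) := by
  subst h₁ h₂ h₃
  exact X.mapComp'₀₂₃_hom_comp_mapComp'_hom_whiskerRight_app g.op.toLoc h.op.toLoc l.op.toLoc
    _ _ _ rfl rfl rfl x

lemma resComp_id_left {V U : AffOver S} (g : V ⟶ U) (x : X.Fib U) :
    (X.resComp (𝟙 V) g g (Category.id_comp g)).hom.app x ≫
      (X.resId V).hom.app ((X.res g).obj x) = 𝟙 _ := by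
  have h := X.mapComp'_comp_id_hom_app g.op.toLoc x
  have h' : (X.resComp (𝟙 V) g g (Category.id_comp g)).hom.app x =
      (X.mapId (.mk (op V))).inv.toNatTrans.app ((X.res g).obj x) := h.trans (by simp)
  have h₂ : (X.resId V).hom.app ((X.res g).obj x) =
      (X.mapId (.mk (op V))).hom.toNatTrans.app ((X.res g).obj x) := by
    simp only [resId, Cat.Hom.toNatIso_hom]
    exact congrArg (fun (e : X.map (𝟙 _) ≅ 𝟙 _) => e.hom.toNatTrans.app ((X.res g).obj x))
      (X.mapId'_eq_mapId (.mk (op V)))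
  rw [h', h₂]
  exact (Cat.Hom.toNatIso (X.mapId (.mk (op V)))).inv_hom_id_app _

lemma resComp_id_right {V U : AffOver S} (g : V ⟶ U) (x : X.Fib U) :
    (X.resComp g (𝟙 U) g (Category.comp_id g)).hom.app x ≫
      (X.res g).map ((X.resId U).hom.app x) = 𝟙 _ := by
  have h := X.mapComp'_id_comp_hom_app g.op.toLoc x
  have h' : (X.resComp g (𝟙 U) g (Category.comp_id g)).hom.app x =
      (X.res g).map ((X.mapId (.mk (op U))).inv.toNatTrans.app x) := h.trans (by simp)
  have h₂ : (X.resId U).hom.app x = (X.mapId (.mk (op U))).hom.toNatTrans.app x := by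
    simp only [resId, Cat.Hom.toNatIso_hom]
    exact congrArg (fun (e : X.map (𝟙 _) ≅ 𝟙 _) => e.hom.toNatTrans.app x)
      (X.mapId'_eq_mapId (.mk (op U)))
  rw [h', h₂]
  have := (Cat.Hom.toNatIso (X.mapId (.mk (op U)))).inv_hom_id_app x
  exact ((X.res g).map_comp _ _).symm.trans
    ((congrArg (X.res g).map this).trans ((X.res g).map_id _))

end coherence

end Fibred

/-! ### Extension pairs and the Schlessinger–Rim condition (S1) -/

/-- `A₂ ⟶ A₁ ⟶ A₀` is an extension pair: a pair of surjective homomorphisms of Noetherian rings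
with nilpotent kernels, with `A₀` reduced, such that the kernel of `A₂ ⟶ A₁` is annihilated by
the kernel of `A₂ ⟶ A₀`. -/
structure IsExtensionPair {A₂ A₁ A₀ : Type u} [CommRing A₂] [CommRing A₁] [CommRing A₀]
    (q : A₂ →+* A₁) (q₀ : A₁ →+* A₀) : Prop where
  noetherian : IsNoetherianRing A₂
  surjective : Function.Surjective q
  surjective₀ : Function.Surjective q₀
  nilpotent : IsNilpotent (RingHom.ker q)
  nilpotent₀ : IsNilpotent (RingHom.ker q₀)
  reduced : IsReduced A₀
  annihilated : RingHom.ker q * RingHom.ker (q₀.comp q) = ⊥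

namespace Fibred

variable (X : Fibred.{v, w} S)

/-- The functor from the fibre over `P` to the 2-fibre product attached to a commutative square
over `S`. -/
def gluing {P A₂ A₁ B : AffOver S} (i : A₁ ⟶ A₂) (g : A₁ ⟶ B) (p₁ : A₂ ⟶ P) (p₂ : B ⟶ P)
    (comm : i ≫ p₁ = g ≫ p₂) :
    X.Fib P ⥤ Limits.CategoricalPullback (X.res i) (X.res g) where
  obj z :=
    { fst := (X.res p₁).obj z
      snd := (X.res p₂).obj z
      iso := (X.resSq i p₁ g p₂ comm).app z }
  map a :=
    { fst := (X.res p₁).map a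
      snd := (X.res p₂).map a
      w := (X.resSq i p₁ g p₂ comm).hom.naturality a }

/-- The Schlessinger–Rim condition (S1): for an extension pair `A₂ ⟶ A₁ ⟶ A₀` and a homomorphism
`B ⟶ A₁` of Noetherian `𝒪_S`-algebras such that `B ⟶ A₀` is surjective, with fibre product
`P = A₂ ×_{A₁} B`, the functor `X(P) ⟶ X(A₂) ×_{X(A₁)} X(B)` is an equivalence. -/
def S1 : Prop :=
  ∀ ⦃P A₂ A₁ A₀ B : AffOver S⦄ (i : A₁ ⟶ A₂) (i₀ : A₀ ⟶ A₁) (g : A₁ ⟶ B)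
    (p₁ : A₂ ⟶ P) (p₂ : B ⟶ P) (comm : i ≫ p₁ = g ≫ p₂),
    IsExtensionPair i.toRing.hom i₀.toRing.hom →
    IsNoetherianRing B.ring →
    Function.Surjective (i₀ ≫ g).toRing.hom →
    (∀ (a : A₂.ring) (b : B.ring), i.toRing.hom a = g.toRing.hom b →
      ∃! c : P.ring, p₁.toRing.hom c = a ∧ p₂.toRing.hom c = b) →
    (X.gluing i g p₁ p₂ comm).IsEquivalence

end Fibred

/-! ### Liftings -/

/-- For `i : T ⟶ T₂` over `S` and an object `x` over `T`, an object over `T₂` with an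
identification of its restriction to `T` with `x`; equivalently an arrow `x ⟶ obj` of the fibred
category over `i`. -/
structure Lifting (X : Fibred.{v, w} S) {T T₂ : AffOver S} (i : T ⟶ T₂) (x : X.Fib T) where
  obj : X.Fib T₂
  iso : (X.res i).obj obj ≅ x

namespace Lifting

variable {X Y : Fibred.{v, w} S}

/-- Two liftings are isomorphic if there is an isomorphism compatible with the identifications
over `T`. -/
def Isom {T T₂ : AffOver S} {i : T ⟶ T₂} {x : X.Fib T} (l l' : Lifting X i x) : Prop :=
  ∃ e : l.obj ≅ l'.obj, (X.res i).map e.hom ≫ l'.iso.hom = l.iso.hom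

instance setoid {T T₂ : AffOver S} (i : T ⟶ T₂) (x : X.Fib T) : Setoid (Lifting X i x) where
  r := Isom
  iseqv :=
    { refl l := ⟨Iso.refl _, by simp⟩
      symm := by
        rintro l l' ⟨e, he⟩
        exact ⟨e.symm, by rw [← he, ← Category.assoc, ← Functor.map_comp]; simp⟩
      trans := by
        rintro l l' l'' ⟨e, he⟩ ⟨e', he'⟩
        exact ⟨e ≪≫ e', by rw [Iso.trans_hom, Functor.map_comp, Category.assoc, he', he]⟩ }

/-- Restriction of a lifting to an intermediate `T ⟶ T₁ ⟶ T₂`. -/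
def push {T T₁ T₂ : AffOver S} {i : T ⟶ T₂} {x : X.Fib T} (l : Lifting X i x)
    (j : T ⟶ T₁) (h : T₁ ⟶ T₂) (e : j ≫ h = i) : Lifting X j x where
  obj := (X.res h).obj l.obj
  iso := (X.resComp j h i e).symm.app l.obj ≪≫ l.iso

/-- Base change of a lifting along a commutative square. -/
def baseChange {T T₂ V V₂ : AffOver S} {i : T ⟶ T₂} {x : X.Fib T} (l : Lifting X i x)
    (j : V ⟶ V₂) (g : V ⟶ T) (g₂ : V₂ ⟶ T₂) (e : j ≫ g₂ = g ≫ i) :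
    Lifting X j ((X.res g).obj x) where
  obj := (X.res g₂).obj l.obj
  iso := (X.resSq j g₂ g i e).app l.obj ≪≫ (X.res g).mapIso l.iso

/-- The trivial lifting along a morphism with a retraction. -/
def trivial {T T₂ : AffOver S} (i : T ⟶ T₂) (r : T₂ ⟶ T) (e : i ≫ r = 𝟙 T) (x : X.Fib T) :
    Lifting X i x where
  obj := (X.res r).obj x
  iso := (X.resComp i r (𝟙 T) e).symm.app x ≪≫ (X.resId T).app x


lemma Isom.push {T T₁ T₂ : AffOver S} {i : T ⟶ T₂} {x : X.Fib T} {l l' : Lifting X i x}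
    (H : l.Isom l') (j : T ⟶ T₁) (h : T₁ ⟶ T₂) (e : j ≫ h = i) :
    (l.push j h e).Isom (l'.push j h e) := by
  obtain ⟨a, ha⟩ := H
  refine ⟨(X.res h).mapIso a, ?_⟩
  have n := Fibred.resComp_naturality j h i e a.hom
  simp only [Lifting.push, Iso.trans_hom, Iso.app_hom, Iso.symm_hom, Functor.mapIso_hom]
  rw [← ha, ← cancel_epi ((X.resComp j h i e).hom.app l.obj)]
  rw [← reassoc_of% n]
  simp

lemma Isom.baseChange {T T₂ V V₂ : AffOver S} {i : T ⟶ T₂} {x : X.Fib T} {l l' : Lifting X i x}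
    (H : l.Isom l') (j : V ⟶ V₂) (g : V ⟶ T) (g₂ : V₂ ⟶ T₂) (e : j ≫ g₂ = g ≫ i) :
    (l.baseChange j g g₂ e).Isom (l'.baseChange j g g₂ e) := by
  obtain ⟨a, ha⟩ := H
  refine ⟨(X.res g₂).mapIso a, ?_⟩
  have n : (X.res j).map ((X.res g₂).map a.hom) ≫ (X.resSq j g₂ g i e).hom.app l'.obj =
      (X.resSq j g₂ g i e).hom.app l.obj ≫ (X.res g).map ((X.res i).map a.hom) :=
    (X.resSq j g₂ g i e).hom.naturality a.hom
  simp only [Lifting.baseChange, Iso.trans_hom, Iso.app_hom, Functor.mapIso_hom]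
  rw [reassoc_of% n, ← Functor.map_comp, ha]

lemma push_id {T T₂ : AffOver S} {i : T ⟶ T₂} {x : X.Fib T} (l : Lifting X i x) :
    (l.push i (𝟙 T₂) (Category.comp_id i)).Isom l := by
  refine ⟨(X.resId T₂).app l.obj, ?_⟩
  have n := Fibred.resComp_id_right (X := X) i l.obj
  simp only [Lifting.push, Iso.trans_hom, Iso.app_hom, Iso.symm_hom]
  rw [← cancel_epi ((X.resComp i (𝟙 T₂) i (Category.comp_id i)).hom.app l.obj)]
  rw [reassoc_of% n]
  simp

lemma push_push {T T₀ T₁ T₂ : AffOver S} {i : T ⟶ T₂} {x : X.Fib T} (l : Lifting X i x)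
    (j : T ⟶ T₁) (h : T₁ ⟶ T₂) (e : j ≫ h = i) (k : T ⟶ T₀) (h' : T₀ ⟶ T₁) (e' : k ≫ h' = j)
    (h'' : T₀ ⟶ T₂) (e'' : h' ≫ h = h'') (e₃ : k ≫ h'' = i) :
    ((l.push j h e).push k h' e').Isom (l.push k h'' e₃) := by
  refine ⟨((X.resComp h' h h'' e'').app l.obj).symm, ?_⟩
  have n := Fibred.resComp_assoc k h' h j h'' i e' e'' e₃ e l.obj
  simp only [Lifting.push, Iso.trans_hom, Iso.app_hom, Iso.symm_hom, Iso.app_inv]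
  rw [← cancel_epi ((X.resComp k h' j e').hom.app ((X.res h).obj l.obj)),
    ← cancel_epi ((X.resComp j h i e).hom.app l.obj)]
  have m : (X.res k).map ((X.resComp h' h h'' e'').hom.app l.obj) ≫
      (X.res k).map ((X.resComp h' h h'' e'').inv.app l.obj) = 𝟙 _ := by
    rw [← Functor.map_comp, Iso.hom_inv_id_app, CategoryTheory.Functor.map_id]
  rw [← reassoc_of% n, reassoc_of% m]
  simp

lemma push_trivial {T T₁ T₂ : AffOver S} {i : T ⟶ T₂} {x : X.Fib T} (l : Lifting X i x)
    (j : T ⟶ T₁) (r : T₁ ⟶ T) (h : T₁ ⟶ T₂) (e : j ≫ h = i) (hr : r ≫ i = h)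
    (jr : j ≫ r = 𝟙 T) :
    (l.push j h e).Isom (trivial j r jr x) := by
  refine ⟨(X.resComp r i h hr).app l.obj ≪≫ (X.res r).mapIso l.iso, ?_⟩
  have n := Fibred.resComp_assoc j r i (𝟙 T) h i jr hr e (Category.id_comp i) l.obj
  have n₂ := Fibred.resComp_naturality j r (𝟙 T) jr l.iso.hom
  have n₃ := Fibred.resComp_id_left (X := X) i l.obj
  have n₄ := (X.resId T).hom.naturality l.iso.hom
  simp only [Lifting.push, Lifting.trivial, Iso.trans_hom, Iso.app_hom, Iso.symm_hom,
    Functor.mapIso_hom, Functor.map_comp, Category.assoc]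
  rw [← cancel_epi ((X.resComp j h i e).hom.app l.obj)]
  rw [reassoc_of% n, ← reassoc_of% n₂]
  have m : (X.resComp j r (𝟙 T) jr).hom.app x ≫ (X.resComp j r (𝟙 T) jr).inv.app x ≫
      (X.resId T).hom.app x = (X.resId T).hom.app x := by simp
  have n₅ : (X.res (𝟙 T)).map l.iso.hom ≫ (X.resId T).hom.app x =
      (X.resId T).hom.app ((X.res i).obj l.obj) ≫ l.iso.hom := n₄
  rw [m, n₅, reassoc_of% n₃]
  simp

end Lifting

/-- Isomorphism classes of liftings. -/
def Def (X : Fibred.{v, w} S) {T T₂ : AffOver S} (i : T ⟶ T₂) (x : X.Fib T) :=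
  Quotient (Lifting.setoid (X := X) i x)

namespace Def

variable {X : Fibred.{v, w} S}

/-- Restriction of classes of liftings to an intermediate `T ⟶ T₁ ⟶ T₂`. -/
def push {T T₁ T₂ : AffOver S} {i : T ⟶ T₂} {x : X.Fib T}
    (j : T ⟶ T₁) (h : T₁ ⟶ T₂) (e : j ≫ h = i) : Def X i x → Def X j x :=
  Quotient.map (fun l => l.push j h e) (fun _ _ H => Lifting.Isom.push H j h e)


/-- The class of the trivial lifting. -/
def trivial {T T₂ : AffOver S} (i : T ⟶ T₂) (r : T₂ ⟶ T) (e : i ≫ r = 𝟙 T) (x : X.Fib T) :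
    Def X i x :=
  Quotient.mk _ (Lifting.trivial i r e x)

lemma push_id {T T₂ : AffOver S} {i : T ⟶ T₂} {x : X.Fib T} (d : Def X i x) :
    d.push i (𝟙 T₂) (Category.comp_id i) = d := by
  induction d using Quotient.inductionOn with
  | h l => exact Quotient.sound (Lifting.push_id l)

lemma push_push {T T₀ T₁ T₂ : AffOver S} {i : T ⟶ T₂} {x : X.Fib T} (d : Def X i x)
    (j : T ⟶ T₁) (h : T₁ ⟶ T₂) (e : j ≫ h = i) (k : T ⟶ T₀) (h' : T₀ ⟶ T₁) (e' : k ≫ h' = j)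
    (h'' : T₀ ⟶ T₂) (e'' : h' ≫ h = h'') (e₃ : k ≫ h'' = i) :
    (d.push j h e).push k h' e' = d.push k h'' e₃ := by
  induction d using Quotient.inductionOn with
  | h l => exact Quotient.sound (Lifting.push_push l j h e k h' e' h'' e'' e₃)

lemma push_trivial {T T₁ T₂ : AffOver S} {i : T ⟶ T₂} {x : X.Fib T} (d : Def X i x)
    (j : T ⟶ T₁) (r : T₁ ⟶ T) (h : T₁ ⟶ T₂) (e : j ≫ h = i) (hr : r ≫ i = h)
    (jr : j ≫ r = 𝟙 T) :
    d.push j h e = trivial j r jr x := by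
  induction d using Quotient.inductionOn with
  | h l => exact Quotient.sound (Lifting.push_trivial l j r h e hr jr)

/-- Base change of classes of liftings along a commutative square. -/
def baseChange {T T₂ V V₂ : AffOver S} {i : T ⟶ T₂} {x : X.Fib T}
    (j : V ⟶ V₂) (g : V ⟶ T) (g₂ : V₂ ⟶ T₂) (e : j ≫ g₂ = g ≫ i) :
    Def X i x → Def X j ((X.res g).obj x) :=
  Quotient.map (fun l => l.baseChange j g g₂ e) (fun _ _ H => Lifting.Isom.baseChange H j g g₂ e)

end Def

/-! ### The deformation modules -/

section DefModule

variable (U : AffOver S)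

/-- `Spec (A + M)`, the trivial extension of `U = Spec A` by the `A`-module `M`. -/
def AffOver.sqZero (M : Type u) [AddCommGroup M] [Module U.ring M] [Module U.ringᵐᵒᵖ M]
    [IsCentralScalar U.ring M] : AffOver S :=
  U.spec (TrivSqZeroExt.inlHom U.ring M)

variable {U}
variable {M N : Type u} [AddCommGroup M] [Module U.ring M] [Module U.ringᵐᵒᵖ M]
  [IsCentralScalar U.ring M] [AddCommGroup N] [Module U.ring N] [Module U.ringᵐᵒᵖ N]
  [IsCentralScalar U.ring N]

variable (U M) in
/-- The closed immersion `Spec A ⟶ Spec (A + M)`. -/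
def AffOver.zeroSection : U ⟶ U.sqZero M where
  toRing := CommRingCat.ofHom (TrivSqZeroExt.fstHom U.ring U.ring M).toRingHom
  w := by
    have e : CommRingCat.ofHom (TrivSqZeroExt.inlHom U.ring M) ≫
        CommRingCat.ofHom (TrivSqZeroExt.fstHom U.ring U.ring M).toRingHom = 𝟙 U.ring := by
      ext x; rfl
    have key : ∀ k : U.ring ⟶ U.ring, k = 𝟙 _ → S.map (Spec.map k).op U.pt = U.pt := by
      rintro _ rfl
      simp
    calc S.map (Spec.map (CommRingCat.ofHom
            (TrivSqZeroExt.fstHom U.ring U.ring M).toRingHom)).op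
          (S.map (Spec.map (CommRingCat.ofHom (TrivSqZeroExt.inlHom U.ring M))).op U.pt)
        = S.map (Spec.map (CommRingCat.ofHom (TrivSqZeroExt.inlHom U.ring M) ≫
            CommRingCat.ofHom (TrivSqZeroExt.fstHom U.ring U.ring M).toRingHom)).op U.pt := by
          rw [Spec.map_comp, op_comp, Functor.map_comp]; rfl
      _ = U.pt := key _ e

variable (U M) in
/-- The retraction `Spec (A + M) ⟶ Spec A`. -/
def AffOver.retraction : U.sqZero M ⟶ U := U.specHom _

/-- The morphism `Spec (A + N) ⟶ Spec (A + M)` attached to an `A`-linear map `M ⟶ N`. -/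
def AffOver.sqZeroMap (φ : M →ₗ[U.ring] N) : U.sqZero N ⟶ U.sqZero M :=
  AffOver.specMap (𝟙 U) _ _ (TrivSqZeroExt.map φ).toRingHom (by ext <;> simp)

@[simp] lemma AffOver.zeroSection_retraction :
    AffOver.zeroSection U M ≫ AffOver.retraction U M = 𝟙 U := by
  ext x
  rfl

@[simp] lemma AffOver.zeroSection_sqZeroMap (φ : M →ₗ[U.ring] N) :
    AffOver.zeroSection U N ≫ AffOver.sqZeroMap φ = AffOver.zeroSection U M := by
  refine AffOver.hom_ext (CommRingCat.hom_ext (RingHom.ext fun x => ?_))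
  exact TrivSqZeroExt.fst_map φ x

lemma AffOver.sqZeroMap_id :
    AffOver.sqZeroMap (LinearMap.id : M →ₗ[U.ring] M) = 𝟙 _ := by
  refine AffOver.hom_ext (CommRingCat.hom_ext (RingHom.ext fun x => ?_))
  exact congrArg (fun k => k x) (TrivSqZeroExt.map_id (R' := U.ring) (M := M))

lemma AffOver.sqZeroMap_comp {N' : Type u} [AddCommGroup N'] [Module U.ring N']
    [Module U.ringᵐᵒᵖ N'] [IsCentralScalar U.ring N']
    (φ : M →ₗ[U.ring] N) (ψ : N →ₗ[U.ring] N') :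
    AffOver.sqZeroMap ψ ≫ AffOver.sqZeroMap φ = AffOver.sqZeroMap (ψ ∘ₗ φ) := by
  refine AffOver.hom_ext (CommRingCat.hom_ext (RingHom.ext fun x => ?_))
  exact (congrArg (fun k => k x) (TrivSqZeroExt.map_comp_map φ ψ)).symm

lemma AffOver.sqZeroMap_zero :
    AffOver.retraction U N ≫ AffOver.zeroSection U M =
      AffOver.sqZeroMap (0 : M →ₗ[U.ring] N) := by
  refine AffOver.hom_ext (CommRingCat.hom_ext (RingHom.ext fun x => ?_))
  change TrivSqZeroExt.inl (TrivSqZeroExt.fst x) =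
    TrivSqZeroExt.map (0 : M →ₗ[U.ring] N) x
  ext
  · exact (TrivSqZeroExt.fst_map _ x).symm
  · exact (TrivSqZeroExt.snd_map (0 : M →ₗ[U.ring] N) x).symm

variable {X : Fibred.{v, w} S}

variable (M) in
/-- `D_a(M)`: isomorphism classes of deformations of `a` over `A + M`. -/
def DefModule (a : X.Fib U) : Type (max v w) := Def X (AffOver.zeroSection U M) a

namespace DefModule

variable {a : X.Fib U}

/-- Functoriality of `D_a` in the module. -/
def map (φ : M →ₗ[U.ring] N) : DefModule M a → DefModule N a :=
  Def.push _ (AffOver.sqZeroMap φ) (AffOver.zeroSection_sqZeroMap φ)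

lemma map_id (d : DefModule M a) : map LinearMap.id d = d := by
  have : ∀ (h : U.sqZero M ⟶ U.sqZero M) (e : AffOver.zeroSection U M ≫ h = _) (_ : h = 𝟙 _),
    Def.push _ h e d = d := by
      rintro _ e rfl
      exact Def.push_id d
  exact this _ _ AffOver.sqZeroMap_id

lemma map_map {N' : Type u} [AddCommGroup N'] [Module U.ring N']
    [Module U.ringᵐᵒᵖ N'] [IsCentralScalar U.ring N']
    (φ : M →ₗ[U.ring] N) (ψ : N →ₗ[U.ring] N') (d : DefModule M a) :
    map ψ (map φ d) = map (ψ ∘ₗ φ) d :=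
  Def.push_push _ _ _ _ _ _ _ _ (AffOver.sqZeroMap_comp φ ψ) _

lemma map_zero (d : DefModule M a) :
    map (0 : M →ₗ[U.ring] N) d =
      Def.trivial _ (AffOver.retraction U N) AffOver.zeroSection_retraction a :=
  Def.push_trivial _ _ _ _ _ AffOver.sqZeroMap_zero _


lemma isNoetherianRing_sqZero {A M : Type u} [CommRing A] [AddCommGroup M] [Module A M]
    [Module Aᵐᵒᵖ M] [IsCentralScalar A M] [IsNoetherianRing A] [Module.Finite A M] :
    IsNoetherianRing (TrivSqZeroExt A M) := by
  have : Module.Finite A (TrivSqZeroExt A M) := inferInstanceAs (Module.Finite A (A × M))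
  have : IsNoetherian A (TrivSqZeroExt A M) := isNoetherian_of_isNoetherianRing_of_finite _ _
  exact isNoetherian_of_tower A this

lemma existsUnique_sqZero {A M N : Type u} [CommRing A] [AddCommGroup M] [Module A M]
    [Module Aᵐᵒᵖ M] [IsCentralScalar A M] [AddCommGroup N] [Module A N] [Module Aᵐᵒᵖ N]
    [IsCentralScalar A N] (x : TrivSqZeroExt A M) (y : TrivSqZeroExt A N) (hxy : x.fst = y.fst) :
    ∃! c : TrivSqZeroExt A (M × N), TrivSqZeroExt.map (LinearMap.fst A M N) c = x ∧
      TrivSqZeroExt.map (LinearMap.snd A M N) c = y := by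
  refine ⟨TrivSqZeroExt.inl x.fst + TrivSqZeroExt.inr (x.snd, y.snd), ⟨?_, ?_⟩, ?_⟩
  · ext <;> simp
  · ext <;> simp [hxy]
  · rintro c ⟨rfl, rfl⟩
    ext <;> simp

lemma iso_aux {C : Type*} [Category C] {z z' a b₁ b₂ b₁' b₂' : C} (r₁ : z ≅ b₁)
    (r₂ : z ≅ b₂) (r₁' : z' ≅ b₁') (r₂' : z' ≅ b₂') (t : z ≅ a) (t' : z' ≅ a)
    (α : b₁ ⟶ b₁') (β : b₂ ⟶ b₂') (hα : α ≫ r₁'.inv ≫ t'.hom = r₁.inv ≫ t.hom)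
    (hβ : β ≫ r₂'.inv ≫ t'.hom = r₂.inv ≫ t.hom) :
    α ≫ r₁'.inv ≫ r₂'.hom = (r₁.inv ≫ r₂.hom) ≫ β := by
  rw [← cancel_mono (r₂'.inv ≫ t'.hom)]
  simp only [Category.assoc, Iso.hom_inv_id_assoc, hα, hβ]

lemma iso_aux' {C : Type*} [Category C] {z z' a b b' : C} (r : z ≅ b)
    (r' : z' ≅ b') (t : z ≅ a) (t' : z' ≅ a) (κ : z ⟶ z') (α : b ⟶ b')
    (n : κ ≫ r'.hom = r.hom ≫ α) (hα : α ≫ r'.inv ≫ t'.hom = r.inv ≫ t.hom) :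
    κ ≫ t'.hom = t.hom := by
  rw [← cancel_epi r.inv, ← hα, ← Category.assoc, ← Category.assoc]
  congr 1
  rw [Iso.inv_comp_eq, ← Category.assoc, ← n, Category.assoc, Iso.hom_inv_id, Category.comp_id]

/-- Under (S1), a deformation over `A + (M × N)` is the same as a pair of deformations over
`A + M` and `A + N`. -/
lemma map_fst_snd_bijective (h : X.S1) [IsNoetherianRing U.ring] [IsReduced U.ring]
    [Module.Finite U.ring M] [Module.Finite U.ring N] :
    Function.Bijective (fun d : DefModule (M × N) a =>
      (map (LinearMap.fst U.ring M N) d, map (LinearMap.snd U.ring M N) d)) := by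
  let i := AffOver.zeroSection U M
  let g := AffOver.zeroSection U N
  let k := AffOver.zeroSection U (M × N)
  let p₁ := AffOver.sqZeroMap (LinearMap.fst U.ring M N)
  let p₂ := AffOver.sqZeroMap (LinearMap.snd U.ring M N)
  have e₁ : i ≫ p₁ = k := AffOver.zeroSection_sqZeroMap _
  have e₂ : g ≫ p₂ = k := AffOver.zeroSection_sqZeroMap _
  have comm : i ≫ p₁ = g ≫ p₂ := e₁.trans e₂.symm
  have hk : ∀ z, (X.resSq i p₁ g p₂ comm).hom.app z =
      (X.resComp i p₁ k e₁).inv.app z ≫ (X.resComp g p₂ k e₂).hom.app z := by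
    intro z
    have : ∀ (k' : U ⟶ U.sqZero (M × N)) (e₁' : i ≫ p₁ = k') (e₂' : g ≫ p₂ = k'),
        (X.resSq i p₁ g p₂ comm).hom.app z =
          (X.resComp i p₁ k' e₁').inv.app z ≫ (X.resComp g p₂ k' e₂').hom.app z := by
      rintro _ rfl e₂'
      rfl
    exact this k e₁ e₂
  have hE : (X.gluing i g p₁ p₂ comm).IsEquivalence := by
    refine h i (𝟙 U) g p₁ p₂ comm ?_ isNoetherianRing_sqZero ?_ ?_
    · have hker : RingHom.ker i.toRing.hom ^ 2 = ⊥ := TrivSqZeroExt.kerIdeal_sq U.ring M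
      refine ⟨isNoetherianRing_sqZero, fun x => ⟨TrivSqZeroExt.inl x, rfl⟩,
        fun x => ⟨x, rfl⟩, ⟨2, hker⟩, ⟨1, ?_⟩, inferInstance, ?_⟩
      · rw [pow_one]
        exact RingHom.ker_coe_equiv (RingEquiv.refl U.ring)
      · rw [pow_two] at hker
        exact hker
    · exact fun x => ⟨TrivSqZeroExt.inl x, rfl⟩
    · rintro (x : TrivSqZeroExt U.ring M) (y : TrivSqZeroExt U.ring N)
        (hxy : x.fst = y.fst)
      exact existsUnique_sqZero x y hxy
  constructor
  · intro d d' hd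
    induction d using Quotient.inductionOn with
    | h l =>
    induction d' using Quotient.inductionOn with
    | h l' =>
    simp only [Prod.mk.injEq] at hd
    obtain ⟨(a₁ : (X.res p₁).obj l.obj ≅ (X.res p₁).obj l'.obj), ha₁⟩ := Quotient.exact hd.1
    obtain ⟨(a₂ : (X.res p₂).obj l.obj ≅ (X.res p₂).obj l'.obj), ha₂⟩ := Quotient.exact hd.2
    change (X.res i).map a₁.hom ≫ (X.resComp i p₁ k e₁).inv.app l'.obj ≫ l'.iso.hom =
      (X.resComp i p₁ k e₁).inv.app l.obj ≫ l.iso.hom at ha₁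
    change (X.res g).map a₂.hom ≫ (X.resComp g p₂ k e₂).inv.app l'.obj ≫ l'.iso.hom =
      (X.resComp g p₂ k e₂).inv.app l.obj ≫ l.iso.hom at ha₂
    let m : (X.gluing i g p₁ p₂ comm).obj l.obj ≅ (X.gluing i g p₁ p₂ comm).obj l'.obj :=
      Limits.CategoricalPullback.mkIso a₁ a₂ (by
        change (X.res i).map a₁.hom ≫ (X.resSq i p₁ g p₂ comm).hom.app l'.obj =
          (X.resSq i p₁ g p₂ comm).hom.app l.obj ≫ (X.res g).map a₂.hom
        rw [hk, hk]
        exact iso_aux ((X.resComp i p₁ k e₁).app l.obj) ((X.resComp g p₂ k e₂).app l.obj)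
          ((X.resComp i p₁ k e₁).app l'.obj) ((X.resComp g p₂ k e₂).app l'.obj)
          l.iso l'.iso _ _ ha₁ ha₂)
    refine Quotient.sound ⟨(X.gluing i g p₁ p₂ comm).preimageIso m, ?_⟩
    have hm : (X.res p₁).map ((X.gluing i g p₁ p₂ comm).preimageIso m).hom = a₁.hom :=
      congrArg Limits.CategoricalPullback.Hom.fst
        ((X.gluing i g p₁ p₂ comm).map_preimage m.hom)
    have n := Fibred.resComp_naturality i p₁ k e₁
      ((X.gluing i g p₁ p₂ comm).preimageIso m).hom
    rw [hm] at n
    exact iso_aux' ((X.resComp i p₁ k e₁).app l.obj) ((X.resComp i p₁ k e₁).app l'.obj)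
      l.iso l'.iso _ _ n ha₁
  · rintro ⟨d, d'⟩
    induction d using Quotient.inductionOn with
    | h l =>
    induction d' using Quotient.inductionOn with
    | h l' =>
    let t : Limits.CategoricalPullback (X.res i) (X.res g) :=
      { fst := l.obj, snd := l'.obj, iso := l.iso ≪≫ l'.iso.symm }
    let z := (X.gluing i g p₁ p₂ comm).objPreimage t
    let e : (X.gluing i g p₁ p₂ comm).obj z ≅ t := (X.gluing i g p₁ p₂ comm).objObjPreimageIso t
    let ε₁ : (X.res p₁).obj z ≅ l.obj := (Limits.CategoricalPullback.π₁ _ _).mapIso e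
    let ε₂ : (X.res p₂).obj z ≅ l'.obj := (Limits.CategoricalPullback.π₂ _ _).mapIso e
    have hw : (X.res i).map ε₁.hom ≫ l.iso.hom ≫ l'.iso.inv =
      (X.resSq i p₁ g p₂ comm).hom.app z ≫ (X.res g).map ε₂.hom := e.hom.w
    let L : Lifting X k a :=
      { obj := z
        iso := (X.resComp i p₁ k e₁).app z ≪≫ (X.res i).mapIso ε₁ ≪≫ l.iso }
    refine ⟨Quotient.mk _ L, Prod.ext (Quotient.sound ⟨ε₁, ?_⟩) (Quotient.sound ⟨ε₂, ?_⟩)⟩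
    · change _ = (X.resComp i p₁ k e₁).inv.app z ≫ (X.resComp i p₁ k e₁).hom.app z ≫
        (X.res i).map ε₁.hom ≫ l.iso.hom
      exact (Iso.inv_hom_id_assoc ((X.resComp i p₁ k e₁).app z) _).symm
    · change _ = (X.resComp g p₂ k e₂).inv.app z ≫ (X.resComp i p₁ k e₁).hom.app z ≫
        (X.res i).map ε₁.hom ≫ l.iso.hom
      rw [hk, Category.assoc] at hw
      have hw' : (X.res i).map ε₁.hom ≫ l.iso.hom = (X.resComp i p₁ k e₁).inv.app z ≫
          (X.resComp g p₂ k e₂).hom.app z ≫ (X.res g).map ε₂.hom ≫ l'.iso.hom := by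
        rw [← cancel_mono l'.iso.inv]
        simpa using hw
      rw [hw']
      refine Eq.symm ((congrArg (_ ≫ ·) (Iso.hom_inv_id_assoc ((X.resComp i p₁ k e₁).app z) _)).trans
        (Iso.inv_hom_id_assoc ((X.resComp g p₂ k e₂).app z) _))

variable [IsNoetherianRing U.ring] [IsReduced U.ring] [Module.Finite U.ring N]

variable [Module.Finite U.ring M]

/-- The deformation over `A + (M × N)` glued from two deformations. -/
def pair (h : X.S1) (d : DefModule M a) (d' : DefModule N a) : DefModule (M × N) a :=
  ((map_fst_snd_bijective h).surjective (d, d')).choose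

lemma map_fst_pair (h : X.S1) (d : DefModule M a) (d' : DefModule N a) :
    map (LinearMap.fst U.ring M N) (pair h d d') = d :=
  congrArg Prod.fst ((map_fst_snd_bijective h).surjective (d, d')).choose_spec

lemma map_snd_pair (h : X.S1) (d : DefModule M a) (d' : DefModule N a) :
    map (LinearMap.snd U.ring M N) (pair h d d') = d' :=
  congrArg Prod.snd ((map_fst_snd_bijective h).surjective (d, d')).choose_spec

/-- The sum of two deformations: the image under `+ : M × M ⟶ M` of the glued deformation. -/
def add (h : X.S1) (d d' : DefModule M a) : DefModule M a :=
  map (LinearMap.fst U.ring M M + LinearMap.snd U.ring M M) (pair h d d')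

lemma add_map (h : X.S1) (φ ψ : M →ₗ[U.ring] N) (d : DefModule M a) :
    add h (map φ d) (map ψ d) = map (φ + ψ) d := by
  have : pair h (map φ d) (map ψ d) = map (φ.prod ψ) d := by
    apply (map_fst_snd_bijective h).injective
    simp only [map_fst_pair, map_snd_pair, map_map, LinearMap.fst_prod, LinearMap.snd_prod]
  rw [add, this, map_map]
  congr 1

/-- Three deformations come from one over `A + (M × M × M)`. -/
lemma exists_triple (h : X.S1) (d₁ d₂ d₃ : DefModule M a) :
    ∃ (z : DefModule (M × M × M) a) (φ₁ φ₂ φ₃ : M × M × M →ₗ[U.ring] M),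
      map φ₁ z = d₁ ∧ map φ₂ z = d₂ ∧ map φ₃ z = d₃ := by
  refine ⟨pair h d₁ (pair h d₂ d₃), LinearMap.fst _ _ _,
    LinearMap.fst _ _ _ ∘ₗ LinearMap.snd _ _ _, LinearMap.snd _ _ _ ∘ₗ LinearMap.snd _ _ _,
    ?_, ?_, ?_⟩
  · rw [map_fst_pair]
  · rw [← map_map, map_snd_pair, map_fst_pair]
  · rw [← map_map, map_snd_pair, map_snd_pair]

/-- The zero deformation, i.e. the trivial one. -/
def zero : DefModule M a :=
  Def.trivial _ (AffOver.retraction U M) AffOver.zeroSection_retraction a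

lemma map_add_add (h : X.S1) (φ : M →ₗ[U.ring] N) (d d' : DefModule M a) :
    map φ (add h d d') = add h (map φ d) (map φ d') := by
  have e : d = map (LinearMap.fst _ _ _) (pair h d d') := (map_fst_pair h d d').symm
  have e' : d' = map (LinearMap.snd _ _ _) (pair h d d') := (map_snd_pair h d d').symm
  generalize pair h d d' = z at e e'
  subst e e'
  rw [add_map, map_map, map_map, map_map, add_map, LinearMap.comp_add]

lemma add_assoc (h : X.S1) (d₁ d₂ d₃ : DefModule M a) :
    add h (add h d₁ d₂) d₃ = add h d₁ (add h d₂ d₃) := by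
  obtain ⟨z, φ₁, φ₂, φ₃, rfl, rfl, rfl⟩ := exists_triple h d₁ d₂ d₃
  simp only [add_map, _root_.add_assoc]

lemma add_comm (h : X.S1) (d₁ d₂ : DefModule M a) : add h d₁ d₂ = add h d₂ d₁ := by
  obtain ⟨z, φ₁, φ₂, φ₃, rfl, rfl, -⟩ := exists_triple h d₁ d₂ d₁
  simp only [add_map, _root_.add_comm]

lemma zero_add (h : X.S1) (d : DefModule M a) : add h zero d = d := by
  conv_lhs => rw [← map_id d, zero, ← map_zero d, add_map, _root_.zero_add, map_id]

lemma neg_add_cancel (h : X.S1) (d : DefModule M a) :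
    add h (map (-LinearMap.id) d) d = zero := by
  have : add h (map (-LinearMap.id) d) (map LinearMap.id d) = zero := by
    rw [add_map, _root_.neg_add_cancel, map_zero, zero]
  rwa [map_id] at this

variable (M a) in
/-- The group structure on `D_a(M)`. -/
@[reducible]
def addCommGroup (h : X.S1) : AddCommGroup (DefModule M a) :=
  letI : Add (DefModule M a) := ⟨add h⟩
  letI : Zero (DefModule M a) := ⟨zero⟩
  letI : Neg (DefModule M a) := ⟨map (-LinearMap.id)⟩
  { add_assoc := add_assoc h
    zero_add := zero_add h
    add_zero := fun d => (add_comm h d zero).trans (zero_add h d)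
    neg_add_cancel := neg_add_cancel h
    add_comm := add_comm h
    nsmul := nsmulRec
    zsmul := zsmulRec }

variable (M a) in
/-- The module structure on `D_a(M)`: scalars act through their action on `M`. -/
@[reducible]
def module (h : X.S1) :
    letI := addCommGroup M a h
    Module U.ring (DefModule M a) :=
  letI := addCommGroup M a h
  { smul := fun r d => map (r • LinearMap.id) d
    one_smul := fun d => by
      change map _ d = d
      rw [one_smul, map_id]
    mul_smul := fun r s d => by
      change map _ d = map _ (map _ d)
      rw [map_map]
      congr 1
      ext x
      simp [mul_smul]
    smul_zero := fun r => by
      change map _ zero = zero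
      rw [zero, ← map_zero (M := M) zero, map_map, LinearMap.comp_zero]
    smul_add := fun r d d' => map_add_add h _ d d'
    add_smul := fun r s d => by
      change map _ d = add h (map _ d) (map _ d)
      rw [add_map, add_smul]
    zero_smul := fun d => by
      change map _ d = zero
      rw [zero_smul, map_zero, zero] }

end DefModule

/-- The homomorphism `A + M ⟶ B + N` attached to a homomorphism `σ : A ⟶ B` and a `σ`-semilinear
map `M ⟶ N`. -/
def sqZeroRingHom {A B M N : Type u} [CommRing A] [CommRing B] [AddCommGroup M] [Module A M]
    [Module Aᵐᵒᵖ M] [IsCentralScalar A M] [AddCommGroup N] [Module B N] [Module Bᵐᵒᵖ N]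
    [IsCentralScalar B N] (σ : A →+* B) (φ : M →ₛₗ[σ] N) :
    TrivSqZeroExt A M →+* TrivSqZeroExt B N where
  toFun z := TrivSqZeroExt.inl (σ z.fst) + TrivSqZeroExt.inr (φ z.snd)
  map_one' := by ext <;> simp
  map_zero' := by ext <;> simp
  map_add' y z := by ext <;> simp
  map_mul' y z := by ext <;> simp

section BaseChange

variable {A : Type u} [CommRing A] [Algebra U.ring A]

variable (U M A) in
/-- The morphism `Spec (A' + A' ⊗ M) ⟶ Spec (A + M)` for an `A`-algebra `A'`. -/
def AffOver.sqZeroBaseChange :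
    (U.spec (algebraMap U.ring A)).sqZero (A ⊗[U.ring] M) ⟶ U.sqZero M :=
  AffOver.specMap (U.specHom (algebraMap U.ring A)) _ _
    (sqZeroRingHom (algebraMap U.ring A)
      { toFun := fun m => (1 : A) ⊗ₜ[U.ring] m
        map_add' := TensorProduct.tmul_add _
        map_smul' := fun r m => by
          rw [TensorProduct.tmul_smul, algebraMap_smul] })
    (by ext x <;> simp [sqZeroRingHom, AffOver.specHom])

lemma AffOver.sqZeroBaseChange_comm :
    AffOver.zeroSection (U.spec (algebraMap U.ring A)) (A ⊗[U.ring] M) ≫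
        AffOver.sqZeroBaseChange U M A =
      U.specHom (algebraMap U.ring A) ≫ AffOver.zeroSection U M := by
  refine AffOver.hom_ext (CommRingCat.hom_ext (RingHom.ext fun x => ?_))
  change TrivSqZeroExt.fst (sqZeroRingHom (algebraMap U.ring A) _ x) =
    algebraMap U.ring A (TrivSqZeroExt.fst x)
  simp [sqZeroRingHom]

variable (A) in
/-- The natural map `D_a(M) ⟶ D_b(B ⊗ M)` for an `A`-algebra `B`, where `b` is the restriction
of `a`. -/
def DefModule.baseChange {a : X.Fib U} (d : DefModule M a) :
    DefModule (U := U.spec (algebraMap U.ring A)) (A ⊗[U.ring] M)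
      ((X.res (U.specHom (algebraMap U.ring A))).obj a) :=
  Def.baseChange _ _ (AffOver.sqZeroBaseChange U M A) AffOver.sqZeroBaseChange_comm d

end BaseChange

end DefModule

/-! ### Finiteness of deformations and their compatibility with base change -/

namespace Fibred

variable (X : Fibred.{v, w} S)

/-- (S2): for a reduced `𝒪_S`-algebra `A` of finite type, `a` over `A` and a finite `A`-module
`M`, the `A`-module `D_a(M)` is finite. -/
def S2 (h : X.S1) : Prop :=
  ∀ (U : AffOver S) [IsNoetherianRing U.ring] [IsReduced U.ring], U.IsFiniteType →
  ∀ (a : X.Fib U) (M : Type u) [AddCommGroup M] [Module U.ring M] [Module U.ringᵐᵒᵖ M]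
    [IsCentralScalar U.ring M] [Module.Finite U.ring M],
    letI := DefModule.addCommGroup M a h
    letI := DefModule.module M a h
    Module.Finite U.ring (DefModule M a)

/-- The map `B ⊗ D_a(M) ⟶ D_b(B ⊗ M)` induced by base change to the `A`-algebra `B` is an
isomorphism of `B`-modules. -/
def DefCompatible (h : X.S1) {U : AffOver S} [IsNoetherianRing U.ring] [IsReduced U.ring]
    (a : X.Fib U) (M : Type u) [AddCommGroup M] [Module U.ring M] [Module U.ringᵐᵒᵖ M]
    [IsCentralScalar U.ring M] [Module.Finite U.ring M]
    (B : Type u) [CommRing B] [Algebra U.ring B] [IsNoetherianRing B] [IsReduced B] : Prop :=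
  letI : AddCommGroup (DefModule M a) := DefModule.addCommGroup M a h
  letI : Module U.ring (DefModule M a) := DefModule.module M a h
  letI V := U.spec (algebraMap U.ring B)
  letI b : X.Fib V := (X.res (U.specHom (algebraMap U.ring B))).obj a
  haveI : IsNoetherianRing V.ring := inferInstanceAs (IsNoetherianRing B)
  haveI : IsReduced V.ring := inferInstanceAs (IsReduced B)
  letI : AddCommGroup (DefModule (B ⊗[U.ring] M) b) := DefModule.addCommGroup _ b h
  letI : Module B (DefModule (B ⊗[U.ring] M) b) := DefModule.module _ b h
  ∃ e : B ⊗[U.ring] DefModule M a ≃ₗ[B] DefModule (B ⊗[U.ring] M) b,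
    ∀ d : DefModule M a, e (1 ⊗ₜ d) = DefModule.baseChange B d

/-- Deformations are compatible with étale localization on `𝒪_S`-algebras of finite type. -/
def DefEtaleCompatible (h : X.S1) : Prop :=
  ∀ (U : AffOver S) [IsNoetherianRing U.ring] [IsReduced U.ring], U.IsFiniteType →
  ∀ (a : X.Fib U) (M : Type u) [AddCommGroup M] [Module U.ring M] [Module U.ringᵐᵒᵖ M]
    [IsCentralScalar U.ring M] [Module.Finite U.ring M]
    (B : Type u) [CommRing B] [Algebra U.ring B] [Algebra.Etale U.ring B]
    [IsNoetherianRing B] [IsReduced B],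
    X.DefCompatible h a M B

/-- Deformations are compatible with passage to the residue field at all points of finite type of
a dense open subset of `Spec A`, for reduced `𝒪_S`-algebras `A` of finite type. -/
def DefResidueCompatible (h : X.S1) : Prop :=
  ∀ (U : AffOver S) [IsNoetherianRing U.ring] [IsReduced U.ring], U.IsFiniteType →
  ∀ (a : X.Fib U) (M : Type u) [AddCommGroup M] [Module U.ring M] [Module U.ringᵐᵒᵖ M]
    [IsCentralScalar U.ring M] [Module.Finite U.ring M],
    ∃ V : Set (PrimeSpectrum U.ring), IsOpen V ∧ Dense V ∧
      ∀ p ∈ V, Algebra.FiniteType U.ring p.asIdeal.ResidueField →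
        X.DefCompatible h a M p.asIdeal.ResidueField

end Fibred

/-! ### Deformation situations over a 1-morphism -/

namespace Lifting

variable {X Y : Fibred.{v, w} S}

/-- The isomorphism `f(g^* x) ≅ g^* f(x)` of a 1-morphism. -/
def resIso (f : X ⟶ Y) {V U : AffOver S} (g : V ⟶ U) (x : X.Fib U) :
    (f.app _).toFunctor.obj ((X.res g).obj x) ≅ (Y.res g).obj ((f.app _).toFunctor.obj x) :=
  (Cat.Hom.toNatIso (f.naturality g.op.toLoc)).app x

/-- The image of a lifting under a 1-morphism. -/
def map (f : X ⟶ Y) {T T₂ : AffOver S} {i : T ⟶ T₂} {x : X.Fib T} (l : Lifting X i x) :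
    Lifting Y i ((f.app _).toFunctor.obj x) where
  obj := (f.app _).toFunctor.obj l.obj
  iso := (resIso f i l.obj).symm ≪≫ (f.app _).toFunctor.mapIso l.iso

end Lifting

section Situation

variable {X Y : Fibred.{v, w} S}

/-- The data of a deformation situation over `f : X ⟶ Y`, up to the requirement that the rings
form an extension pair.  The pair `B' ⟶ B ⟶ B₀` is written `B' ⟶ B' ⧸ I ⟶ B' ⧸ J`, so `I` is the
kernel (called `M`) of `B' ⟶ B`; the rest is an object `x` of `X` over `B` and a morphism
`f(x) ⟶ y` of `Y` over `B' ⟶ B`. -/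
structure Situation (f : X ⟶ Y) where
  T₂ : AffOver S
  I : Ideal T₂.ring
  J : Ideal T₂.ring
  le : I ≤ J
  x : X.Fib (T₂.spec (Ideal.Quotient.mk I))
  y : Lifting Y (T₂.specHom (Ideal.Quotient.mk I)) ((f.app _).toFunctor.obj x)

namespace Situation

variable {f : X ⟶ Y} (ξ : Situation f)

/-- The ring `B₀`. -/
abbrev Zero : Type u := ξ.T₂.ring ⧸ ξ.J

/-- The rings form an extension pair and `B₀` is an `𝒪_S`-algebra of finite type: the
deformation situation is algebraic. -/
structure IsAlgebraic : Prop where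
  isExtensionPair : IsExtensionPair (Ideal.Quotient.mk ξ.I) (Ideal.Quotient.factor ξ.le)
  isFiniteType : (ξ.T₂.spec (Ideal.Quotient.mk ξ.J)).IsFiniteType

/-- The base change of a deformation situation along a homomorphism `v : B' ⟶ C'`; the new
pair is `C' ⟶ C' ⊗ B ⟶ C' ⊗ B₀`. -/
def baseChange {C : Type u} [CommRing C] (v : ξ.T₂.ring →+* C) : Situation f :=
  letI g : (ξ.T₂.spec v).spec (Ideal.Quotient.mk (ξ.I.map v)) ⟶
      ξ.T₂.spec (Ideal.Quotient.mk ξ.I) :=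
    AffOver.specMap (ξ.T₂.specHom v) _ _
      (Ideal.quotientMap (ξ.I.map v) v Ideal.le_comap_map) (by ext x; simp [AffOver.specHom])
  letI y : Lifting Y ((ξ.T₂.spec v).specHom (Ideal.Quotient.mk (ξ.I.map v)))
      ((Y.res g).obj ((f.app _).toFunctor.obj ξ.x)) :=
    ξ.y.baseChange _ g (ξ.T₂.specHom v) (by
      refine AffOver.hom_ext (CommRingCat.hom_ext (RingHom.ext fun z => ?_))
      rfl)
  { T₂ := ξ.T₂.spec v
    I := ξ.I.map v
    J := ξ.J.map v
    le := Ideal.map_mono ξ.le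
    x := (X.res g).obj ξ.x
    y := ⟨y.obj, y.iso ≪≫ (Lifting.resIso f g ξ.x).symm⟩ }

/-- The induced homomorphism `B₀ ⟶ C' ⊗ B₀`. -/
def zeroMap {C : Type u} [CommRing C] (v : ξ.T₂.ring →+* C) :
    ξ.Zero →+* (ξ.baseChange v).Zero :=
  Ideal.quotientMap (ξ.J.map v) v Ideal.le_comap_map

/-- For the quotient `M ⟶ M ⧸ K`: there is a lifting to `X` of the restriction of `f(x) ⟶ y`
to `B' ⧸ K`, i.e. a morphism `x ⟶ z` of `X` over `B' ⧸ K ⟶ B` whose image under `f` is isomorphic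
to the restriction of `f(x) ⟶ y`. -/
def LiftsOver (K : Ideal ξ.T₂.ring) (hK : K ≤ ξ.I) : Prop :=
  letI j : ξ.T₂.spec (Ideal.Quotient.mk ξ.I) ⟶ ξ.T₂.spec (Ideal.Quotient.mk K) :=
    AffOver.specMap (𝟙 ξ.T₂) _ _ (Ideal.Quotient.factor hK) (by ext x; simp)
  ∃ l : Lifting X j ξ.x,
    (l.map f).Isom (ξ.y.push j (ξ.T₂.specHom (Ideal.Quotient.mk K)) (by
      refine AffOver.hom_ext (CommRingCat.hom_ext (RingHom.ext fun z => ?_))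
      rfl))

/-- A localization `A₀` of `B₀` at the multiplicative set `W` and a quotient of the `A₀`-module
`M ⊗ A₀`.  All such quotients are of the form `(M ⧸ L) ⊗ A₀` with `L` a submodule of `M`, and we
record `L`. -/
structure Quot where
  W : Submonoid ξ.Zero
  L : Ideal ξ.T₂.ring
  le : L ≤ ξ.I

namespace Quot

variable {ξ} (Q : ξ.Quot)

/-- The multiplicative set of `B'` such that the localization of `B'` is the infinitesimal
extension corresponding to `A₀`. -/
def lift : Submonoid ξ.T₂.ring := Q.W.comap (Ideal.Quotient.mk ξ.J)

/-- The base change of the deformation situation to the localization `A' ⟶ A ⟶ A₀`. -/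
abbrev situation : Situation f := ξ.baseChange (algebraMap ξ.T₂.ring (Localization Q.lift))

/-- The kernel of `M ⊗ A₀ ⟶ N`, as an ideal of `A'`. -/
abbrev ideal : Ideal Q.situation.T₂.ring :=
  Q.L.map (algebraMap ξ.T₂.ring (Localization Q.lift))

lemma ideal_le : Q.ideal ≤ Q.situation.I := Ideal.map_mono Q.le

/-- The localization `A₀` is `𝔞`-generic: `Spec A₀ ∩ V(𝔞)` is dense in `V(𝔞)`. -/
def IsGeneric (𝔞 : Ideal ξ.Zero) : Prop :=
  PrimeSpectrum.zeroLocus (𝔞 : Set ξ.Zero) ⊆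
    closure (PrimeSpectrum.zeroLocus (𝔞 : Set ξ.Zero) ∩
      Set.range (PrimeSpectrum.comap (algebraMap ξ.Zero (Localization Q.W))))

/-- `A₀` is a `B₀`-algebra of finite type. -/
def IsFiniteType : Prop := Algebra.FiniteType ξ.Zero (Localization Q.W)

/-- `N = (M ⧸ L) ⊗ A₀` is a projective module over `A₀ ⧸ 𝔞 A₀`, provided that `M` is a
`B₀ ⧸ 𝔞`-module (then `(M ⧸ L) ⊗ A₀` and `(M ⧸ L) ⊗ (A₀ ⧸ 𝔞 A₀)` coincide). -/
def IsProjective (𝔞 : Ideal ξ.Zero) : Prop :=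
  Module.Projective (Localization Q.W ⧸ 𝔞.map (algebraMap ξ.Zero (Localization Q.W)))
    ((Localization Q.W ⧸ 𝔞.map (algebraMap ξ.Zero (Localization Q.W))) ⊗[ξ.T₂.ring]
      (ξ.I ⧸ Submodule.comap (Submodule.subtype ξ.I) Q.L))

/-- The restriction of the deformation situation to `A'_N ⟶ A ⟶ A₀` has a lifting to `X`. -/
def IsExtending : Prop := Q.situation.LiftsOver Q.ideal Q.ideal_le

/-- A finite type, projective, extending, `𝔞`-generic quotient. -/
structure IsAdmissible (𝔞 : Ideal ξ.Zero) : Prop where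
  isGeneric : Q.IsGeneric 𝔞
  isFiniteType : Q.IsFiniteType
  isProjective : Q.IsProjective 𝔞
  isExtending : Q.IsExtending

/-- The base change of the pair `(A₀, N)` along `B' ⟶ C'`. -/
def baseChange {C : Type u} [CommRing C] (v : ξ.T₂.ring →+* C) : (ξ.baseChange v).Quot where
  W := Q.W.map (ξ.zeroMap v)
  L := Q.L.map v
  le := Ideal.map_mono Q.le

end Quot

/-- The multiplicative set of `B'` whose image in `B₀` is the set of elements avoiding the generic
points of `V(𝔞)`.  The localization of `B₀` at this image is the semilocalization `R` of `B₀` at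
the generic points of `𝔞`. -/
def genericSubmonoid (𝔞 : Ideal ξ.Zero) : Submonoid ξ.T₂.ring :=
  (⨅ p : 𝔞.minimalPrimes, haveI : (p : Ideal ξ.Zero).IsPrime := p.2.1.1
    (p : Ideal ξ.Zero).primeCompl).comap (Ideal.Quotient.mk ξ.J)

/-- `(A₀, N)` is a generic extender: it is a finite type, projective, extending, `𝔞`-generic
quotient, and for every other such `(C₀, P)` the quotient `P ⊗ R` of `M ⊗ R` factors through
`N ⊗ R`. -/
structure IsGenericExtender (𝔞 : Ideal ξ.Zero) (Q : ξ.Quot) : Prop where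
  isAdmissible : Q.IsAdmissible 𝔞
  factors : ∀ P : ξ.Quot, P.IsAdmissible 𝔞 →
    Q.L.map (algebraMap ξ.T₂.ring (Localization (ξ.genericSubmonoid 𝔞))) ≤
      P.L.map (algebraMap ξ.T₂.ring (Localization (ξ.genericSubmonoid 𝔞)))

/-- Compatibility of a generic extender with étale extensions. -/
def IsEtaleCompatible (𝔞 : Ideal ξ.Zero) (Q : ξ.Quot) : Prop :=
  ∀ (C : Type u) [CommRing C] (v : ξ.T₂.ring →+* C), v.Etale →
    (ξ.baseChange v).IsGenericExtender (𝔞.map (ξ.zeroMap v)) (Q.baseChange v)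

/-- Compatibility of a generic extender with closed points: for every closed point of `Spec A₀`,
given by a maximal ideal `𝔪` of `A'`, and every quotient `N_y` of `M ⊗ k(y)`, given by the kernel
`K` of `M ⊗ A₀ ⟶ N_y`, there is a lifting over `A'_{N_y}` if and only if `N_y` is a quotient of
`N ⊗ k(y)`. -/
def IsClosedPointCompatible (Q : ξ.Quot) : Prop :=
  ∀ 𝔪 : Ideal Q.situation.T₂.ring, 𝔪.IsMaximal → Q.situation.J ≤ 𝔪 →
    ∀ (K : Ideal Q.situation.T₂.ring) (hK : K ≤ Q.situation.I), 𝔪 * Q.situation.I ≤ K →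
      (Q.situation.LiftsOver K hK ↔ Q.ideal ≤ K)

end Situation

/-- Every algebraic deformation situation over `f`, with kernel `M` a module over `B₀ ⧸ 𝔞` for a
radical ideal `𝔞`, has a generic extender that is compatible with étale extensions and with closed
points. -/
def HasCompatibleGenericExtenders (f : X ⟶ Y) : Prop :=
  ∀ ξ : Situation f, ξ.IsAlgebraic → ∀ 𝔞 : Ideal ξ.Zero, 𝔞.IsRadical →
    ξ.I * 𝔞.comap (Ideal.Quotient.mk ξ.J) = ⊥ →
    ∃ Q : ξ.Quot, ξ.IsGenericExtender 𝔞 Q ∧ ξ.IsEtaleCompatible 𝔞 Q ∧ ξ.IsClosedPointCompatible Q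

end Situation

end
end ArtinStack

/-!
A lifting for a deformation situation over `f` is studied through pairs `(s, L)` of an element `s` of
`B'` avoiding the generic points of `V(𝔟)`, where `𝔟` is the preimage of `𝔞`, and an ideal `L` of `B'`
contained in `M`. Such a pair is good (`Situation.IsGood`, `Situation.IsGoodAtPoints`) if a lifting
exists over every `B'`-algebra in which `s` is invertible and `L` vanishes, and if conversely a lifting
forces `L` to vanish: generically, over quotients of étale `B'`-algebras, and exactly, over Artinian
local algebras which are localizations of quotients of `B'`. Compatible generic extenders exist for
all situations if and only if good pairs do. One direction is `Situation.exists_compatible_of_isGood`.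
The other, `Situation.exists_isGood_and_isGoodAtPoints`, also applies the hypothesis to the base change to
`B'[X]`, because an Artinian local algebra as above is a quotient of `B'[X]` but not always of `B'`;
the ideals over `B'` and `B'[X]` are compared along roots of unity, which generate étale algebras.

Let now a deformation situation over `e ≫ f` be given, with an object `w` over `B`. The hypothesis on
`f`, for the object `e(w)`, gives a good pair `(s₁, L₁)`. Over `R = (B' ⧸ L₁)[1/s₁]` the object `e(w)`
extends to an object `x'` whose image under `f` is the given extension `y'` of `f(e(w))`. Other
extensions differ from `x'` by deformations with trivial image under `f`. Let `A` be the quotient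
`(B' ⧸ 𝔟)[1/s₁]` of `R`. The kernel of `D_{x'|A} ⟶ D_{f(x'|A)}` is a finite module by `S2`, so it is
generated by the components of one deformation over `A + Q` with `Q` free, and generically on `Spec A`
this remains true after étale base change and over residue fields (`DefModule.exists_generator`),
where `D` is compatible with base change by hypothesis. By `S1` that deformation and `x'` glue to an
object `x''` over `R + Q`, which together with `w` forms a deformation situation over `e` (`Situation.Refinement`). It is
versal (`Situation.exists_refinement`): under a projectivity condition, a lifting for the composite
over an `R`-algebra `D` is a lifting for this situation along some homomorphism `R + Q ⟶ D` extending
`R ⟶ D`.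

The hypothesis on `e` gives a good pair `(s₃, L₃)` for the auxiliary situation. The pair for the
composite has `L` equal to the elements of `M` whose image in `R + Q` lies in `L₃`. Where `L` vanishes
there is a lifting, since a homomorphism from `R` that kills `L` extends to one from `R + Q` that kills
`L₃`, the relevant module being generically projective (`Situation.hasLift_of_isGood`). Conversely a
lifting for the composite yields one for the auxiliary situation by versality, which forces `L` to
vanish (`Situation.exists_genericElement_of_hasLift` on étale extensions,
`Situation.eq_zero_of_hasLift_of_isLocalRing` at points).

Objects and arrows of the fibre categories are handled in the total category of a fibred category, in
which every arrow is cartesian and the squares provided by `S1` are pushouts (`Tot.exists_glue`,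
`Tot.exists_desc`).
-/

namespace ArtinStack

noncomputable section

variable {S : Scheme.{u}ᵒᵖ ⥤ Type u}

set_option linter.unusedSectionVars false

/-! ### The total category of a fibred category -/

/-- The total category of a fibred category: its arrows lie over arrows of `(Aff/S)`. -/
abbrev Tot (X : Fibred.{v, w} S) := Pseudofunctor.CoGrothendieck X

namespace Tot

variable {X Y : Fibred.{v, w} S}

/-- The object of the total category given by an object of a fibre category. -/
abbrev tot {U : AffOver S} (a : X.Fib U) : Tot X := ⟨U, a⟩

/-- The arrow of the total category over `g` given by an arrow of a fibre category. -/
abbrev homMk {V U : AffOver S} {a : X.Fib V} {b : X.Fib U} (g : V ⟶ U) (φ : a ⟶ (X.res g).obj b) :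
    tot a ⟶ tot b := ⟨g, φ⟩

/-- The canonical arrow from the restriction of an object. -/
abbrev cart {V U : AffOver S} (g : V ⟶ U) (b : X.Fib U) : tot ((X.res g).obj b) ⟶ tot b :=
  homMk g (𝟙 _)

lemma homMk_comp {W V U : AffOver S} {a : X.Fib W} {b : X.Fib V} {c : X.Fib U} (h : W ⟶ V)
    (g : V ⟶ U) (k : W ⟶ U) (hk : h ≫ g = k) (φ : a ⟶ (X.res h).obj b)
    (ψ : b ⟶ (X.res g).obj c) :
    homMk h φ ≫ homMk g ψ =
      homMk k (φ ≫ (X.res h).map ψ ≫ (X.resComp h g k hk).inv.app c) := by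
  subst hk
  refine Pseudofunctor.CoGrothendieck.Hom.ext _ _ rfl ?_
  simp only [Pseudofunctor.CoGrothendieck.categoryStruct_comp_fiber, eqToHom_refl]
  rw [Category.comp_id]
  have : X.resComp h g (h ≫ g) rfl = Cat.Hom.toNatIso (X.mapComp g.op.toLoc h.op.toLoc) :=
    congrArg _ (X.mapComp'_eq_mapComp g.op.toLoc h.op.toLoc)
  rw [this]
  rfl

lemma homMk_inj {V U : AffOver S} {a : X.Fib V} {b : X.Fib U} {g : V ⟶ U}
    {φ ψ : a ⟶ (X.res g).obj b} (h : homMk g φ = homMk g ψ) : φ = ψ := by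
  simpa using Pseudofunctor.CoGrothendieck.Hom.congr h

lemma exists_homMk {V U : AffOver S} {a : X.Fib V} {b : X.Fib U} (α : tot a ⟶ tot b) (g : V ⟶ U)
    (h : α.base = g) : ∃ φ, α = homMk g φ := by
  subst h
  exact ⟨α.fiber, rfl⟩

/-- In a category fibred in groupoids every arrow is cartesian. -/
lemma existsUnique_lift [hX : ∀ U, IsGroupoid (X.obj U)] {a b c : Tot X} (φ : b ⟶ c) (ψ : a ⟶ c)
    (g : a.base ⟶ b.base) (h : g ≫ φ.base = ψ.base) :
    ∃! χ : a ⟶ b, χ.base = g ∧ χ ≫ φ = ψ := by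
  obtain ⟨A, a⟩ := a
  obtain ⟨B, b⟩ := b
  obtain ⟨C, c⟩ := c
  obtain ⟨p, φ⟩ := φ
  obtain ⟨q, ψ⟩ := ψ
  dsimp only at g h
  have i₁ : IsIso ((X.res g).map φ) := (hX _).all_isIso _
  have key : ∀ χ : a ⟶ (X.res g).obj b, (homMk g χ ≫ homMk p φ = homMk q ψ ↔
      χ = ψ ≫ (X.resComp g p q h).hom.app c ≫ inv ((X.res g).map φ)) := by
    intro χ
    rw [homMk_comp g p q h]
    constructor
    · intro e
      rw [← homMk_inj e]
      simp
    · rintro rfl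
      simp
  refine ⟨homMk g (ψ ≫ (X.resComp g p q h).hom.app c ≫ inv ((X.res g).map φ)),
    ⟨rfl, (key _).2 rfl⟩, ?_⟩
  rintro ⟨g', χ⟩ ⟨e, h'⟩
  dsimp only at e
  subst e
  rw [(key χ).1 h']

section Groupoid

variable [hX : ∀ U, IsGroupoid (X.obj U)]

/-- The arrow over `g` through which `ψ` factors. -/
lemma exists_lift {a b c : Tot X} (φ : b ⟶ c) (ψ : a ⟶ c)
    (g : a.base ⟶ b.base) (h : g ≫ φ.base = ψ.base) :
    ∃ χ : a ⟶ b, χ.base = g ∧ χ ≫ φ = ψ := (existsUnique_lift φ ψ g h).exists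

lemma hom_ext_of_comp {a b c : Tot X} (φ : b ⟶ c) {χ χ' : a ⟶ b} (hb : χ.base = χ'.base)
    (h : χ ≫ φ = χ' ≫ φ) : χ = χ' :=
  (existsUnique_lift φ (χ' ≫ φ) χ'.base rfl).unique ⟨hb, h⟩ ⟨rfl, rfl⟩

end Groupoid

@[simp] lemma comp_base {a b c : Tot X} (φ : a ⟶ b) (ψ : b ⟶ c) :
    (φ ≫ ψ).base = φ.base ≫ ψ.base := rfl

/-- The image of an object of a fibre category under a 1-morphism. -/
abbrev fobj (f : X ⟶ Y) {U : AffOver S} (a : X.Fib U) : Y.Fib U := (f.app _).toFunctor.obj a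

/-- The image of an arrow of the total category under a 1-morphism. -/
def map (f : X ⟶ Y) {V U : AffOver S} {a : X.Fib V} {b : X.Fib U} (φ : tot a ⟶ tot b) :
    tot (fobj f a) ⟶ tot (fobj f b) :=
  (Pseudofunctor.CoGrothendieck.map f).map φ

section
variable {W V U : AffOver S} {a : X.Fib W} {b : X.Fib V} {c : X.Fib U}

@[simp] lemma map_base (f : X ⟶ Y) (φ : tot a ⟶ tot b) : (map f φ).base = φ.base := rfl

@[simp] lemma map_comp (f : X ⟶ Y) (φ : tot a ⟶ tot b) (ψ : tot b ⟶ tot c) :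
    map f (φ ≫ ψ) = map f φ ≫ map f ψ :=
  (Pseudofunctor.CoGrothendieck.map f).map_comp φ ψ

@[simp] lemma map_id (f : X ⟶ Y) : map f (𝟙 (tot a)) = 𝟙 _ :=
  (Pseudofunctor.CoGrothendieck.map f).map_id _

end

lemma map_homMk (f : X ⟶ Y) {V U : AffOver S} {a : X.Fib V} {b : X.Fib U} (g : V ⟶ U)
    (φ : a ⟶ (X.res g).obj b) :
    map f (homMk g φ) =
      homMk g ((f.app _).toFunctor.map φ ≫ (Lifting.resIso f g b).hom) := rfl

lemma map_comp_map {Z : Fibred.{v, w} S} (e : X ⟶ Y) (f : Y ⟶ Z) {V U : AffOver S}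
    {a : X.Fib V} {b : X.Fib U} (φ : tot a ⟶ tot b) :
    map (e ≫ f) φ = map f (map e φ) := by
  have n := (Pseudofunctor.CoGrothendieck.mapCompIso e f).hom.naturality φ
  exact (Category.comp_id _).symm.trans (n.trans (Category.id_comp _))

lemma isIso_of_base [hX : ∀ U, IsGroupoid (X.obj U)] {U : AffOver S} {a b : X.Fib U}
    (φ : tot a ⟶ tot b) (h : φ.base = 𝟙 U) :
    ∃ ψ : tot b ⟶ tot a, ψ.base = 𝟙 U ∧ φ ≫ ψ = 𝟙 _ ∧ ψ ≫ φ = 𝟙 _ := by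
  obtain ⟨ψ, hψ, e⟩ := exists_lift φ (𝟙 (tot b)) (𝟙 U) (by simp [h])
  refine ⟨ψ, hψ, hom_ext_of_comp φ (by simp [h, hψ]) (by simp [e]), e⟩

/-- Arrows over an identity come from the fibre category. -/
lemma exists_vertical {U : AffOver S} {a b : X.Fib U} (φ : tot a ⟶ tot b) (h : φ.base = 𝟙 U) :
    ∃ χ : a ⟶ b, φ = homMk (𝟙 U) (χ ≫ (X.resId U).inv.app b) := by
  obtain ⟨χ, rfl⟩ := exists_homMk φ _ h
  exact ⟨χ ≫ (X.resId U).hom.app b, by simp⟩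

lemma inv_comp_inv_eq_id {C : Type*} [Category C] {a b : C} (r : a ≅ b) (s : b ≅ a)
    (h : r.hom ≫ s.hom = 𝟙 a) : s.inv ≫ r.inv = 𝟙 a := by
  rw [← Iso.trans_inv, Iso.inv_eq_inv (r ≪≫ s) (Iso.refl a) |>.2 h, Iso.refl_inv]

lemma homMk_vertical_comp {V U : AffOver S} {a a' : X.Fib V} {b : X.Fib U} (χ : a ⟶ a') (g : V ⟶ U)
    (φ : a' ⟶ (X.res g).obj b) :
    homMk (𝟙 V) (χ ≫ (X.resId V).inv.app a') ≫ homMk g φ = homMk g (χ ≫ φ) := by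
  rw [homMk_comp (𝟙 V) g g (Category.id_comp g)]
  congr 1
  have n : φ ≫ (X.resId V).inv.app _ = (X.resId V).inv.app a' ≫ (X.res (𝟙 V)).map φ :=
    (X.resId V).inv.naturality φ
  have n' := Fibred.resComp_id_left (X := X) g b
  rw [Category.assoc, ← reassoc_of% n]
  have : (X.resId V).inv.app ((X.res g).obj b) ≫
      (X.resComp (𝟙 V) g g (Category.id_comp g)).inv.app b = 𝟙 _ :=
    inv_comp_inv_eq_id ((X.resComp (𝟙 V) g g (Category.id_comp g)).app b)
      ((X.resId V).app ((X.res g).obj b)) n'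
  exact congrArg (χ ≫ ·) ((congrArg (φ ≫ ·) this).trans (Category.comp_id _))

lemma homMk_comp_vertical {V U : AffOver S} {a : X.Fib V} {b b' : X.Fib U} (χ : b ⟶ b') (g : V ⟶ U)
    (φ : a ⟶ (X.res g).obj b) :
    homMk g φ ≫ homMk (𝟙 U) (χ ≫ (X.resId U).inv.app b') = homMk g (φ ≫ (X.res g).map χ) := by
  rw [homMk_comp g (𝟙 U) g (Category.comp_id g)]
  congr 2
  have n' := Fibred.resComp_id_right (X := X) g b'
  rw [Functor.map_comp, Category.assoc]
  have : (X.res g).map ((X.resId U).inv.app b') ≫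
      (X.resComp g (𝟙 U) g (Category.comp_id g)).inv.app b' = 𝟙 _ :=
    inv_comp_inv_eq_id ((X.resComp g (𝟙 U) g (Category.comp_id g)).app b')
      ((X.res g).mapIso ((X.resId U).app b')) n'
  exact (congrArg ((X.res g).map χ ≫ ·) this).trans (Category.comp_id _)

end Tot

namespace Tot
variable {X Y : Fibred.{v, w} S}

section Gluing

variable {P A₂ A₁ B : AffOver S} {i : A₁ ⟶ A₂} {g : A₁ ⟶ B} {p₁ : A₂ ⟶ P} {p₂ : B ⟶ P}

/-- If the gluing functor of a square is an equivalence, two arrows out of an object over the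
corner can be completed to a commutative square. -/
lemma exists_glue [hX : ∀ U, IsGroupoid (X.obj U)] (comm : i ≫ p₁ = g ≫ p₂)
    (h : (X.gluing i g p₁ p₂ comm).IsEquivalence) {a : X.Fib A₁} {z : X.Fib A₂} {c : X.Fib B}
    (α : tot a ⟶ tot z) (β : tot a ⟶ tot c) (hα : α.base = i) (hβ : β.base = g) :
    ∃ (ζ : X.Fib P) (p : tot z ⟶ tot ζ) (q : tot c ⟶ tot ζ), p.base = p₁ ∧ q.base = p₂ ∧
      α ≫ p = β ≫ q := by
  obtain ⟨φ, rfl⟩ := exists_homMk α _ hα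
  obtain ⟨ψ, rfl⟩ := exists_homMk β _ hβ
  have i₁ : IsIso φ := (hX _).all_isIso _
  have i₂ : IsIso ψ := (hX _).all_isIso _
  let t : Limits.CategoricalPullback (X.res i) (X.res g) :=
    { fst := z, snd := c, iso := (asIso φ).symm ≪≫ asIso ψ }
  let ζ := (X.gluing i g p₁ p₂ comm).objPreimage t
  let e : (X.gluing i g p₁ p₂ comm).obj ζ ≅ t := (X.gluing i g p₁ p₂ comm).objObjPreimageIso t
  have hw : (X.res i).map e.inv.fst ≫ (X.resComp i p₁ (i ≫ p₁) rfl).inv.app ζ ≫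
      (X.resComp g p₂ (i ≫ p₁) comm.symm).hom.app ζ =
      (inv φ ≫ ψ) ≫ (X.res g).map e.inv.snd := e.inv.w
  let ε₁ : z ⟶ (X.res p₁).obj ζ := e.inv.fst
  let ε₂ : c ⟶ (X.res p₂).obj ζ := e.inv.snd
  replace hw : (X.res i).map ε₁ ≫ (X.resComp i p₁ (i ≫ p₁) rfl).inv.app ζ ≫
      (X.resComp g p₂ (i ≫ p₁) comm.symm).hom.app ζ =
      (inv φ ≫ ψ) ≫ (X.res g).map ε₂ := hw
  refine ⟨ζ, homMk p₁ ε₁, homMk p₂ ε₂, rfl, rfl, ?_⟩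
  rw [homMk_comp i p₁ (i ≫ p₁) rfl, homMk_comp g p₂ (i ≫ p₁) comm.symm]
  congr 1
  rw [← cancel_mono ((X.resComp g p₂ (i ≫ p₁) comm.symm).hom.app ζ)]
  simp only [Category.assoc, Iso.inv_hom_id_app]
  rw [hw, Category.assoc, IsIso.hom_inv_id_assoc]
  exact congrArg (ψ ≫ ·) (Category.comp_id _).symm

/-- The compatibility with the gluing isomorphisms required of a pair of arrows in
`exists_desc`. -/
lemma gluing_aux {C : Type*} [Category C] {a z₁ c₁ ζ₁ ζ₂ ζ t₁ t₂ t : C} (φ : a ⟶ z₁) (ψ : a ⟶ c₁)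
    (π₁ : z₁ ⟶ ζ₁) (π₂ : c₁ ⟶ ζ₂) (r₁ : ζ ≅ ζ₁) (r₂ : ζ ≅ ζ₂) (ω₁ : z₁ ⟶ t₁) (ω₂ : c₁ ⟶ t₂)
    (s₁ : t ≅ t₁) (s₂ : t ≅ t₂) [IsIso φ] (χ₁ : ζ₁ ⟶ t₁) (χ₂ : ζ₂ ⟶ t₂) [IsIso π₁]
    (hπ : φ ≫ π₁ ≫ r₁.inv = ψ ≫ π₂ ≫ r₂.inv) (hω : φ ≫ ω₁ ≫ s₁.inv = ψ ≫ ω₂ ≫ s₂.inv)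
    (h₁ : π₁ ≫ χ₁ = ω₁) (h₂ : π₂ ≫ χ₂ = ω₂) :
    χ₁ ≫ s₁.inv ≫ s₂.hom = (r₁.inv ≫ r₂.hom) ≫ χ₂ := by
  rw [← cancel_epi π₁, ← cancel_epi φ, reassoc_of% h₁, reassoc_of% hω, Category.assoc,
    reassoc_of% hπ]
  simp [h₂]

/-- If the gluing functor of a square is an equivalence, the squares of `exists_glue` are
pushouts. -/
lemma exists_desc [hX : ∀ U, IsGroupoid (X.obj U)] (comm : i ≫ p₁ = g ≫ p₂)
    (h : (X.gluing i g p₁ p₂ comm).IsEquivalence) {a : X.Fib A₁} {z : X.Fib A₂} {c : X.Fib B}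
    (α : tot a ⟶ tot z) (β : tot a ⟶ tot c) (hα : α.base = i) (hβ : β.base = g)
    {ζ : X.Fib P} (p : tot z ⟶ tot ζ) (q : tot c ⟶ tot ζ) (hp : p.base = p₁) (hq : q.base = p₂)
    (hpq : α ≫ p = β ≫ q) {t : Tot X} (k : P ⟶ t.base) (a₁ : tot z ⟶ t) (a₂ : tot c ⟶ t)
    (h₁ : a₁.base = p₁ ≫ k) (h₂ : a₂.base = p₂ ≫ k) (h₁₂ : α ≫ a₁ = β ≫ a₂) :
    ∃ χ : tot ζ ⟶ t, χ.base = k ∧ p ≫ χ = a₁ ∧ q ≫ χ = a₂ := by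
  obtain ⟨U, t⟩ := t
  obtain ⟨b₁, hb₁, rfl⟩ := exists_lift (cart k t) a₁ p₁ h₁.symm
  obtain ⟨b₂, hb₂, rfl⟩ := exists_lift (cart k t) a₂ p₂ h₂.symm
  replace h₁₂ : α ≫ b₁ = β ≫ b₂ := by
    refine hom_ext_of_comp (cart k t) ?_ (by simpa only [Category.assoc] using h₁₂)
    simp [hα, hβ, hb₁, hb₂, comm]
  obtain ⟨φ, rfl⟩ := exists_homMk α _ hα
  obtain ⟨ψ, rfl⟩ := exists_homMk β _ hβ
  obtain ⟨π₁, rfl⟩ := exists_homMk p _ hp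
  obtain ⟨π₂, rfl⟩ := exists_homMk q _ hq
  obtain ⟨ω₁, rfl⟩ := exists_homMk b₁ _ hb₁
  obtain ⟨ω₂, rfl⟩ := exists_homMk b₂ _ hb₂
  have i₁ : IsIso π₁ := (hX _).all_isIso _
  have i₂ : IsIso π₂ := (hX _).all_isIso _
  have i₃ : IsIso φ := (hX _).all_isIso _
  rw [homMk_comp i p₁ (i ≫ p₁) rfl, homMk_comp g p₂ (i ≫ p₁) comm.symm] at hpq h₁₂
  let m₁ : (X.res p₁).obj ζ ⟶ (X.res p₁).obj ((X.res k).obj t) := inv π₁ ≫ ω₁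
  let m₂ : (X.res p₂).obj ζ ⟶ (X.res p₂).obj ((X.res k).obj t) := inv π₂ ≫ ω₂
  have hm₁ : π₁ ≫ m₁ = ω₁ := IsIso.hom_inv_id_assoc π₁ ω₁
  have hm₂ : π₂ ≫ m₂ = ω₂ := IsIso.hom_inv_id_assoc π₂ ω₂
  let m : (X.gluing i g p₁ p₂ comm).obj ζ ⟶ (X.gluing i g p₁ p₂ comm).obj ((X.res k).obj t) :=
    { fst := m₁
      snd := m₂
      w := gluing_aux φ ψ ((X.res i).map π₁) ((X.res g).map π₂)
        ((X.resComp i p₁ (i ≫ p₁) rfl).app ζ) ((X.resComp g p₂ (i ≫ p₁) comm.symm).app ζ)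
        ((X.res i).map ω₁) ((X.res g).map ω₂)
        ((X.resComp i p₁ (i ≫ p₁) rfl).app ((X.res k).obj t))
        ((X.resComp g p₂ (i ≫ p₁) comm.symm).app ((X.res k).obj t))
        ((X.res i).map m₁) ((X.res g).map m₂) (homMk_inj hpq) (homMk_inj h₁₂)
        (by rw [← Functor.map_comp, hm₁]) (by rw [← Functor.map_comp, hm₂]) }
  let χ : ζ ⟶ (X.res k).obj t := (X.gluing i g p₁ p₂ comm).preimage m
  have e₁ : (X.res p₁).map χ = m₁ :=
    congrArg Limits.CategoricalPullback.Hom.fst ((X.gluing i g p₁ p₂ comm).map_preimage m)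
  have e₂ : (X.res p₂).map χ = m₂ :=
    congrArg Limits.CategoricalPullback.Hom.snd ((X.gluing i g p₁ p₂ comm).map_preimage m)
  refine ⟨homMk (𝟙 P) (χ ≫ (X.resId P).inv.app _) ≫ cart k t, by simp, ?_, ?_⟩
  · rw [← Category.assoc, homMk_comp_vertical, e₁, hm₁]
  · rw [← Category.assoc, homMk_comp_vertical, e₂, hm₂]

end Gluing

end Tot

/-! ### Liftings as arrows of the total category -/

namespace Lifting
open Tot
variable {X Y : Fibred.{v, w} S}

/-- The arrow of the total category given by a lifting. -/
abbrev toArr {T T₂ : AffOver S} {i : T ⟶ T₂} {x : X.Fib T} (l : Lifting X i x) :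
    tot x ⟶ tot l.obj := Tot.homMk i l.iso.inv

/-- The lifting given by an arrow of the total category. -/
def ofArr [hX : ∀ U, IsGroupoid (X.obj U)] {T T₂ : AffOver S} {i : T ⟶ T₂} {x : X.Fib T}
    {z : X.Fib T₂} (α : tot x ⟶ tot z) (h : α.base = i) : Lifting X i x where
  obj := z
  iso :=
    letI φ : x ⟶ (X.res i).obj z := (Tot.exists_homMk α i h).choose
    haveI : IsIso φ := (hX _).all_isIso _
    (asIso φ).symm

lemma toArr_ofArr [∀ U, IsGroupoid (X.obj U)] {T T₂ : AffOver S} {i : T ⟶ T₂} {x : X.Fib T}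
    {z : X.Fib T₂} (α : tot x ⟶ tot z) (h : α.base = i) : (ofArr α h).toArr = α :=
  (Tot.exists_homMk α i h).choose_spec.symm

lemma toArr_push {T T₁ T₂ : AffOver S} {i : T ⟶ T₂} {x : X.Fib T} (l : Lifting X i x)
    (j : T ⟶ T₁) (h : T₁ ⟶ T₂) (e : j ≫ h = i) :
    (l.push j h e).toArr ≫ cart h l.obj = l.toArr := by
  refine (homMk_comp j h i e _ _).trans ?_
  congr 1
  simp [push]

lemma toArr_baseChange {T T₂ V V₂ : AffOver S} {i : T ⟶ T₂} {x : X.Fib T} (l : Lifting X i x)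
    (j : V ⟶ V₂) (g : V ⟶ T) (g₂ : V₂ ⟶ T₂) (e : j ≫ g₂ = g ≫ i) :
    (l.baseChange j g g₂ e).toArr ≫ cart g₂ l.obj = cart g x ≫ l.toArr := by
  refine (homMk_comp j g₂ (j ≫ g₂) rfl _ _).trans
    (Eq.trans ?_ (homMk_comp g i (j ≫ g₂) e.symm _ _).symm)
  congr 1
  simp [baseChange, Fibred.resSq]

lemma isom_iff [hX : ∀ U, IsGroupoid (X.obj U)] {T T₂ : AffOver S} {i : T ⟶ T₂} {x : X.Fib T}
    (l l' : Lifting X i x) :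
    l.Isom l' ↔ ∃ χ : tot l.obj ⟶ tot l'.obj, χ.base = 𝟙 T₂ ∧ l.toArr ≫ χ = l'.toArr := by
  constructor
  · rintro ⟨e, he⟩
    refine ⟨homMk (𝟙 _) (e.hom ≫ (X.resId T₂).inv.app _), rfl, ?_⟩
    rw [homMk_comp_vertical]
    congr 1
    rw [Iso.inv_comp_eq, ← he]
    simp
  · rintro ⟨χ, h, e⟩
    obtain ⟨χ, rfl⟩ := exists_vertical χ h
    have : IsIso χ := (hX _).all_isIso _
    refine ⟨asIso χ, ?_⟩
    rw [homMk_comp_vertical] at e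
    have := homMk_inj e
    rw [asIso_hom]
    rw [Iso.inv_comp_eq] at this
    rw [this]
    simp

/-- The image of a lifting is isomorphic to the restriction of a lifting `y` if and only if it
maps to `y`. -/
lemma map_isom_push_iff [hY : ∀ U, IsGroupoid (Y.obj U)] (f : X ⟶ Y) {T T₁ T₂ : AffOver S}
    {i : T ⟶ T₂} {x : X.Fib T} (y : Lifting Y i (fobj f x)) (j : T ⟶ T₁) (h : T₁ ⟶ T₂)
    (e : j ≫ h = i) (l : Lifting X j x) :
    (l.map f).Isom (y.push j h e) ↔ ∃ m : tot (fobj f l.obj) ⟶ tot y.obj, m.base = h ∧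
      Tot.map f l.toArr ≫ m = y.toArr := by
  have key : ∀ (L P : Lifting Y j (fobj f x)) (c : tot P.obj ⟶ tot y.obj), c.base = h →
      P.toArr ≫ c = y.toArr → (L.Isom P ↔ ∃ m : tot L.obj ⟶ tot y.obj, m.base = h ∧
        L.toArr ≫ m = y.toArr) := by
    intro L P c hc hP
    rw [isom_iff]
    constructor
    · rintro ⟨χ, hχ, e⟩
      exact ⟨χ ≫ c, by simp [hχ, hc], by rw [← Category.assoc, e, hP]⟩
    · rintro ⟨m, hm, e⟩
      obtain ⟨χ, hχ, rfl⟩ := exists_lift c m (𝟙 _) (by simp [hm, hc])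
      exact ⟨χ, hχ, hom_ext_of_comp c (by simp [hχ]) (by rw [Category.assoc, e, hP])⟩
  exact key (l.map f) (y.push j h e) (cart h y.obj) rfl (toArr_push y j h e)

end Lifting

namespace AffOver

/-- A homomorphism of algebras over the ring of `U` gives a morphism over `S`. -/
def factor {V V' U : AffOver S} (i : V ⟶ U) (k : V' ⟶ U) (r : V.ring →+* V'.ring)
    (h : r.comp i.toRing.hom = k.toRing.hom) : V' ⟶ V :=
  ⟨CommRingCat.ofHom r, by
    have e : i.toRing ≫ CommRingCat.ofHom r = k.toRing := CommRingCat.hom_ext h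
    rw [← i.w, ← k.w, ← e]
    simp⟩

@[simp] lemma factor_comp {V V' U : AffOver S} (i : V ⟶ U) (k : V' ⟶ U)
    (r : V.ring →+* V'.ring) (h : r.comp i.toRing.hom = k.toRing.hom) :
    factor i k r h ≫ i = k :=
  hom_ext (CommRingCat.hom_ext h)

@[simp] lemma specHom_toRing (U : AffOver S) {A : Type u} [CommRing A] (φ : U.ring →+* A) :
    (U.specHom φ).toRing.hom = φ := rfl

lemma hom_ext' {V U : AffOver S} {f g : V ⟶ U} (h : ∀ a, f.toRing.hom a = g.toRing.hom a) : f = g :=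
  hom_ext (CommRingCat.hom_ext (RingHom.ext h))

lemma congr_toRing {V U : AffOver S} {f g : V ⟶ U} (h : f = g) (a : U.ring) :
    f.toRing.hom a = g.toRing.hom a := by rw [h]

/-- The morphism of spectra of algebras over `U` attached to a homomorphism of algebras. -/
def specAlg (U : AffOver S) {A B : Type u} [CommRing A] [CommRing B] (φ : U.ring →+* A)
    (ψ : U.ring →+* B) (r : A →+* B) (h : r.comp φ = ψ) : U.spec ψ ⟶ U.spec φ :=
  factor (U.specHom φ) (U.specHom ψ) r h

@[simp] lemma specAlg_comp (U : AffOver S) {A B : Type u} [CommRing A] [CommRing B]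
    (φ : U.ring →+* A) (ψ : U.ring →+* B) (r : A →+* B) (h : r.comp φ = ψ) :
    U.specAlg φ ψ r h ≫ U.specHom φ = U.specHom ψ := factor_comp ..

lemma eq_of_surjective {V V' U : AffOver S} (i : V ⟶ U) (hi : Function.Surjective i.toRing.hom)
    {p q : V' ⟶ V} (h : p ≫ i = q ≫ i) : p = q := by
  refine hom_ext' fun a => ?_
  obtain ⟨b, rfl⟩ := hi a
  exact congr_toRing h b

end AffOver

/-! ### The lifting problem attached to a deformation situation -/

namespace Situation
open Tot
variable {X Y : Fibred.{v, w} S} {f : X ⟶ Y} (ξ : Situation f)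

/-- The closed subscheme `Spec B` of `Spec B'`. -/
abbrev T : AffOver S := ξ.T₂.spec (Ideal.Quotient.mk ξ.I)

/-- The morphism `Spec B ⟶ Spec B'`. -/
abbrev incl : ξ.T ⟶ ξ.T₂ := ξ.T₂.specHom (Ideal.Quotient.mk ξ.I)

lemma incl_surjective : Function.Surjective ξ.incl.toRing.hom := Ideal.Quotient.mk_surjective

/-- The arrow `f(x) ⟶ y` of the deformation situation. -/
abbrev arr : tot (fobj f ξ.x) ⟶ tot ξ.y.obj := ξ.y.toArr

/-- For `g : V₂ ⟶ Spec B'`, the deformation problem restricted to `V₂` has a solution: with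
`V ⟶ V₂` the closed subscheme obtained from `Spec B` by base change, the restriction of `x` to `V`
lifts to `V₂` compatibly with `f(x) ⟶ y`. -/
def LiftsAlong {V₂ : AffOver S} (g : V₂ ⟶ ξ.T₂) : Prop :=
  ∃ (V : AffOver S) (i : V ⟶ V₂) (x₁ : X.Fib V) (z : X.Fib V₂)
    (α : tot x₁ ⟶ tot ξ.x) (l : tot x₁ ⟶ tot z) (m : tot (fobj f z) ⟶ tot ξ.y.obj),
    Function.Surjective i.toRing.hom ∧ RingHom.ker i.toRing.hom = ξ.I.map g.toRing.hom ∧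
    l.base = i ∧ m.base = g ∧ map f l ≫ m = map f α ≫ ξ.arr

/-- The restriction of the deformation problem to a `B'`-algebra `D` has a solution. -/
def HasLift {D : Type u} [CommRing D] (v : ξ.T₂.ring →+* D) : Prop :=
  ξ.LiftsAlong (ξ.T₂.specHom v)

variable {ξ}

section
variable [hX : ∀ U, IsGroupoid (X.obj U)] [hY : ∀ U, IsGroupoid (Y.obj U)]

/-- A solution of the lifting problem restricts along every morphism, and may be taken to extend
any given restriction of `x`. -/
lemma LiftsAlong.exists_arrow {V₂ : AffOver S} {g : V₂ ⟶ ξ.T₂} (H : ξ.LiftsAlong g)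
    {V' V₃ : AffOver S} (i' : V' ⟶ V₃) (h : V₃ ⟶ V₂) {x' : X.Fib V'} (α' : tot x' ⟶ tot ξ.x)
    (hp : i' ≫ h ≫ g = α'.base ≫ ξ.incl) :
    ∃ (z' : X.Fib V₃) (l' : tot x' ⟶ tot z') (m' : tot (fobj f z') ⟶ tot ξ.y.obj),
      l'.base = i' ∧ m'.base = h ≫ g ∧ map f l' ≫ m' = map f α' ≫ ξ.arr := by
  obtain ⟨V, i, x₁, z, α, l, m, hi, hker, rfl, rfl, e⟩ := H
  have hle : RingHom.ker l.base.toRing.hom ≤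
      RingHom.ker ((i'.toRing.hom).comp h.toRing.hom) := by
    rw [hker, Ideal.map_le_iff_le_comap]
    intro b hb
    have := AffOver.congr_toRing hp b
    rw [Ideal.mem_comap, RingHom.mem_ker]
    refine this.trans ?_
    change α'.base.toRing.hom (Ideal.Quotient.mk ξ.I b) = 0
    rw [Ideal.Quotient.eq_zero_iff_mem.2 hb, map_zero]
  let j : V' ⟶ V := AffOver.factor l.base (i' ≫ h)
    (l.base.toRing.hom.liftOfSurjective hi ⟨(i'.toRing.hom).comp h.toRing.hom, hle⟩)
    (RingHom.liftOfRightInverse_comp _ _ (Function.rightInverse_surjInv hi)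
      ⟨(i'.toRing.hom).comp h.toRing.hom, hle⟩)
  have hj : j ≫ l.base = i' ≫ h := AffOver.factor_comp ..
  have hα : α.base ≫ ξ.incl = l.base ≫ m.base := by
    exact (congrArg Pseudofunctor.CoGrothendieck.Hom.base e).symm
  have hjα : j ≫ α.base = α'.base := by
    refine AffOver.eq_of_surjective ξ.incl ξ.incl_surjective ?_
    rw [Category.assoc, hα, ← Category.assoc, hj, Category.assoc, hp]
  obtain ⟨χ, hχ, rfl⟩ := exists_lift α α' j hjα
  obtain ⟨l', hl', e'⟩ := exists_lift (cart h z) (χ ≫ l) i' (by simp [hχ, hj])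
  refine ⟨(X.res h).obj z, l', map f (cart h z) ≫ m, hl', rfl, ?_⟩
  rw [← Category.assoc, ← map_comp, e', map_comp, Category.assoc, e, map_comp, Category.assoc]

lemma LiftsAlong.comp {V₂ V₃ : AffOver S} {g : V₂ ⟶ ξ.T₂} (H : ξ.LiftsAlong g)
    (h : V₃ ⟶ V₂) : ξ.LiftsAlong (h ≫ g) := by
  let i' : V₃.spec (Ideal.Quotient.mk (ξ.I.map (h ≫ g).toRing.hom)) ⟶ V₃ :=
    V₃.specHom (Ideal.Quotient.mk (ξ.I.map (h ≫ g).toRing.hom))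
  let r : ξ.T₂.ring ⧸ ξ.I →+* V₃.ring ⧸ ξ.I.map (h ≫ g).toRing.hom :=
    Ideal.quotientMap _ (h ≫ g).toRing.hom Ideal.le_comap_map
  let p : V₃.spec (Ideal.Quotient.mk (ξ.I.map (h ≫ g).toRing.hom)) ⟶ ξ.T :=
    AffOver.factor ξ.incl (i' ≫ h ≫ g) r rfl
  have hp : p ≫ ξ.incl = i' ≫ h ≫ g := AffOver.factor_comp ..
  obtain ⟨z', l', m', h₁, h₂, e⟩ := H.exists_arrow i' h (cart p ξ.x) hp.symm
  exact ⟨_, i', _, z', cart p ξ.x, l', m', Ideal.Quotient.mk_surjective,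
    Ideal.mk_ker, h₁, h₂, e⟩

lemma HasLift.comp {D E : Type u} [CommRing D] [CommRing E] {v : ξ.T₂.ring →+* D}
    (H : ξ.HasLift v) (w : D →+* E) : ξ.HasLift (w.comp v) := by
  have := LiftsAlong.comp H (ξ.T₂.specAlg v (w.comp v) w rfl)
  rwa [AffOver.specAlg_comp] at this

/-- Solutions transfer along homomorphisms of `B'`-algebras. -/
lemma HasLift.of_comp_eq {D E : Type u} [CommRing D] [CommRing E] {v : ξ.T₂.ring →+* D}
    (H : ξ.HasLift v) (w : D →+* E) {v' : ξ.T₂.ring →+* E} (h : ∀ b, w (v b) = v' b) :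
    ξ.HasLift v' := by
  obtain rfl : w.comp v = v' := RingHom.ext h
  exact H.comp w

lemma liftsAlong_iff {V₂ : AffOver S} (g : V₂ ⟶ ξ.T₂) :
    ξ.LiftsAlong g ↔ ξ.HasLift g.toRing.hom := by
  have e₁ := AffOver.factor_comp g (ξ.T₂.specHom g.toRing.hom) (RingHom.id _) rfl
  have e₂ := AffOver.factor_comp (ξ.T₂.specHom g.toRing.hom) g (RingHom.id _) rfl
  constructor
  · intro H
    have h := H.comp (AffOver.factor g (ξ.T₂.specHom g.toRing.hom) (RingHom.id _) rfl)
    exact Eq.mp (congrArg (fun k => ξ.LiftsAlong k) e₁) h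
  · intro H
    have h := LiftsAlong.comp H (AffOver.factor (ξ.T₂.specHom g.toRing.hom) g (RingHom.id _) rfl)
    exact Eq.mp (congrArg (fun k => ξ.LiftsAlong k) e₂) h

lemma liftsOver_iff (K : Ideal ξ.T₂.ring) (hK : K ≤ ξ.I) :
    ξ.LiftsOver K hK ↔ ξ.HasLift (Ideal.Quotient.mk K) := by
  let j : ξ.T ⟶ ξ.T₂.spec (Ideal.Quotient.mk K) :=
    AffOver.specMap (𝟙 ξ.T₂) _ _ (Ideal.Quotient.factor hK) (by ext x; simp)
  have hj : j ≫ ξ.T₂.specHom (Ideal.Quotient.mk K) = ξ.incl := AffOver.hom_ext' fun _ => rfl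
  have key : ξ.LiftsOver K hK ↔ ∃ l : Lifting X j ξ.x, ∃ m : tot (fobj f l.obj) ⟶ tot ξ.y.obj,
      m.base = ξ.T₂.specHom (Ideal.Quotient.mk K) ∧ map f l.toArr ≫ m = ξ.arr :=
    exists_congr fun l => Lifting.map_isom_push_iff f ξ.y j _ hj l
  rw [key]
  constructor
  · rintro ⟨l, m, hm, e⟩
    exact ⟨_, _, _, _, 𝟙 (tot ξ.x), l.toArr, m, Ideal.Quotient.factor_surjective hK,
      Ideal.Quotient.factor_ker hK, rfl, hm, by simp [e]⟩
  · intro H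
    obtain ⟨z, l, m, h₁, h₂, e⟩ := LiftsAlong.exists_arrow H j (𝟙 _) (𝟙 (tot ξ.x))
      (by rw [Category.id_comp, hj]; exact (Category.id_comp _).symm)
    refine ⟨Lifting.ofArr l h₁, m, by rw [h₂, Category.id_comp], ?_⟩
    rw [Lifting.toArr_ofArr]
    exact e.trans (by simp)

section BaseChange

/-- The structure arrow of the base change of a deformation situation. -/
lemma toArr_baseChange_resIso {T T₂ V V₂ : AffOver S} {i : T ⟶ T₂} {x : X.Fib T}
    (y : Lifting Y i (fobj f x)) (j : V ⟶ V₂) (g : V ⟶ T) (g₂ : V₂ ⟶ T₂) (e : j ≫ g₂ = g ≫ i) :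
    (Lifting.mk (x := fobj f ((X.res g).obj x)) (y.baseChange j g g₂ e).obj
      ((y.baseChange j g g₂ e).iso ≪≫ (Lifting.resIso f g x).symm)).toArr ≫ cart g₂ y.obj =
        map f (cart g x) ≫ y.toArr := by
  let ρ := (Lifting.resIso f g x).hom
  have e₀ : (y.baseChange j g g₂ e).toArr ≫ cart g₂ y.obj = cart g (fobj f x) ≫ y.toArr :=
    Lifting.toArr_baseChange y j g g₂ e
  have e₁ := homMk_vertical_comp ρ j (y.baseChange j g g₂ e).iso.inv
  have e₂ := homMk_vertical_comp ρ g (𝟙 ((Y.res g).obj (fobj f x)))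
  have h₂ : map f (cart g x) = homMk g (ρ ≫ 𝟙 _) := by
    rw [map_homMk, Category.comp_id]
    congr 1
    simp [ρ]
  rw [h₂, ← e₂, Category.assoc]
  refine Eq.trans ?_ (congrArg (_ ≫ ·) e₀)
  refine (congrArg (· ≫ cart g₂ y.obj) e₁.symm).trans ?_
  exact Category.assoc _ _ _

/-- A morphism of deformation situations given by arrows identifies the lifting problems over
every `V₂ ⟶ T₂`. -/
lemma liftsAlong_iff_of_arr {ξ ξ' : Situation f} (g₂ : ξ'.T₂ ⟶ ξ.T₂)
    (G : tot ξ'.x ⟶ tot ξ.x) (m₀ : tot ξ'.y.obj ⟶ tot ξ.y.obj) (hm₀ : m₀.base = g₂)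
    (hI : ξ'.I = ξ.I.map g₂.toRing.hom) (e₀ : ξ'.arr ≫ m₀ = map f G ≫ ξ.arr)
    {V₂ : AffOver S} (g : V₂ ⟶ ξ'.T₂) : ξ'.LiftsAlong g ↔ ξ.LiftsAlong (g ≫ g₂) := by
  have hb : ξ'.incl ≫ g₂ = G.base ≫ ξ.incl := by
    rw [← hm₀]
    exact congrArg Pseudofunctor.CoGrothendieck.Hom.base e₀
  constructor
  · rintro ⟨V, i, x₁, z, α, l, m, hi, hker, hl, hm, e⟩
    refine ⟨V, i, x₁, z, α ≫ G, l, m ≫ m₀, hi, ?_, hl, ?_, ?_⟩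
    · rw [hker, hI, Ideal.map_map]
      rfl
    · rw [comp_base, hm, hm₀]
    · rw [map_comp, Category.assoc, ← e₀, ← Category.assoc, e, Category.assoc]
  · intro H
    let I₃ : Ideal V₂.ring := ξ'.I.map g.toRing.hom
    let i' : V₂.spec (Ideal.Quotient.mk I₃) ⟶ V₂ := V₂.specHom (Ideal.Quotient.mk I₃)
    let p : V₂.spec (Ideal.Quotient.mk I₃) ⟶ ξ'.T :=
      AffOver.factor ξ'.incl (i' ≫ g)
        (Ideal.quotientMap I₃ g.toRing.hom Ideal.le_comap_map) rfl
    have hp : p ≫ ξ'.incl = i' ≫ g := AffOver.factor_comp ..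
    obtain ⟨z', l', m', h₁, h₂, e⟩ := H.exists_arrow i' (𝟙 _)
      (cart p ξ'.x ≫ G) (by
        rw [Category.id_comp, comp_base, Category.assoc, ← hb, ← Category.assoc, ← Category.assoc]
        exact congrArg (· ≫ g₂) hp.symm)
    obtain ⟨m₁, hm₁, e₁⟩ := exists_lift m₀ m' g (by rw [h₂, Category.id_comp, hm₀])
    refine ⟨_, i', _, z', cart p ξ'.x, l', m₁, Ideal.Quotient.mk_surjective,
      Ideal.mk_ker, h₁, hm₁, ?_⟩
    refine hom_ext_of_comp m₀ ?_ ?_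
    · rw [comp_base, comp_base, map_base, map_base, hm₁, h₁]
      exact hp.symm
    · rw [Category.assoc, e₁, e, Category.assoc, e₀, map_comp, Category.assoc]

variable (ξ) {C : Type u} [CommRing C] (v : ξ.T₂.ring →+* C)

/-- The base of the arrow from the base change of `x` to `x`. -/
def baseChangeMap : (ξ.baseChange v).T ⟶ ξ.T :=
  AffOver.specMap (ξ.T₂.specHom v) _ _
    (Ideal.quotientMap (ξ.I.map v) v Ideal.le_comap_map) (RingHom.ext fun _ => rfl)

lemma baseChange_hasLift {D : Type u} [CommRing D] (u : C →+* D) :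
    (ξ.baseChange v).HasLift u ↔ ξ.HasLift (u.comp v) := by
  refine Iff.trans (liftsAlong_iff_of_arr (ξ := ξ) (ξ' := ξ.baseChange v) (ξ.T₂.specHom v)
    (cart (ξ.baseChangeMap v) ξ.x) (cart (ξ.T₂.specHom v) ξ.y.obj) rfl rfl
    (toArr_baseChange_resIso ξ.y (ξ.baseChange v).incl (ξ.baseChangeMap v)
      (ξ.T₂.specHom v) (AffOver.hom_ext' fun _ => rfl)) ((ξ.T₂.spec v).specHom u)) ?_
  exact liftsAlong_iff ((ξ.T₂.spec v).specHom u ≫ ξ.T₂.specHom v)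

end BaseChange

end

end Situation

namespace Situation
open Tot
variable {X Y : Fibred.{v, w} S} {f : X ⟶ Y} {ξ : Situation f}

/-- Let `C ⟶ D` be a surjection of `B'`-algebras whose kernel meets `IC` in zero.  Then `C` is the
fibre product of `D` and `C ⧸ IC` over `D ⧸ ID`, so that a solution over `D` glues with the
restriction of `x` to `C ⧸ IC`. -/
lemma HasLift.of_ker_inf_eq_bot [hX : ∀ U, IsGroupoid (X.obj U)] [hY : ∀ U, IsGroupoid (Y.obj U)]
    (hX₁ : X.S1) (hY₁ : Y.S1)
    {C D A₀ : Type u} [CommRing C] [CommRing D] [CommRing A₀] [IsNoetherianRing C]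
    {v : ξ.T₂.ring →+* C} (h : C →+* D) (hs : Function.Surjective h)
    (hker : ∀ c ∈ ξ.I.map v, h c = 0 → c = 0)
    (q₀ : D ⧸ ξ.I.map (h.comp v) →+* A₀)
    (hext : IsExtensionPair (Ideal.Quotient.mk (ξ.I.map (h.comp v))) q₀)
    (H : ξ.HasLift (h.comp v)) : ξ.HasLift v := by
  have hmap : ξ.I.map (h.comp v) = (ξ.I.map v).map h := (Ideal.map_map v h).symm
  let qC := Ideal.Quotient.mk (ξ.I.map v)
  let qD := Ideal.Quotient.mk (ξ.I.map (h.comp v))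
  let r₀ : C ⧸ ξ.I.map v →+* D ⧸ ξ.I.map (h.comp v) :=
    Ideal.quotientMap _ h (Ideal.map_le_iff_le_comap.1 hmap.ge)
  let p : ξ.T₂.spec (qC.comp v) ⟶ ξ.T :=
    ξ.T₂.specAlg _ _ (Ideal.quotientMap (ξ.I.map v) v Ideal.le_comap_map) rfl
  let iC : ξ.T₂.spec (qC.comp v) ⟶ ξ.T₂.spec v := ξ.T₂.specAlg _ _ qC rfl
  let iD : ξ.T₂.spec (qD.comp (h.comp v)) ⟶ ξ.T₂.spec (h.comp v) := ξ.T₂.specAlg _ _ qD rfl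
  let r : ξ.T₂.spec (qD.comp (h.comp v)) ⟶ ξ.T₂.spec (qC.comp v) := ξ.T₂.specAlg _ _ r₀ rfl
  let t : ξ.T₂.spec (h.comp v) ⟶ ξ.T₂.spec v := ξ.T₂.specAlg _ _ h rfl
  let i₀ : ξ.T₂.spec (q₀.comp (qD.comp (h.comp v))) ⟶ ξ.T₂.spec (qD.comp (h.comp v)) :=
    ξ.T₂.specAlg _ _ q₀ rfl
  have comm : iD ≫ t = r ≫ iC := AffOver.hom_ext' fun _ => rfl
  obtain ⟨z', l', m', h₁, h₂, e⟩ := H.exists_arrow iD (𝟙 _) (cart r _ ≫ cart p ξ.x)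
    (AffOver.hom_ext' fun _ => rfl)
  have hq₀s : Function.Surjective (i₀ ≫ r).toRing.hom :=
    hext.surjective₀.comp
      (Ideal.quotientMap_surjective (H := Ideal.map_le_iff_le_comap.1 hmap.ge) hs)
  have hC : IsNoetherianRing (C ⧸ ξ.I.map v) := inferInstance
  have hpb : ∀ (a : D) (b : C ⧸ ξ.I.map v), qD a = r₀ b → ∃! c : C, h c = a ∧ qC c = b := by
    intro a b hab
    obtain ⟨c₁, rfl⟩ := hs a
    obtain ⟨c₂, rfl⟩ := Ideal.Quotient.mk_surjective b
    have h₃ : h (c₁ - c₂) ∈ (ξ.I.map v).map h := by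
      rw [map_sub, ← hmap]
      exact Ideal.Quotient.eq.1 hab
    obtain ⟨c₃, hc₃, e₃⟩ := (Ideal.mem_map_iff_of_surjective h hs).1 h₃
    refine ⟨c₂ + c₃, ⟨?_, ?_⟩, ?_⟩
    · rw [map_add, e₃, map_sub]; ring
    · rw [map_add, Ideal.Quotient.eq_zero_iff_mem.2 hc₃, add_zero]
    · rintro c ⟨hc, hc'⟩
      refine sub_eq_zero.1 (hker _ ?_ ?_)
      · rw [← Ideal.Quotient.eq_zero_iff_mem, map_sub, map_add,
          Ideal.Quotient.eq_zero_iff_mem.2 hc₃, add_zero]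
        exact sub_eq_zero.2 hc'
      · rw [map_sub, map_add, e₃, hc, map_sub]; ring
  obtain ⟨ζ, a, b, ha, hb, hab⟩ := exists_glue comm
    (hX₁ iD i₀ r t iC comm hext hC hq₀s hpb) l' (cart r _) h₁ rfl
  have hm : map f l' ≫ m' = map f (cart r _) ≫ map f (cart p ξ.x) ≫ ξ.arr := by
    rw [e, map_comp, Category.assoc]
  obtain ⟨m, hm₁, -, hm₃⟩ := exists_desc comm (hY₁ iD i₀ r t iC comm hext hC hq₀s hpb)
    (map f l') (map f (cart r _)) h₁ rfl (map f a) (map f b) ha hb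
    (by rw [← map_comp, hab, map_comp]) (t := tot ξ.y.obj) (ξ.T₂.specHom v) m'
    (map f (cart p ξ.x) ≫ ξ.arr) (by rw [h₂]; exact AffOver.hom_ext' fun _ => rfl)
    (AffOver.hom_ext' fun _ => rfl) hm
  exact ⟨_, iC, _, ζ, cart p ξ.x, b, m, Ideal.Quotient.mk_surjective, Ideal.mk_ker, hb, hm₁, hm₃⟩

end Situation

/-! ### Elements avoiding the generic points of a closed subset -/

section Generic

variable {R C : Type*} [CommRing R] [CommRing C]

/-- The elements of `R` that do not vanish at any generic point of `V(𝔟)`. -/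
def genericElements (𝔟 : Ideal R) : Submonoid R where
  carrier := {s | ∀ p ∈ 𝔟.minimalPrimes, s ∉ p}
  one_mem' p hp := (Ideal.ne_top_iff_one p).1 hp.1.1.ne_top
  mul_mem' ha hb p hp h := (hp.1.1.mem_or_mem h).elim (ha p hp) (hb p hp)

lemma mem_genericElements {𝔟 : Ideal R} {s : R} :
    s ∈ genericElements 𝔟 ↔ ∀ p ∈ 𝔟.minimalPrimes, s ∉ p := Iff.rfl

/-- Prime avoidance. -/
lemma exists_mem_genericElements [IsNoetherianRing R] {𝔟 𝔠 : Ideal R}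
    (h : ∀ p ∈ 𝔟.minimalPrimes, ¬ 𝔠 ≤ p) : ∃ s ∈ 𝔠, s ∈ genericElements 𝔟 := by
  by_contra! H
  obtain ⟨p, hp, hle⟩ := (Ideal.subset_union_prime_finite
    (𝔟.finite_minimalPrimes_of_isNoetherianRing R) (f := id) ⊥ ⊥ (fun p hp _ _ => hp.1.1)
    (I := 𝔠)).1 (fun s hs => by
      have := H s hs
      rw [mem_genericElements] at this
      push Not at this
      obtain ⟨p, hp, hps⟩ := this
      exact Set.mem_biUnion hp hps)
  exact h p hp hle

lemma mem_genericElements_comap {f : R →+* C} (hf : Function.Surjective f) (𝔞 : Ideal C) (s : R) :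
    s ∈ genericElements (𝔞.comap f) ↔ f s ∈ genericElements 𝔞 := by
  simp only [mem_genericElements, Ideal.comap_minimalPrimes_eq_of_surjective hf,
    Set.forall_mem_image, Ideal.mem_comap]

/-- Going down: an element avoiding the generic points of `V(𝔟)` avoids those of its preimage
under a flat morphism. -/
lemma map_mem_genericElements [Algebra R C] [Module.Flat R C] {𝔟 : Ideal R} {s : R}
    (hs : s ∈ genericElements 𝔟) :
    algebraMap R C s ∈ genericElements (𝔟.map (algebraMap R C)) := by
  intro P hP hsP
  have := hP.1.1
  obtain ⟨q, hq, hqle⟩ := Ideal.exists_minimalPrimes_le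
    (I := 𝔟) (J := P.under R) (Ideal.map_le_iff_le_comap.1 hP.1.2)
  have := hq.1.1
  obtain ⟨Q, hQP, hQ, hQq⟩ := Ideal.exists_ideal_le_liesOver_of_le (p := q) (q := P.under R) P hqle
  have hle : P ≤ Q := hP.2 ⟨hQ, Ideal.map_le_iff_le_comap.2
    (hq.1.2.trans (Q.over_def q).le)⟩ hQP
  refine hs q hq ?_
  rw [Q.over_def q]
  exact hle hsP

end Generic

/-! ### Generic splitting of finite modules -/

section Splitting

/-- By prime avoidance, a prime ideal that contains no element avoiding all minimal primes is minimal;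
so the localization at these elements has dimension zero. -/
lemma krullDimLE_zero_localization {R : Type*} [CommRing R] [IsNoetherianRing R] :
    Ring.KrullDimLE 0 (Localization (genericElements (⊥ : Ideal R))) := by
  refine Ring.KrullDimLE.mk₀ fun P hP => ?_
  obtain ⟨m, hm, hPm⟩ := P.exists_le_maximal hP.ne_top
  have key : ∀ Q : Ideal (Localization (genericElements (⊥ : Ideal R))), Q.IsPrime →
      Q.comap (algebraMap R _) ∈ (⊥ : Ideal R).minimalPrimes := by
    intro Q hQ
    by_contra hmin
    obtain ⟨s, hs, hs'⟩ := exists_mem_genericElements (𝔟 := (⊥ : Ideal R))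
      (𝔠 := Q.comap (algebraMap R _)) (fun p hp hle => hmin
        (le_antisymm hle (hp.2 ⟨hQ.comap _, bot_le⟩ hle) ▸ hp))
    exact hQ.ne_top (Q.eq_top_of_isUnit_mem hs (IsLocalization.map_units _ ⟨s, hs'⟩))
  have h₁ := key P hP
  have h₂ := key m hm.isPrime
  have : P = m := by
    refine le_antisymm hPm ?_
    rw [← IsLocalization.map_under (genericElements (⊥ : Ideal R)) _ P,
      ← IsLocalization.map_under (genericElements (⊥ : Ideal R)) _ m]
    exact Ideal.map_mono (h₂.2 h₁.1 (Ideal.comap_mono hPm))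
  exact this ▸ hm

/-- A finite module over a reduced Noetherian ring is generically projective: up to an element `s`
avoiding all minimal primes, it is a direct summand of a free module. -/
lemma exists_generic_splitting {R : Type*} [CommRing R] [IsNoetherianRing R] [IsReduced R]
    (M : Type*) [AddCommGroup M] [Module R M] [Module.Finite R M] :
    ∃ s ∈ genericElements (⊥ : Ideal R), ∃ (n : ℕ) (φ : M →ₗ[R] (Fin n → R))
      (ψ : (Fin n → R) →ₗ[R] M), ∀ x, ψ (φ x) = s • x := by
  -- the total ring of fractions of `R` is semisimple, so `M` is projective over it; the
  -- splitting is spread out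
  let Γ₀ := genericElements (⊥ : Ideal R)
  have := krullDimLE_zero_localization (R := R)
  have : IsArtinianRing (Localization Γ₀) := IsNoetherianRing.isArtinianRing_of_krullDimLE_zero
  have : IsReduced (Localization Γ₀) := isReduced_localizationPreserves Γ₀ _ inferInstance
  have : IsSemisimpleRing (Localization Γ₀) := IsArtinianRing.isSemisimpleRing_of_isReduced _
  have : Module.Projective (Localization Γ₀) (LocalizedModule Γ₀ M) :=
    Module.projective_of_isSemisimpleRing _ _
  obtain ⟨n, ψ, hψ⟩ := Module.Finite.exists_fin' R M
  let f₁ := LocalizedModule.mkLinearMap Γ₀ (Fin n → R)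
  let f₂ := LocalizedModule.mkLinearMap Γ₀ M
  let Ψ : LocalizedModule Γ₀ (Fin n → R) →ₗ[Localization Γ₀] LocalizedModule Γ₀ M :=
    LocalizedModule.map Γ₀ ψ
  have hΨ : Function.Surjective Ψ := LocalizedModule.map_surjective Γ₀ ψ hψ
  obtain ⟨σ, hσ⟩ := Module.projective_lifting_property Ψ LinearMap.id hΨ
  have : Module.FinitePresentation R M := Module.finitePresentation_of_finite R M
  obtain ⟨φ, s, hφ⟩ := Module.FinitePresentation.exists_lift_of_isLocalizedModule Γ₀ f₁
    ((σ.restrictScalars R).comp f₂)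
  have hz : ∀ x, f₂ (ψ (φ x) - s.1 • x) = 0 := by
    intro x
    have h₁ : f₁ (φ x) = s.1 • σ (f₂ x) := congrArg (fun k => k x) hφ
    have h₂ : f₂ (ψ (φ x)) = Ψ (f₁ (φ x)) := by
      exact (LocalizedModule.map_mk (S := Γ₀) ψ (φ x) 1).symm
    have h₃ : Ψ (s.1 • σ (f₂ x)) = s.1 • Ψ (σ (f₂ x)) :=
      (Ψ.restrictScalars R).map_smul s.1 _
    have h₄ : Ψ (σ (f₂ x)) = f₂ x := congrArg (fun k => k (f₂ x)) hσ
    rw [map_sub, h₂, h₁, h₃, h₄, map_smul, sub_self]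
  obtain ⟨T, hT⟩ := Module.Finite.fg_top (R := R) (M := M)
  choose t ht using fun x => (IsLocalizedModule.eq_zero_iff Γ₀ f₂).1 (hz x)
  let τ : R := ∏ x ∈ T, (t x).1
  have hτ : τ ∈ Γ₀ := prod_mem fun x _ => (t x).2
  have hτx : ∀ x, τ • (ψ (φ x) - s.1 • x) = 0 := by
    intro x
    have hx : x ∈ Submodule.span R (T : Set M) := hT ▸ Submodule.mem_top
    induction hx using Submodule.span_induction with
    | mem x hx =>
      obtain ⟨c, hc⟩ := Finset.dvd_prod_of_mem (fun x => (t x).1) hx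
      have : τ = c * (t x).1 := by rw [mul_comm]; exact hc
      rw [this, mul_smul]
      exact (congrArg (c • ·) (ht x)).trans (smul_zero _)
    | zero => simp
    | add x y _ _ hx hy =>
      have : ψ (φ (x + y)) - s.1 • (x + y) = (ψ (φ x) - s.1 • x) + (ψ (φ y) - s.1 • y) := by
        simp only [map_add, smul_add]; abel
      rw [this, smul_add, hx, hy, add_zero]
    | smul a x _ hx =>
      have : ψ (φ (a • x)) - s.1 • (a • x) = a • (ψ (φ x) - s.1 • x) := by
        simp only [map_smul, smul_sub, smul_comm a]
      rw [this, smul_comm, hx, smul_zero]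
  refine ⟨τ * s.1, mul_mem hτ s.2, n, τ • φ, ψ, fun x => ?_⟩
  have := hτx x
  rw [smul_sub, sub_eq_zero] at this
  rw [LinearMap.smul_apply, map_smul, this, mul_smul]

end Splitting

/-! ### Étale extensions -/

section Etale

/-- An étale algebra over a reduced Noetherian ring is reduced. -/
lemma isReduced_of_etale {A C : Type u} [CommRing A] [CommRing C] [Algebra A C]
    [IsNoetherianRing A] [IsReduced A] [Algebra.Etale A C] : IsReduced C := by
  -- `A` embeds into the product of its residue fields at the minimal primes, and `C` is flat
  let ι := minimalPrimes A
  have : Finite ι := (minimalPrimes.finite_of_isNoetherianRing A)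
  have := Fintype.ofFinite ι
  classical
  have hp : ∀ p : ι, p.1.IsPrime := fun p => p.2.1.1
  let F : ι → Type u := fun p => p.1.ResidueField
  let j : A →ₗ[A] (∀ p, F p) := LinearMap.pi fun p => Algebra.linearMap A (F p)
  have hj : Function.Injective j := by
    rw [← LinearMap.ker_eq_bot, eq_bot_iff]
    intro a ha
    have h₁ : ∀ p : ι, a ∈ p.1 := fun p => by
      have : algebraMap A (F p) a = 0 := congrFun ha p
      exact Ideal.algebraMap_residueField_eq_zero.1 this
    have h₂ : a ∈ nilradical A := by
      rw [nilradical, ← Ideal.sInf_minimalPrimes]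
      exact Ideal.mem_sInf.2 fun {p} hp => h₁ ⟨p, hp⟩
    rw [nilradical_eq_zero A] at h₂
    exact h₂
  have hinj : Function.Injective (LinearMap.lTensor C j) :=
    Module.Flat.lTensor_preserves_injective_linearMap j hj
  have hred : ∀ p : ι, IsReduced (F p ⊗[A] C) := fun p =>
    Algebra.FormallyUnramified.isReduced_of_field (F p) (F p ⊗[A] C)
  refine ⟨fun c hc => ?_⟩
  have h₀ : ∀ p : ι, c ⊗ₜ[A] (1 : F p) = 0 := by
    intro p
    have h₁ : IsNilpotent ((Algebra.TensorProduct.includeRight : C →ₐ[A] F p ⊗[A] C) c) :=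
      hc.map _
    have h₂ : (1 : F p) ⊗ₜ[A] c = 0 := h₁.eq_zero
    simpa using congrArg (TensorProduct.comm A (F p) C) h₂
  have h₃ : LinearMap.lTensor C j (c ⊗ₜ 1) = 0 := by
    refine (TensorProduct.piRight A A C F).injective ?_
    rw [LinearMap.lTensor_tmul, map_zero]
    refine funext fun p => ?_
    simp only [TensorProduct.piRight_apply, TensorProduct.piRightHom_tmul, Pi.zero_apply]
    exact (congrArg (c ⊗ₜ[A] ·) (map_one (algebraMap A (F p)))).trans (h₀ p)
  have h₄ : c ⊗ₜ[A] (1 : A) = 0 := hinj (h₃.trans (map_zero _).symm)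
  simpa using congrArg (TensorProduct.rid A C) h₄

/-- A linear map from an ideal `I` of `R` to a module over a flat `R`-algebra `C` extends to
`IC`. -/
lemma exists_linearMap_map_of_flat {R C : Type*} [CommRing R] [CommRing C] [Algebra R C]
    [Module.Flat R C] (I : Ideal R) {N : Type*} [AddCommGroup N] [Module R N] [Module C N]
    [IsScalarTower R C N] (φ : I →ₗ[R] N) :
    ∃ φ' : I.map (algebraMap R C) →ₗ[C] N, ∀ x : I,
      φ' ⟨algebraMap R C x, Ideal.mem_map_of_mem _ x.2⟩ = φ x := by
  let g : C ⊗[R] I →ₗ[C] C := ((Algebra.linearMap R C).comp I.subtype).liftBaseChange C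
  have hg : Function.Injective g := by
    have h₁ : Function.Injective (LinearMap.lTensor C I.subtype) :=
      Module.Flat.lTensor_preserves_injective_linearMap _ I.injective_subtype
    have h₂ : ∀ x, g x = TensorProduct.rid R C (LinearMap.lTensor C I.subtype x) := by
      intro x
      induction x with
      | zero => simp
      | tmul c x =>
        simp only [g, LinearMap.liftBaseChange_tmul, LinearMap.lTensor_tmul,
          TensorProduct.rid_tmul, LinearMap.comp_apply, Algebra.linearMap_apply, smul_eq_mul]
        rw [Algebra.smul_def, mul_comm]
      | add x y hx hy => simp only [map_add, hx, hy]
    intro x y h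
    rw [h₂, h₂] at h
    exact h₁ ((TensorProduct.rid R C).injective h)
  have hr : I.map (algebraMap R C) ≤ LinearMap.range g := by
    refine Ideal.map_le_iff_le_comap.2 fun x hx => ⟨1 ⊗ₜ ⟨x, hx⟩, ?_⟩
    simp [g]
  refine ⟨(φ.liftBaseChange C).comp ((LinearEquiv.ofInjective g hg).symm.toLinearMap.comp
    (Submodule.inclusion hr)), fun x => ?_⟩
  have : (LinearEquiv.ofInjective g hg).symm
      (Submodule.inclusion hr ⟨algebraMap R C x, Ideal.mem_map_of_mem _ x.2⟩) = 1 ⊗ₜ x := by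
    rw [LinearEquiv.symm_apply_eq]
    refine Subtype.ext ?_
    simp [g]
  rw [LinearMap.comp_apply, LinearMap.comp_apply, LinearEquiv.coe_coe, this]
  simp

end Etale

section IsSplitAt

variable {R C : Type*} [CommRing R] [CommRing C]

/-- For ideals `K ≤ I` with `𝔟I ≤ K`, multiplication by `s` on the `R ⧸ 𝔟`-module `I ⧸ K` factors
through a finite free `R ⧸ 𝔟`-module. -/
def IsSplitAt (I K 𝔟 : Ideal R) (s : R) : Prop :=
  ∃ (n : ℕ) (φ : I →ₗ[R] (Fin n → R ⧸ 𝔟)) (m : Fin n → R), (∀ i, m i ∈ I) ∧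
    (∀ x : I, x.1 ∈ K → φ x = 0) ∧ ∀ x : I, ∃ c : Fin n → R,
      (∀ i, Ideal.Quotient.mk 𝔟 (c i) = φ x i) ∧ s * x - ∑ i, c i * m i ∈ K

/-- A module annihilated by a radical ideal splits generically. -/
lemma exists_isSplitAt [IsNoetherianRing R] {I K 𝔟 : Ideal R} (h𝔟 : 𝔟.IsRadical)
    (hIK : 𝔟 * I ≤ K) : ∃ s ∈ genericElements 𝔟, IsSplitAt I K 𝔟 s := by
  let M := I ⧸ Submodule.comap I.subtype K
  have ht : Module.IsTorsionBySet R M 𝔟 := by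
    intro x b
    obtain ⟨x, rfl⟩ := Submodule.Quotient.mk_surjective _ x
    refine (Submodule.Quotient.mk_eq_zero _).2 ?_
    exact hIK (Ideal.mul_mem_mul b.2 x.2)
  let _ : Module (R ⧸ 𝔟) M := ht.module
  have : IsScalarTower R (R ⧸ 𝔟) M := ht.isScalarTower
  have : Module.Finite (R ⧸ 𝔟) M := Module.Finite.of_restrictScalars_finite R _ _
  have : IsReduced (R ⧸ 𝔟) := (Ideal.isRadical_iff_quotient_reduced 𝔟).1 h𝔟
  obtain ⟨s, hs, n, φ, ψ, h⟩ := exists_generic_splitting (R := R ⧸ 𝔟) M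
  obtain ⟨s, rfl⟩ := Ideal.Quotient.mk_surjective s
  rw [← mem_genericElements_comap Ideal.Quotient.mk_surjective, ← RingHom.ker_eq_comap_bot,
    Ideal.mk_ker] at hs
  classical
  choose m hm using fun i => Submodule.Quotient.mk_surjective _ (ψ (Pi.single i 1))
  refine ⟨s, hs, n, (φ.restrictScalars R).comp (Submodule.mkQ _), fun i => m i,
    fun i => (m i).2, fun x hx => ?_, fun x => ?_⟩
  · have : Submodule.mkQ (Submodule.comap I.subtype K) x = 0 :=
      (Submodule.Quotient.mk_eq_zero _).2 hx
    rw [LinearMap.comp_apply, this, map_zero]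
  · choose c hc using fun i => Ideal.Quotient.mk_surjective (φ (Submodule.Quotient.mk x) i)
    refine ⟨c, hc, ?_⟩
    have h₁ := h (Submodule.Quotient.mk x)
    rw [pi_eq_sum_univ' (φ (Submodule.Quotient.mk x)), map_sum] at h₁
    have h₂ : ∀ i, ψ (φ (Submodule.Quotient.mk x) i • Pi.single i 1) =
        (Submodule.Quotient.mk (c i • m i) : M) := by
      intro i
      rw [map_smul, ← hc, Submodule.Quotient.mk_smul, hm]
      exact algebraMap_smul (R ⧸ 𝔟) (c i) _
    have h₃ : (Ideal.Quotient.mk 𝔟 s) • (Submodule.Quotient.mk x : M) =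
      Submodule.Quotient.mk (s • x) := algebraMap_smul (R ⧸ 𝔟) s _
    rw [h₃, Finset.sum_congr rfl (fun i _ => h₂ i)] at h₁
    have h₄ : (Submodule.Quotient.mk (s • x - ∑ i, c i • m i) : M) = 0 := by
      rw [Submodule.Quotient.mk_sub, ← h₁, sub_eq_zero]
      exact (map_sum (Submodule.mkQ (Submodule.comap I.subtype K)) _ _).symm
    have h₅ := (Submodule.Quotient.mk_eq_zero _).1 h₄
    simpa using h₅

lemma IsSplitAt.map_of_flat [Algebra R C] [Module.Flat R C] {I K 𝔟 : Ideal R} {s : R}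
    (h : IsSplitAt I K 𝔟 s) (hK : K ≤ I) :
    IsSplitAt (I.map (algebraMap R C)) (K.map (algebraMap R C)) (𝔟.map (algebraMap R C))
      (algebraMap R C s) := by
  obtain ⟨n, φ, m, hm, hφ, h⟩ := h
  let a := algebraMap R C
  let q : R ⧸ 𝔟 →ₗ[R] C ⧸ 𝔟.map a :=
    (Ideal.quotientMapₐ (𝔟.map a) (Algebra.ofId R C) Ideal.le_comap_map).toLinearMap
  obtain ⟨φ', hφ'⟩ := exists_linearMap_map_of_flat (C := C) I
    (N := Fin n → C ⧸ 𝔟.map a) ((LinearMap.compLeft q (Fin n)).comp φ)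
  refine ⟨n, φ', fun i => a (m i), fun i => Ideal.mem_map_of_mem _ (hm i), ?_, ?_⟩
  · rintro ⟨y, hy⟩ hyK
    dsimp only at hyK
    have : ∀ y ∈ K.map a, ∀ hy : y ∈ I.map a, φ' ⟨y, hy⟩ = 0 := by
      intro y hyK
      induction hyK using Submodule.span_induction with
      | mem y hy =>
        obtain ⟨x, hx, rfl⟩ := hy
        intro _
        refine (hφ' ⟨x, hK hx⟩).trans ?_
        rw [LinearMap.comp_apply, hφ _ hx, map_zero]
      | zero => exact fun _ => map_zero φ'
      | add y z hy' hz' hy hz =>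
        intro _
        have := φ'.map_add ⟨y, Ideal.map_mono hK hy'⟩ ⟨z, Ideal.map_mono hK hz'⟩
        rw [hy, hz, add_zero] at this
        exact this
      | smul c y hy' hy =>
        intro _
        have := φ'.map_smul c ⟨y, Ideal.map_mono hK hy'⟩
        rw [hy, smul_zero] at this
        exact this
    exact this y hyK hy
  · rintro ⟨y, hy⟩
    have : ∀ y (hy : y ∈ I.map a), ∃ c : Fin n → C, (∀ i, Ideal.Quotient.mk (𝔟.map a) (c i) =
        φ' ⟨y, hy⟩ i) ∧ a s * y - ∑ i, c i * a (m i) ∈ K.map a := by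
      intro y hy
      induction hy using Submodule.span_induction with
      | mem y hy =>
        obtain ⟨x, hx, rfl⟩ := hy
        obtain ⟨c, hc, e⟩ := h ⟨x, hx⟩
        refine ⟨fun i => a (c i), fun i => ?_, ?_⟩
        · have := congrFun (hφ' ⟨x, hx⟩) i
          refine Eq.trans ?_ this.symm
          change _ = q (φ ⟨x, hx⟩ i)
          rw [← hc]
          rfl
        · have := Ideal.mem_map_of_mem a e
          simpa only [map_sub, map_mul, map_sum] using this
      | zero =>
        refine ⟨0, fun i => ?_, by simp⟩
        have : φ' 0 = 0 := map_zero φ'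
        exact (map_zero _).trans (congrFun this i).symm
      | add y z hy' hz' hy hz =>
        obtain ⟨c, hc, e⟩ := hy
        obtain ⟨d, hd, e'⟩ := hz
        refine ⟨c + d, fun i => ?_, ?_⟩
        · have := congrFun (φ'.map_add ⟨y, hy'⟩ ⟨z, hz'⟩) i
          refine Eq.trans ?_ this.symm
          rw [Pi.add_apply, Pi.add_apply, map_add, hc, hd]
        · have := add_mem e e'
          convert this using 1
          simp only [Pi.add_apply, add_mul, Finset.sum_add_distrib]
          ring
      | smul t y hy' hy =>
        obtain ⟨c, hc, e⟩ := hy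
        refine ⟨t • c, fun i => ?_, ?_⟩
        · have := congrFun (φ'.map_smul t ⟨y, hy'⟩) i
          refine Eq.trans ?_ this.symm
          rw [Pi.smul_apply, Pi.smul_apply, smul_eq_mul, map_mul, hc]
          rfl
        · have := Ideal.mul_mem_left _ t e
          convert this using 1
          simp only [Pi.smul_apply, smul_eq_mul, mul_sub, Finset.mul_sum, mul_assoc]
          ring
    exact this y hy

/-- If `s` splits `I ⧸ K` then `I ⧸ K` becomes projective over every `R ⧸ 𝔟`-algebra in which `s` is
invertible. -/
lemma IsSplitAt.projective [Algebra R C] {I K 𝔟 : Ideal R} {s : R} (h : IsSplitAt I K 𝔟 s)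
    (h𝔟 : ∀ b ∈ 𝔟, algebraMap R C b = 0) (hs : IsUnit (algebraMap R C s)) :
    Module.Projective C (C ⊗[R] (I ⧸ Submodule.comap I.subtype K)) := by
  obtain ⟨n, φ, m, hm, hφ, h⟩ := h
  let M := I ⧸ Submodule.comap I.subtype K
  let q : R ⧸ 𝔟 →ₗ[R] C := (Ideal.Quotient.liftₐ 𝔟 (Algebra.ofId R C) h𝔟).toLinearMap
  let φ₁ : M →ₗ[R] (Fin n → C) := Submodule.liftQ _ ((LinearMap.compLeft q (Fin n)).comp φ)
    fun x hx => by rw [LinearMap.mem_ker, LinearMap.comp_apply, hφ x hx, map_zero]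
  let φ₂ : C ⊗[R] M →ₗ[C] (Fin n → C) := φ₁.liftBaseChange C
  obtain ⟨t, ht⟩ := hs.exists_left_inv
  classical
  let ψ : (Fin n → C) →ₗ[C] C ⊗[R] M :=
    Fintype.linearCombination C fun i => t ⊗ₜ[R] (Submodule.Quotient.mk ⟨m i, hm i⟩ : M)
  refine Module.Projective.of_split φ₂ ψ (TensorProduct.AlgebraTensorModule.ext fun r x => ?_)
  obtain ⟨x, rfl⟩ := Submodule.Quotient.mk_surjective _ x
  obtain ⟨c, hc, e⟩ := h x
  have h₁ : φ₂ (r ⊗ₜ Submodule.Quotient.mk x) = fun i => r * algebraMap R C (c i) := by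
    ext i
    have : q (φ x i) = algebraMap R C (c i) := by rw [← hc]; rfl
    rw [← this]
    rfl
  have h₂ : (Submodule.Quotient.mk (s • x) : M) =
      ∑ i, c i • (Submodule.Quotient.mk ⟨m i, hm i⟩ : M) := by
    have h₃ : (Submodule.Quotient.mk (s • x - ∑ i, c i • ⟨m i, hm i⟩ : I) : M) = 0 := by
      refine (Submodule.Quotient.mk_eq_zero _).2 ?_
      simpa using e
    rw [Submodule.Quotient.mk_sub, sub_eq_zero] at h₃
    rw [h₃]
    exact map_sum (Submodule.mkQ (Submodule.comap I.subtype K)) _ _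
  rw [LinearMap.comp_apply, h₁, Fintype.linearCombination_apply, LinearMap.id_apply]
  have h₄ : ∀ i, (r * algebraMap R C (c i)) • t ⊗ₜ[R] (Submodule.Quotient.mk ⟨m i, hm i⟩ : M) =
      (r * t) ⊗ₜ (c i • (Submodule.Quotient.mk ⟨m i, hm i⟩ : M)) := by
    intro i
    rw [TensorProduct.tmul_smul, TensorProduct.smul_tmul', TensorProduct.smul_tmul']
    congr 1
    rw [Algebra.smul_def (c i), smul_eq_mul]
    ring
  rw [Finset.sum_congr rfl fun i _ => h₄ i, ← TensorProduct.tmul_sum, ← h₂,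
    Submodule.Quotient.mk_smul, TensorProduct.tmul_smul, TensorProduct.smul_tmul',
    Algebra.smul_def]
  congr 1
  calc algebraMap R C s * (r * t) = r * (t * algebraMap R C s) := by ring
    _ = r := by rw [ht, mul_one]

end IsSplitAt

/-- A localization of finite type is a localization at one element. -/
lemma exists_dvd_pow_of_finiteType {A : Type*} [CommRing A] [IsNoetherianRing A] (W : Submonoid A)
    [hW : Algebra.FiniteType A (Localization W)] : ∃ w ∈ W, ∀ x ∈ W, ∃ n, x ∣ w ^ n := by
  obtain ⟨T, hT⟩ := hW.out
  obtain ⟨b, hb⟩ := IsLocalization.exist_integer_multiples_of_finset W T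
  have key : ∀ x : Localization W, ∃ n : ℕ, ∃ a : A,
      algebraMap A _ b.1 ^ n * x = algebraMap A (Localization W) a := by
    intro x
    have hx : x ∈ Algebra.adjoin A (T : Set (Localization W)) := hT ▸ Algebra.mem_top
    induction hx using Algebra.adjoin_induction with
    | mem x hx =>
      obtain ⟨a, ha⟩ := hb x hx
      refine ⟨1, a, ?_⟩
      rw [ha, pow_one]
      exact (Algebra.smul_def b.1 x).symm
    | algebraMap r => exact ⟨0, r, by simp⟩
    | add x y _ _ hx hy =>
      obtain ⟨n, a, ha⟩ := hx
      obtain ⟨k, c, hc⟩ := hy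
      refine ⟨n + k, b.1 ^ k * a + b.1 ^ n * c, ?_⟩
      rw [map_add, map_mul, map_mul, ← ha, ← hc, map_pow, map_pow]
      ring
    | mul x y _ _ hx hy =>
      obtain ⟨n, a, ha⟩ := hx
      obtain ⟨k, c, hc⟩ := hy
      refine ⟨n + k, a * c, ?_⟩
      rw [map_mul, ← ha, ← hc]
      ring
  -- an element of `W` killing the kernel of the localization map
  obtain ⟨w₀, hw₀, hk⟩ : ∃ w₀ ∈ W, ∀ a, algebraMap A (Localization W) a = 0 → w₀ * a = 0 := by
    obtain ⟨G, hG⟩ := (isNoetherianRing_iff_ideal_fg A).1 inferInstance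
      (RingHom.ker (algebraMap A (Localization W)))
    have hmem : ∀ g : G, ∃ w : W, w.1 * g.1 = 0 := fun g =>
      (IsLocalization.map_eq_zero_iff W (Localization W) g.1).1
        (RingHom.mem_ker.1 (hG ▸ Ideal.subset_span g.2))
    choose w hw using hmem
    refine ⟨∏ g, (w g).1, prod_mem fun g _ => (w g).2, fun a ha => ?_⟩
    have ha' : a ∈ Ideal.span (G : Set A) := hG ▸ ha
    induction ha' using Submodule.span_induction with
    | mem x hx =>
      obtain ⟨c, hc⟩ := Finset.dvd_prod_of_mem (fun g => (w g).1) (Finset.mem_univ (⟨x, hx⟩ : G))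
      rw [hc, mul_right_comm, hw ⟨x, hx⟩, zero_mul]
    | zero => simp
    | add x y hx hy h h' =>
      have h₁ : ∀ x ∈ Submodule.span A (G : Set A), algebraMap A (Localization W) x = 0 :=
        fun x hx => RingHom.mem_ker.1 (hG.le hx)
      rw [mul_add, h (h₁ _ hx), h' (h₁ _ hy), add_zero]
    | smul c x hx h =>
      have h₁ : algebraMap A (Localization W) x = 0 := RingHom.mem_ker.1 (hG.le hx)
      rw [smul_eq_mul, mul_left_comm, h h₁, mul_zero]
  refine ⟨w₀ * b.1, mul_mem hw₀ b.2, fun x hx => ?_⟩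
  obtain ⟨y, hy⟩ := (IsLocalization.map_units (Localization W) ⟨x, hx⟩).exists_right_inv
  obtain ⟨n, a, ha⟩ := key y
  have h₁ : algebraMap A (Localization W) (b.1 ^ n - x * a) = 0 := by
    rw [map_sub, map_mul, ← ha, map_pow, mul_left_comm, hy, mul_one, sub_self]
  have h₂ := hk _ h₁
  refine ⟨n + 1, w₀ ^ n * b.1 * (w₀ * a), ?_⟩
  rw [mul_sub, sub_eq_zero] at h₂
  calc (w₀ * b.1) ^ (n + 1) = w₀ ^ n * b.1 * (w₀ * b.1 ^ n) := by ring
    _ = _ := by rw [h₂]; ring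

/-- A divisor of a power modulo a nilpotent ideal is a divisor of a power. -/
lemma exists_dvd_pow_of_mk {R : Type*} [CommRing R] {J : Ideal R} (hJ : IsNilpotent J) {w t : R}
    (h : Ideal.Quotient.mk J w ∣ Ideal.Quotient.mk J t) : ∃ n, w ∣ t ^ n := by
  obtain ⟨n, hn⟩ := hJ
  obtain ⟨c, hc⟩ := h
  obtain ⟨c, rfl⟩ := Ideal.Quotient.mk_surjective c
  have h₁ : t - w * c ∈ J := by
    rw [← Ideal.Quotient.eq_zero_iff_mem, map_sub, map_mul, hc, sub_self]
  have h₂ : (t - w * c) ^ n = 0 := by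
    have := Ideal.pow_mem_pow h₁ n
    rwa [hn] at this
  refine ⟨n, ?_⟩
  have h₃ : w ∣ t ^ n - (t - w * c) ^ n := by
    refine dvd_trans ?_ (sub_dvd_pow_sub_pow t (t - w * c) n)
    exact ⟨c, by ring⟩
  rwa [h₂, sub_zero] at h₃

lemma isUnit_of_dvd_pow {R : Type*} [CommRing R] {w t : R} {n : ℕ} (h : w ∣ t ^ n)
    (ht : IsUnit t) : IsUnit w := isUnit_of_dvd_unit h (ht.pow n)

/-- The set of points of `V(𝔞)` at which `t` does not vanish is dense in `V(𝔞)` only if `t` does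
not vanish at any generic point of `V(𝔞)`. -/
lemma mem_genericElements_of_subset_closure {A : Type*} [CommRing A] [IsNoetherianRing A]
    {𝔞 : Ideal A} {t : A}
    (h : PrimeSpectrum.zeroLocus (𝔞 : Set A) ⊆
      closure (PrimeSpectrum.zeroLocus (𝔞 : Set A) ∩ {p | t ∉ p.asIdeal})) :
    t ∈ genericElements 𝔞 := by
  intro p hp htp
  let F := {q ∈ 𝔞.minimalPrimes | t ∉ q}
  have hF : F.Finite := (𝔞.finite_minimalPrimes_of_isNoetherianRing A).subset fun q hq => hq.1
  let Z : Set (PrimeSpectrum A) := ⋃ q ∈ F, PrimeSpectrum.zeroLocus (q : Set A)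
  have hZ : IsClosed Z := hF.isClosed_biUnion fun q _ => PrimeSpectrum.isClosed_zeroLocus _
  have hsub : PrimeSpectrum.zeroLocus (𝔞 : Set A) ∩ {p | t ∉ p.asIdeal} ⊆ Z := by
    rintro q ⟨hq, hqt⟩
    obtain ⟨q', hq', hle⟩ := Ideal.exists_minimalPrimes_le (I := 𝔞) (J := q.asIdeal) hq
    exact Set.mem_biUnion (show q' ∈ F from ⟨hq', fun h => hqt (hle h)⟩) hle
  have hpZ := (hZ.closure_subset_iff.2 hsub) (h (show (⟨p, hp.1.1⟩ : PrimeSpectrum A) ∈ _ from hp.1.2))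
  obtain ⟨q, hq, hqp⟩ := Set.mem_iUnion₂.1 hpZ
  exact hq.2 (hp.2 hq.1.1 hqp htp)

/-! ### Pairs describing generic extenders -/

namespace Situation
variable {X Y : Fibred.{v, w} S} {f : X ⟶ Y}

/-- The hypotheses on the rings of a deformation situation that are stable under étale base
change, for an ideal `𝔟` of `B'` which annihilates `M`. -/
structure IsAdapted (ξ : Situation f) (𝔟 : Ideal ξ.T₂.ring) : Prop where
  noetherian : IsNoetherianRing ξ.T₂.ring
  nilpotent : IsNilpotent ξ.J
  le : ξ.J ≤ 𝔟
  mul : 𝔟 * ξ.I = ⊥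

lemma IsAdapted.nilpotent_map {ξ : Situation f} {𝔟 : Ideal ξ.T₂.ring} (h : ξ.IsAdapted 𝔟)
    {C : Type u} [CommRing C] (v : ξ.T₂.ring →+* C) : IsNilpotent (ξ.J.map v) := by
  obtain ⟨n, hn⟩ := h.nilpotent
  refine ⟨n, ?_⟩
  rw [← Ideal.map_pow, hn]
  exact Ideal.map_bot

lemma IsAdapted.mul_map {ξ : Situation f} {𝔟 : Ideal ξ.T₂.ring} (h : ξ.IsAdapted 𝔟)
    {C : Type u} [CommRing C] (v : ξ.T₂.ring →+* C) : 𝔟.map v * ξ.I.map v = ⊥ := by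
  rw [← Ideal.map_mul, h.mul]
  exact Ideal.map_bot

lemma IsAdapted.baseChange {ξ : Situation f} {𝔟 : Ideal ξ.T₂.ring} (h : ξ.IsAdapted 𝔟)
    {C : Type u} [CommRing C] [IsNoetherianRing C] (v : ξ.T₂.ring →+* C) :
    (ξ.baseChange v).IsAdapted (𝔟.map v) :=
  ⟨‹_›, h.nilpotent_map v, Ideal.map_mono h.le, h.mul_map v⟩

/-- `L` describes, over the open subset where `s` is invertible, the largest quotient of `M` over
which there is a lifting, generically on every étale extension. -/
structure IsGood (ξ : Situation f) (𝔟 : Ideal ξ.T₂.ring) (s : ξ.T₂.ring) (L : Ideal ξ.T₂.ring) :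
    Prop where
  le : L ≤ ξ.I
  mem : s ∈ genericElements 𝔟
  hasLift : ∀ ⦃D : Type u⦄ [CommRing D] (v : ξ.T₂.ring →+* D), IsUnit (v s) →
    (∀ l ∈ L, v l = 0) → ξ.HasLift v
  etale : ∀ ⦃C : Type u⦄ [CommRing C] (v : ξ.T₂.ring →+* C), v.Etale → IsUnit (v s) →
    ∀ K ≤ ξ.I.map v, ξ.HasLift ((Ideal.Quotient.mk K).comp v) →
      ∃ τ ∈ genericElements (𝔟.map v), ∀ l ∈ L, τ * v l ∈ K

/-- Over a local `B'`-algebra `D` which is a localization of a quotient of `B'` by an ideal and has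
a nilpotent maximal ideal annihilating `ID`, there is a lifting only if `L` vanishes in `D`. -/
def IsGoodAtPoints (ξ : Situation f) (s : ξ.T₂.ring) (L : Ideal ξ.T₂.ring) : Prop :=
  ∀ ⦃D : Type u⦄ [CommRing D] [IsLocalRing D] (v : ξ.T₂.ring →+* D),
    IsNilpotent (IsLocalRing.maximalIdeal D) →
    (∃ t, IsUnit (v t) ∧ ∀ d, ∃ b n, d * v t ^ n = v b) → IsUnit (v s) →
    IsLocalRing.maximalIdeal D * ξ.I.map v = ⊥ → ξ.HasLift v → ∀ l ∈ L, v l = 0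

lemma IsGood.mul {ξ : Situation f} {𝔟 : Ideal ξ.T₂.ring} {s : ξ.T₂.ring} {L : Ideal ξ.T₂.ring}
    (h : ξ.IsGood 𝔟 s L) {t : ξ.T₂.ring} (ht : t ∈ genericElements 𝔟) : ξ.IsGood 𝔟 (s * t) L where
  le := h.le
  mem := mul_mem h.mem ht
  hasLift _ _ v hu hL := h.hasLift v (isUnit_of_mul_isUnit_left (map_mul v s t ▸ hu)) hL
  etale _ _ v hv hu K hK H :=
    h.etale v hv (isUnit_of_mul_isUnit_left (map_mul v s t ▸ hu)) K hK H

lemma IsGoodAtPoints.mul {ξ : Situation f} {s : ξ.T₂.ring} {L : Ideal ξ.T₂.ring}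
    (h : ξ.IsGoodAtPoints s L) (t : ξ.T₂.ring) : ξ.IsGoodAtPoints (s * t) L :=
  fun _ _ _ v hn ht hu => h v hn ht (isUnit_of_mul_isUnit_left (map_mul v s t ▸ hu))

section
variable [hX : ∀ U, IsGroupoid (X.obj U)] [hY : ∀ U, IsGroupoid (Y.obj U)]

lemma IsGood.baseChange {ξ : Situation f} {𝔟 : Ideal ξ.T₂.ring} {s : ξ.T₂.ring}
    {L : Ideal ξ.T₂.ring} (h : ξ.IsGood 𝔟 s L) {C : Type u} [CommRing C] (v : ξ.T₂.ring →+* C)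
    (hv : v.Etale) : (ξ.baseChange v).IsGood (𝔟.map v) (v s) (L.map v) where
  le := Ideal.map_mono h.le
  mem := by
    algebraize [v]
    have : Algebra.Etale ξ.T₂.ring C := hv
    exact map_mem_genericElements (R := ξ.T₂.ring) (C := C) h.mem
  hasLift D _ u hu hL := (ξ.baseChange_hasLift v u).2
    (h.hasLift (u.comp v) hu fun l hl => hL _ (Ideal.mem_map_of_mem v hl))
  etale D _ u hu hs K hK H := by
    have key : ∀ u : C →+* D, u.Etale → IsUnit (u (v s)) → K ≤ (ξ.I.map v).map u →
        ξ.HasLift (((Ideal.Quotient.mk K).comp u).comp v) →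
        ∃ τ ∈ genericElements ((𝔟.map v).map u), ∀ l ∈ L.map v, τ * u l ∈ K := by
      intro u hu hs hK H
      rw [Ideal.map_map] at hK
      obtain ⟨τ, hτ, e⟩ := h.etale (u.comp v)
        (RingHom.Etale.stableUnderComposition _ _ hv hu) hs K hK H
      rw [← Ideal.map_map] at hτ
      refine ⟨τ, hτ, fun l hl => ?_⟩
      induction hl using Submodule.span_induction with
      | mem l hl =>
        obtain ⟨l, hl, rfl⟩ := hl
        exact e l hl
      | zero => rw [map_zero, mul_zero]; exact K.zero_mem
      | add x y _ _ hx hy => rw [map_add, mul_add]; exact K.add_mem hx hy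
      | smul c x _ hx =>
        rw [smul_eq_mul, map_mul, mul_left_comm]
        exact K.mul_mem_left _ hx
    exact key u hu hs hK ((ξ.baseChange_hasLift v ((Ideal.Quotient.mk K).comp u)).1 H)

variable {ξ : Situation f} {𝔟 : Ideal ξ.T₂.ring} (hξ : ξ.IsAdapted 𝔟)

/-- An extending quotient gives liftings over all algebras over it. -/
lemma Quot.IsExtending.hasLift {Q : ξ.Quot} (hQ : Q.IsExtending) {t : ξ.T₂.ring}
    (ht : ∀ x ∈ Q.lift, ∃ n, x ∣ t ^ n) {D : Type u} [CommRing D] (v : ξ.T₂.ring →+* D)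
    (hu : IsUnit (v t)) (hL : ∀ l ∈ Q.L, v l = 0) : ξ.HasLift v := by
  have H := (ξ.baseChange_hasLift _ _).1 ((liftsOver_iff _ _).1 hQ)
  have hw : ∀ w : Q.lift, IsUnit (v w) := fun w => by
    obtain ⟨n, hn⟩ := ht w w.2
    exact isUnit_of_dvd_pow (n := n) (map_pow v t n ▸ map_dvd v hn) hu
  let u : Localization Q.lift →+* D := IsLocalization.lift (M := Q.lift) (g := v) hw
  have hu : ∀ b, u (algebraMap _ _ b) = v b := IsLocalization.lift_eq hw
  have hle : ∀ a ∈ Q.ideal, u a = 0 := by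
    have : Q.ideal ≤ RingHom.ker u := Ideal.map_le_iff_le_comap.2 fun l hl =>
      (hu l).trans (hL l hl)
    exact fun a ha => this ha
  exact H.of_comp_eq (Ideal.Quotient.lift Q.ideal u hle) hu

include hξ in
lemma Quot.exists_dvd_pow {Q : ξ.Quot} {t : ξ.T₂.ring}
    (ht : ∀ x ∈ Q.W, ∃ n, x ∣ Ideal.Quotient.mk ξ.J t ^ n) :
    ∀ x ∈ Q.lift, ∃ n, x ∣ t ^ n := by
  intro x hx
  obtain ⟨n, hn⟩ := ht _ hx
  obtain ⟨k, hk⟩ := exists_dvd_pow_of_mk hξ.nilpotent (w := x) (t := t ^ n) (by rwa [map_pow])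
  exact ⟨n * k, by rwa [pow_mul]⟩

include hξ in
lemma Quot.IsFiniteType.exists_dvd_pow {Q : ξ.Quot} (hQ : Q.IsFiniteType) :
    ∃ t ∈ Q.lift, ∀ x ∈ Q.lift, ∃ n, x ∣ t ^ n := by
  have := hξ.noetherian
  obtain ⟨w, hw, h⟩ := exists_dvd_pow_of_finiteType Q.W (hW := hQ)
  obtain ⟨t, rfl⟩ := Ideal.Quotient.mk_surjective w
  exact ⟨t, hw, Quot.exists_dvd_pow hξ h⟩

include hξ in
lemma Quot.IsGeneric.mem_genericElements {Q : ξ.Quot} {𝔞 : Ideal ξ.Zero} (hQ : Q.IsGeneric 𝔞)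
    {t : ξ.T₂.ring} (ht : t ∈ Q.lift) :
    t ∈ genericElements (𝔞.comap (Ideal.Quotient.mk ξ.J)) := by
  have := hξ.noetherian
  rw [mem_genericElements_comap Ideal.Quotient.mk_surjective]
  refine mem_genericElements_of_subset_closure (hQ.trans (closure_mono
    (Set.inter_subset_inter_right _ ?_)))
  rintro _ ⟨p, rfl⟩ hp
  exact p.2.ne_top (p.asIdeal.eq_top_of_isUnit_mem hp
    (IsLocalization.map_units (Localization Q.W) (⟨_, ht⟩ : Q.W)))

lemma Quot.isGeneric_of_le {Q : ξ.Quot} {𝔞 : Ideal ξ.Zero} (h : Q.W ≤ genericElements 𝔞) :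
    Q.IsGeneric 𝔞 := by
  intro q hq
  obtain ⟨p, hp, hle⟩ := Ideal.exists_minimalPrimes_le (I := 𝔞) (J := q.asIdeal) hq
  have hpr := hp.1.1
  have h₁ : (⟨p, hpr⟩ : PrimeSpectrum ξ.Zero) ∈ PrimeSpectrum.zeroLocus (𝔞 : Set ξ.Zero) ∩
      Set.range (PrimeSpectrum.comap (algebraMap ξ.Zero (Localization Q.W))) := by
    refine ⟨hp.1.2, ?_⟩
    rw [PrimeSpectrum.localization_comap_range _ Q.W]
    exact Set.disjoint_left.2 fun x hx hxp => h hx p hp hxp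
  have h₂ : (⟨p, hpr⟩ : PrimeSpectrum ξ.Zero) ⤳ q := (PrimeSpectrum.le_iff_specializes _ _).1 hle
  exact h₂.mem_closed isClosed_closure (subset_closure h₁)

variable {s : ξ.T₂.ring} {L : Ideal ξ.T₂.ring}

include hξ in
/-- The quotient of `M` attached to a good pair is admissible. -/
lemma isAdmissible_of_isSplitAt {𝔞 : Ideal ξ.Zero} (h𝔞 : 𝔞.comap (Ideal.Quotient.mk ξ.J) = 𝔟)
    {Q : ξ.Quot} (hW : Q.W = Submonoid.powers (Ideal.Quotient.mk ξ.J s))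
    (hs : s ∈ genericElements 𝔟)
    (hlift : ∀ ⦃D : Type u⦄ [CommRing D] (v : ξ.T₂.ring →+* D), IsUnit (v s) →
      (∀ l ∈ Q.L, v l = 0) → ξ.HasLift v)
    (hsplit : IsSplitAt ξ.I Q.L 𝔟 s) : Q.IsAdmissible 𝔞 := by
  have hsW : s ∈ Q.lift := by
    change Ideal.Quotient.mk ξ.J s ∈ Q.W
    rw [hW]
    exact Submonoid.mem_powers _
  refine ⟨Quot.isGeneric_of_le ?_, ?_, ?_, ?_⟩
  · rw [hW, Submonoid.powers_le]
    rwa [← mem_genericElements_comap Ideal.Quotient.mk_surjective, h𝔞]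
  · have : Monoid.FG Q.W := (Monoid.fg_iff_submonoid_fg _).2 (hW ▸ Submonoid.powers_fg _)
    exact IsLocalization.finiteType_of_monoid_fg Q.W (Localization Q.W)
  · refine IsSplitAt.projective
      (C := Localization Q.W ⧸ 𝔞.map (algebraMap ξ.Zero (Localization Q.W))) hsplit
      (fun b hb => ?_) ?_
    · rw [← h𝔞] at hb
      refine Ideal.Quotient.eq_zero_iff_mem.2 ?_
      exact Ideal.mem_map_of_mem _ hb
    · exact (IsLocalization.map_units (Localization Q.W) (⟨_, hsW⟩ : Q.W)).map
        (Ideal.Quotient.mk _)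
  · let K : Ideal (Localization Q.lift) := Q.L.map (algebraMap ξ.T₂.ring (Localization Q.lift))
    refine (liftsOver_iff _ _).2 ((ξ.baseChange_hasLift _ (Ideal.Quotient.mk K)).2 (hlift _ ?_ ?_))
    · exact (IsLocalization.map_units (Localization Q.lift) ⟨s, hsW⟩).map (Ideal.Quotient.mk _)
    · intro l hl
      exact Ideal.Quotient.eq_zero_iff_mem.2 (Ideal.mem_map_of_mem _ hl)

end
end Situation

/-- In a localization, the numerator of an element avoiding the generic points of `V(𝔟C)` avoids
those generic points of `V(𝔟)` that the denominators avoid. -/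
lemma exists_mem_genericElements_of_localization {R C : Type*} [CommRing R] [CommRing C]
    [Algebra R C] (M : Submonoid R) [IsLocalization M C] {𝔟 : Ideal R}
    (hM : M ≤ genericElements 𝔟) {τ : C}
    (hτ : τ ∈ genericElements (𝔟.map (algebraMap R C))) :
    ∃ a ∈ genericElements 𝔟, ∃ c, IsUnit c ∧ algebraMap R C a = c * τ := by
  obtain ⟨⟨a, m⟩, ham⟩ := IsLocalization.surj M τ
  refine ⟨a, fun p hp hap => ?_, algebraMap R C m, IsLocalization.map_units C m,
    by rw [← ham, mul_comm]⟩
  have hpr := hp.1.1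
  have hdisj : Disjoint (M : Set R) p := Set.disjoint_left.2 fun x hx hxp => hM hx p hp hxp
  have hcomap : (p.map (algebraMap R C)).comap (algebraMap R C) = p :=
    IsLocalization.under_map_of_isPrime_disjoint M C hpr hdisj
  have hmin : p.map (algebraMap R C) ∈ (𝔟.map (algebraMap R C)).minimalPrimes := by
    rw [IsLocalization.minimalPrimes_map M C 𝔟]
    exact Set.mem_preimage.2 ((congrArg (· ∈ 𝔟.minimalPrimes) hcomap).mpr hp)
  refine hτ _ hmin ?_
  have h₁ : τ * algebraMap R C m ∈ p.map (algebraMap R C) := ham ▸ Ideal.mem_map_of_mem _ hap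
  exact (hmin.1.1.mem_or_mem h₁).resolve_right fun h =>
    hmin.1.1.ne_top (Ideal.eq_top_of_isUnit_mem _ h (IsLocalization.map_units C m))

namespace Situation
variable {X Y : Fibred.{v, w} S} {f : X ⟶ Y} {ξ : Situation f}

lemma mem_genericSubmonoid {𝔞 : Ideal ξ.Zero} {x : ξ.T₂.ring} :
    x ∈ ξ.genericSubmonoid 𝔞 ↔ x ∈ genericElements (𝔞.comap (Ideal.Quotient.mk ξ.J)) := by
  rw [mem_genericElements_comap Ideal.Quotient.mk_surjective, genericSubmonoid,
    Submonoid.mem_comap, Submonoid.mem_iInf, mem_genericElements, Subtype.forall]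
  rfl

section
variable [hX : ∀ U, IsGroupoid (X.obj U)] [hY : ∀ U, IsGroupoid (Y.obj U)]
variable {𝔟 : Ideal ξ.T₂.ring} {s : ξ.T₂.ring} {L : Ideal ξ.T₂.ring}

/-- A finite type quotient is given, generically, over a localization of `B'`, which is an étale
`B'`-algebra; there the maximality of a good pair applies. -/
lemma IsGood.isGenericExtender (hξ : ξ.IsAdapted 𝔟) (h : ξ.IsGood 𝔟 s L) {𝔞 : Ideal ξ.Zero}
    (h𝔞 : 𝔞.comap (Ideal.Quotient.mk ξ.J) = 𝔟) (hsplit : IsSplitAt ξ.I L 𝔟 s)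
    {Q : ξ.Quot} (hW : Q.W = Submonoid.powers (Ideal.Quotient.mk ξ.J s)) (hL : Q.L = L) :
    ξ.IsGenericExtender 𝔞 Q := by
  subst hL
  refine ⟨isAdmissible_of_isSplitAt hξ h𝔞 hW h.mem h.hasLift hsplit, fun P hP => ?_⟩
  obtain ⟨t, htP, ht⟩ := hP.isFiniteType.exists_dvd_pow hξ
  have ht' : t ∈ genericElements 𝔟 := h𝔞 ▸ hP.isGeneric.mem_genericElements hξ htP
  let C := Localization.Away (s * t)
  let v : ξ.T₂.ring →+* C := algebraMap _ _
  have hv : v.Etale := by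
    rw [RingHom.etale_algebraMap]
    exact Algebra.Etale.of_isLocalizationAway (s * t)
  have hu : IsUnit (v (s * t)) := IsLocalization.Away.algebraMap_isUnit (s * t)
  rw [map_mul] at hu
  let K := P.L.map v
  obtain ⟨τ, hτ, e⟩ := h.etale v hv (isUnit_of_mul_isUnit_left hu) K (Ideal.map_mono P.le)
    (hP.isExtending.hasLift ht _ ((isUnit_of_mul_isUnit_right hu).map (Ideal.Quotient.mk K))
      fun l hl => Ideal.Quotient.eq_zero_iff_mem.2 (Ideal.mem_map_of_mem v hl))
  have hM : Submonoid.powers (s * t) ≤ genericElements 𝔟 :=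
    Submonoid.powers_le.2 (mul_mem h.mem ht')
  obtain ⟨a, ha, c, -, hc⟩ := exists_mem_genericElements_of_localization
    (Submonoid.powers (s * t)) hM hτ
  refine Ideal.map_le_iff_le_comap.2 fun l hl => ?_
  have h₁ : v (a * l) ∈ P.L.map v := by
    rw [map_mul, hc, mul_assoc]
    exact Ideal.mul_mem_left _ _ (e l hl)
  obtain ⟨m, hm, h₂⟩ := (IsLocalization.algebraMap_mem_map_algebraMap_iff
    (Submonoid.powers (s * t)) C P.L (a * l)).1 h₁
  refine (IsLocalization.algebraMap_mem_map_algebraMap_iff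
    (ξ.genericSubmonoid 𝔞) _ P.L l).2 ⟨m * a, ?_, by rwa [mul_assoc]⟩
  rw [mem_genericSubmonoid, h𝔞]
  exact mul_mem (hM hm) ha

/-- Good pairs are stable under étale base change, so compatibility with étale extensions follows
from `IsGood.isGenericExtender`. -/
lemma IsGood.isEtaleCompatible (hξ : ξ.IsAdapted 𝔟) (h : ξ.IsGood 𝔟 s L) {𝔞 : Ideal ξ.Zero}
    (h𝔞 : 𝔞.comap (Ideal.Quotient.mk ξ.J) = 𝔟) (hsplit : IsSplitAt ξ.I L 𝔟 s)
    {Q : ξ.Quot} (hW : Q.W = Submonoid.powers (Ideal.Quotient.mk ξ.J s)) (hL : Q.L = L) :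
    ξ.IsEtaleCompatible 𝔞 Q := by
  intro C _ v hv
  have hN := hξ.noetherian
  have hC : IsNoetherianRing C := by
    algebraize [v]
    have : Algebra.Etale ξ.T₂.ring C := hv
    exact Algebra.FiniteType.isNoetherianRing ξ.T₂.ring C
  have hsplit' : IsSplitAt (ξ.I.map v) (L.map v) (𝔟.map v) (v s) := by
    algebraize [v]
    have : Algebra.Etale ξ.T₂.ring C := hv
    exact hsplit.map_of_flat (C := C) h.le
  refine (h.baseChange v hv).isGenericExtender (hξ.baseChange v) ?_ hsplit' ?_ ?_
  · subst h𝔞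
    have h₁ : (𝔞.comap (Ideal.Quotient.mk ξ.J)).map (Ideal.Quotient.mk ξ.J) = 𝔞 :=
      Ideal.map_comap_of_surjective _ Ideal.Quotient.mk_surjective 𝔞
    have h₂ : 𝔞.map (ξ.zeroMap v) =
        ((𝔞.comap (Ideal.Quotient.mk ξ.J)).map v).map (Ideal.Quotient.mk (ξ.J.map v)) := by
      conv_lhs => rw [← h₁]
      rw [Ideal.map_map, Ideal.map_map]
      rfl
    refine (congrArg (Ideal.comap (Ideal.Quotient.mk (ξ.J.map v))) h₂).trans ?_
    rw [Ideal.comap_map_of_surjective _ Ideal.Quotient.mk_surjective, ← RingHom.ker_eq_comap_bot,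
      Ideal.mk_ker]
    exact sup_eq_left.2 (Ideal.map_mono hξ.le)
  · change Q.W.map (ξ.zeroMap v) = _
    rw [hW, Submonoid.map_powers]
    rfl
  · exact congrArg (Ideal.map v) hL

/-- The condition at points is stated for Artinian local algebras; the local ring at a closed point
need not be Artinian, but it may be replaced by its quotients by powers of the maximal ideal. -/
lemma IsGoodAtPoints.isClosedPointCompatible (hξ : ξ.IsAdapted 𝔟) (h : ξ.IsGood 𝔟 s L)
    (hp : ξ.IsGoodAtPoints s L)
    {Q : ξ.Quot} (hW : Q.W = Submonoid.powers (Ideal.Quotient.mk ξ.J s)) (hL : Q.L = L) :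
    ξ.IsClosedPointCompatible Q := by
  subst hL
  have hN := hξ.noetherian
  have hsW : s ∈ Q.lift := by
    change Ideal.Quotient.mk ξ.J s ∈ Q.W
    rw [hW]
    exact Submonoid.mem_powers _
  have hdvd : ∀ x ∈ Q.lift, ∃ n, x ∣ s ^ n := by
    refine Quot.exists_dvd_pow hξ fun x hx => ?_
    rw [hW] at hx
    obtain ⟨n, rfl⟩ := hx
    exact ⟨n, dvd_rfl⟩
  let E := Localization Q.lift
  let ι : ξ.T₂.ring →+* E := algebraMap _ _
  have hsu : IsUnit (ι s) := IsLocalization.map_units E (⟨s, hsW⟩ : Q.lift)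
  -- the statement over the localization, with all rings in the form given by their definition
  have key : ∀ 𝔪 : Ideal E, 𝔪.IsMaximal → ∀ K ≤ ξ.I.map ι, 𝔪 * ξ.I.map ι ≤ K →
      (ξ.HasLift ((Ideal.Quotient.mk K).comp ι) ↔ Q.L.map ι ≤ K) := by
    intro 𝔪 h𝔪 K hK h𝔪K
    constructor
    swap
    · intro hle
      refine h.hasLift _ (hsu.map (Ideal.Quotient.mk K)) fun l hl => ?_
      exact Ideal.Quotient.eq_zero_iff_mem.2 (hle (Ideal.mem_map_of_mem ι hl))
    intro H
    have hEN : IsNoetherianRing E := IsLocalization.isNoetherianRing Q.lift E hN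
    refine Ideal.map_le_iff_le_comap.2 fun l hl => ?_
    -- by Artin-Rees it is enough to test modulo the powers of the maximal ideal
    have hmem : ∀ n, n ≠ 0 → ι l ∈ K ⊔ 𝔪 ^ n := by
      intro n hn
      by_cases htop : K ⊔ 𝔪 ^ n = ⊤
      · rw [htop]; trivial
      let D := E ⧸ (K ⊔ 𝔪 ^ n)
      have : Nontrivial D := Ideal.Quotient.nontrivial_iff.2 htop
      have hle : K ⊔ 𝔪 ^ n ≤ 𝔪 := by
        have h₁ : K ≤ 𝔪 := by
          by_contra hK'
          refine htop (Ideal.eq_top_iff_one _ |>.2 ?_)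
          have h₂ : K ⊔ 𝔪 = ⊤ := by
            rw [sup_comm]
            exact h𝔪.out.2 _ (lt_of_le_of_ne le_sup_left fun e => hK' (le_sup_right.trans e.ge))
          have h₃ : K ⊔ 𝔪 ^ n = ⊤ := by
            exact Ideal.sup_pow_eq_top h₂
          exact h₃ ▸ Submodule.mem_top
        exact sup_le h₁ (Ideal.pow_le_self hn)
      let mD : Ideal D := 𝔪.map (Ideal.Quotient.mk (K ⊔ 𝔪 ^ n))
      have hnil : mD ^ n = ⊥ := by
        rw [← Ideal.map_pow, eq_bot_iff, Ideal.map_le_iff_le_comap]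
        intro x hx
        rw [Ideal.mem_comap, Ideal.mem_bot, Ideal.Quotient.eq_zero_iff_mem]
        exact le_sup_right (a := K) hx
      have hmD : mD.IsMaximal := by
        refine Ideal.IsMaximal.map_of_surjective_of_ker_le Ideal.Quotient.mk_surjective ?_
        rwa [Ideal.mk_ker]
      have hloc : IsLocalRing D := IsLocalRing.of_unique_max_ideal ⟨mD, hmD, fun M hM => by
        refine (hmD.eq_of_le hM.ne_top ?_).symm
        exact hM.isPrime.le_of_pow_le (n := n) (hnil ▸ bot_le)⟩
      have hmax : IsLocalRing.maximalIdeal D = mD := (IsLocalRing.eq_maximalIdeal hmD).symm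
      have hI : ξ.I.map ((Ideal.Quotient.mk (K ⊔ 𝔪 ^ n)).comp ι) =
          (ξ.I.map ι).map (Ideal.Quotient.mk (K ⊔ 𝔪 ^ n)) := (Ideal.map_map _ _).symm
      have := hp ((Ideal.Quotient.mk (K ⊔ 𝔪 ^ n)).comp ι) (hmax ▸ ⟨n, hnil⟩)
        ⟨s, hsu.map (Ideal.Quotient.mk (K ⊔ 𝔪 ^ n)), fun d => ?_⟩
        (hsu.map (Ideal.Quotient.mk (K ⊔ 𝔪 ^ n))) ?_ ?_ l hl
      · exact Ideal.Quotient.eq_zero_iff_mem.1 this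
      · obtain ⟨d, rfl⟩ := Ideal.Quotient.mk_surjective d
        obtain ⟨⟨b, w⟩, hbw⟩ := IsLocalization.surj Q.lift d
        obtain ⟨k, c, hc⟩ := hdvd w w.2
        refine ⟨b * c, k, ?_⟩
        have : d * ι s ^ k = ι (b * c) := by
          rw [← map_pow, hc, map_mul, ← mul_assoc, map_mul]
          exact congrArg (· * ι c) hbw
        rw [RingHom.comp_apply, RingHom.comp_apply, ← this, map_mul, map_pow]
      · rw [hmax, hI, ← Ideal.map_mul, eq_bot_iff, Ideal.map_le_iff_le_comap]
        intro x hx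
        rw [Ideal.mem_comap, Ideal.mem_bot, Ideal.Quotient.eq_zero_iff_mem]
        exact le_sup_left (b := 𝔪 ^ n) (h𝔪K hx)
      · exact H.of_comp_eq (Ideal.Quotient.factor le_sup_left) fun b => rfl
    obtain ⟨k, hk⟩ := Ideal.exists_pow_inf_eq_pow_smul 𝔪 (ξ.I.map ι)
    obtain ⟨x, hx, y, hy, hxy⟩ := Submodule.mem_sup.1 (hmem (k + 1) k.succ_ne_zero)
    have hyI : y ∈ ξ.I.map ι := by
      have : y = ι l - x := by rw [← hxy]; ring
      rw [this]
      exact sub_mem (Ideal.mem_map_of_mem ι (h.le hl)) (hK hx)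
    have hyK : y ∈ K := by
      have h₁ : y ∈ 𝔪 ^ (k + 1) • (⊤ : Ideal E) ⊓ ξ.I.map ι :=
        ⟨by rwa [smul_eq_mul, Ideal.mul_top], hyI⟩
      rw [hk (k + 1) (Nat.le_succ k), Nat.add_sub_cancel_left, pow_one, smul_eq_mul] at h₁
      exact h𝔪K (Ideal.mul_mono_right inf_le_right h₁)
    rw [Ideal.mem_comap, ← hxy]
    exact add_mem hx hyK
  intro 𝔪 h𝔪 _ K hK h𝔪K
  exact (liftsOver_iff K hK).trans ((ξ.baseChange_hasLift ι (Ideal.Quotient.mk K : E →+* E ⧸ K)).trans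
    (key 𝔪 h𝔪 K hK h𝔪K))

/-- Good pairs give compatible generic extenders. -/
lemma exists_compatible_of_isGood (hξ : ξ.IsAdapted 𝔟) (h : ξ.IsGood 𝔟 s L)
    (hp : ξ.IsGoodAtPoints s L) (hr : 𝔟.IsRadical) {𝔞 : Ideal ξ.Zero}
    (h𝔞 : 𝔞.comap (Ideal.Quotient.mk ξ.J) = 𝔟) :
    ∃ Q : ξ.Quot, ξ.IsGenericExtender 𝔞 Q ∧ ξ.IsEtaleCompatible 𝔞 Q ∧
      ξ.IsClosedPointCompatible Q := by
  have hN := hξ.noetherian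
  -- the quotient `M ⧸ L` need not be projective over `D(s)`; it is over a smaller open subset
  obtain ⟨t, ht, hsp⟩ := exists_isSplitAt (I := ξ.I) (K := L) hr (hξ.mul.le.trans bot_le)
  have hsp' : IsSplitAt ξ.I L 𝔟 (s * t) := by
    obtain ⟨n, φ, m, hm, hφ, hc⟩ := hsp
    refine ⟨n, s • φ, m, hm, fun x hx => ?_, fun x => ?_⟩
    · rw [LinearMap.smul_apply, hφ x hx, smul_zero]
    · obtain ⟨c, hc, e⟩ := hc x
      refine ⟨fun i => s * c i, fun i => ?_, ?_⟩
      · rw [map_mul, hc]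
        rfl
      · convert Ideal.mul_mem_left _ s e using 1
        rw [mul_sub, Finset.mul_sum]
        simp only [mul_assoc]
  let Q : ξ.Quot := ⟨Submonoid.powers (Ideal.Quotient.mk ξ.J (s * t)), L, h.le⟩
  exact ⟨Q, (h.mul ht).isGenericExtender hξ h𝔞 hsp' rfl rfl,
    (h.mul ht).isEtaleCompatible hξ h𝔞 hsp' rfl rfl,
    (hp.mul t).isClosedPointCompatible hξ (h.mul ht) rfl rfl⟩

end
end Situation

/-! ### Algebraic deformation situations -/

/-- Algebras of finite type over an `𝒪_S`-algebra of finite type are of finite type. -/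
lemma AffOver.IsFiniteType.of_hom {V U : AffOver S} (g : V ⟶ U) (hg : g.toRing.hom.FiniteType)
    (hU : U.IsFiniteType) : V.IsFiniteType := by
  have h₁ : yonedaEquiv.symm V.pt =
      yoneda.map (Spec.map g.toRing) ≫ yonedaEquiv.symm U.pt := by
    rw [← g.w]
    exact (yonedaEquiv_symm_map (Spec.map g.toRing).op U.pt)
  let P₁ : MorphismProperty Scheme.{u} := @LocallyOfFiniteType
  let P₂ : MorphismProperty Scheme.{u} := @QuasiCompact
  have i₁ : P₁.IsStableUnderBaseChange := inferInstanceAs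
    (MorphismProperty.IsStableUnderBaseChange @LocallyOfFiniteType)
  have i₂ : P₂.IsStableUnderBaseChange := inferInstanceAs
    (MorphismProperty.IsStableUnderBaseChange @QuasiCompact)
  have j₁ : P₁.IsStableUnderComposition := inferInstanceAs
    (MorphismProperty.IsStableUnderComposition @LocallyOfFiniteType)
  have j₂ : P₂.IsStableUnderComposition := inferInstanceAs
    (MorphismProperty.IsStableUnderComposition @QuasiCompact)
  have i : (P₁ ⊓ P₂).IsStableUnderBaseChange := inferInstance
  have j : (P₁ ⊓ P₂).IsStableUnderComposition := inferInstance
  have h₂ : MorphismProperty.presheaf (P₁ ⊓ P₂) (yoneda.map (Spec.map g.toRing)) := by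
    refine MorphismProperty.relative_map ⟨?_, ?_⟩
    · exact (HasRingHomProperty.Spec_iff (P := @LocallyOfFiniteType)).2 hg
    · exact inferInstanceAs (QuasiCompact (Spec.map g.toRing))
  have h₃ : (MorphismProperty.presheaf (P₁ ⊓ P₂)).IsStableUnderComposition :=
    MorphismProperty.relative_isStableUnderComposition _
  rw [IsFiniteType, h₁]
  exact MorphismProperty.comp_mem _ _ _ h₂ hU

lemma etale_quotient {R C : Type*} [CommRing R] [CommRing C] [Algebra R C] [Algebra.Etale R C]
    (𝔟 : Ideal R) : Algebra.Etale (R ⧸ 𝔟) (C ⧸ 𝔟.map (algebraMap R C)) :=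
  .of_equiv (Algebra.TensorProduct.quotIdealMapEquivQuotTensor C 𝔟).symm

lemma isRadical_map_of_etale {R C : Type u} [CommRing R] [CommRing C] [Algebra R C]
    [Algebra.Etale R C] [IsNoetherianRing R] {𝔟 : Ideal R} (h𝔟 : 𝔟.IsRadical) :
    (𝔟.map (algebraMap R C)).IsRadical := by
  have := etale_quotient (C := C) 𝔟
  have : IsReduced (R ⧸ 𝔟) := (Ideal.isRadical_iff_quotient_reduced 𝔟).1 h𝔟
  exact (Ideal.isRadical_iff_quotient_reduced _).2 (isReduced_of_etale (A := R ⧸ 𝔟))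

open Polynomial in
lemma isRadical_map_C {R : Type*} [CommRing R] {𝔟 : Ideal R} (h𝔟 : 𝔟.IsRadical) :
    (𝔟.map (C : R →+* R[X])).IsRadical := by
  have : IsReduced (R ⧸ 𝔟) := (Ideal.isRadical_iff_quotient_reduced 𝔟).1 h𝔟
  refine (Ideal.isRadical_iff_quotient_reduced _).2 ?_
  have : IsReduced (R ⧸ 𝔟)[X] := ⟨fun p hp => Polynomial.ext fun i =>
    (Polynomial.isNilpotent_iff.1 hp i).eq_zero⟩
  exact isReduced_of_injective _ (Ideal.polynomialQuotientEquivQuotientPolynomial 𝔟).symm.injective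

namespace Situation
variable {X Y : Fibred.{v, w} S} {f : X ⟶ Y} {ξ : Situation f} {𝔟 : Ideal ξ.T₂.ring}

lemma IsAlgebraic.isNoetherianRing (h : ξ.IsAlgebraic) : IsNoetherianRing ξ.T₂.ring :=
  h.isExtensionPair.noetherian

lemma factor_comp_mk : (Ideal.Quotient.factor ξ.le).comp (Ideal.Quotient.mk ξ.I) =
    Ideal.Quotient.mk ξ.J := rfl

lemma isNilpotent_of_pow_le {R : Type*} [CommRing R] {I J : Ideal R} {n : ℕ} (h : J ^ n ≤ I)
    (hI : IsNilpotent I) : IsNilpotent J := by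
  obtain ⟨m, hm⟩ := hI
  refine ⟨n * m, ?_⟩
  rw [pow_mul, Ideal.zero_eq_bot, ← le_bot_iff]
  exact (Ideal.pow_right_mono h m).trans hm.le

lemma IsAlgebraic.nilpotent (h : ξ.IsAlgebraic) : IsNilpotent ξ.J := by
  have h₁ := h.isExtensionPair.nilpotent
  obtain ⟨n, hn⟩ := h.isExtensionPair.nilpotent₀
  rw [Ideal.mk_ker] at h₁
  refine isNilpotent_of_pow_le (n := n) ?_ h₁
  rw [Ideal.Quotient.factor_ker] at hn
  rw [← Ideal.mk_ker (I := ξ.I), RingHom.ker_eq_comap_bot, ← Ideal.map_le_iff_le_comap,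
    Ideal.map_pow]
  exact hn.le

lemma IsAlgebraic.isAdapted (h : ξ.IsAlgebraic) (hle : ξ.J ≤ 𝔟) (hmul : 𝔟 * ξ.I = ⊥) :
    ξ.IsAdapted 𝔟 := ⟨h.isNoetherianRing, h.nilpotent, hle, hmul⟩

lemma IsAlgebraic.isReduced (h : ξ.IsAlgebraic) : IsReduced ξ.Zero := h.isExtensionPair.reduced

lemma IsAlgebraic.mul_eq_bot (h : ξ.IsAlgebraic) : ξ.I * ξ.J = ⊥ := by
  have := h.isExtensionPair.annihilated
  rwa [factor_comp_mk, Ideal.mk_ker, Ideal.mk_ker] at this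

/-- The criterion for a deformation situation to be algebraic in terms of ideals. -/
lemma isAlgebraic_of (h₁ : IsNoetherianRing ξ.T₂.ring) (h₂ : IsNilpotent ξ.J)
    (h₃ : IsReduced ξ.Zero) (h₄ : ξ.I * ξ.J = ⊥)
    (h₅ : (ξ.T₂.spec (Ideal.Quotient.mk ξ.J)).IsFiniteType) : ξ.IsAlgebraic := by
  refine ⟨⟨h₁, Ideal.Quotient.mk_surjective, Ideal.Quotient.factor_surjective ξ.le, ?_, ?_, h₃,
    ?_⟩, h₅⟩
  · rw [Ideal.mk_ker]
    exact isNilpotent_of_pow_le (n := 1) (by rw [pow_one]; exact ξ.le) h₂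
  · obtain ⟨n, hn⟩ := h₂
    refine ⟨n, ?_⟩
    rw [Ideal.Quotient.factor_ker, ← Ideal.map_pow, hn]
    exact Ideal.map_bot
  · rw [factor_comp_mk, Ideal.mk_ker, Ideal.mk_ker, h₄]

lemma IsAlgebraic.baseChange (h : ξ.IsAlgebraic) {C : Type u} [CommRing C] [IsNoetherianRing C]
    (v : ξ.T₂.ring →+* C) (hv : v.FiniteType) (hred : IsReduced (C ⧸ ξ.J.map v)) :
    (ξ.baseChange v).IsAlgebraic := by
  refine isAlgebraic_of ‹_› ?_ hred ?_ ?_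
  · obtain ⟨n, hn⟩ := h.nilpotent
    refine ⟨n, ?_⟩
    change ξ.J.map v ^ n = ⊥
    rw [← Ideal.map_pow, hn]
    exact Ideal.map_bot
  · change ξ.I.map v * ξ.J.map v = ⊥
    rw [← Ideal.map_mul, h.mul_eq_bot]
    exact Ideal.map_bot
  · let g : (ξ.T₂.spec v).spec (Ideal.Quotient.mk (ξ.J.map v)) ⟶
        ξ.T₂.spec (Ideal.Quotient.mk ξ.J) :=
      AffOver.specMap (ξ.T₂.specHom v) _ _ (ξ.zeroMap v) rfl
    refine AffOver.IsFiniteType.of_hom g ?_ h.isFiniteType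
    have h₁ : (ξ.zeroMap v).comp (Ideal.Quotient.mk ξ.J) =
      (Ideal.Quotient.mk (ξ.J.map v)).comp v := rfl
    refine RingHom.FiniteType.of_comp_finiteType (f := Ideal.Quotient.mk ξ.J) ?_
    change ((Ideal.Quotient.mk (ξ.J.map v)).comp v).FiniteType
    exact hv.comp_surjective Ideal.Quotient.mk_surjective

open Polynomial in
lemma IsAlgebraic.polynomial (h : ξ.IsAlgebraic) :
    (ξ.baseChange (C : ξ.T₂.ring →+* ξ.T₂.ring[X])).IsAlgebraic := by
  have := h.isNoetherianRing
  refine h.baseChange _ ?_ ?_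
  · exact RingHom.finiteType_algebraMap.2 (inferInstanceAs (Algebra.FiniteType ξ.T₂.ring ξ.T₂.ring[X]))
  · have := h.isReduced
    rw [← Ideal.isRadical_iff_quotient_reduced] at this ⊢
    exact isRadical_map_C this

section
variable [hX : ∀ U, IsGroupoid (X.obj U)] [hY : ∀ U, IsGroupoid (Y.obj U)]

/-- If there is a lifting over a local quotient `D` of a `B'`-algebra `E` whose maximal ideal is
nilpotent and annihilates `ID`, then there is one over the largest quotient of `E` in which `IE` has
the same image as in `D`. -/
lemma HasLift.of_surjective_of_isLocalRing (hX₁ : X.S1) (hY₁ : Y.S1) {E D : Type u} [CommRing E]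
    [CommRing D] [IsLocalRing D] [IsNoetherianRing E] {ι : ξ.T₂.ring →+* E} (φ : E →+* D)
    (hφs : Function.Surjective φ) (hJ : IsNilpotent (ξ.J.map ι))
    (hnil : IsNilpotent (IsLocalRing.maximalIdeal D))
    (hann : IsLocalRing.maximalIdeal D * ξ.I.map (φ.comp ι) = ⊥) (H : ξ.HasLift (φ.comp ι)) :
    ξ.HasLift ((Ideal.Quotient.mk (RingHom.ker φ ⊓ ξ.I.map ι)).comp ι) := by
  let K : Ideal E := RingHom.ker φ ⊓ ξ.I.map ι
  let h₀ : E ⧸ K →+* D := Ideal.Quotient.lift K φ fun a ha => ha.1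
  have hc : h₀.comp ((Ideal.Quotient.mk K).comp ι) = φ.comp ι := RingHom.ext fun _ => rfl
  have hImap : ξ.I.map ((Ideal.Quotient.mk K).comp ι) =
      (ξ.I.map ι).map (Ideal.Quotient.mk K) := (Ideal.map_map _ _).symm
  have hIle : ξ.I.map (h₀.comp ((Ideal.Quotient.mk K).comp ι)) ≤
      IsLocalRing.maximalIdeal D := by
    rw [hc, ← Ideal.map_map]
    refine Ideal.map_le_iff_le_comap.2 ((Ideal.map_mono ξ.le).trans ?_)
    obtain ⟨n, hn⟩ := hJ
    exact ((IsLocalRing.maximalIdeal.isMaximal D).isPrime.comap φ).le_of_pow_le (n := n)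
      (hn ▸ bot_le)
  have hDN : IsNoetherianRing D := isNoetherianRing_of_surjective E D φ hφs
  refine HasLift.of_ker_inf_eq_bot hX₁ hY₁ h₀ (Ideal.Quotient.lift_surjective_of_surjective K _ hφs)
    ?_ (A₀ := D ⧸ IsLocalRing.maximalIdeal D) (Ideal.Quotient.factor hIle) ?_ H
  · intro c hcI hc0
    rw [hImap] at hcI
    obtain ⟨a, ha, rfl⟩ := (Ideal.mem_map_iff_of_surjective _ Ideal.Quotient.mk_surjective).1 hcI
    exact Ideal.Quotient.eq_zero_iff_mem.2 ⟨hc0, ha⟩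
  · refine ⟨hDN, Ideal.Quotient.mk_surjective, Ideal.Quotient.factor_surjective hIle, ?_, ?_,
      ?_, ?_⟩
    · rw [Ideal.mk_ker]
      exact isNilpotent_of_pow_le (n := 1) (by rw [pow_one]; exact hIle) hnil
    · rw [Ideal.Quotient.factor_ker]
      obtain ⟨n, hn⟩ := hnil
      refine ⟨n, ?_⟩
      rw [← Ideal.map_pow, hn]
      exact Ideal.map_bot
    · rw [← Ideal.isRadical_iff_quotient_reduced]
      exact (IsLocalRing.maximalIdeal.isMaximal D).isPrime.isRadical
    · have : (Ideal.Quotient.factor hIle).comp (Ideal.Quotient.mk _) =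
        Ideal.Quotient.mk (IsLocalRing.maximalIdeal D) := rfl
      rw [this, Ideal.mk_ker, Ideal.mk_ker, hc, mul_comm, hann]

/-- Compatibility of an extender with closed points gives a necessary condition for the existence
of a lifting over a local quotient of `B'` with nilpotent maximal ideal. -/
lemma Quot.eq_zero_of_hasLift (hX₁ : X.S1) (hY₁ : Y.S1) (hξ : ξ.IsAdapted 𝔟) {Q : ξ.Quot}
    (hQp : ξ.IsClosedPointCompatible Q) {s : ξ.T₂.ring} (hdvd : ∀ x ∈ Q.lift, ∃ n, x ∣ s ^ n)
    {D : Type u} [CommRing D] [IsLocalRing D] (v : ξ.T₂.ring →+* D)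
    (hnil : IsNilpotent (IsLocalRing.maximalIdeal D)) (hsurj : Function.Surjective v)
    (hu : IsUnit (v s)) (hann : IsLocalRing.maximalIdeal D * ξ.I.map v = ⊥) (H : ξ.HasLift v)
    {l : ξ.T₂.ring} (hl : l ∈ Q.L) : v l = 0 := by
  have hN := hξ.noetherian
  have hw : ∀ w : Q.lift, IsUnit (v w) := fun w => by
    obtain ⟨n, hn⟩ := hdvd w w.2
    exact isUnit_of_dvd_pow (n := n) (map_pow v s n ▸ map_dvd v hn) hu
  let E := Localization Q.lift
  let ι : ξ.T₂.ring →+* E := algebraMap _ _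
  obtain ⟨φ, rfl⟩ : ∃ φ : E →+* D, φ.comp ι = v :=
    ⟨IsLocalization.lift (M := Q.lift) (g := v) hw, IsLocalization.lift_comp hw⟩
  have hφs : Function.Surjective φ := fun d => by
    obtain ⟨b, rfl⟩ := hsurj d
    exact ⟨ι b, rfl⟩
  have hEN : IsNoetherianRing E := IsLocalization.isNoetherianRing Q.lift E hN
  let 𝔪 : Ideal E := (IsLocalRing.maximalIdeal D).comap φ
  have h𝔪 : 𝔪.IsMaximal := Ideal.comap_isMaximal_of_surjective φ hφs
  let K : Ideal E := RingHom.ker φ ⊓ ξ.I.map ι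
  have h𝔪K : 𝔪 * ξ.I.map ι ≤ K := by
    refine le_inf ?_ Ideal.mul_le_right
    rw [RingHom.ker_eq_comap_bot, ← Ideal.map_le_iff_le_comap, Ideal.map_mul, Ideal.map_map, ← hann]
    exact Ideal.mul_mono_left Ideal.map_comap_le
  have hJ : ξ.J.map ι ≤ 𝔪 := by
    obtain ⟨n, hn⟩ := hξ.nilpotent_map ι
    exact h𝔪.isPrime.le_of_pow_le (n := n) (hn ▸ bot_le)
  have hK : ξ.HasLift ((Ideal.Quotient.mk K).comp ι) :=
    H.of_surjective_of_isLocalRing hX₁ hY₁ φ hφs (hξ.nilpotent_map ι) hnil hann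
  have hK' : Q.situation.LiftsOver K inf_le_right :=
    (liftsOver_iff (ξ := Q.situation) K inf_le_right).2
      ((ξ.baseChange_hasLift ι (Ideal.Quotient.mk K : E →+* E ⧸ K)).2 hK)
  have hQK : Q.L.map ι ≤ K := (hQp 𝔪 h𝔪 hJ K inf_le_right h𝔪K).1 hK'
  exact RingHom.mem_ker.1 (hQK (Ideal.mem_map_of_mem ι hl)).1

/-- A compatible generic extender gives a good pair `(s, L)` for which the condition at points
holds for quotients of `B'`. -/
lemma exists_isGood_of_hasCompatible (hX₁ : X.S1) (hY₁ : Y.S1)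
    (hf : HasCompatibleGenericExtenders f) (h : ξ.IsAlgebraic) (hr : 𝔟.IsRadical)
    (hle : ξ.J ≤ 𝔟) (hmul : 𝔟 * ξ.I = ⊥) :
    ∃ s L, ξ.IsGood 𝔟 s L ∧ ∀ ⦃D : Type u⦄ [CommRing D] [IsLocalRing D] (v : ξ.T₂.ring →+* D),
      IsNilpotent (IsLocalRing.maximalIdeal D) → Function.Surjective v → IsUnit (v s) →
      IsLocalRing.maximalIdeal D * ξ.I.map v = ⊥ → ξ.HasLift v → ∀ l ∈ L, v l = 0 := by
  have hN := h.isNoetherianRing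
  have hξ := h.isAdapted hle hmul
  have h𝔞 : (𝔟.map (Ideal.Quotient.mk ξ.J)).comap (Ideal.Quotient.mk ξ.J) = 𝔟 := by
    rw [Ideal.comap_map_of_surjective _ Ideal.Quotient.mk_surjective, ← RingHom.ker_eq_comap_bot,
      Ideal.mk_ker, sup_eq_left.2 hle]
  obtain ⟨Q, hQ, hQe, hQp⟩ := hf ξ h (𝔟.map (Ideal.Quotient.mk ξ.J)) (by
    intro x ⟨n, hx⟩
    obtain ⟨x, rfl⟩ := Ideal.Quotient.mk_surjective x
    refine Ideal.mem_map_of_mem _ (hr ⟨n, ?_⟩)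
    rw [← h𝔞, Ideal.mem_comap, map_pow]
    exact hx) (by rw [h𝔞, mul_comm, hmul])
  obtain ⟨s, hs, hdvd⟩ := hQ.isAdmissible.isFiniteType.exists_dvd_pow hξ
  refine ⟨s, Q.L, ⟨Q.le, h𝔞 ▸ hQ.isAdmissible.isGeneric.mem_genericElements hξ hs,
    fun D _ v hu hL => hQ.isAdmissible.isExtending.hasLift hdvd v hu hL, ?_⟩,
    fun D _ _ v hnil hsurj hu hann H l hl =>
      Quot.eq_zero_of_hasLift hX₁ hY₁ hξ hQp hdvd v hnil hsurj hu hann H hl⟩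
  -- after inverting `τ`, the ideal `K` defines an admissible quotient of the situation over `C`
  · intro C _ v hv _ K hK H
    have hC : IsNoetherianRing C := by
      algebraize [v]
      have : Algebra.Etale ξ.T₂.ring C := hv
      exact Algebra.FiniteType.isNoetherianRing ξ.T₂.ring C
    have hrC : (𝔟.map v).IsRadical := by
      algebraize [v]
      have : Algebra.Etale ξ.T₂.ring C := hv
      exact isRadical_map_of_etale (C := C) hr
    obtain ⟨τ, hτ, hsp⟩ := exists_isSplitAt (I := ξ.I.map v) (K := K) hrC
      ((hξ.mul_map v).le.trans bot_le)
    let P : (ξ.baseChange v).Quot :=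
      ⟨Submonoid.powers (Ideal.Quotient.mk (ξ.J.map v) τ), K, hK⟩
    have h𝔞C : ((𝔟.map (Ideal.Quotient.mk ξ.J)).map (ξ.zeroMap v)).comap
        (Ideal.Quotient.mk (ξ.baseChange v).J) = 𝔟.map v := by
      have h₂ : (𝔟.map (Ideal.Quotient.mk ξ.J)).map (ξ.zeroMap v) =
          (𝔟.map v).map (Ideal.Quotient.mk (ξ.J.map v)) := by
        rw [Ideal.map_map, Ideal.map_map]
        rfl
      refine (congrArg (Ideal.comap (Ideal.Quotient.mk (ξ.J.map v))) h₂).trans ?_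
      rw [Ideal.comap_map_of_surjective _ Ideal.Quotient.mk_surjective,
        ← RingHom.ker_eq_comap_bot, Ideal.mk_ker]
      exact sup_eq_left.2 (Ideal.map_mono hle)
    have hP : P.IsAdmissible ((𝔟.map (Ideal.Quotient.mk ξ.J)).map (ξ.zeroMap v)) := by
      refine isAdmissible_of_isSplitAt (s := τ) (hξ.baseChange v) h𝔞C rfl hτ (fun D _ u _ hu => ?_) hsp
      refine (ξ.baseChange_hasLift v u).2 ?_
      exact H.of_comp_eq (Ideal.Quotient.lift K u hu) fun b => rfl
    have hfac := (hQe C v hv).factors P hP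
    have hl : ∀ l ∈ Q.L, ∃ τ ∈ genericElements (𝔟.map v), τ * v l ∈ K := by
      intro l hl
      have h₁ := hfac (Ideal.mem_map_of_mem _ (Ideal.mem_map_of_mem v hl))
      obtain ⟨m, hm, h₂⟩ := (IsLocalization.algebraMap_mem_map_algebraMap_iff
        ((ξ.baseChange v).genericSubmonoid
          ((𝔟.map (Ideal.Quotient.mk ξ.J)).map (ξ.zeroMap v))) _ P.L (v l)).1 h₁
      refine ⟨m, ?_, h₂⟩
      rw [mem_genericSubmonoid, h𝔞C] at hm
      exact hm
    obtain ⟨G, hG⟩ := (isNoetherianRing_iff_ideal_fg _).1 hN Q.L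
    choose! t ht ht' using hl
    refine ⟨∏ g ∈ G, t g, prod_mem fun g hg => ht g (hG ▸ Ideal.subset_span hg), fun l hl => ?_⟩
    rw [← hG] at hl
    induction hl using Submodule.span_induction with
    | mem l hl =>
      obtain ⟨c, hc⟩ := Finset.dvd_prod_of_mem t hl
      rw [hc, mul_comm (t l), mul_assoc]
      exact K.mul_mem_left _ (ht' l (hG ▸ Ideal.subset_span hl))
    | zero => rw [map_zero, mul_zero]; exact K.zero_mem
    | add x y _ _ hx hy => rw [map_add, mul_add]; exact K.add_mem hx hy
    | smul c x _ hx =>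
      rw [smul_eq_mul, map_mul, mul_left_comm]
      exact K.mul_mem_left _ hx

end
end Situation

/-! ### Roots of unity as points of the affine line -/

section Polynomial
open Polynomial

/-- The minimal primes over the extension of `𝔟` to the polynomial ring are extended. -/
lemma mem_minimalPrimes_map_C {R : Type*} [CommRing R] {𝔟 : Ideal R} {P : Ideal R[X]} :
    P ∈ (𝔟.map (C : R →+* R[X])).minimalPrimes ↔
      ∃ q ∈ 𝔟.minimalPrimes, q.map (C : R →+* R[X]) = P := by
  constructor
  · intro hP
    have := hP.1.1
    obtain ⟨q, hq, hle⟩ := Ideal.exists_minimalPrimes_le (I := 𝔟) (J := P.comap C)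
      (Ideal.map_le_iff_le_comap.1 hP.1.2)
    have hqP := hq.1.1
    have h₁ : q.map (C : R →+* R[X]) ≤ P := Ideal.map_le_iff_le_comap.2 hle
    exact ⟨q, hq, le_antisymm h₁ (hP.2 ⟨Ideal.isPrime_map_C_of_isPrime, Ideal.map_mono hq.1.2⟩ h₁)⟩
  · rintro ⟨q, hq, rfl⟩
    have hqP := hq.1.1
    refine ⟨⟨Ideal.isPrime_map_C_of_isPrime, Ideal.map_mono hq.1.2⟩, fun Q hQ hle => ?_⟩
    have := hQ.1
    refine Ideal.map_le_iff_le_comap.2 (hq.2 ⟨inferInstance, Ideal.map_le_iff_le_comap.1 hQ.2⟩ ?_)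
    intro x hx
    have := Ideal.mem_map_C_iff.1 (hle hx) 0
    rwa [coeff_C_zero] at this

/-- Over an algebraically closed field, some root of unity of order invertible in the field is not
a root of a given nonzero polynomial. -/
lemma exists_rootOfUnity_eval_ne_zero {k : Type*} [Field k] [IsAlgClosed k] {q : k[X]}
    (hq : q ≠ 0) : ∃ N : ℕ, N ≠ 0 ∧ (N : k) ≠ 0 ∧ ∃ α : k, α ^ N = 1 ∧ q.eval α ≠ 0 := by
  classical
  obtain ⟨N, hN, hNk⟩ : ∃ N : ℕ, q.natDegree < N ∧ (N : k) ≠ 0 := by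
    by_contra! H
    have h₁ := H (q.natDegree + 1) (by omega)
    have h₂ := H (q.natDegree + 2) (by omega)
    push_cast at h₁ h₂
    have : (1 : k) = 0 := by linear_combination h₂ - h₁
    exact one_ne_zero this
  have hN0 : N ≠ 0 := by omega
  refine ⟨N, hN0, hNk, ?_⟩
  have hsep : (X ^ N - C (1 : k)).Separable := separable_X_pow_sub_C 1 hNk one_ne_zero
  have hcard : (X ^ N - C (1 : k)).roots.toFinset.card = N := by
    rw [Multiset.toFinset_card_of_nodup (nodup_roots hsep),
      ← (IsAlgClosed.splits _).natDegree_eq_card_roots, natDegree_X_pow_sub_C]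
  obtain ⟨α, hα, hα'⟩ : ∃ α ∈ (X ^ N - C (1 : k)).roots.toFinset, α ∉ q.roots.toFinset := by
    by_contra! H
    have h₁ := Finset.card_le_card (show _ ⊆ q.roots.toFinset from H)
    have h₂ := q.roots.toFinset_card_le
    have h₃ := q.card_roots'
    omega
  refine ⟨α, ?_, fun h => hα' ?_⟩
  · rw [Multiset.mem_toFinset, mem_roots hsep.ne_zero, IsRoot, eval_sub, eval_pow, eval_X, eval_C,
      sub_eq_zero] at hα
    exact hα
  · rw [Multiset.mem_toFinset, mem_roots hq]
    exact h

/-- The standard étale pair for the group of `N`-th roots of unity, localized at `N h`. -/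
def rootsOfUnityPair {R : Type*} [CommRing R] (N : ℕ) (hN : N ≠ 0) (h : R[X]) :
    StandardEtalePair R where
  f := X ^ N - C 1
  monic_f := monic_X_pow_sub_C 1 hN
  g := C (N : R) * h
  cond := ⟨X * h, - C (N : R) * h, 1, by
    obtain ⟨n, rfl⟩ := Nat.exists_eq_add_one_of_ne_zero hN
    rw [derivative_sub, derivative_X_pow, derivative_C, Nat.add_sub_cancel, C_1]
    ring⟩

/-- If a local ring `D` with nilpotent maximal ideal is obtained from the image of `R` by inverting
one element, then it is the image of `R[X]` under some evaluation map, which can be chosen such that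
a polynomial which is not zero over the residue field becomes invertible, unless `D` is the image
of `R`. -/
lemma exists_eval_surjective {R D : Type*} [CommRing R] [CommRing D] [IsLocalRing D]
    {v : R →+* D} (hv : ¬ Function.Surjective v) (hnil : IsNilpotent (IsLocalRing.maximalIdeal D))
    {t : R} (ht : IsUnit (v t)) (hfrac : ∀ d, ∃ b n, d * v t ^ n = v b) {q : R[X]} {s : R}
    (hs : IsUnit (v s)) (hq : s ∈ Ideal.span (Set.range q.coeff)) :
    ∃ ω : D, Function.Surjective (eval₂RingHom v ω) ∧ IsUnit (eval₂RingHom v ω q) := by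
  classical
  -- `ω` is a power of the inverse `w` of `v t`: these are distinct in the residue field, for if
  -- `v t` were a root of unity there, `w` would lie in the image of `v`
  obtain ⟨w, hw⟩ := ht.exists_right_inv
  let r := IsLocalRing.residue D
  have hpow : ∀ k, k ≠ 0 → r (v t) ^ k ≠ 1 := by
    intro k hk h
    refine hv fun d => ?_
    obtain ⟨m, hm⟩ := hnil
    have h₁ : 1 - v t ^ k ∈ IsLocalRing.maximalIdeal D := by
      rw [← IsLocalRing.residue_eq_zero_iff, map_sub, map_one, map_pow]
      exact sub_eq_zero.2 h.symm
    have h₂ : (1 - v t ^ k) ^ m = 0 := by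
      have := Ideal.pow_mem_pow h₁ m
      rwa [hm] at this
    obtain ⟨e, he⟩ : t ^ k ∣ 1 - (1 - t ^ k) ^ m := by
      have := sub_dvd_pow_sub_pow (1 : R) (1 - t ^ k) m
      rwa [one_pow, sub_sub_cancel] at this
    have h₃ : v t ^ k * v e = 1 := by
      rw [← map_pow, ← map_mul, ← he, map_sub, map_pow, map_sub, map_pow, map_one, h₂, sub_zero]
    obtain ⟨b, n, hb⟩ := hfrac d
    obtain ⟨j, rfl⟩ := Nat.exists_eq_add_one_of_ne_zero hk
    refine ⟨b * (t ^ j * e) ^ n, ?_⟩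
    rw [map_mul, ← hb, map_pow, map_mul, map_pow, mul_assoc, ← mul_pow]
    have : v t * (v t ^ j * v e) = 1 := by rw [← h₃]; ring
    rw [this, one_pow, mul_one]
  have hrw : r (v t) * r w = 1 := by rw [← map_mul, hw, map_one]
  have hq₀ : q.map (r.comp v) ≠ 0 := by
    intro h
    have h₁ : Ideal.span (Set.range q.coeff) ≤ RingHom.ker (r.comp v) := by
      rw [Ideal.span_le]
      rintro _ ⟨i, rfl⟩
      rw [SetLike.mem_coe, RingHom.mem_ker, ← coeff_map, h, coeff_zero]
    exact (hs.map r).ne_zero (RingHom.mem_ker.1 (h₁ hq))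
  have hinj : Function.Injective fun k : ℕ => r w ^ (k + 1) := by
    have key : ∀ a b : ℕ, a < b → r w ^ (a + 1) ≠ r w ^ (b + 1) := by
      intro a b hab h
      refine hpow (b - a) (by omega) ?_
      have hb : b + 1 = (a + 1) + (b - a) := by omega
      have h₁ : r (v t) ^ (b + 1) * r w ^ (b + 1) = 1 := by rw [← mul_pow, hrw, one_pow]
      have h₂ : r (v t) ^ (a + 1) * r w ^ (a + 1) = 1 := by rw [← mul_pow, hrw, one_pow]
      rw [← h, hb, pow_add, mul_right_comm, h₂, one_mul] at h₁
      exact h₁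
    intro a b h
    rcases lt_trichotomy a b with hab | hab | hab
    · exact (key a b hab h).elim
    · exact hab
    · exact (key b a hab h.symm).elim
  obtain ⟨_, ⟨k, rfl⟩, hk⟩ := (Set.infinite_range_of_injective hinj).exists_notMem_finset
    (q.map (r.comp v)).roots.toFinset
  rw [Multiset.mem_toFinset, mem_roots hq₀, IsRoot] at hk
  refine ⟨w ^ (k + 1), fun d => ?_, ?_⟩
  · obtain ⟨b, n, hb⟩ := hfrac d
    refine ⟨C b * (X * C (t ^ k)) ^ n, ?_⟩
    have h₁ : eval₂RingHom v (w ^ (k + 1)) (X * C (t ^ k)) = w := by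
      rw [map_mul, coe_eval₂RingHom, eval₂_X, eval₂_C, map_pow]
      calc w ^ (k + 1) * v t ^ k = w * (v t * w) ^ k := by ring
        _ = w := by rw [hw, one_pow, mul_one]
    rw [map_mul, map_pow, h₁, coe_eval₂RingHom, eval₂_C, ← hb, mul_assoc, ← mul_pow, hw, one_pow,
      mul_one]
  · rw [← IsLocalRing.notMem_maximalIdeal, ← IsLocalRing.residue_eq_zero_iff]
    intro h
    apply hk
    dsimp only
    rw [← map_pow, Polynomial.eval_map, ← hom_eval₂]
    exact h

/-- Let `φ` be a linear form on `I[X]` with values in `(R ⧸ 𝔟)[X]` which vanishes on `Lt`. If a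
constant `m` of `I` belongs to `Lt` generically over all étale `R`-algebras generated by a root of
unity, then `φ m = 0`: otherwise some root of unity is not a zero of `φ m`. -/
lemma eq_zero_of_forall_etale {R : Type u} [CommRing R] {𝔟 I : Ideal R}
    (h𝔟 : 𝔟.IsRadical) {Lt : Ideal R[X]} (hLt : Lt ≤ I.map (C : R →+* R[X]))
    (φ : I.map (C : R →+* R[X]) →ₗ[R[X]] (R[X] ⧸ 𝔟.map (C : R →+* R[X])))
    (hφ : ∀ x : I.map (C : R →+* R[X]), x.1 ∈ Lt → φ x = 0) {q : R[X]}
    (hq : q ∈ genericElements (𝔟.map (C : R →+* R[X]))) {m : R} (hm : m ∈ I)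
    (H : ∀ (E : Type u) [CommRing E] (c : R[X] →+* E), (c.comp C).Etale → IsUnit (c q) →
      ∃ τ ∈ genericElements (𝔟.map (c.comp C)), τ * c (C m) ∈ Lt.map c) :
    φ ⟨C m, Ideal.mem_map_of_mem C hm⟩ = 0 := by
  -- if `p = φ m` is nonzero at the generic point of a component, choose a root of unity `α` over
  -- an algebraic closure of the residue field of `R` at which neither `p` nor `q` vanishes
  obtain ⟨p, hp⟩ := Ideal.Quotient.mk_surjective (φ ⟨C m, Ideal.mem_map_of_mem C hm⟩)
  rw [← hp, Ideal.Quotient.eq_zero_iff_mem]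
  by_contra hpn
  obtain ⟨P, hP, hpP⟩ : ∃ P ∈ (𝔟.map (C : R →+* R[X])).minimalPrimes, p ∉ P := by
    by_contra! h
    refine hpn ?_
    rw [← (isRadical_map_C h𝔟).radical, ← Ideal.sInf_minimalPrimes]
    exact (Submodule.mem_sInf).2 h
  obtain ⟨𝔮, h𝔮, rfl⟩ := mem_minimalPrimes_map_C.1 hP
  have := h𝔮.1.1
  let k := AlgebraicClosure 𝔮.ResidueField
  let θ : R →+* k := algebraMap R k
  have hθ : ∀ x, θ x = 0 ↔ x ∈ 𝔮 := by
    intro x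
    rw [← Ideal.algebraMap_residueField_eq_zero (I := 𝔮)]
    change algebraMap R k x = 0 ↔ _
    rw [IsScalarTower.algebraMap_apply R 𝔮.ResidueField k, map_eq_zero]
  have hne : ∀ p : R[X], p ∉ 𝔮.map (C : R →+* R[X]) → p.map θ ≠ 0 := by
    intro p hp h
    refine hp (Ideal.mem_map_C_iff.2 fun n => (hθ _).1 ?_)
    rw [← coeff_map, h, coeff_zero]
  obtain ⟨N, hN, hNk, α, hα, hpα⟩ := exists_rootOfUnity_eval_ne_zero
    (mul_ne_zero (hne p hpP) (hne q (hq _ hP)))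
  rw [eval_mul, Polynomial.eval_map, Polynomial.eval_map] at hpα
  let Q := rootsOfUnityPair N hN q
  let c : R[X] →+* Q.Ring := (aeval (R := R) Q.X).toRingHom
  have hc : c.comp C = algebraMap R Q.Ring := RingHom.ext fun r => aeval_C _ r
  have hcu : IsUnit (c q) := by
    have : IsUnit (c (C (N : R) * q)) := Q.hasMap_X.2
    rw [map_mul] at this
    exact isUnit_of_mul_isUnit_right this
  obtain ⟨τ, hτ, hτm⟩ := H Q.Ring c (hc ▸ RingHom.etale_algebraMap.2 inferInstance) hcu
  rw [hc] at hτ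
  let 𝔟E : Ideal Q.Ring := 𝔟.map (algebraMap R Q.Ring)
  have h𝔟c : 𝔟.map (C : R →+* R[X]) ≤ 𝔟E.comap c := by
    rw [← Ideal.map_le_iff_le_comap, Ideal.map_map, hc]
  let cbar : R[X] ⧸ 𝔟.map (C : R →+* R[X]) →+* Q.Ring ⧸ 𝔟E := Ideal.quotientMap 𝔟E c h𝔟c
  have hcbar : ∀ (a : R[X]) z, cbar (a • z) = c a • cbar z := by
    intro a z
    obtain ⟨z, rfl⟩ := Ideal.Quotient.mk_surjective z
    exact congrArg (Ideal.Quotient.mk 𝔟E) (map_mul c a z)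
  let φ₀ : I →ₗ[R] Q.Ring ⧸ 𝔟E :=
    { toFun := fun x => cbar (φ ⟨C x.1, Ideal.mem_map_of_mem C x.2⟩)
      map_add' := fun x y => by
        rw [← map_add, ← map_add]
        congr 2
        exact Subtype.ext (map_add C _ _)
      map_smul' := fun r x => by
        have h₁ : (⟨C (r • x).1, Ideal.mem_map_of_mem C (r • x).2⟩ : I.map (C : R →+* R[X])) =
          C r • ⟨C x.1, Ideal.mem_map_of_mem C x.2⟩ := Subtype.ext (map_mul C r x.1)
        rw [h₁, map_smul, hcbar, RingHom.id_apply, ← algebraMap_smul Q.Ring r, ← hc]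
        rfl }
  obtain ⟨φ', hφ'⟩ := exists_linearMap_map_of_flat (C := Q.Ring) I φ₀
  have hcI : ∀ y ∈ I.map (C : R →+* R[X]), c y ∈ I.map (algebraMap R Q.Ring) := by
    intro y hy
    rw [← hc, ← Ideal.map_map]
    exact Ideal.mem_map_of_mem c hy
  have key : ∀ y (hy : y ∈ I.map (C : R →+* R[X])), φ' ⟨c y, hcI y hy⟩ = cbar (φ ⟨y, hy⟩) := by
    intro y hy
    induction hy using Submodule.span_induction with
    | mem y hy =>
      obtain ⟨x, hx, rfl⟩ := hy
      refine Eq.trans ?_ (hφ' ⟨x, hx⟩)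
      congr 1
      exact Subtype.ext (RingHom.congr_fun hc x)
    | zero =>
      refine Eq.trans ?_ (map_zero φ') |>.trans ?_
      · congr 1; exact Subtype.ext (map_zero c)
      · rw [← map_zero cbar, ← map_zero φ]; rfl
    | add x y hx hy hx' hy' =>
      have h₁ : (⟨c (x + y), hcI _ (add_mem hx hy)⟩ : I.map (algebraMap R Q.Ring)) =
        ⟨c x, hcI x hx⟩ + ⟨c y, hcI y hy⟩ := Subtype.ext (map_add c x y)
      have h₂ : (⟨x + y, add_mem hx hy⟩ : I.map (C : R →+* R[X])) = ⟨x, hx⟩ + ⟨y, hy⟩ := rfl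
      rw [h₁, h₂, map_add, map_add, map_add, hx', hy']
    | smul a x hx hx' =>
      have h₁ : (⟨c (a • x), hcI _ (Submodule.smul_mem _ a hx)⟩ : I.map (algebraMap R Q.Ring)) =
        c a • ⟨c x, hcI x hx⟩ := Subtype.ext (map_mul c a x)
      have h₂ : (⟨a • x, Submodule.smul_mem _ a hx⟩ : I.map (C : R →+* R[X])) = a • ⟨x, hx⟩ := rfl
      rw [h₁, h₂, map_smul, map_smul, hx', hcbar]
  have hLtI : ∀ z ∈ Lt.map c, z ∈ I.map (algebraMap R Q.Ring) := by
    intro z hz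
    rw [← hc, ← Ideal.map_map]
    exact Ideal.map_mono hLt hz
  have hzero : ∀ z (hz : z ∈ Lt.map c), φ' ⟨z, hLtI z hz⟩ = 0 := by
    intro z hz
    induction hz using Submodule.span_induction with
    | mem y hy =>
      obtain ⟨x, hx, rfl⟩ := hy
      rw [key x (hLt hx), hφ _ hx, map_zero]
    | zero => exact map_zero φ'
    | add x y hx hy hx' hy' =>
      have h₁ : (⟨x + y, hLtI _ (add_mem hx hy)⟩ : I.map (algebraMap R Q.Ring)) =
        ⟨x, hLtI x hx⟩ + ⟨y, hLtI y hy⟩ := rfl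
      rw [h₁, map_add, hx', hy', add_zero]
    | smul a x hx hx' =>
      have h₁ : (⟨a • x, hLtI _ (Submodule.smul_mem _ a hx)⟩ : I.map (algebraMap R Q.Ring)) =
        a • ⟨x, hLtI x hx⟩ := rfl
      rw [h₁, map_smul, hx', smul_zero]
  have hτp : τ * c p ∈ 𝔟E := by
    have h₁ := hzero _ hτm
    have h₂ : (⟨τ * c (C m), hLtI _ hτm⟩ : I.map (algebraMap R Q.Ring)) =
      τ • ⟨c (C m), hcI _ (Ideal.mem_map_of_mem C hm)⟩ := rfl
    rw [h₂, map_smul, key _ (Ideal.mem_map_of_mem C hm), ← hp] at h₁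
    exact Ideal.Quotient.eq_zero_iff_mem.1 h₁
  have hmap : Q.HasMap (S := k) α := by
    refine ⟨?_, ?_⟩
    · change aeval α (X ^ N - C 1) = 0
      rw [map_sub, map_pow, aeval_X, hα, aeval_C, map_one, sub_self]
    · change IsUnit (aeval α (C (N : R) * q))
      rw [map_mul, aeval_C, map_natCast]
      exact (mul_ne_zero hNk (right_ne_zero_of_mul hpα)).isUnit
  let π : Q.Ring →ₐ[R] k := Q.lift α hmap
  have hπ : ∀ a : R[X], π (c a) = aeval α a := by
    intro a
    change π (aeval Q.X a) = _
    rw [← aeval_algHom_apply, Q.lift_X]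
  have hker : 𝔟E ≤ RingHom.ker π := by
    rw [Ideal.map_le_iff_le_comap]
    intro x hx
    rw [Ideal.mem_comap, RingHom.mem_ker, AlgHom.commutes]
    exact (hθ x).2 (h𝔮.1.2 hx)
  have : (RingHom.ker π).IsPrime := RingHom.ker_isPrime π
  obtain ⟨T, hT, hTle⟩ := Ideal.exists_minimalPrimes_le hker
  have hcp := ((hT.1.1.mem_or_mem (hT.1.2 hτp)).resolve_left (hτ T hT))
  have h₁ := RingHom.mem_ker.1 (hTle hcp)
  rw [hπ] at h₁
  exact left_ne_zero_of_mul hpα h₁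

end Polynomial

namespace Situation
variable {X Y : Fibred.{v, w} S} {f : X ⟶ Y} {ξ : Situation f} {𝔟 : Ideal ξ.T₂.ring}
variable [hX : ∀ U, IsGroupoid (X.obj U)] [hY : ∀ U, IsGroupoid (Y.obj U)]

open Polynomial in
/-- Compatible generic extenders provide good pairs. For the condition at points, a local
`B'`-algebra `D` as in `IsGoodAtPoints` is a quotient of `B'[X]`, though not of `B'` in general; so
the extenders of the deformation situation over `B'[X]` enter. -/
theorem exists_isGood_and_isGoodAtPoints (hX₁ : X.S1) (hY₁ : Y.S1)
    (hf : HasCompatibleGenericExtenders f) (h : ξ.IsAlgebraic) (hr : 𝔟.IsRadical)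
    (hle : ξ.J ≤ 𝔟) (hmul : 𝔟 * ξ.I = ⊥) :
    ∃ s L, ξ.IsGood 𝔟 s L ∧ ξ.IsGoodAtPoints s L := by
  have hN := h.isNoetherianRing
  have hξ := h.isAdapted hle hmul
  obtain ⟨s₁, L, hg, hp⟩ := exists_isGood_of_hasCompatible hX₁ hY₁ hf h hr hle hmul
  obtain ⟨st, Lt, hgt, hpt⟩ : ∃ (st : ξ.T₂.ring[X]) (Lt : Ideal ξ.T₂.ring[X]), _ :=
    exists_isGood_of_hasCompatible hX₁ hY₁ hf h.polynomial
    (isRadical_map_C hr) (Ideal.map_mono hle) (hξ.mul_map C)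
  have hLt : Lt ≤ ξ.I.map (C : ξ.T₂.ring →+* ξ.T₂.ring[X]) := hgt.le
  have hst : st ∈ genericElements (𝔟.map (C : ξ.T₂.ring →+* ξ.T₂.ring[X])) := hgt.mem
  obtain ⟨st', hst', n, φ, m, hm, hφ, hsp⟩ := exists_isSplitAt
    (I := ξ.I.map (C : ξ.T₂.ring →+* ξ.T₂.ring[X])) (K := Lt) (isRadical_map_C hr)
    ((hξ.mul_map C).le.trans bot_le)
  have hCs₁ : C s₁ ∈ genericElements (𝔟.map (C : ξ.T₂.ring →+* ξ.T₂.ring[X])) :=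
    map_mem_genericElements (R := ξ.T₂.ring) (C := ξ.T₂.ring[X]) hg.mem
  -- every étale `B'`-algebra generated by one element is a specialization of `B'[X]`, and the lifting
  -- over `B'[X] ⧸ Lt` restricts to it; so `L` is contained in `Lt` generically
  have claim : ∀ l ∈ L, st' * C l ∈ Lt := by
    intro l hl
    have hlI := Ideal.mem_map_of_mem (C : ξ.T₂.ring →+* ξ.T₂.ring[X]) (hg.le hl)
    have h₀ : φ ⟨C l, hlI⟩ = 0 := by
      funext i
      refine eq_zero_of_forall_etale hr hLt ((LinearMap.proj i).comp φ)
        (fun x hx => congrFun (hφ x hx) i) (q := st * C s₁) (mul_mem hst hCs₁) (hg.le hl) ?_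
      intro E _ c hc hu
      rw [map_mul] at hu
      have hu₁ : IsUnit (c st) := isUnit_of_mul_isUnit_left hu
      have hu₂ : IsUnit (c (C s₁)) := isUnit_of_mul_isUnit_right hu
      have hle : Lt.map c ≤ ξ.I.map (c.comp C) := by
        rw [← Ideal.map_map]
        exact Ideal.map_mono hLt
      have H₁ := hgt.hasLift ((Ideal.Quotient.mk (Lt.map c) : E →+* E ⧸ Lt.map c).comp c)
        (hu₁.map (Ideal.Quotient.mk (Lt.map c)))
        (fun y hy => Ideal.Quotient.eq_zero_iff_mem.2 (Ideal.mem_map_of_mem c hy))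
      have H₂ := (ξ.baseChange_hasLift C
        ((Ideal.Quotient.mk (Lt.map c) : E →+* E ⧸ Lt.map c).comp c)).1 H₁
      obtain ⟨τ, hτ, hτL⟩ := hg.etale (c.comp C) hc hu₂ (Lt.map c) hle H₂
      exact ⟨τ, hτ, hτL l hl⟩
    obtain ⟨d, hd, hdm⟩ := hsp ⟨C l, hlI⟩
    rw [h₀] at hd
    have h₁ : ∑ i, d i * m i = 0 := Finset.sum_eq_zero fun i _ => by
      have h₂ := Ideal.mul_mem_mul (Ideal.Quotient.eq_zero_iff_mem.1 (hd i)) (hm i)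
      rw [hξ.mul_map] at h₂
      exact h₂
    rwa [h₁, sub_zero] at hdm
  -- where `s₂` is invertible, the polynomial `st * st'` does not vanish on the fibre of the affine
  -- line, so it is invertible for a suitable evaluation map onto `D`
  obtain ⟨s₂, hs₂, hs₂'⟩ := exists_mem_genericElements (𝔟 := 𝔟)
    (𝔠 := Ideal.span (Set.range (st * st').coeff)) (by
      intro 𝔮 h𝔮 hle'
      refine mul_mem hst hst' _ (mem_minimalPrimes_map_C.2 ⟨𝔮, h𝔮, rfl⟩) ?_
      exact Ideal.mem_map_C_iff.2 fun i => hle' (Ideal.subset_span ⟨i, rfl⟩))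
  refine ⟨s₁ * s₂, L, hg.mul hs₂', ?_⟩
  intro D _ _ v hnil ⟨t, ht, hfrac⟩ hu hann H l hl
  rw [map_mul] at hu
  have hu₁ : IsUnit (v s₁) := isUnit_of_mul_isUnit_left hu
  have hu₂ : IsUnit (v s₂) := isUnit_of_mul_isUnit_right hu
  by_cases hv : Function.Surjective v
  · exact hp v hnil hv hu₁ hann H l hl
  obtain ⟨ω, hω, hωu⟩ := exists_eval_surjective hv hnil ht hfrac hu₂ hs₂
  obtain ⟨c, hc⟩ : ∃ c : ξ.T₂.ring[X] →+* D, c = eval₂RingHom v ω := ⟨_, rfl⟩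
  rw [← hc] at hω hωu
  obtain rfl : c.comp C = v := RingHom.ext fun x => by
    rw [hc, RingHom.comp_apply, coe_eval₂RingHom, eval₂_C]
  rw [map_mul] at hωu
  have hann' : IsLocalRing.maximalIdeal D * (ξ.I.map (C : ξ.T₂.ring →+* ξ.T₂.ring[X])).map c = ⊥ := by
    rw [Ideal.map_map]
    exact hann
  have h₁ : c (st' * C l) = 0 := hpt c hnil hω (isUnit_of_mul_isUnit_left hωu) hann'
    ((ξ.baseChange_hasLift C c).2 H) _ (claim l hl)
  rw [map_mul] at h₁
  exact (isUnit_of_mul_isUnit_right hωu).mul_right_eq_zero.1 h₁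

end Situation

/-! ### Functoriality of deformation modules -/

namespace Def
open Tot
variable {X Y : Fibred.{v, w} S}
variable {T T₂ : AffOver S} {i : T ⟶ T₂} {a : X.Fib T}
variable {V V₂ : AffOver S} {j : V ⟶ V₂} {b : X.Fib V}
variable {W W₂ : AffOver S} {k : W ⟶ W₂} {c : X.Fib W}

/-- The class `d` is the restriction of the class `d'` along `α` and `h`: there is an arrow over `h`
between representatives which extends `α`. -/
def Over (d : Def X i a) (d' : Def X j b) (α : tot a ⟶ tot b) (h : T₂ ⟶ V₂) : Prop :=
  ∃ (l : Lifting X i a) (l' : Lifting X j b), Quotient.mk _ l = d ∧ Quotient.mk _ l' = d' ∧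
    ∃ χ : tot l.obj ⟶ tot l'.obj, χ.base = h ∧ l.toArr ≫ χ = α ≫ l'.toArr

lemma over_push (d : Def X i a) {T₁ : AffOver S} (t : T ⟶ T₁) (h : T₁ ⟶ T₂) (e : t ≫ h = i) :
    Over (d.push t h e) d (𝟙 _) h := by
  induction d using Quotient.inductionOn with
  | h l =>
    exact ⟨_, l, rfl, rfl, cart h l.obj, rfl, by rw [Lifting.toArr_push, Category.id_comp]⟩

lemma over_baseChange (d : Def X i a) (t : V ⟶ V₂) (g : V ⟶ T) (g₂ : V₂ ⟶ T₂)
    (e : t ≫ g₂ = g ≫ i) : Over (d.baseChange t g g₂ e) d (cart g a) g₂ := by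
  induction d using Quotient.inductionOn with
  | h l => exact ⟨_, l, rfl, rfl, cart g₂ l.obj, rfl, Lifting.toArr_baseChange l t g g₂ e⟩

section
variable [hX : ∀ U, IsGroupoid (X.obj U)] [hY : ∀ U, IsGroupoid (Y.obj U)]

lemma over_mk {l : Lifting X i a} {l' : Lifting X j b} {α : tot a ⟶ tot b} {h : T₂ ⟶ V₂} :
    Over (Quotient.mk _ l) (Quotient.mk _ l') α h ↔
      ∃ χ : tot l.obj ⟶ tot l'.obj, χ.base = h ∧ l.toArr ≫ χ = α ≫ l'.toArr := by
  constructor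
  · rintro ⟨m, m', hm, hm', χ, hχ, e⟩
    obtain ⟨χ₁, h₁, e₁⟩ := (Lifting.isom_iff _ _).1 (Quotient.exact hm.symm)
    obtain ⟨χ₂, h₂, e₂⟩ := (Lifting.isom_iff _ _).1 (Quotient.exact hm')
    refine ⟨χ₁ ≫ χ ≫ χ₂, by simp [h₁, h₂, hχ], ?_⟩
    rw [← Category.assoc, e₁, ← Category.assoc, e, Category.assoc, e₂]
  · rintro ⟨χ, hχ, e⟩
    exact ⟨l, l', rfl, rfl, χ, hχ, e⟩

lemma Over.trans {d : Def X i a} {d' : Def X j b} {d'' : Def X k c} {α : tot a ⟶ tot b}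
    {h : T₂ ⟶ V₂} {α' : tot b ⟶ tot c} {h' : V₂ ⟶ W₂} (H : Over d d' α h) (H' : Over d' d'' α' h') :
    Over d d'' (α ≫ α') (h ≫ h') := by
  obtain ⟨l, l', rfl, rfl, χ, hχ, e⟩ := H
  induction d'' using Quotient.inductionOn with
  | h l'' =>
    obtain ⟨χ', hχ', e'⟩ := over_mk.1 H'
    refine over_mk.2 ⟨χ ≫ χ', by simp [hχ, hχ'], ?_⟩
    rw [← Category.assoc, e, Category.assoc, e', Category.assoc]

lemma Over.unique {d₁ d₂ : Def X i a} {d' : Def X j b} {α : tot a ⟶ tot b} {h : T₂ ⟶ V₂}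
    (H₁ : Over d₁ d' α h) (H₂ : Over d₂ d' α h) : d₁ = d₂ := by
  induction d₁ using Quotient.inductionOn with
  | h l₁ =>
  induction d₂ using Quotient.inductionOn with
  | h l₂ =>
  induction d' using Quotient.inductionOn with
  | h l' =>
    obtain ⟨χ₁, h₁, e₁⟩ := over_mk.1 H₁
    obtain ⟨χ₂, h₂, e₂⟩ := over_mk.1 H₂
    obtain ⟨χ, hχ, rfl⟩ := exists_lift χ₂ χ₁ (𝟙 _) (by rw [h₁, h₂]; exact Category.id_comp _)
    refine Quotient.sound ((Lifting.isom_iff _ _).2 ⟨χ, hχ, hom_ext_of_comp χ₂ ?_ ?_⟩)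
    · rw [comp_base, hχ]
      exact Category.comp_id _
    · rw [Category.assoc, e₁, e₂]

lemma mk_eq_mk_iff_of_arr {l p : Lifting X i a} {r : T₂ ⟶ T} (ρ₀ : tot p.obj ⟶ tot a)
    (h₀ : ρ₀.base = r) (e₀ : p.toArr ≫ ρ₀ = 𝟙 _) :
    (Quotient.mk _ l : Def X i a) = Quotient.mk _ p ↔
      ∃ ρ : tot l.obj ⟶ tot a, ρ.base = r ∧ l.toArr ≫ ρ = 𝟙 _ := by
  constructor
  · intro H
    obtain ⟨χ, hχ, e⟩ := (Lifting.isom_iff _ _).1 (Quotient.exact H)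
    refine ⟨χ ≫ ρ₀, by rw [comp_base, hχ, h₀]; exact Category.id_comp _, ?_⟩
    rw [← Category.assoc, e, e₀]
  · rintro ⟨ρ, hρ, e⟩
    obtain ⟨χ, hχ, h₁⟩ := exists_lift ρ₀ ρ (𝟙 _) (by rw [hρ, h₀]; exact Category.id_comp _)
    refine Quotient.sound ((Lifting.isom_iff _ _).2 ⟨χ, hχ, hom_ext_of_comp ρ₀ ?_ ?_⟩)
    · rw [comp_base, hχ]
      exact Category.comp_id _
    · rw [Category.assoc, h₁, e, e₀]

/-- The trivial class is the one which has a retraction. -/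
lemma mk_eq_trivial_iff {l : Lifting X i a} {r : T₂ ⟶ T} {e : i ≫ r = 𝟙 T} :
    Quotient.mk _ l = Def.trivial i r e a ↔
      ∃ ρ : tot l.obj ⟶ tot a, ρ.base = r ∧ l.toArr ≫ ρ = 𝟙 _ := by
  refine mk_eq_mk_iff_of_arr (p := Lifting.trivial i r e a) (cart r a) rfl ?_
  refine (homMk_comp i r (𝟙 T) e _ _).trans ?_
  have h₁ : 𝟙 (tot a) = homMk (𝟙 T) ((X.resId T).inv.app a) := by
    refine congrArg (homMk (𝟙 T)) ?_
    simp only [Fibred.resId, Cat.Hom.toNatIso_inv]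
    exact congrArg (fun (e : X.map (𝟙 _) ≅ 𝟙 _) => e.inv.toNatTrans.app a)
      (X.mapId'_eq_mapId (.mk (op T))).symm
  rw [h₁]
  congr 1
  simp [Lifting.trivial]

/-- The image of a lifting under a 1-morphism `f`, for an identification `β` of `b` with `f(a)`. -/
def mapLifting (f : X ⟶ Y) {b : Y.Fib T} (β : tot b ⟶ tot (fobj f a)) (hβ : β.base = 𝟙 T)
    (l : Lifting X i a) : Lifting Y i b :=
  Lifting.ofArr (β ≫ Tot.map f l.toArr) (by
    have : (β ≫ Tot.map f l.toArr).base = β.base ≫ i := rfl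
    rw [this, hβ, Category.id_comp])

lemma exists_mapLifting (f : X ⟶ Y) {b : Y.Fib T} (β : tot b ⟶ tot (fobj f a)) (hβ : β.base = 𝟙 T)
    (l : Lifting X i a) : ∃ (ε : tot (mapLifting f β hβ l).obj ⟶ tot (fobj f l.obj))
      (ε' : tot (fobj f l.obj) ⟶ tot (mapLifting f β hβ l).obj), ε.base = 𝟙 _ ∧ ε'.base = 𝟙 _ ∧
      (mapLifting f β hβ l).toArr ≫ ε = β ≫ Tot.map f l.toArr ∧
      β ≫ Tot.map f l.toArr ≫ ε' = (mapLifting f β hβ l).toArr := by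
  have h : (mapLifting f β hβ l).toArr = β ≫ Tot.map f l.toArr := Lifting.toArr_ofArr _ _
  refine ⟨𝟙 (tot (fobj f l.obj)), 𝟙 (tot (fobj f l.obj)), rfl, rfl, ?_, ?_⟩
  · exact (congrArg (· ≫ 𝟙 (tot (fobj f l.obj))) h).trans (Category.comp_id _)
  · exact (congrArg (β ≫ ·) (Category.comp_id _)).trans h.symm

/-- The map on classes of deformations induced by a 1-morphism `f`, for an identification `β` of
`b` with `f(a)`. -/
def mapObj (f : X ⟶ Y) {b : Y.Fib T} (β : tot b ⟶ tot (fobj f a)) (hβ : β.base = 𝟙 T) :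
    Def X i a → Def Y i b :=
  Quotient.map (mapLifting f β hβ) (by
    intro l l' H
    obtain ⟨χ, hχ, e⟩ := (Lifting.isom_iff _ _).1 H
    obtain ⟨ε, -, h₁, -, h₂, -⟩ := exists_mapLifting f β hβ l
    obtain ⟨-, ε', -, h₁', -, h₂'⟩ := exists_mapLifting f β hβ l'
    refine (Lifting.isom_iff _ _).2 ⟨ε ≫ Tot.map f χ ≫ ε', ?_, ?_⟩
    · rw [comp_base, comp_base, map_base, h₁, hχ, h₁', Category.comp_id]
      exact Category.comp_id _
    · rw [← Category.assoc, h₂, Category.assoc, ← Category.assoc (Tot.map f _), ← map_comp, e, h₂'])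

lemma Over.mapObj {d : Def X i a} {d' : Def X j b} {α : tot a ⟶ tot b} {h : T₂ ⟶ V₂}
    (H : Over d d' α h) (f : X ⟶ Y) {a' : Y.Fib T} {β : tot a' ⟶ tot (fobj f a)}
    (hβ : β.base = 𝟙 T) {b' : Y.Fib V} {β' : tot b' ⟶ tot (fobj f b)} (hβ' : β'.base = 𝟙 V)
    {α' : tot a' ⟶ tot b'} (e : β ≫ Tot.map f α = α' ≫ β') :
    Over (d.mapObj f β hβ) (d'.mapObj f β' hβ') α' h := by
  obtain ⟨l, l', rfl, rfl, χ, hχ, e'⟩ := H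
  obtain ⟨ε, -, h₁, -, h₂, -⟩ := exists_mapLifting f β hβ l
  obtain ⟨-, ε', -, h₁', -, h₂'⟩ := exists_mapLifting f β' hβ' l'
  refine over_mk.2 ⟨ε ≫ Tot.map f χ ≫ ε', ?_, ?_⟩
  · rw [comp_base, comp_base, map_base, h₁, hχ, h₁']
    exact (Category.id_comp _).trans (Category.comp_id _)
  · rw [← Category.assoc, h₂, Category.assoc, ← Category.assoc (Tot.map f _), ← map_comp, e',
      map_comp, Category.assoc, ← Category.assoc, e, Category.assoc, h₂']

lemma mapObj_eq_trivial {l : Lifting X i a} {f : X ⟶ Y} {b : Y.Fib T} {β : tot b ⟶ tot (fobj f a)}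
    (hβ : β.base = 𝟙 T) {r : T₂ ⟶ T} {e : i ≫ r = 𝟙 T}
    (ρ : tot (fobj f l.obj) ⟶ tot (fobj f a)) (hρ : ρ.base = r)
    (e' : Tot.map f l.toArr ≫ ρ = 𝟙 _) :
    Def.mapObj f β hβ (Quotient.mk _ l) = Def.trivial i r e b := by
  obtain ⟨β', hβ', e₁, e₂⟩ := isIso_of_base β hβ
  obtain ⟨ε, -, h₁, -, h₂, -⟩ := exists_mapLifting f β hβ l
  refine mk_eq_trivial_iff.2 ⟨ε ≫ ρ ≫ β', ?_, ?_⟩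
  · rw [comp_base, comp_base, h₁, hρ, hβ']
    exact (Category.id_comp _).trans (Category.comp_id _)
  · rw [← Category.assoc, h₂, Category.assoc, ← Category.assoc (Tot.map f _), e',
      Category.id_comp, e₁]

lemma exists_retraction_of_mapObj_eq_trivial {f : X ⟶ Y} {r : T₂ ⟶ T} {e : i ≫ r = 𝟙 T}
    {l : Lifting X i a}
    (H : Def.mapObj f (𝟙 (tot (fobj f a))) rfl (Quotient.mk _ l) = Def.trivial i r e (fobj f a)) :
    ∃ ρ : tot (fobj f l.obj) ⟶ tot (fobj f a), ρ.base = r ∧ Tot.map f l.toArr ≫ ρ = 𝟙 _ := by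
  obtain ⟨ρ, hρ, e'⟩ := mk_eq_trivial_iff.1 H
  obtain ⟨-, ε', -, h₁', -, h₂'⟩ := exists_mapLifting f (𝟙 (tot (fobj f a))) rfl l
  refine ⟨ε' ≫ ρ, ?_, ?_⟩
  · rw [comp_base, h₁', hρ]
    exact Category.id_comp _
  · rw [Category.id_comp] at h₂'
    rw [← Category.assoc]
    exact (congrArg (· ≫ ρ) h₂').trans e'

end
end Def

namespace DefModule
open Tot
variable {X Y : Fibred.{v, w} S} {U : AffOver S} {a : X.Fib U}
variable [hX : ∀ U, IsGroupoid (X.obj U)] [hY : ∀ U, IsGroupoid (Y.obj U)]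
variable {M N : Type u} [AddCommGroup M] [Module U.ring M] [Module U.ringᵐᵒᵖ M]
  [IsCentralScalar U.ring M] [AddCommGroup N] [Module U.ring N] [Module U.ringᵐᵒᵖ N]
  [IsCentralScalar U.ring N]

lemma over_map (φ : M →ₗ[U.ring] N) (d : DefModule M a) :
    Def.Over (map φ d) d (𝟙 _) (AffOver.sqZeroMap φ) := Def.over_push d _ _ _

/-- The map `D_a(M) ⟶ D_b(M)` induced by a 1-morphism `f`, for an identification `β` of `b` with
`f(a)`. -/
def mapObj (f : X ⟶ Y) {b : Y.Fib U} (β : tot b ⟶ tot (fobj f a)) (hβ : β.base = 𝟙 U)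
    (d : DefModule M a) : DefModule M b := Def.mapObj f β hβ d

section
variable (f : X ⟶ Y) {b : Y.Fib U} (β : tot b ⟶ tot (fobj f a)) (hβ : β.base = 𝟙 U)

lemma mapObj_map (φ : M →ₗ[U.ring] N) (d : DefModule M a) :
    mapObj f β hβ (map φ d) = map φ (mapObj f β hβ d) := by
  refine Def.Over.unique (Def.Over.mapObj (over_map φ d) f hβ hβ ?_) (over_map φ (mapObj f β hβ d))
  rw [Tot.map_id, Category.id_comp, Category.comp_id]

lemma mapObj_add [IsNoetherianRing U.ring] [IsReduced U.ring] [Module.Finite U.ring M] (h : X.S1)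
    (h' : Y.S1) (d d' : DefModule M a) :
    mapObj f β hβ (add h d d') = add h' (mapObj f β hβ d) (mapObj f β hβ d') := by
  have e : d = map (LinearMap.fst _ _ _) (pair h d d') := (map_fst_pair h d d').symm
  have e' : d' = map (LinearMap.snd _ _ _) (pair h d d') := (map_snd_pair h d d').symm
  generalize pair h d d' = z at e e'
  subst e e'
  rw [add_map, mapObj_map, mapObj_map, mapObj_map, add_map]

end

section
variable {A : Type u} [CommRing A] [Algebra U.ring A]

lemma over_baseChange (d : DefModule M a) :
    Def.Over (baseChange A d) d (cart (U.specHom (algebraMap U.ring A)) a)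
      (AffOver.sqZeroBaseChange U M A) := Def.over_baseChange d _ _ _ _

lemma sqZeroBaseChange_sqZeroMap (φ : M →ₗ[U.ring] N) :
    AffOver.sqZeroBaseChange U N A ≫ AffOver.sqZeroMap φ =
      AffOver.sqZeroMap (U := U.spec (algebraMap U.ring A)) (φ.baseChange A) ≫
        AffOver.sqZeroBaseChange U M A := by
  refine AffOver.hom_ext' fun x => ?_
  let φB := φ.baseChange A
  change sqZeroRingHom (algebraMap U.ring A) _ (TrivSqZeroExt.map φ x) =
    TrivSqZeroExt.map φB (sqZeroRingHom (algebraMap U.ring A) _ x)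
  ext
  · simp only [sqZeroRingHom, RingHom.coe_mk, MonoidHom.coe_mk, OneHom.coe_mk,
      TrivSqZeroExt.fst_map, TrivSqZeroExt.fst_add, TrivSqZeroExt.fst_inl, TrivSqZeroExt.fst_inr]
    exact congrArg (algebraMap U.ring A · + 0) (TrivSqZeroExt.fst_map φ x)
  · simp only [sqZeroRingHom, RingHom.coe_mk, MonoidHom.coe_mk, OneHom.coe_mk,
      TrivSqZeroExt.snd_map, TrivSqZeroExt.snd_add, TrivSqZeroExt.snd_inl, TrivSqZeroExt.snd_inr,
      LinearMap.coe_mk, AddHom.coe_mk, _root_.zero_add, φB, LinearMap.baseChange_tmul]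
    exact congrArg ((1 : A) ⊗ₜ[U.ring] ·) (TrivSqZeroExt.snd_map φ x)

lemma baseChange_map (φ : M →ₗ[U.ring] N) (d : DefModule M a) :
    baseChange A (map φ d) =
      map (U := U.spec (algebraMap U.ring A)) (φ.baseChange A) (baseChange A d) := by
  have h₁ := (over_baseChange (A := A) (map φ d)).trans (over_map φ d)
  have h₂ := (over_map (U := U.spec (algebraMap U.ring A)) (φ.baseChange A)
    (baseChange A d)).trans (over_baseChange (A := A) d)
  rw [sqZeroBaseChange_sqZeroMap, Category.comp_id] at h₁
  rw [Category.id_comp] at h₂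
  exact h₁.unique h₂

end

section Module
variable [hX₁ : Fact X.S1] [hY₁ : Fact Y.S1] [IsNoetherianRing U.ring] [IsReduced U.ring]
  [Module.Finite U.ring M] [Module.Finite U.ring N]

instance : AddCommGroup (DefModule M a) := addCommGroup M a hX₁.out

instance : Module U.ring (DefModule M a) := module M a hX₁.out

lemma smul_def (r : U.ring) (d : DefModule M a) : r • d = map (r • LinearMap.id) d := rfl

/-- A deformation over `A + M` as a linear map from the homomorphisms `M ⟶ N` to `D_a(N)`. -/
def evalHom (d : DefModule M a) : (M →ₗ[U.ring] N) →ₗ[U.ring] DefModule N a where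
  toFun φ := map φ d
  map_add' φ ψ := (add_map hX₁.out φ ψ d).symm
  map_smul' r φ := by
    rw [RingHom.id_apply, smul_def, map_map]
    rfl

/-- The linear map `D_a(M) ⟶ D_a(N)` induced by a homomorphism `M ⟶ N`. -/
def mapHom (φ : M →ₗ[U.ring] N) : DefModule M a →ₗ[U.ring] DefModule N a where
  toFun d := map φ d
  map_add' d d' := map_add_add hX₁.out φ d d'
  map_smul' r d := by
    rw [RingHom.id_apply, smul_def, smul_def, map_map, map_map]
    congr 1
    ext x
    simp

/-- The linear map `D_a(M) ⟶ D_b(M)` induced by a 1-morphism. -/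
def mapObjHom (f : X ⟶ Y) {b : Y.Fib U} (β : tot b ⟶ tot (fobj f a)) (hβ : β.base = 𝟙 U) :
    DefModule M a →ₗ[U.ring] DefModule M b where
  toFun := mapObj f β hβ
  map_add' := mapObj_add f β hβ hX₁.out hY₁.out
  map_smul' _ d := mapObj_map f β hβ _ d

lemma mapHom_apply (φ : M →ₗ[U.ring] N) (d : DefModule M a) : mapHom φ d = map φ d := rfl

lemma evalHom_apply (φ : M →ₗ[U.ring] N) (d : DefModule M a) : evalHom d φ = map φ d := rfl

end Module

end DefModule

/-! ### The kernel of a homomorphism of deformation modules -/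

/-- Let `F` be a homomorphism of finite modules over a reduced Noetherian ring. After inverting an
element avoiding all minimal primes, every base change of the kernel of `F` generates the kernel of
the base change, because the image of `F` becomes a direct summand. -/
lemma exists_ker_baseChange {R : Type*} [CommRing R] [IsNoetherianRing R] [IsReduced R]
    {M N : Type*} [AddCommGroup M] [Module R M] [AddCommGroup N] [Module R N] [Module.Finite R N]
    (F : M →ₗ[R] N) : ∃ s ∈ genericElements (⊥ : Ideal R), ∀ (B : Type u) [CommRing B] [Algebra R B],
      IsUnit (algebraMap R B s) → ∀ t : B ⊗[R] M, F.baseChange B t = 0 →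
        t ∈ LinearMap.range ((LinearMap.ker F).subtype.baseChange B) := by
  obtain ⟨s, hs, n, φ, ψ, h⟩ := exists_generic_splitting (R := R) (N ⧸ LinearMap.range F)
  obtain ⟨ψ', hψ'⟩ := Module.projective_lifting_property (LinearMap.range F).mkQ ψ
    (LinearMap.range F).mkQ_surjective
  refine ⟨s, hs, fun B _ _ hu t ht => ?_⟩
  let ρ : N →ₗ[R] LinearMap.range F :=
    (s • LinearMap.id - ψ' ∘ₗ φ ∘ₗ (LinearMap.range F).mkQ).codRestrict _ fun y => by
      have h₁ := h ((LinearMap.range F).mkQ y)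
      rw [← hψ', LinearMap.comp_apply, ← map_smul, ← sub_eq_zero, ← map_sub, Submodule.mkQ_apply,
        Submodule.Quotient.mk_eq_zero] at h₁
      rw [← neg_mem_iff]
      simpa using h₁
  have hρ : ρ ∘ₗ F = s • F.rangeRestrict := by
    ext x
    have : (LinearMap.range F).mkQ (F x) = 0 :=
      (Submodule.Quotient.mk_eq_zero _).2 (LinearMap.mem_range_self F x)
    simp [ρ, this]
  have h₁ : (F.rangeRestrict).baseChange B t = 0 := by
    have h₂ : (ρ ∘ₗ F).baseChange B t = 0 := by
      rw [LinearMap.baseChange_comp, LinearMap.comp_apply, ht, map_zero]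
    rw [hρ, LinearMap.baseChange_smul, LinearMap.smul_apply, ← algebraMap_smul B s] at h₂
    exact hu.smul_eq_zero.1 h₂
  have h₂ : Function.Exact (LinearMap.ker F).subtype F.rangeRestrict := by
    intro x
    simp [LinearMap.rangeRestrict, LinearMap.codRestrict_apply, Subtype.ext_iff]
  obtain ⟨k, hk⟩ := (lTensor_exact B h₂ F.surjective_rangeRestrict t).1 h₁
  exact ⟨k, hk⟩

namespace DefModule
open Tot
variable {X Y : Fibred.{v, w} S} {U : AffOver S} {a : X.Fib U}
variable [hX : ∀ U, IsGroupoid (X.obj U)] [hY : ∀ U, IsGroupoid (Y.obj U)]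
variable [hX₁ : Fact X.S1] [hY₁ : Fact Y.S1] [IsNoetherianRing U.ring] [IsReduced U.ring]

section
variable (f : X ⟶ Y) (a : X.Fib U) {B : Type u} [CommRing B] [Algebra U.ring B]

/-- The identification of `f(a)|_B` with `f(a|_B)`. -/
lemma exists_baseChange_identification : ∃ β :
    tot ((Y.res (U.specHom (algebraMap U.ring B))).obj (fobj f a)) ⟶
      tot (fobj f ((X.res (U.specHom (algebraMap U.ring B))).obj a)),
    β.base = 𝟙 (U.spec (algebraMap U.ring B)) ∧
      β ≫ Tot.map f (cart (U.specHom (algebraMap U.ring B)) a) = cart _ (fobj f a) :=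
  exists_lift (Tot.map f (cart (U.specHom (algebraMap U.ring B)) a)) (cart _ (fobj f a)) (𝟙 _)
    (Category.id_comp _)

end

section BaseChange
variable {B : Type u} [CommRing B] [Algebra U.ring B] [IsNoetherianRing B] [IsReduced B]

/-- Restriction to `B` commutes with `f` on deformations. -/
lemma mapObj_baseChange (f : X ⟶ Y) {M : Type u} [AddCommGroup M] [Module U.ring M]
    [Module U.ringᵐᵒᵖ M] [IsCentralScalar U.ring M]
    {β : tot ((Y.res (U.specHom (algebraMap U.ring B))).obj (fobj f a)) ⟶
      tot (fobj f ((X.res (U.specHom (algebraMap U.ring B))).obj a))}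
    (hβ : β.base = 𝟙 (U.spec (algebraMap U.ring B)))
    (e : β ≫ Tot.map f (cart (U.specHom (algebraMap U.ring B)) a) = cart _ (fobj f a))
    (d : DefModule M a) :
    mapObj (U := U.spec (algebraMap U.ring B)) f β hβ (baseChange B d) =
      baseChange B (mapObj f (𝟙 _) rfl d) := by
  refine Def.Over.unique (Def.Over.mapObj (over_baseChange (A := B) d) f hβ rfl ?_)
    (over_baseChange (A := B) (mapObj f (𝟙 _) rfl d))
  exact e.trans (Category.comp_id _).symm

instance {P : Type u} [AddCommGroup P] [Module B P] [Module Bᵐᵒᵖ P] [IsCentralScalar B P]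
    [Module.Finite B P] (b : X.Fib (U.spec (algebraMap U.ring B))) :
    AddCommGroup (DefModule (U := U.spec (algebraMap U.ring B)) P b) :=
  addCommGroup P b hX₁.out

instance {P : Type u} [AddCommGroup P] [Module B P] [Module Bᵐᵒᵖ P] [IsCentralScalar B P]
    [Module.Finite B P] (b : X.Fib (U.spec (algebraMap U.ring B))) :
    Module B (DefModule (U := U.spec (algebraMap U.ring B)) P b) :=
  module P b hX₁.out

/-- Under compatibility of deformations with the base change to `B`, the elements of the kernel of
`D ⟶ D_f` over `B` come from `κ` if this holds over the original ring. -/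
lemma exists_eq_map_of_mapObj_eq_zero {f : X ⟶ Y} {r : ℕ} {κ : DefModule (Fin r → U.ring) a}
    (hκ : ∀ x : DefModule U.ring a, mapObj f (𝟙 _) rfl x = zero →
      x ∈ Submodule.span U.ring (Set.range fun j => map (LinearMap.proj j) κ))
    (hker : ∀ t : B ⊗[U.ring] DefModule U.ring a,
      (mapObjHom (M := U.ring) f (𝟙 (tot (fobj f a))) rfl).baseChange B t = 0 →
      t ∈ LinearMap.range
        ((LinearMap.ker (mapObjHom (M := U.ring) f (𝟙 (tot (fobj f a))) rfl)).subtype.baseChange B))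
    (hXB : X.DefCompatible hX₁.out a U.ring B) (hYB : Y.DefCompatible hY₁.out (fobj f a) U.ring B)
    {β : tot ((Y.res (U.specHom (algebraMap U.ring B))).obj (fobj f a)) ⟶
      tot (fobj f ((X.res (U.specHom (algebraMap U.ring B))).obj a))}
    (hβ : β.base = 𝟙 (U.spec (algebraMap U.ring B)))
    (e : β ≫ Tot.map f (cart (U.specHom (algebraMap U.ring B)) a) = cart _ (fobj f a))
    (d : DefModule (U := U.spec (algebraMap U.ring B)) (B ⊗[U.ring] U.ring)
      ((X.res (U.specHom (algebraMap U.ring B))).obj a))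
    (hd : mapObj (U := U.spec (algebraMap U.ring B)) f β hβ d = zero) :
    ∃ k : B ⊗[U.ring] (Fin r → U.ring) →ₗ[B] B ⊗[U.ring] U.ring,
      d = map (U := U.spec (algebraMap U.ring B)) k (baseChange B κ) := by
  let V := U.spec (algebraMap U.ring B)
  let F : DefModule U.ring a →ₗ[U.ring] DefModule U.ring (fobj f a) := mapObjHom f (𝟙 _) rfl
  obtain ⟨eX, heX⟩ := hXB
  obtain ⟨eY, heY⟩ := hYB
  let G := mapObjHom (U := V) (M := B ⊗[U.ring] U.ring) f β hβ
  have key : ∀ t, G (eX t) = eY (F.baseChange B t) := by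
    intro t
    induction t using TensorProduct.induction_on with
    | zero => rw [_root_.map_zero, _root_.map_zero, _root_.map_zero, _root_.map_zero]
    | add x y hx hy => rw [map_add, map_add, map_add, map_add, hx, hy]
    | tmul c x =>
      have h₁ : c ⊗ₜ[U.ring] x = c • ((1 : B) ⊗ₜ[U.ring] x) := by
        rw [TensorProduct.smul_tmul', smul_eq_mul, mul_one]
      rw [h₁, eX.map_smul, heX, (F.baseChange B).map_smul, LinearMap.baseChange_tmul, eY.map_smul,
        heY]
      refine (LinearMap.map_smul G c _).trans ?_
      exact congrArg (c • ·) (mapObj_baseChange f hβ e x)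
  obtain ⟨t, rfl⟩ := eX.surjective d
  have ht : F.baseChange B t = 0 := by
    rw [← eY.map_eq_zero_iff, ← key]
    exact hd
  obtain ⟨t, rfl⟩ := hker t ht
  let E : (B ⊗[U.ring] (Fin r → U.ring) →ₗ[B] B ⊗[U.ring] U.ring) →ₗ[B]
      DefModule (U := V) (B ⊗[U.ring] U.ring) ((X.res (U.specHom (algebraMap U.ring B))).obj a) :=
    evalHom (U := V) (baseChange B κ)
  -- the multiples of `κ` form a submodule, so it is enough to consider generators of the kernel
  suffices H : ∀ t : B ⊗[U.ring] LinearMap.ker F,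
      eX ((LinearMap.ker F).subtype.baseChange B t) ∈ LinearMap.range E by
    obtain ⟨k, hk⟩ := H t
    exact ⟨k, hk.symm⟩
  intro t
  induction t using TensorProduct.induction_on with
  | zero => rw [_root_.map_zero, _root_.map_zero]; exact zero_mem _
  | add x y hx hy => rw [map_add, map_add]; exact add_mem hx hy
  | tmul c x =>
    have h₁ : c ⊗ₜ[U.ring] x = c • ((1 : B) ⊗ₜ[U.ring] x) := by
      rw [TensorProduct.smul_tmul', smul_eq_mul, mul_one]
    rw [h₁, map_smul, map_smul]
    refine Submodule.smul_mem _ c ?_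
    rw [LinearMap.baseChange_tmul]
    obtain ⟨x, hx⟩ := x
    rw [Submodule.subtype_apply]
    dsimp only
    clear h₁
    replace hx := hκ x hx
    induction hx using Submodule.span_induction with
    | mem y hy =>
      obtain ⟨j, rfl⟩ := hy
      rw [heX, baseChange_map]
      exact ⟨(LinearMap.proj j).baseChange B, rfl⟩
    | zero => rw [TensorProduct.tmul_zero, _root_.map_zero]; exact zero_mem _
    | add y z _ _ hy hz => rw [TensorProduct.tmul_add, map_add]; exact add_mem hy hz
    | smul c y _ hy =>
      rw [TensorProduct.tmul_smul, ← algebraMap_smul B c, map_smul]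
      exact Submodule.smul_mem _ _ hy

end BaseChange

/-- The kernel of `D_a ⟶ D_{f(a)}` is generated by the components of one deformation `κ` of `a`
over the trivial extension by a free module, and generically this persists after base change. -/
theorem exists_generator (f : X ⟶ Y) (a : X.Fib U)
    (hXf : Module.Finite U.ring (DefModule U.ring a))
    (hYf : Module.Finite U.ring (DefModule U.ring (fobj f a))) :
    ∃ (r : ℕ) (κ : DefModule (Fin r → U.ring) a), mapObj f (𝟙 _) rfl κ = zero ∧
    ∃ s ∈ genericElements (⊥ : Ideal U.ring), ∀ (B : Type u) [CommRing B] [Algebra U.ring B]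
      [IsNoetherianRing B] [IsReduced B], IsUnit (algebraMap U.ring B s) →
      X.DefCompatible hX₁.out a U.ring B → Y.DefCompatible hY₁.out (fobj f a) U.ring B →
      ∀ (P : Type u) [AddCommGroup P] [Module B P] [Module Bᵐᵒᵖ P] [IsCentralScalar B P]
        [Module.Finite B P] (n : ℕ) (φ : P →ₗ[B] (Fin n → B)) (ψ : (Fin n → B) →ₗ[B] P),
        ψ ∘ₗ φ = LinearMap.id →
        ∀ l : Lifting X (AffOver.zeroSection (U.spec (algebraMap U.ring B)) P)
            ((X.res (U.specHom (algebraMap U.ring B))).obj a),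
          (∃ ρ : tot (fobj f l.obj) ⟶ tot (fobj f ((X.res (U.specHom (algebraMap U.ring B))).obj a)),
            ρ.base = AffOver.retraction (U.spec (algebraMap U.ring B)) P ∧
              Tot.map f l.toArr ≫ ρ = 𝟙 _) →
          ∃ k : B ⊗[U.ring] (Fin r → U.ring) →ₗ[B] P,
            Def.Over (Quotient.mk _ l) κ (cart _ a)
              (AffOver.sqZeroMap (U := U.spec (algebraMap U.ring B)) k ≫
                AffOver.sqZeroBaseChange U (Fin r → U.ring) B) := by
  classical
  let F : DefModule U.ring a →ₗ[U.ring] DefModule U.ring (fobj f a) := mapObjHom f (𝟙 _) rfl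
  obtain ⟨G, hG⟩ := (isNoetherian_def.1 (isNoetherian_of_isNoetherianRing_of_finite U.ring
    (DefModule U.ring a))) (LinearMap.ker F)
  obtain ⟨r, g, hg⟩ : ∃ (r : ℕ) (g : Fin r → DefModule U.ring a),
      Submodule.span U.ring (Set.range g) = LinearMap.ker F :=
    ⟨G.card, fun i => (G.equivFin.symm i : DefModule U.ring a), by
      rw [← hG]
      congr 1
      ext x
      constructor
      · rintro ⟨i, rfl⟩
        exact (G.equivFin.symm i).2
      · intro hx
        exact ⟨G.equivFin ⟨x, hx⟩, by simp⟩⟩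
  have hgF : ∀ j, mapObj f (𝟙 _) rfl (g j) = zero := fun j => by
    have : g j ∈ LinearMap.ker F := hg ▸ Submodule.subset_span ⟨j, rfl⟩
    exact this
  -- `κ` is the deformation whose `j`-th component is the `j`-th generator of the kernel
  let κ : DefModule (Fin r → U.ring) a := ∑ j, mapHom (LinearMap.single U.ring (fun _ => U.ring) j) (g j)
  have hκ : ∀ j, map (LinearMap.proj j) κ = g j := by
    intro j
    change mapHom (LinearMap.proj j) κ = g j
    rw [map_sum, Finset.sum_eq_single j]
    · rw [mapHom_apply, mapHom_apply, map_map, LinearMap.proj_comp_single_same, map_id]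
    · intro i _ hij
      rw [mapHom_apply, mapHom_apply, map_map, LinearMap.proj_comp_single_ne _ _ _ _ hij.symm,
        map_zero]
      rfl
    · intro h
      exact (h (Finset.mem_univ j)).elim
  obtain ⟨s, hs, hker⟩ := exists_ker_baseChange F
  refine ⟨r, κ, ?_, s, hs, ?_⟩
  · change mapObjHom f (𝟙 _) rfl κ = 0
    rw [map_sum]
    refine Finset.sum_eq_zero fun j _ => ?_
    change mapObj f (𝟙 _) rfl (map _ (g j)) = 0
    rw [mapObj_map, hgF]
    exact LinearMap.map_zero (mapHom (a := fobj f a) (LinearMap.single U.ring (fun _ => U.ring) j))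
  intro B _ _ _ _ hu hXB hYB P _ _ _ _ _ n φ ψ hψ l ⟨ρ, hρ, eρ⟩
  let V := U.spec (algebraMap U.ring B)
  obtain ⟨β, hβ, e⟩ := exists_baseChange_identification f a (B := B)
  let θ : B ⊗[U.ring] U.ring ≃ₗ[B] B := TensorProduct.AlgebraTensorModule.rid U.ring B B
  let d : DefModule (U := V) P ((X.res (U.specHom (algebraMap U.ring B))).obj a) := Quotient.mk _ l
  have hd : mapObj (U := V) f β hβ d = zero := Def.mapObj_eq_trivial hβ ρ hρ eρ
  -- `P` is a direct summand of a free module, so `d` is determined by `n` deformations over `B + B`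
  let φ' : Fin n → (P →ₗ[B] B ⊗[U.ring] U.ring) := fun i =>
    θ.symm.toLinearMap ∘ₗ LinearMap.proj i ∘ₗ φ
  let ψ' : Fin n → (B ⊗[U.ring] U.ring →ₗ[B] P) := fun i =>
    ψ ∘ₗ LinearMap.single B (fun _ => B) i ∘ₗ θ.toLinearMap
  have hφψ : ∑ i, ψ' i ∘ₗ φ' i = LinearMap.id := by
    rw [← hψ]
    ext x
    simp only [LinearMap.sum_apply, LinearMap.comp_apply, φ', ψ', LinearEquiv.coe_coe,
      LinearEquiv.apply_symm_apply, LinearMap.proj_apply, LinearMap.coe_single]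
    rw [← map_sum, Finset.univ_sum_single]
  have hk : ∀ i, ∃ k : B ⊗[U.ring] (Fin r → U.ring) →ₗ[B] B ⊗[U.ring] U.ring,
      map (U := V) (φ' i) d = map (U := V) k (baseChange B κ) := by
    intro i
    refine exists_eq_map_of_mapObj_eq_zero (fun x hx => ?_) (hker B hu) hXB hYB hβ e _ ?_
    · have h₁ : (fun j => map (LinearMap.proj j) κ) = g := funext hκ
      rw [h₁, hg]
      exact hx
    · rw [mapObj_map, hd]
      exact LinearMap.map_zero (mapHom (U := V) (φ' i))
  choose k hk using hk
  refine ⟨∑ i, ψ' i ∘ₗ k i, ?_⟩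
  have hdk : d = map (U := V) (∑ i, ψ' i ∘ₗ k i) (baseChange B κ) := by
    calc d = evalHom (U := V) d (∑ i, ψ' i ∘ₗ φ' i) := by
          rw [hφψ]
          exact (map_id (U := V) d).symm
      _ = ∑ i, evalHom (U := V) (baseChange B κ) (ψ' i ∘ₗ k i) := by
          rw [map_sum]
          refine Finset.sum_congr rfl fun i _ => ?_
          rw [evalHom_apply, evalHom_apply, ← map_map (U := V) (φ' i) (ψ' i),
            ← map_map (U := V) (k i) (ψ' i), hk]
      _ = _ := by
          rw [← map_sum]
          rfl
  change Def.Over d κ _ _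
  rw [hdk]
  have h := (over_map (U := V) (∑ i, ψ' i ∘ₗ k i) (baseChange B κ)).trans
    (over_baseChange (A := B) κ)
  rw [Category.id_comp] at h
  exact h

end DefModule

/-! ### Gluing along trivial extensions -/

namespace AffOver
variable {V U : AffOver S}
variable {M N : Type u} [AddCommGroup M] [Module U.ring M] [Module U.ringᵐᵒᵖ M]
  [IsCentralScalar U.ring M] [AddCommGroup N] [Module V.ring N] [Module V.ringᵐᵒᵖ N]
  [IsCentralScalar V.ring N]

/-- The morphism of trivial extensions attached to a morphism `V ⟶ U` and a semilinear map. -/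
def sqZeroSemi (g : V ⟶ U) (φ : M →ₛₗ[g.toRing.hom] N) : V.sqZero N ⟶ U.sqZero M :=
  factor (retraction U M) (retraction V N ≫ g) (sqZeroRingHom g.toRing.hom φ) (by
    refine RingHom.ext fun x => ?_
    change sqZeroRingHom g.toRing.hom φ (TrivSqZeroExt.inl x) = TrivSqZeroExt.inl (g.toRing.hom x)
    ext <;> simp [sqZeroRingHom])

lemma sqZeroSemi_toRing (g : V ⟶ U) (φ : M →ₛₗ[g.toRing.hom] N) (z : TrivSqZeroExt U.ring M) :
    (sqZeroSemi g φ).toRing.hom z =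
      (TrivSqZeroExt.inl (g.toRing.hom z.fst) + TrivSqZeroExt.inr (φ z.snd) :
        TrivSqZeroExt V.ring N) := rfl

@[simp] lemma sqZeroSemi_retraction (g : V ⟶ U) (φ : M →ₛₗ[g.toRing.hom] N) :
    sqZeroSemi g φ ≫ retraction U M = retraction V N ≫ g := factor_comp ..

@[simp] lemma zeroSection_sqZeroSemi (g : V ⟶ U) (φ : M →ₛₗ[g.toRing.hom] N) :
    zeroSection V N ≫ sqZeroSemi g φ = g ≫ zeroSection U M := by
  refine hom_ext' fun (z : TrivSqZeroExt U.ring M) => ?_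
  change TrivSqZeroExt.fst (TrivSqZeroExt.inl (g.toRing.hom z.fst) + TrivSqZeroExt.inr (φ z.snd) :
    TrivSqZeroExt V.ring N) = g.toRing.hom z.fst
  simp

lemma isExtensionPair_zeroSection [IsNoetherianRing V.ring] [IsReduced V.ring]
    [Module.Finite V.ring N] :
    IsExtensionPair (zeroSection V N).toRing.hom (Hom.toRing (𝟙 V)).hom := by
  have hker : RingHom.ker (zeroSection V N).toRing.hom ^ 2 = ⊥ := TrivSqZeroExt.kerIdeal_sq V.ring N
  refine ⟨DefModule.isNoetherianRing_sqZero, fun x => ⟨TrivSqZeroExt.inl x, rfl⟩,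
    fun x => ⟨x, rfl⟩, ⟨2, hker⟩, ⟨1, ?_⟩, inferInstance, ?_⟩
  · rw [pow_one]
    exact RingHom.ker_coe_equiv (RingEquiv.refl V.ring)
  · rw [pow_two] at hker
    exact hker

/-- For a surjection `A ⟶ B` and a `B`-module `M`, the ring `A + M` is the fibre product of `A` and
`B + M` over `B`. -/
lemma isEquivalence_gluing_sqZeroSemi {X : Fibred.{v, w} S} (h : X.S1) [IsNoetherianRing V.ring]
    [IsReduced V.ring] [Module.Finite V.ring N] [IsNoetherianRing U.ring] (g : V ⟶ U)
    (hg : Function.Surjective g.toRing.hom) (φ : M →ₛₗ[g.toRing.hom] N)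
    (hφ : Function.Bijective φ) :
    (X.gluing (zeroSection V N) g (sqZeroSemi g φ) (zeroSection U M)
      (zeroSection_sqZeroSemi g φ)).IsEquivalence := by
  refine h (zeroSection V N) (𝟙 V) g (sqZeroSemi g φ) (zeroSection U M)
    (zeroSection_sqZeroSemi g φ) isExtensionPair_zeroSection inferInstance ?_ ?_
  · rw [Category.id_comp]
    exact hg
  · rintro (a : TrivSqZeroExt V.ring N) (b : U.ring) (hab : a.fst = g.toRing.hom b)
    obtain ⟨m, hm⟩ := hφ.2 a.snd
    refine ⟨(TrivSqZeroExt.inl b + TrivSqZeroExt.inr m : TrivSqZeroExt U.ring M), ⟨?_, ?_⟩, ?_⟩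
    · rw [sqZeroSemi_toRing]
      refine TrivSqZeroExt.ext ?_ ?_ <;> simp [hab, hm]
    · change TrivSqZeroExt.fst _ = b
      simp
    · rintro (c : TrivSqZeroExt U.ring M) ⟨h₁, h₂ : c.fst = b⟩
      rw [sqZeroSemi_toRing] at h₁
      refine TrivSqZeroExt.ext ?_ ?_
      · simpa using h₂
      · refine hφ.1 ?_
        have := congrArg TrivSqZeroExt.snd h₁
        simpa [hm] using this

end AffOver

namespace AffOver
variable {D : AffOver S} {P : Type u} [AddCommGroup P] [Module D.ring P] [Module D.ringᵐᵒᵖ P]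
  [IsCentralScalar D.ring P]

/-- The homomorphism `D + P ⟶ D`, `(d, p) ↦ d + j p`, for a homomorphism `j : P ⟶ D` whose image has
square zero. -/
def plusRingHom {D P : Type u} [CommRing D] [AddCommGroup P] [Module D P] [Module Dᵐᵒᵖ P]
    [IsCentralScalar D P] (j : P →ₗ[D] D) (hj : ∀ p p', j p * j p' = 0) : TrivSqZeroExt D P →+* D where
  toFun z := z.fst + j z.snd
  map_one' := by simp
  map_zero' := by simp
  map_add' y z := by simp; ring
  map_mul' y z := by
    simp only [TrivSqZeroExt.fst_mul, TrivSqZeroExt.snd_mul, map_add, map_smul, op_smul_eq_smul,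
      smul_eq_mul]
    linear_combination (-1 : D) * hj y.snd z.snd

/-- The morphism `Spec D ⟶ Spec (D + P)` given by `plusRingHom`. -/
def plus (j : P →ₗ[D.ring] D.ring) (hj : ∀ p p', j p * j p' = 0) : D ⟶ D.sqZero P :=
  factor (retraction D P) (𝟙 D) (plusRingHom j hj) (by
    refine RingHom.ext fun x => ?_
    change TrivSqZeroExt.fst (TrivSqZeroExt.inl x : TrivSqZeroExt D.ring P) +
      j (TrivSqZeroExt.snd (TrivSqZeroExt.inl x : TrivSqZeroExt D.ring P)) = x
    simp)

variable {j : P →ₗ[D.ring] D.ring} {hj : ∀ p p', j p * j p' = 0}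

@[simp] lemma plus_retraction : plus j hj ≫ retraction D P = 𝟙 D := factor_comp ..

lemma plus_toRing (z : TrivSqZeroExt D.ring P) :
    (plus j hj).toRing.hom z = z.fst + j z.snd := rfl

lemma comp_zeroSection_eq_comp_plus {D₀ : AffOver S} (i : D₀ ⟶ D)
    (hi : ∀ p, i.toRing.hom (j p) = 0) : i ≫ zeroSection D P = i ≫ plus j hj := by
  refine hom_ext' fun (z : TrivSqZeroExt D.ring P) => ?_
  change i.toRing.hom z.fst = i.toRing.hom (z.fst + j z.snd)
  rw [map_add, hi, add_zero]

/-- If `P` is an ideal of square zero in `D`, the ring `D + P` is the fibre product of two copies of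
`D` over `D ⧸ P`. -/
lemma isEquivalence_gluing_plus {X : Fibred.{v, w} S} (h : X.S1) {D₀ A₀ : AffOver S} (i : D₀ ⟶ D)
    (i₀ : A₀ ⟶ D₀) (hext : IsExtensionPair i.toRing.hom i₀.toRing.hom)
    (hjinj : Function.Injective j) (hker : ∀ d, i.toRing.hom d = 0 ↔ ∃ p, j p = d) :
    (X.gluing i i (zeroSection D P) (plus j hj)
      (comp_zeroSection_eq_comp_plus i fun p => (hker _).2 ⟨p, rfl⟩)).IsEquivalence := by
  have := hext.noetherian
  refine h i i₀ i (zeroSection D P) (plus j hj) _ hext inferInstance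
    (hext.surjective₀.comp hext.surjective) ?_
  intro (a : D.ring) (b : D.ring) hab
  obtain ⟨p, hp⟩ := (hker (b - a)).1 (by rw [map_sub, hab, sub_self])
  refine ⟨(TrivSqZeroExt.inl a + TrivSqZeroExt.inr p : TrivSqZeroExt D.ring P), ⟨?_, ?_⟩, ?_⟩
  · change TrivSqZeroExt.fst _ = a
    simp
  · rw [plus_toRing]
    simp [hp]
  · rintro (c : TrivSqZeroExt D.ring P) ⟨h₁ : c.fst = a, h₂⟩
    rw [plus_toRing] at h₂
    refine TrivSqZeroExt.ext ?_ ?_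
    · simpa using h₁
    · refine hjinj ?_
      rw [h₁] at h₂
      simp [hp, ← h₂]

end AffOver

open Tot AffOver in
/-- Let `z'` be a lifting over `D` of an object `a` over `D₀` such that `f(z')` agrees with the
image of the given lifting `x'` over `A₁`. The difference between `z'` and `x'` is a deformation with
trivial image under `f`, hence it comes from `κ`; so there is an arrow from `z'` to the object `x''`
obtained by gluing `x'` and `κ`. -/
lemma exists_arrow_of_generator {X Y : Fibred.{v, w} S} {f : X ⟶ Y}
    [hX : ∀ U, IsGroupoid (X.obj U)] [hY : ∀ U, IsGroupoid (Y.obj U)] (hX₁ : X.S1) (hY₁ : Y.S1)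
    {U A₁ T₂ : AffOver S} {Q : Type u} [AddCommGroup Q] [Module U.ring Q] [Module U.ringᵐᵒᵖ Q]
    [IsCentralScalar U.ring Q] [Module A₁.ring Q] [Module A₁.ringᵐᵒᵖ Q]
    [IsCentralScalar A₁.ring Q] {ι : U ⟶ A₁} {φQ : Q →ₛₗ[ι.toRing.hom] Q} (hφQ : ∀ q, φQ q = q)
    {x' : X.Fib A₁} {xb : X.Fib U} {x'' : X.Fib (A₁.sqZero Q)} {κ : Lifting X (zeroSection U Q) xb}
    {αx : tot xb ⟶ tot x'} (hαx : αx.base = ι) {p : tot x' ⟶ tot x''} (hp : p.base = zeroSection A₁ Q)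
    {q : tot κ.obj ⟶ tot x''} (hq : q.base = sqZeroSemi ι φQ) (hpq : αx ≫ p = κ.toArr ≫ q)
    {y : Y.Fib T₂} {g₁ : A₁ ⟶ T₂} {m' : tot (fobj f x') ⟶ tot y} (hm' : m'.base = g₁)
    {D D₀ A₀ : AffOver S} {v : D ⟶ A₁} {i : D₀ ⟶ D} {i₀ : A₀ ⟶ D₀}
    (hext : IsExtensionPair i.toRing.hom i₀.toRing.hom)
    {B : Type u} [CommRing B] [Algebra U.ring B] [IsNoetherianRing B] [IsReduced B]
    {δ : U.spec (algebraMap U.ring B) ⟶ D} (hδ : δ ≫ v = U.specHom (algebraMap U.ring B) ≫ ι)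
    (hδs : Function.Surjective δ.toRing.hom)
    {P : Type u} [AddCommGroup P] [Module B P] [Module Bᵐᵒᵖ P] [IsCentralScalar B P]
    [Module.Finite B P] [Module D.ring P] [Module D.ringᵐᵒᵖ P] [IsCentralScalar D.ring P]
    {φP : P →ₛₗ[δ.toRing.hom] P} (hφP : ∀ q, φP q = q)
    {j : P →ₗ[D.ring] D.ring} (hj : ∀ p p', j p * j p' = 0) (hjinj : Function.Injective j)
    (hker : ∀ d, i.toRing.hom d = 0 ↔ ∃ p, j p = d)
    (hGK : ∀ l : Lifting X (zeroSection (U.spec (algebraMap U.ring B)) P)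
        ((X.res (U.specHom (algebraMap U.ring B))).obj xb),
      (∃ ρ : tot (fobj f l.obj) ⟶ tot (fobj f ((X.res (U.specHom (algebraMap U.ring B))).obj xb)),
        ρ.base = retraction (U.spec (algebraMap U.ring B)) P ∧ Tot.map f l.toArr ≫ ρ = 𝟙 _) →
      ∃ (k : Q →ₛₗ[(U.specHom (algebraMap U.ring B)).toRing.hom] P) (χ : tot l.obj ⟶ tot κ.obj),
        χ.base = sqZeroSemi (U.specHom (algebraMap U.ring B)) k ∧ l.toArr ≫ χ = cart _ xb ≫ κ.toArr)
    {a : X.Fib D₀} {z' : X.Fib D} {l' : tot a ⟶ tot z'} (hl' : l'.base = i) {α : tot a ⟶ tot x'}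
    (hα : α.base = i ≫ v) {m₂ : tot (fobj f z') ⟶ tot y} (hm₂ : m₂.base = v ≫ g₁)
    (e : Tot.map f l' ≫ m₂ = Tot.map f α ≫ m') :
    ∃ (k : Q →+ P) (χ : tot z' ⟶ tot x''), (∀ c : TrivSqZeroExt A₁.ring Q,
      χ.base.toRing.hom c = v.toRing.hom c.fst + j (k c.snd)) ∧ l' ≫ χ = α ≫ p := by
  let b := (X.res (U.specHom (algebraMap U.ring B))).obj xb
  have hij := comp_zeroSection_eq_comp_plus (j := j) (hj := hj) i fun p => (hker _).2 ⟨p, rfl⟩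
  -- the object `ζ` over `D + P` restricts to `x'|_D` along the zero section and to `z'` along
  -- `plus`; its image under `f` is pulled back along the retraction
  obtain ⟨l, hl, el⟩ := exists_lift (cart v x') α i hα.symm
  obtain ⟨ζ, pz, pz', hpz, hpz', hpp⟩ := exists_glue hij
    (isEquivalence_gluing_plus hX₁ i i₀ hext hjinj hker) l l' hl hl'
  obtain ⟨n, hn, hnz, -⟩ := exists_desc hij (isEquivalence_gluing_plus hY₁ i i₀ hext hjinj hker)
    (Tot.map f l) (Tot.map f l') hl hl' (Tot.map f pz) (Tot.map f pz') hpz hpz'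
    (by rw [← map_comp, hpp, map_comp]) (t := tot y) (retraction D P ≫ v ≫ g₁)
    (Tot.map f (cart v x') ≫ m') m₂ (by
      rw [comp_base, map_base, hm', ← Category.assoc, zeroSection_retraction, Category.id_comp])
    (by rw [hm₂, ← Category.assoc, plus_retraction, Category.id_comp])
    (by rw [e, ← Category.assoc, ← map_comp, el])
  -- the restriction of `ζ` to `B + P` is a deformation with trivial image under `f`
  obtain ⟨d, hd, ed⟩ := exists_lift (cart v x') (cart (U.specHom (algebraMap U.ring B)) xb ≫ αx) δ
    (by rw [comp_base, hαx]; exact hδ)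
  obtain ⟨lb, hlb, elb⟩ := exists_lift (cart (sqZeroSemi δ φP) ζ) (d ≫ pz) (zeroSection _ P)
    (by rw [comp_base, hd, hpz]; exact zeroSection_sqZeroSemi δ φP)
  have hn' : (Tot.map f (cart (sqZeroSemi δ φP) ζ) ≫ n).base =
      retraction _ P ≫ (Tot.map f d ≫ Tot.map f (cart v x') ≫ m').base := by
    rw [comp_base, comp_base, comp_base, map_base, map_base, map_base, hn, hm', hd,
      ← Category.assoc, ← Category.assoc, ← Category.assoc]
    exact congrArg (fun k => (k ≫ v) ≫ g₁) (sqZeroSemi_retraction δ φP)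
  obtain ⟨ρ, hρ, eρ⟩ := exists_lift (Tot.map f d ≫ Tot.map f (cart v x') ≫ m')
    (Tot.map f (cart (sqZeroSemi δ φP) ζ) ≫ n) (retraction _ P) hn'.symm
  have hρl : Tot.map f lb ≫ ρ = 𝟙 _ := by
    refine hom_ext_of_comp (Tot.map f d ≫ Tot.map f (cart v x') ≫ m') ?_ ?_
    · rw [comp_base, map_base, hlb, hρ]
      exact zeroSection_retraction
    · rw [Category.assoc, eρ, ← Category.assoc, ← map_comp, elb, map_comp, Category.assoc, hnz,
        Category.id_comp]
  -- hence it is induced from `κ` by some `k`, and the arrow extends to `ζ` because `D + P` is the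
  -- fibre product of `D` and `B + P`
  obtain ⟨k, χ₀, hχ₀, eχ₀⟩ : ∃ (k : Q →ₛₗ[(U.specHom (algebraMap U.ring B)).toRing.hom] P)
      (χ₀ : tot ((X.res (sqZeroSemi δ φP)).obj ζ) ⟶ tot κ.obj),
      χ₀.base = sqZeroSemi (U.specHom (algebraMap U.ring B)) k ∧
        lb ≫ χ₀ = cart _ xb ≫ κ.toArr := by
    obtain ⟨k, χ₀, h₁, h₂⟩ := hGK (Lifting.ofArr lb hlb) ⟨ρ, hρ, by
      rw [Lifting.toArr_ofArr]
      exact hρl⟩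
    rw [Lifting.toArr_ofArr] at h₂
    exact ⟨k, χ₀, h₁, h₂⟩
  have hsq : ∀ c, δ.toRing.hom (v.toRing.hom c) =
      (U.specHom (algebraMap U.ring B)).toRing.hom (ι.toRing.hom c) := congr_toRing hδ
  let kv : Q →ₛₗ[v.toRing.hom] P :=
    { toFun := k
      map_add' := k.map_add
      map_smul' := fun c q => by
        have h₁ : c • q = ι.toRing.hom c • q := by
          have := φQ.map_smulₛₗ c q
          rwa [hφQ, hφQ] at this
        have h₂ : v.toRing.hom c • k q = δ.toRing.hom (v.toRing.hom c) • k q := by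
          have := φP.map_smulₛₗ (v.toRing.hom c) (k q)
          rwa [hφP, hφP] at this
        rw [h₁, k.map_smulₛₗ, h₂, hsq] }
  have hφPb : Function.Bijective φP := by
    have : ⇑φP = id := funext hφP
    rw [this]
    exact Function.bijective_id
  have : IsNoetherianRing D.ring := hext.noetherian
  have hcomm : sqZeroSemi δ φP ≫ sqZeroSemi v kv =
      sqZeroSemi (U.specHom (algebraMap U.ring B)) k ≫ sqZeroSemi ι φQ := by
    refine hom_ext' fun (c : TrivSqZeroExt A₁.ring Q) => ?_
    change (sqZeroSemi δ φP).toRing.hom ((sqZeroSemi v kv).toRing.hom c) =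
      (sqZeroSemi (U.specHom (algebraMap U.ring B)) k).toRing.hom ((sqZeroSemi ι φQ).toRing.hom c)
    rw [sqZeroSemi_toRing v kv c, sqZeroSemi_toRing ι φQ c]
    refine (sqZeroSemi_toRing δ φP _).trans (Eq.trans ?_
      (sqZeroSemi_toRing (U.specHom (algebraMap U.ring B)) k _).symm)
    refine TrivSqZeroExt.ext ?_ ?_
    · simpa using hsq c.fst
    · simp [hφP, hφQ, kv]
  obtain ⟨χ₁, hχ₁, -, eχ₁⟩ := exists_desc (zeroSection_sqZeroSemi δ φP)
    (isEquivalence_gluing_sqZeroSemi hX₁ δ hδs φP hφPb) lb d hlb hd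
    (cart (sqZeroSemi δ φP) ζ) pz rfl hpz elb (t := tot x'') (sqZeroSemi v kv)
    (χ₀ ≫ q) (cart v x' ≫ p)
    (by
      rw [comp_base, hχ₀, hq]
      exact hcomm.symm)
    (by rw [comp_base, hp]; exact (zeroSection_sqZeroSemi v kv).symm)
    (by rw [← Category.assoc, eχ₀, Category.assoc, ← hpq, ← Category.assoc, ← ed, Category.assoc])
  refine ⟨k.toAddMonoidHom, pz' ≫ χ₁, fun c => ?_, ?_⟩
  · rw [comp_base, hχ₁, hpz']
    change (plus j hj).toRing.hom ((sqZeroSemi v kv).toRing.hom c) = _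
    rw [sqZeroSemi_toRing v kv c]
    refine (plus_toRing _).trans ?_
    simp [kv]
    rfl
  · rw [← Category.assoc, ← hpp, Category.assoc, eχ₁, ← Category.assoc, el]

/-! ### The auxiliary deformation situation over the first factor of a composite -/

namespace Situation
open Tot AffOver
variable {W X Y : Fibred.{v, w} S} {e : W ⟶ X} {f : X ⟶ Y}

/-- The deformation situation over `f` underlying a deformation situation over `e ≫ f`. -/
def image (ξ : Situation (e ≫ f)) : Situation f where
  T₂ := ξ.T₂
  I := ξ.I
  J := ξ.J
  le := ξ.le
  x := fobj e ξ.x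
  y := ξ.y

/-- Pasting of a commutative square in `X` and one in `Y`, where the first is mapped to `Y`. -/
lemma map_comp_of_eq {U₁ U₂ U₃ U₄ U₅ U₆ : AffOver S} {a : W.Fib U₁} {b : W.Fib U₂} {c : W.Fib U₃}
    {z : W.Fib U₄} {x : X.Fib U₅} {y : Y.Fib U₆} {l : tot a ⟶ tot z} {m : tot (fobj e z) ⟶ tot x}
    {α : tot a ⟶ tot b} {γ : tot (fobj e b) ⟶ tot x} {n : tot (fobj f x) ⟶ tot y}
    {β : tot b ⟶ tot c} {t : tot (fobj f (fobj e c)) ⟶ tot y} (h : Tot.map e l ≫ m = Tot.map e α ≫ γ)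
    (h' : Tot.map f γ ≫ n = Tot.map f (Tot.map e β) ≫ t) :
    Tot.map (e ≫ f) l ≫ Tot.map f m ≫ n = Tot.map (e ≫ f) (α ≫ β) ≫ t := by
  have h₂ : Tot.map f (Tot.map e l) ≫ Tot.map f m ≫ n = Tot.map f (Tot.map e (α ≫ β)) ≫ t := by
    rw [← Category.assoc, ← map_comp, h, map_comp, Category.assoc, h', map_comp, map_comp,
      Category.assoc]
  exact (congrArg (· ≫ Tot.map f m ≫ n) (map_comp_map e f l)).trans
    (h₂.trans (congrArg (· ≫ t) (map_comp_map e f (α ≫ β))).symm)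

/-- A lifting for the composite gives one for the situation over the second factor. -/
lemma HasLift.image {ξ : Situation (e ≫ f)} {D : Type u} [CommRing D] {v : ξ.T₂.ring →+* D}
    (H : ξ.HasLift v) : ξ.image.HasLift v := by
  obtain ⟨V, i, x₁, z, α, l, m, hi, hker, hl, hm, h⟩ := H
  refine ⟨V, i, fobj e x₁, fobj e z, Tot.map e α, Tot.map e l, m, hi, hker, hl, hm, ?_⟩
  have h₁ := map_comp_map e f l
  have h₂ := map_comp_map e f α
  exact (congrArg (· ≫ m) h₁).symm.trans (h.trans (congrArg (· ≫ ξ.arr) h₂))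

section
variable (ξ : Situation (e ≫ f)) {R : Type u} [CommRing R] (r : ξ.T₂.ring →+* R) (Q : Type u)
  [AddCommGroup Q] [Module R Q] [Module Rᵐᵒᵖ Q] [IsCentralScalar R Q]

/-- The affine scheme `Spec (R + Q)` of the trivial extension of a `B'`-algebra `R`. -/
abbrev extBase : AffOver S := (ξ.T₂.spec r).sqZero Q

/-- The ideal of `R + Q` with quotient `R ⧸ KR`. -/
def extIdeal (K : Ideal ξ.T₂.ring) : Ideal (TrivSqZeroExt R Q) :=
  (K.map r).comap (TrivSqZeroExt.fstHom R R Q).toRingHom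

lemma mem_extIdeal {K : Ideal ξ.T₂.ring} {c : TrivSqZeroExt R Q} :
    c ∈ ξ.extIdeal r Q K ↔ c.fst ∈ K.map r := Iff.rfl

/-- The homomorphism `B' ⧸ I ⟶ (R + Q) ⧸ (IR + Q)`. -/
def extRingHom : ξ.T₂.ring ⧸ ξ.I →+* TrivSqZeroExt R Q ⧸ ξ.extIdeal r Q ξ.I :=
  Ideal.quotientMap _ ((TrivSqZeroExt.inlHom R Q).comp r) fun b hb => by
    rw [Ideal.mem_comap, mem_extIdeal]
    exact Ideal.mem_map_of_mem r hb

/-- The morphism from the closed subscheme of `Spec (R + Q)` to `Spec B`. -/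
def extMap : (ξ.extBase r Q).spec (Ideal.Quotient.mk (ξ.extIdeal r Q ξ.I)) ⟶ ξ.T :=
  factor ξ.incl ((ξ.extBase r Q).specHom _ ≫ retraction _ Q ≫ ξ.T₂.specHom r) (ξ.extRingHom r Q) rfl

/-- For a deformation situation over `e ≫ f` with object `w`, an extension of the restriction of
`e(w)` to an object over the trivial extension `R + Q` of a `B'`-algebra `R` by a module of
deformations, compatible with the given extension of `f(e(w))`. -/
structure Refinement where
  obj : X.Fib (ξ.extBase r Q)
  arr : tot (fobj e ((W.res (ξ.extMap r Q)).obj ξ.x)) ⟶ tot obj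
  arr_base : arr.base = (ξ.extBase r Q).specHom (Ideal.Quotient.mk (ξ.extIdeal r Q ξ.I))
  cmp : tot (fobj f obj) ⟶ tot ξ.y.obj
  cmp_base : cmp.base = retraction _ Q ≫ ξ.T₂.specHom r
  comm : Tot.map f arr ≫ cmp = Tot.map f (Tot.map e (cart (ξ.extMap r Q) ξ.x)) ≫ ξ.image.arr

end

namespace Refinement
variable {ξ : Situation (e ≫ f)} {R : Type u} [CommRing R] {r : ξ.T₂.ring →+* R} {Q : Type u}
  [AddCommGroup Q] [Module R Q] [Module Rᵐᵒᵖ Q] [IsCentralScalar R Q] (𝓡 : ξ.Refinement r Q)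
variable [hW : ∀ U, IsGroupoid (W.obj U)] [hX : ∀ U, IsGroupoid (X.obj U)]
  [hY : ∀ U, IsGroupoid (Y.obj U)]

/-- The deformation situation over `e` given by the restriction of `w` and its extension. -/
def situation : Situation e where
  T₂ := ξ.extBase r Q
  I := ξ.extIdeal r Q ξ.I
  J := ξ.extIdeal r Q ξ.J
  le := Ideal.comap_mono (Ideal.map_mono ξ.le)
  x := (W.res (ξ.extMap r Q)).obj ξ.x
  y := Lifting.ofArr 𝓡.arr 𝓡.arr_base

lemma situation_arr : 𝓡.situation.arr = 𝓡.arr := Lifting.toArr_ofArr _ 𝓡.arr_base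

lemma liftsAlong_situation_iff {V₂ : AffOver S} (g : V₂ ⟶ ξ.extBase r Q) :
    𝓡.situation.LiftsAlong g ↔ ∃ (V : AffOver S) (i : V ⟶ V₂) (x₁ : W.Fib V) (z : W.Fib V₂)
      (α : tot x₁ ⟶ tot ((W.res (ξ.extMap r Q)).obj ξ.x)) (l : tot x₁ ⟶ tot z)
      (m : tot (fobj e z) ⟶ tot 𝓡.obj), Function.Surjective i.toRing.hom ∧
      RingHom.ker i.toRing.hom = (ξ.extIdeal r Q ξ.I).map g.toRing.hom ∧ l.base = i ∧ m.base = g ∧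
      Tot.map e l ≫ m = Tot.map e α ≫ 𝓡.arr := by
  constructor
  · rintro ⟨V, i, x₁, z, α, l, m, hi, hker, hl, hm, h⟩
    exact ⟨V, i, x₁, z, α, l, m, hi, hker, hl, hm,
      h.trans (congrArg (Tot.map e α ≫ ·) 𝓡.situation_arr)⟩
  · rintro ⟨V, i, x₁, z, α, l, m, hi, hker, hl, hm, h⟩
    exact ⟨V, i, x₁, z, α, l, m, hi, hker, hl, hm,
      h.trans (congrArg (Tot.map e α ≫ ·) 𝓡.situation_arr).symm⟩

lemma liftsAlong_comp {V₂ : AffOver S} {g : V₂ ⟶ ξ.extBase r Q}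
    (hI : (ξ.extIdeal r Q ξ.I).map g.toRing.hom =
      ξ.I.map (g ≫ retraction _ Q ≫ ξ.T₂.specHom r).toRing.hom)
    (H : 𝓡.situation.LiftsAlong g) : ξ.LiftsAlong (g ≫ retraction _ Q ≫ ξ.T₂.specHom r) := by
  obtain ⟨V, i, x₁, z, α, l, m, hi, hker, hl, hm, h⟩ := (𝓡.liftsAlong_situation_iff g).1 H
  refine ⟨V, i, x₁, z, α ≫ cart (ξ.extMap r Q) ξ.x, l, Tot.map f m ≫ 𝓡.cmp, hi, hker.trans hI, hl,
    ?_, ?_⟩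
  · exact congrArg₂ (· ≫ ·) hm 𝓡.cmp_base
  · exact map_comp_of_eq h 𝓡.comm

/-- A lifting for the auxiliary situation gives one for the composite. -/
lemma hasLift_comp {D : Type u} [CommRing D] (σ : TrivSqZeroExt R Q →+* D)
    (hσ : ∀ c : TrivSqZeroExt R Q, c.fst ∈ ξ.I.map r →
      σ c ∈ ξ.I.map (σ.comp ((TrivSqZeroExt.inlHom R Q).comp r)))
    (H : 𝓡.situation.HasLift σ) : ξ.HasLift (σ.comp ((TrivSqZeroExt.inlHom R Q).comp r)) := by
  have hI : (ξ.extIdeal r Q ξ.I).map σ = ξ.I.map (σ.comp ((TrivSqZeroExt.inlHom R Q).comp r)) := by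
    refine le_antisymm (Ideal.map_le_iff_le_comap.2 fun c hc => hσ c hc) ?_
    rw [← Ideal.map_map]
    refine Ideal.map_mono (Ideal.map_le_iff_le_comap.2 fun b hb => ?_)
    exact Ideal.mem_map_of_mem r hb
  exact (liftsAlong_iff _).1 (𝓡.liftsAlong_comp (g := (ξ.extBase r Q).specHom σ) hI H)

section
variable {A : Type u} [CommRing A] [Module A Q] {π : R →+* A} {𝔟 : Ideal ξ.T₂.ring}

/-- The auxiliary deformation situation is algebraic. -/
lemma isAlgebraic (h : ξ.IsAlgebraic) [IsNoetherianRing R] [Module.Finite R Q] (hr : r.FiniteType)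
    (hJ : (ξ.J.map r).IsRadical) (hle : ξ.J.map r ≤ RingHom.ker π)
    (hQ : ∀ (a : R) (q : Q), π a • q = a • q) : 𝓡.situation.IsAlgebraic := by
  have hs : Function.Surjective (TrivSqZeroExt.fstHom R R Q).toRingHom :=
    fun a => ⟨TrivSqZeroExt.inl a, rfl⟩
  refine isAlgebraic_of DefModule.isNoetherianRing_sqZero ?_ ?_ ?_ ?_
  · change IsNilpotent (ξ.extIdeal r Q ξ.J)
    obtain ⟨n, hn⟩ := h.nilpotent
    refine isNilpotent_of_pow_le (n := n) (I := TrivSqZeroExt.kerIdeal R Q) ?_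
      ⟨2, TrivSqZeroExt.kerIdeal_sq R Q⟩
    refine (Ideal.map_le_iff_le_comap.1 ?_ : _ ≤ (⊥ : Ideal R).comap
      (TrivSqZeroExt.fstHom R R Q).toRingHom)
    rw [Ideal.map_pow, extIdeal, Ideal.map_comap_of_surjective _ hs, ← Ideal.map_pow, hn]
    exact Ideal.map_bot.le
  · refine (Ideal.isRadical_iff_quotient_reduced (ξ.extIdeal r Q ξ.J)).1 ?_
    exact hJ.comap _
  · change ξ.extIdeal r Q ξ.I * ξ.extIdeal r Q ξ.J = ⊥
    rw [← le_bot_iff, Ideal.mul_le]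
    intro c hc c' hc'
    rw [mem_extIdeal] at hc hc'
    have h₁ : c.fst * c'.fst = 0 := by
      have := Ideal.mul_mem_mul hc hc'
      rw [← Ideal.map_mul, h.mul_eq_bot, Ideal.map_bot] at this
      exact this
    have h₂ : ∀ a ∈ ξ.J.map r, ∀ q : Q, a • q = 0 := fun a ha q => by
      rw [← hQ, hle ha, zero_smul]
    refine TrivSqZeroExt.ext h₁ ?_
    rw [TrivSqZeroExt.snd_mul, op_smul_eq_smul, h₂ _ hc', h₂ _ (Ideal.map_mono ξ.le hc), add_zero]
    rfl
  · refine AffOver.IsFiniteType.of_hom (factor (ξ.T₂.specHom (Ideal.Quotient.mk ξ.J))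
      ((ξ.extBase r Q).specHom _ ≫ retraction _ Q ≫ ξ.T₂.specHom r)
      (Ideal.quotientMap (ξ.extIdeal r Q ξ.J) ((TrivSqZeroExt.inlHom R Q).comp r) fun b hb =>
        Ideal.mem_map_of_mem r hb) rfl) ?_ h.isFiniteType
    refine RingHom.FiniteType.of_comp_finiteType (f := Ideal.Quotient.mk ξ.J) ?_
    change (((Ideal.Quotient.mk (ξ.extIdeal r Q ξ.J)).comp (TrivSqZeroExt.inlHom R Q)).comp r).FiniteType
    refine RingHom.FiniteType.comp_surjective (f := r) hr ?_
    intro x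
    obtain ⟨c, rfl⟩ := Ideal.Quotient.mk_surjective x
    refine ⟨c.fst, Ideal.Quotient.eq.2 ?_⟩
    rw [mem_extIdeal]
    simp

lemma mul_eq_bot (hmul : 𝔟 * ξ.I = ⊥) (hI : ξ.I ≤ 𝔟) (hker : RingHom.ker π = 𝔟.map r)
    (hQ : ∀ (a : R) (q : Q), π a • q = a • q) :
    (RingHom.ker π).comap (TrivSqZeroExt.fstHom R R Q).toRingHom * ξ.extIdeal r Q ξ.I = ⊥ := by
  rw [← le_bot_iff, Ideal.mul_le]
  intro c hc c' hc'
  rw [mem_extIdeal] at hc'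
  change c.fst ∈ RingHom.ker π at hc
  have h₂ : ∀ a ∈ RingHom.ker π, ∀ q : Q, a • q = 0 := fun a ha q => by
    rw [← hQ, RingHom.mem_ker.1 ha, zero_smul]
  have h₁ : c.fst * c'.fst = 0 := by
    have := Ideal.mul_mem_mul (hker ▸ hc) hc'
    rw [← Ideal.map_mul, hmul, Ideal.map_bot] at this
    exact this
  refine TrivSqZeroExt.ext h₁ ?_
  rw [TrivSqZeroExt.snd_mul, op_smul_eq_smul, h₂ _ hc,
    h₂ c'.fst (hker ▸ Ideal.map_mono hI hc'), add_zero]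
  rfl

end
end Refinement
end Situation

namespace DefModule
open Tot AffOver
variable {X : Fibred.{v, w} S} {U : AffOver S} {a : X.Fib U}
variable [hX : ∀ U, IsGroupoid (X.obj U)]
variable {B : Type u} [CommRing B] [Algebra U.ring B]
variable {P : Type u} [AddCommGroup P] [Module B P] [Module Bᵐᵒᵖ P] [IsCentralScalar B P]
variable {Q : Type u} [AddCommGroup Q] [Module U.ring Q] [Module U.ringᵐᵒᵖ Q]
  [IsCentralScalar U.ring Q]

/-- A deformation over `B + P` lying over one over `A + Q` along a `B`-linear map `B ⊗ Q ⟶ P` maps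
to it along the corresponding semilinear map `Q ⟶ P`. -/
lemma exists_arrow_of_over {κ : Lifting X (zeroSection U Q) a}
    {l : Lifting X (zeroSection (U.spec (algebraMap U.ring B)) P)
      ((X.res (U.specHom (algebraMap U.ring B))).obj a)}
    {k : B ⊗[U.ring] Q →ₗ[B] P}
    (H : Def.Over (Quotient.mk _ l) (Quotient.mk _ κ) (cart _ a)
      (sqZeroMap (U := U.spec (algebraMap U.ring B)) k ≫ sqZeroBaseChange U Q B)) :
    ∃ (k : Q →ₛₗ[(U.specHom (algebraMap U.ring B)).toRing.hom] P) (χ : tot l.obj ⟶ tot κ.obj),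
      χ.base = sqZeroSemi (U.specHom (algebraMap U.ring B)) k ∧
        l.toArr ≫ χ = cart _ a ≫ κ.toArr := by
  obtain ⟨χ, hχ, h⟩ := Def.over_mk.1 H
  let k' : Q →ₛₗ[(U.specHom (algebraMap U.ring B)).toRing.hom] P :=
    { toFun := fun q => k (1 ⊗ₜ q)
      map_add' := fun q q' => by rw [TensorProduct.tmul_add, _root_.map_add]
      map_smul' := fun c q => by
        rw [TensorProduct.tmul_smul, ← algebraMap_smul B c, _root_.map_smul]
        rfl }
  refine ⟨k', χ, hχ.trans (hom_ext' fun (c : TrivSqZeroExt U.ring Q) => ?_), h⟩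
  refine Eq.trans ?_ (sqZeroSemi_toRing (U.specHom (algebraMap U.ring B)) k' c).symm
  change TrivSqZeroExt.map k (sqZeroRingHom (algebraMap U.ring B) _ c) = _
  refine TrivSqZeroExt.ext ?_ ?_
  · simp [sqZeroRingHom]
  · simp [sqZeroRingHom, k']
    rfl

end DefModule

namespace AffOver
open Tot

/-- Extend an object over `Spec R` by a deformation of its restriction to a closed subscheme
`Spec A`, whose image under `f` is trivial. -/
lemma exists_extension {X Y : Fibred.{v, w} S} {f : X ⟶ Y}
    [hX : ∀ U, IsGroupoid (X.obj U)] [hY : ∀ U, IsGroupoid (Y.obj U)] (hX₁ : X.S1) (hY₁ : Y.S1)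
    {U A₁ T₂ : AffOver S} [IsNoetherianRing U.ring] [IsReduced U.ring] [IsNoetherianRing A₁.ring]
    {Q : Type u} [AddCommGroup Q] [Module U.ring Q] [Module U.ringᵐᵒᵖ Q]
    [IsCentralScalar U.ring Q] [Module.Finite U.ring Q] [Module A₁.ring Q] [Module A₁.ringᵐᵒᵖ Q]
    [IsCentralScalar A₁.ring Q] {ι : U ⟶ A₁} (hι : Function.Surjective ι.toRing.hom)
    {φQ : Q →ₛₗ[ι.toRing.hom] Q} (hφQ : Function.Bijective φQ)
    {x' : X.Fib A₁} {xb : X.Fib U} {κ : Lifting X (zeroSection U Q) xb}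
    {αx : tot xb ⟶ tot x'} (hαx : αx.base = ι) {y : Y.Fib T₂} {g₁ : A₁ ⟶ T₂}
    {m' : tot (fobj f x') ⟶ tot y} (hm' : m'.base = g₁)
    {ρ : tot (fobj f κ.obj) ⟶ tot (fobj f xb)} (hρ : ρ.base = retraction U Q)
    (hκ : Tot.map f κ.toArr ≫ ρ = 𝟙 _) :
    ∃ (x'' : X.Fib (A₁.sqZero Q)) (p : tot x' ⟶ tot x'') (q : tot κ.obj ⟶ tot x'')
      (m'' : tot (fobj f x'') ⟶ tot y), p.base = zeroSection A₁ Q ∧ q.base = sqZeroSemi ι φQ ∧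
      αx ≫ p = κ.toArr ≫ q ∧ m''.base = retraction A₁ Q ≫ g₁ ∧ Tot.map f p ≫ m'' = m' := by
  obtain ⟨x'', q, p, hq, hp, hqp⟩ := exists_glue (zeroSection_sqZeroSemi ι φQ)
    (isEquivalence_gluing_sqZeroSemi hX₁ ι hι φQ hφQ) κ.toArr αx rfl hαx
  obtain ⟨m'', hm'', -, e⟩ := exists_desc (zeroSection_sqZeroSemi ι φQ)
    (isEquivalence_gluing_sqZeroSemi hY₁ ι hι φQ hφQ) (Tot.map f κ.toArr) (Tot.map f αx) rfl hαx
    (Tot.map f q) (Tot.map f p) hq hp (by rw [← map_comp, hqp, map_comp]) (t := tot y)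
    (retraction A₁ Q ≫ g₁) (ρ ≫ Tot.map f αx ≫ m') m'
    (by
      rw [comp_base, comp_base, map_base, hρ, hαx, hm', ← Category.assoc, ← Category.assoc,
        sqZeroSemi_retraction])
    (by rw [hm', ← Category.assoc, zeroSection_retraction, Category.id_comp])
    (by rw [← Category.assoc, hκ, Category.id_comp])
  exact ⟨x'', p, q, m'', hp, hq, hqp.symm, hm'', e⟩

end AffOver

/-! ### Versality of the auxiliary situation -/

lemma exists_module_of_surjective {D B P : Type*} [CommRing D] [CommRing B] [AddCommGroup P]
    [Module D P] {δ : D →+* B} (hδ : Function.Surjective δ) (h : ∀ d, δ d = 0 → ∀ x : P, d • x = 0) :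
    ∃ _ : Module B P, ∀ (d : D) (x : P), δ d • x = d • x := by
  have ht : Module.IsTorsionBySet D P (RingHom.ker δ : Set D) := fun x d => h d d.2 x
  let _ := ht.module
  refine ⟨Module.compHom P (RingHom.quotientKerEquivOfSurjective hδ).symm.toRingHom, fun d x => ?_⟩
  change (RingHom.quotientKerEquivOfSurjective hδ).symm (δ d) • x = d • x
  have : (RingHom.quotientKerEquivOfSurjective hδ).symm (δ d) = Ideal.Quotient.mk _ d := by
    rw [RingEquiv.symm_apply_eq]
    rfl
  rw [this]
  rfl

lemma exists_module_op (R Q : Type*) [CommRing R] [AddCommGroup Q] [Module R Q] :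
    ∃ (_ : Module Rᵐᵒᵖ Q), IsCentralScalar R Q :=
  letI : Module Rᵐᵒᵖ Q := Module.compHom Q ((RingHom.id R).fromOpposite fun _ _ => mul_comm _ _)
  ⟨inferInstance, ⟨fun _ _ => rfl⟩⟩

lemma exists_module_comp {R A Q : Type*} [CommRing R] [CommRing A] [AddCommGroup Q]
    [Module A Q] (π : R →+* A) : ∃ _ : Module R Q, ∀ (a : R) (q : Q), π a • q = a • q :=
  letI : Module R Q := Module.compHom Q π
  ⟨inferInstance, fun _ _ => rfl⟩

namespace Situation
open Tot AffOver
variable {W X Y : Fibred.{v, w} S} {e : W ⟶ X} {f : X ⟶ Y}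
variable {ξ : Situation (e ≫ f)} {R : Type u} [CommRing R] {r : ξ.T₂.ring →+* R} {Q : Type u}
  [AddCommGroup Q] [Module R Q] [Module Rᵐᵒᵖ Q] [IsCentralScalar R Q]
  {A : Type u} [CommRing A]

/-- Every lifting for the composite over an `R`-algebra `D` gives a lifting for the auxiliary
situation over `D`, for a suitable extension of `R ⟶ D` to `R + Q`.  This is required when
deformations over a reduced quotient `B` of `D` are compatible with base change from `A` to `B`, and
`ID` is a projective `B`-module. -/
def Refinement.IsVersal (𝓡 : ξ.Refinement r Q) (hX₁ : X.S1) (hY₁ : Y.S1) (π : R →+* A)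
    [IsNoetherianRing A] [IsReduced A] (x : X.Fib ((ξ.T₂.spec r).spec π)) (s : A) : Prop :=
  ∀ ⦃D B A₀ : Type u⦄ [CommRing D] [CommRing B] [CommRing A₀] [Algebra A B] [IsNoetherianRing B]
    [IsReduced B] (ρ : R →+* D) (δ : D →+* B) (q₀ : D ⧸ ξ.I.map (ρ.comp r) →+* A₀),
    IsExtensionPair (Ideal.Quotient.mk (ξ.I.map (ρ.comp r))) q₀ → Function.Surjective δ →
    (∀ a, δ (ρ a) = algebraMap A B (π a)) → IsUnit (algebraMap A B s) →
    X.DefCompatible hX₁ (U := (ξ.T₂.spec r).spec π) x A B →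
    Y.DefCompatible hY₁ (U := (ξ.T₂.spec r).spec π) (fobj f x) A B →
    (∀ d, δ d = 0 → ∀ m ∈ ξ.I.map (ρ.comp r), d * m = 0) →
    (∀ _ : Module B (ξ.I.map (ρ.comp r)),
      (∀ (d : D) (m : ξ.I.map (ρ.comp r)), δ d • m = d • m) →
        Module.Projective B (ξ.I.map (ρ.comp r))) →
    ξ.HasLift (ρ.comp r) →
    ∃ σ : TrivSqZeroExt R Q →+* D, (∀ a, σ (TrivSqZeroExt.inl a) = ρ a) ∧
      (∀ q, σ (TrivSqZeroExt.inr q) ∈ ξ.I.map (ρ.comp r)) ∧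
      ∀ [∀ U, IsGroupoid (W.obj U)] [∀ U, IsGroupoid (X.obj U)], 𝓡.situation.HasLift σ

variable [hW : ∀ U, IsGroupoid (W.obj U)] [hX : ∀ U, IsGroupoid (X.obj U)]
  [hY : ∀ U, IsGroupoid (Y.obj U)]

/-- A square for the composite that factors over a square for `f`. -/
lemma map_comp_of_eq' {U₁ U₂ U₃ U₄ U₅ U₆ : AffOver S} {a : W.Fib U₁} {b : W.Fib U₂} {c : W.Fib U₃}
    {z : W.Fib U₄} {x : X.Fib U₅} {y : Y.Fib U₆} {l : tot a ⟶ tot z}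
    {m : tot (fobj f (fobj e z)) ⟶ tot y} {γ : tot a ⟶ tot b} {β : tot b ⟶ tot c}
    {l₀ : tot (fobj e b) ⟶ tot x} {n : tot (fobj f x) ⟶ tot y}
    {t : tot (fobj f (fobj e c)) ⟶ tot y}
    (h : Tot.map (e ≫ f) l ≫ m = Tot.map (e ≫ f) (γ ≫ β) ≫ t)
    (h' : Tot.map f l₀ ≫ n = Tot.map f (Tot.map e β) ≫ t) :
    Tot.map f (Tot.map e l) ≫ m = Tot.map f (Tot.map e γ ≫ l₀) ≫ n := by
  have h₁ : Tot.map f (Tot.map e l) ≫ m = Tot.map f (Tot.map e (γ ≫ β)) ≫ t :=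
    (congrArg (· ≫ m) (map_comp_map e f l)).symm.trans
      (h.trans (congrArg (· ≫ t) (map_comp_map e f (γ ≫ β))))
  rw [h₁, map_comp, map_comp, map_comp, Category.assoc, Category.assoc, h']

lemma map_comp_of_comp_eq {U₁ U₂ U₃ U₅ U₆ : AffOver S} {a : W.Fib U₁} {b : W.Fib U₂} {c : W.Fib U₃}
    {x : X.Fib U₅} {y : Y.Fib U₆} {γ : tot a ⟶ tot b} {β : tot b ⟶ tot c} {β' : tot a ⟶ tot c}
    {l : tot (fobj e b) ⟶ tot x} {n : tot (fobj f x) ⟶ tot y}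
    {t : tot (fobj f (fobj e c)) ⟶ tot y} (h : γ ≫ β = β')
    (h' : Tot.map f l ≫ n = Tot.map f (Tot.map e β) ≫ t) :
    Tot.map f (Tot.map e γ ≫ l) ≫ n = Tot.map f (Tot.map e β') ≫ t := by
  rw [← h, map_comp, map_comp, map_comp, Category.assoc, Category.assoc, h']

lemma map_comp_comp_of_eq {U₁ U₃ U₅ U₆ : AffOver S} {a : X.Fib U₁} {c : X.Fib U₃}
    {x : X.Fib U₅} {y : Y.Fib U₆} {l : tot a ⟶ tot x} {p : tot x ⟶ tot c}
    {n : tot (fobj f c) ⟶ tot y} {m : tot (fobj f x) ⟶ tot y} {t : tot (fobj f a) ⟶ tot y}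
    (h : Tot.map f p ≫ n = m) (h' : Tot.map f l ≫ m = t) : Tot.map f (l ≫ p) ≫ n = t := by
  rw [map_comp, Category.assoc, h, h']

/-- If the object of a refinement is glued from an object `x'` over `R` and a generator `κ` of the
deformations with trivial image under `f`, then it is versal: a lifting for the composite over `D`
gives an object `z'` with `f(z')` over `y`, and `exists_arrow_of_generator` maps it to the object. -/
lemma Refinement.isVersal_of_generator (hX₁ : X.S1) (hY₁ : Y.S1) [IsNoetherianRing A]
    [IsReduced A] {π : R →+* A} [Module A Q] [Module Aᵐᵒᵖ Q] [IsCentralScalar A Q]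
    (𝓡 : ξ.Refinement r Q)
    {x' : X.Fib (ξ.T₂.spec r)} {xb : X.Fib ((ξ.T₂.spec r).spec π)}
    {κ : Lifting X (zeroSection ((ξ.T₂.spec r).spec π) Q) xb}
    {φQ : Q →ₛₗ[((ξ.T₂.spec r).specHom π).toRing.hom] Q} (hφQ : ∀ q, φQ q = q)
    {αx : tot xb ⟶ tot x'} (hαx : αx.base = (ξ.T₂.spec r).specHom π)
    {p : tot x' ⟶ tot 𝓡.obj} (hp : p.base = zeroSection (ξ.T₂.spec r) Q)
    {q : tot κ.obj ⟶ tot 𝓡.obj} (hq : q.base = sqZeroSemi ((ξ.T₂.spec r).specHom π) φQ)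
    (hpq : αx ≫ p = κ.toArr ≫ q) {m' : tot (fobj f x') ⟶ tot ξ.y.obj}
    (hm' : m'.base = ξ.T₂.specHom r)
    {l₀ : tot (fobj e ((W.res (ξ.extMap r Q)).obj ξ.x)) ⟶ tot x'}
    (hl₀ : l₀.base = (ξ.extBase r Q).specHom (Ideal.Quotient.mk (ξ.extIdeal r Q ξ.I)) ≫
      retraction _ Q) (harr : 𝓡.arr = l₀ ≫ p)
    (hm₀ : Tot.map f l₀ ≫ m' = Tot.map f (Tot.map e (cart (ξ.extMap r Q) ξ.x)) ≫ ξ.image.arr)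
    {s : A} (hGK : ∀ (B : Type u) [CommRing B] [Algebra A B] [IsNoetherianRing B] [IsReduced B],
      IsUnit (algebraMap A B s) → X.DefCompatible hX₁ (U := (ξ.T₂.spec r).spec π) xb A B →
      Y.DefCompatible hY₁ (U := (ξ.T₂.spec r).spec π) (fobj f xb) A B →
      ∀ (P : Type u) [AddCommGroup P] [Module B P] [Module Bᵐᵒᵖ P] [IsCentralScalar B P]
        [Module.Finite B P] (n : ℕ) (φ : P →ₗ[B] (Fin n → B)) (ψ : (Fin n → B) →ₗ[B] P),
        ψ ∘ₗ φ = LinearMap.id →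
        ∀ l : Lifting X (zeroSection (((ξ.T₂.spec r).spec π).spec (algebraMap A B)) P)
            ((X.res (((ξ.T₂.spec r).spec π).specHom (algebraMap A B))).obj xb),
          (∃ ρ : tot (fobj f l.obj) ⟶
              tot (fobj f ((X.res (((ξ.T₂.spec r).spec π).specHom (algebraMap A B))).obj xb)),
            ρ.base = retraction (((ξ.T₂.spec r).spec π).spec (algebraMap A B)) P ∧
              Tot.map f l.toArr ≫ ρ = 𝟙 _) →
          ∃ (k : Q →ₛₗ[(((ξ.T₂.spec r).spec π).specHom (algebraMap A B)).toRing.hom] P)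
            (χ : tot l.obj ⟶ tot κ.obj),
            χ.base = sqZeroSemi (((ξ.T₂.spec r).spec π).specHom (algebraMap A B)) k ∧
              l.toArr ≫ χ = cart _ xb ≫ κ.toArr) :
    𝓡.IsVersal hX₁ hY₁ π xb s := by
  intro D B A₀ _ _ _ _ _ _ ρ δ q₀ hext hδ hδρ hu hXB hYB hann hproj H
  let A₁ := ξ.T₂.spec r
  let U := A₁.spec π
  let I' : Ideal D := ξ.I.map (ρ.comp r)
  let T' : AffOver S := A₁.spec ρ
  let D₀ : AffOver S := T'.spec (Ideal.Quotient.mk I')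
  let i : D₀ ⟶ T' := T'.specHom (Ideal.Quotient.mk I')
  let v : T' ⟶ A₁ := A₁.specHom ρ
  have hD : IsNoetherianRing D := hext.noetherian
  obtain ⟨_, hsm⟩ := exists_module_of_surjective (P := I') hδ
    (fun d hd x => Subtype.ext (hann d hd x x.2))
  obtain ⟨_, _⟩ := exists_module_op B I'
  obtain ⟨_, _⟩ := exists_module_op D I'
  have hpr : Module.Projective B I' := hproj _ hsm
  have hfin : Module.Finite B I' := by
    let _ := δ.toAlgebra
    have : IsScalarTower D B I' := ⟨fun d b x => by
      obtain ⟨b, rfl⟩ := hδ b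
      rw [Algebra.smul_def, mul_smul, hsm]
      exact (hsm _ _)⟩
    exact Module.Finite.of_restrictScalars_finite D B I'
  obtain ⟨n, ψ, φ, -, -, hψφ⟩ := Module.Finite.exists_comp_eq_id_of_projective B I'
  -- the image of `e(w)` over `D ⧸ ID`
  have H₁ : ξ.LiftsAlong (v ≫ ξ.T₂.specHom r) := (liftsAlong_iff (v ≫ ξ.T₂.specHom r)).2 H
  let w := (W.res (ξ.extMap r Q)).obj ξ.x
  let c : D₀ ⟶ (ξ.extBase r Q).spec (Ideal.Quotient.mk (ξ.extIdeal r Q ξ.I)) :=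
    factor ((ξ.extBase r Q).specHom (Ideal.Quotient.mk (ξ.extIdeal r Q ξ.I))) (i ≫ v ≫ zeroSection A₁ Q)
      (Ideal.quotientMap I' (ρ.comp (TrivSqZeroExt.fstHom R R Q).toRingHom) (by
        rw [extIdeal, ← Ideal.comap_comap]
        refine Ideal.comap_mono (Ideal.map_le_iff_le_comap.1 ?_)
        rw [Ideal.map_map])) rfl
  obtain ⟨z, l, m, hl, hm, hlm⟩ := H₁.exists_arrow i (𝟙 _) (cart c w ≫ cart (ξ.extMap r Q) ξ.x)
    (hom_ext' fun _ => rfl)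
  let δ' : U.spec (algebraMap A B) ⟶ T' :=
    factor v (U.specHom (algebraMap A B) ≫ A₁.specHom π) δ (RingHom.ext hδρ)
  have hδ' : δ' ≫ v = U.specHom (algebraMap A B) ≫ A₁.specHom π := factor_comp ..
  let φP : I' →ₛₗ[δ'.toRing.hom] I' :=
    { toFun := id, map_add' := fun _ _ => rfl, map_smul' := fun d x => (hsm d x).symm }
  let j : I' →ₗ[D] D := Submodule.subtype I'
  have hj : ∀ x x', j x * j x' = 0 := by
    intro x x'
    have h₁ := hext.annihilated
    have h₂ : (x : D) * x' ∈ RingHom.ker (Ideal.Quotient.mk I') *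
        RingHom.ker (q₀.comp (Ideal.Quotient.mk I')) := by
      refine Ideal.mul_mem_mul (RingHom.mem_ker.2 (Ideal.Quotient.eq_zero_iff_mem.2 x.2)) ?_
      rw [RingHom.mem_ker, RingHom.comp_apply, Ideal.Quotient.eq_zero_iff_mem.2 x'.2, map_zero]
    rw [h₁] at h₂
    exact h₂
  have hker : ∀ d, i.toRing.hom d = 0 ↔ ∃ x, j x = d := fun d =>
    Ideal.Quotient.eq_zero_iff_mem.trans ⟨fun h => ⟨⟨d, h⟩, rfl⟩, fun ⟨x, hx⟩ => hx ▸ x.2⟩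
  let l' : tot (fobj e ((W.res c).obj w)) ⟶ tot (fobj e z) := Tot.map e l
  let α : tot (fobj e ((W.res c).obj w)) ⟶ tot x' := Tot.map e (cart c w) ≫ l₀
  have hα : α.base = i ≫ v := by
    have h₁ : α.base = c ≫ l₀.base := rfl
    rw [h₁, hl₀]
    exact hom_ext' fun _ => rfl
  have hm₂ : m.base = v ≫ ξ.T₂.specHom r := hm.trans (Category.id_comp _)
  have he : Tot.map f l' ≫ m = Tot.map f α ≫ m' :=
    map_comp_of_eq' hlm hm₀
  obtain ⟨k, χ, hχ, hlχ⟩ := exists_arrow_of_generator hX₁ hY₁ (D := T') (P := I') hφQ hαx hp hq hpq hm'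
    (i := i) (i₀ := D₀.specHom q₀) hext hδ' hδ (φP := φP) (fun _ => rfl) hj Subtype.val_injective
    hker (hGK B hu hXB hYB I' n φ ψ hψφ) (l' := l') hl hα (m₂ := m) hm₂ he
  let σ : TrivSqZeroExt R Q →+* D := χ.base.toRing.hom
  have hσ : ∀ c : TrivSqZeroExt R Q, σ c = ρ c.fst + j (k c.snd) := hχ
  refine ⟨σ, fun a => ?_, fun x => ?_, ?_⟩
  · rw [hσ, TrivSqZeroExt.fst_inl, TrivSqZeroExt.snd_inl, map_zero, map_zero, add_zero]
  · rw [hσ, TrivSqZeroExt.fst_inr, TrivSqZeroExt.snd_inr, map_zero, zero_add]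
    exact (k x).2
  · intro _ _
    have hI : I' = (ξ.extIdeal r Q ξ.I).map σ := by
      refine le_antisymm ?_ (Ideal.map_le_iff_le_comap.2 fun c hc => ?_)
      · refine Ideal.map_le_iff_le_comap.2 fun b hb => ?_
        have h₁ : σ (TrivSqZeroExt.inl (r b)) = ρ (r b) := by
          rw [hσ, TrivSqZeroExt.fst_inl, TrivSqZeroExt.snd_inl, map_zero, map_zero, add_zero]
        rw [Ideal.mem_comap, RingHom.comp_apply, ← h₁]
        refine Ideal.mem_map_of_mem σ ?_
        rw [mem_extIdeal, TrivSqZeroExt.fst_inl]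
        exact Ideal.mem_map_of_mem r hb
      · rw [Ideal.mem_comap, hσ]
        refine I'.add_mem ?_ (k c.snd).2
        have := Ideal.mem_map_of_mem ρ (show c.fst ∈ ξ.I.map r from hc)
        rwa [Ideal.map_map] at this
    refine (liftsAlong_iff (ξ := 𝓡.situation) χ.base).1 ((𝓡.liftsAlong_situation_iff χ.base).2
      ⟨D₀, i, (W.res c).obj w, z, cart c w, l, χ, Ideal.Quotient.mk_surjective,
        Ideal.mk_ker.trans hI, hl, rfl, ?_⟩)
    rw [harr, ← Category.assoc]
    exact hlχ

/-- If the situation over the second factor has a lifting `x'` over `R`, there is a versal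
refinement: its object is glued from `x'` and a deformation over `A + Q` of the restriction of `x'`
to the reduced quotient `A` of `R`, the module `Q` being free, which generates the deformations with
trivial image under `f`. -/
theorem exists_refinement (hX₁ : X.S1) (hY₁ : Y.S1) [IsNoetherianRing R] [IsNoetherianRing A]
    [IsReduced A] {π : R →+* A} (hπ : Function.Surjective π) (H : ξ.image.HasLift r)
    (hXf : ∀ x : X.Fib ((ξ.T₂.spec r).spec π),
      letI := DefModule.addCommGroup A x hX₁
      letI := DefModule.module A x hX₁
      Module.Finite A (DefModule (U := (ξ.T₂.spec r).spec π) A x))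
    (hYf : ∀ y : Y.Fib ((ξ.T₂.spec r).spec π),
      letI := DefModule.addCommGroup A y hY₁
      letI := DefModule.module A y hY₁
      Module.Finite A (DefModule (U := (ξ.T₂.spec r).spec π) A y)) :
    ∃ (Q : Type u) (_ : AddCommGroup Q) (_ : Module A Q) (_ : Module R Q) (_ : Module Rᵐᵒᵖ Q)
      (_ : IsCentralScalar R Q) (𝓡 : ξ.Refinement r Q) (x : X.Fib ((ξ.T₂.spec r).spec π)) (s : A),
      Module.Finite A Q ∧ (∀ (a : R) (q : Q), π a • q = a • q) ∧ s ∈ genericElements (⊥ : Ideal A) ∧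
        𝓡.IsVersal hX₁ hY₁ π x s := by
  have i₁ : Fact X.S1 := ⟨hX₁⟩
  have i₂ : Fact Y.S1 := ⟨hY₁⟩
  let A₁ := ξ.T₂.spec r
  let U := A₁.spec π
  have i₃ : IsNoetherianRing U.ring := inferInstanceAs (IsNoetherianRing A)
  have i₄ : IsReduced U.ring := inferInstanceAs (IsReduced A)
  have i₅ : IsNoetherianRing A₁.ring := inferInstanceAs (IsNoetherianRing R)
  let ι : U ⟶ A₁ := A₁.specHom π
  let I₁ : Ideal R := ξ.I.map r
  let T₁ : AffOver S := A₁.spec (Ideal.Quotient.mk I₁)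
  let i : T₁ ⟶ A₁ := A₁.specHom (Ideal.Quotient.mk I₁)
  let g : T₁ ⟶ ξ.T := factor ξ.incl (i ≫ ξ.T₂.specHom r)
    (Ideal.quotientMap I₁ r Ideal.le_comap_map) rfl
  have H' : ξ.image.LiftsAlong (ξ.T₂.specHom r) := H
  obtain ⟨x', l₁, m', hl₁, hm', e₁⟩ := H'.exists_arrow (x' := fobj e ((W.res g).obj ξ.x)) i (𝟙 A₁)
    (Tot.map e (cart g ξ.x)) (hom_ext' fun _ => rfl)
  replace hm' : m'.base = ξ.T₂.specHom r := hm'.trans (Category.id_comp _)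
  let x := (X.res ι).obj x'
  obtain ⟨n, κ, hκ, s, hs, hGK⟩ := DefModule.exists_generator f x (hXf x) (hYf (fobj f x))
  obtain ⟨κ, rfl⟩ := Quotient.exists_rep κ
  obtain ⟨ρ, hρ, eρ⟩ := Def.exists_retraction_of_mapObj_eq_trivial hκ
  let Q : Type u := Fin n → A
  obtain ⟨_, hQ⟩ := exists_module_comp (Q := Q) π
  obtain ⟨_, _⟩ := exists_module_op R Q
  let φQ : Q →ₛₗ[ι.toRing.hom] Q :=
    { toFun := id, map_add' := fun _ _ => rfl, map_smul' := fun a q => (hQ a q).symm }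
  obtain ⟨x'', p, q, m'', hp, hq, hpq, hm'', e₂⟩ := exists_extension hX₁ hY₁ (ι := ι) hπ
    (φQ := φQ) Function.bijective_id (αx := cart ι x') rfl hm' hρ eρ
  let h : (ξ.extBase r Q).spec (Ideal.Quotient.mk (ξ.extIdeal r Q ξ.I)) ⟶ T₁ :=
    factor i ((ξ.extBase r Q).specHom (Ideal.Quotient.mk (ξ.extIdeal r Q ξ.I)) ≫ retraction _ Q)
      (Ideal.quotientMap (ξ.extIdeal r Q ξ.I) (TrivSqZeroExt.inlHom R Q) fun a ha => ha) rfl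
  obtain ⟨χ, hχ, eχ⟩ := exists_lift (cart g ξ.x) (cart (ξ.extMap r Q) ξ.x) h
    (eq_of_surjective ξ.incl ξ.incl_surjective (hom_ext' fun _ => rfl))
  let l₀ : tot (fobj e ((W.res (ξ.extMap r Q)).obj ξ.x)) ⟶ tot x' := Tot.map e χ ≫ l₁
  have hl₀ : l₀.base = (ξ.extBase r Q).specHom (Ideal.Quotient.mk (ξ.extIdeal r Q ξ.I)) ≫
      retraction _ Q := by
    have : l₀.base = χ.base ≫ l₁.base := rfl
    rw [this, hχ, hl₁]
    exact factor_comp ..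
  have hm₀ : Tot.map f l₀ ≫ m' = Tot.map f (Tot.map e (cart (ξ.extMap r Q) ξ.x)) ≫ ξ.image.arr :=
    map_comp_of_comp_eq eχ e₁
  let 𝓡 : ξ.Refinement r Q :=
    { obj := x''
      arr := l₀ ≫ p
      arr_base := by
        have : (l₀ ≫ p).base = l₀.base ≫ p.base := rfl
        rw [this, hl₀, hp]
        refine hom_ext' fun (c : TrivSqZeroExt R Q) => ?_
        change Ideal.Quotient.mk (ξ.extIdeal r Q ξ.I) (TrivSqZeroExt.inl c.fst) =
          Ideal.Quotient.mk (ξ.extIdeal r Q ξ.I) c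
        rw [Ideal.Quotient.eq, mem_extIdeal]
        simp
      cmp := m''
      cmp_base := hm''
      comm := map_comp_comp_of_eq e₂ hm₀ }
  refine ⟨Q, inferInstance, inferInstance, inferInstance, inferInstance, inferInstance, 𝓡, x, s,
    inferInstance, hQ, hs, ?_⟩
  refine 𝓡.isVersal_of_generator hX₁ hY₁ (κ := κ) (φQ := φQ) (fun _ => rfl) (αx := cart ι x') rfl
    hp hq hpq hm' hl₀ rfl hm₀ ?_
  intro B _ _ _ _ hu hXB hYB P _ _ _ _ _ n φ ψ hψ l hl
  obtain ⟨k, hk⟩ := hGK B hu hXB hYB P n φ ψ hψ l hl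
  exact DefModule.exists_arrow_of_over hk

end Situation

/-! ### Generic localizations -/

section
variable {R E : Type*} [CommRing R] [CommRing E] [Algebra R E]

/-- An element avoids the generic points of `V(𝔟)` if this is so after inverting such an element. -/
lemma mem_genericElements_of_localization {𝔟 : Ideal R} {s : R} [IsLocalization.Away s E]
    (hs : s ∈ genericElements 𝔟) {b : R}
    (hb : algebraMap R E b ∈ genericElements (𝔟.map (algebraMap R E))) : b ∈ genericElements 𝔟 := by
  intro p hp hbp
  have := hp.1.1
  have hd : Disjoint (Submonoid.powers s : Set R) p := by
    rw [Set.disjoint_left]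
    rintro _ ⟨n, rfl⟩ h
    exact hs p hp (hp.1.1.mem_of_pow_mem n h)
  have hc := IsLocalization.under_map_of_isPrime_disjoint (Submonoid.powers s) E hp.1.1 hd
  refine hb (p.map (algebraMap R E)) ?_ (Ideal.mem_map_of_mem _ hbp)
  rw [IsLocalization.minimalPrimes_map (Submonoid.powers s) E 𝔟]
  change (p.map (algebraMap R E)).comap (algebraMap R E) ∈ 𝔟.minimalPrimes
  exact (congrArg (· ∈ 𝔟.minimalPrimes) hc).mpr hp

/-- If after inverting an element avoiding the generic points of `V(𝔟)` the ideal `N` is carried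
into `K` by such an element, then this is already so before. -/
lemma exists_genericElement_of_localization [IsNoetherianRing R] {𝔟 K N : Ideal R} {s : R}
    [IsLocalization.Away s E] (hs : s ∈ genericElements 𝔟) {t : E}
    (ht : t ∈ genericElements (𝔟.map (algebraMap R E)))
    (h : ∀ x ∈ N, t * algebraMap R E x ∈ K.map (algebraMap R E)) :
    ∃ c ∈ genericElements 𝔟, ∀ x ∈ N, c * x ∈ K := by
  obtain ⟨n, c, hc⟩ := IsLocalization.Away.surj s t
  have hu : algebraMap R E s ∈ genericElements (𝔟.map (algebraMap R E)) := fun p hp h =>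
    hp.1.1.ne_top (Ideal.eq_top_of_isUnit_mem _ h (IsLocalization.Away.algebraMap_isUnit s))
  have hcg : c ∈ genericElements 𝔟 := by
    refine mem_genericElements_of_localization (E := E) hs ?_
    rw [← hc]
    exact mul_mem ht (pow_mem hu n)
  have key : ∀ x ∈ N, ∃ m, s ^ m * c * x ∈ K := by
    intro x hx
    have h₁ : algebraMap R E (c * x) ∈ K.map (algebraMap R E) := by
      rw [map_mul, ← hc, mul_right_comm]
      exact Ideal.mul_mem_right _ _ (h x hx)
    obtain ⟨_, ⟨m, rfl⟩, h₂⟩ :=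
      (IsLocalization.algebraMap_mem_map_algebraMap_iff (Submonoid.powers s) E K _).1 h₁
    exact ⟨m, by rwa [← mul_assoc] at h₂⟩
  obtain ⟨G, hG⟩ := (isNoetherianRing_iff_ideal_fg _).1 ‹_› N
  choose! m hm using key
  refine ⟨s ^ (∑ g ∈ G, m g) * c, mul_mem (pow_mem hs _) hcg, fun x hx => ?_⟩
  rw [← hG] at hx
  induction hx using Submodule.span_induction with
  | mem g hg =>
    have := K.mul_mem_left (s ^ (∑ g ∈ G, m g - m g)) (hm g (hG ▸ Ideal.subset_span hg))
    rwa [mul_assoc, ← mul_assoc, ← pow_add,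
      Nat.sub_add_cancel (Finset.single_le_sum (fun _ _ => Nat.zero_le _) hg), ← mul_assoc] at this
  | zero => rw [mul_zero]; exact K.zero_mem
  | add x y _ _ hx hy => rw [mul_add]; exact K.add_mem hx hy
  | smul a x _ hx =>
    rw [smul_eq_mul, mul_left_comm]
    exact K.mul_mem_left _ hx

end

/-- The ring `R` is a model of `(B' ⧸ L)[1/s]`, with reduced quotient `A`, a model of
`(B' ⧸ 𝔟)[1/s]`. The first six fields concern `R` and its universal property, the remaining ones are
the consequences for `A`, for radical ideals and for étale algebras that are used. -/
structure IsGenericModel {B' R A : Type u} [CommRing B'] [CommRing R] [CommRing A] (𝔟 : Ideal B')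
    (s : B') (L : Ideal B') (r : B' →+* R) (π : R →+* A) : Prop where
  noetherian : IsNoetherianRing R
  reduced : IsReduced A
  finiteType : r.FiniteType
  isUnit : IsUnit (r s)
  eq_zero : ∀ l ∈ L, r l = 0
  exists_lift : ∀ ⦃D : Type u⦄ [CommRing D] (v : B' →+* D), IsUnit (v s) → (∀ l ∈ L, v l = 0) →
    ∃ ρ : R →+* D, ρ.comp r = v
  exists_pow : ∀ a, ∃ n b, r s ^ n * a = r b
  surjective : Function.Surjective π
  ker : RingHom.ker π = 𝔟.map r
  generic : ∀ b, π (r b) ∈ genericElements (⊥ : Ideal A) → b ∈ genericElements 𝔟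
  radical : ∀ J : Ideal B', J.IsRadical → L ≤ J → (J.map r).IsRadical
  etale : ∀ ⦃C : Type u⦄ [CommRing C] (v : B' →+* C), v.Etale →
    ∀ β : A →+* C ⧸ 𝔟.map v, (∀ b, β (π (r b)) = Ideal.Quotient.mk _ (v b)) → β.Etale

lemma exists_isGenericModel {B' : Type u} [CommRing B'] [IsNoetherianRing B'] {𝔟 L : Ideal B'}
    {s : B'} (h𝔟 : 𝔟.IsRadical) (hs : s ∈ genericElements 𝔟) (hL : L ≤ 𝔟) :
    ∃ (R A : Type u) (_ : CommRing R) (_ : CommRing A) (r : B' →+* R) (π : R →+* A),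
      IsGenericModel 𝔟 s L r π := by
  let E := Localization.Away s
  have hE : IsNoetherianRing E := IsLocalization.isNoetherianRing (Submonoid.powers s) E ‹_›
  have hEt : Algebra.Etale B' E := Algebra.Etale.of_isLocalizationAway s
  let ι : B' →+* E := algebraMap B' E
  let q : E →+* E ⧸ L.map ι := Ideal.Quotient.mk _
  have hr : ∀ J : Ideal B', J.IsRadical → (J.map ι).IsRadical := fun J hJ =>
    isRadical_map_of_etale hJ
  refine ⟨E ⧸ L.map ι, E ⧸ 𝔟.map ι, inferInstance, inferInstance, q.comp ι,
    Ideal.Quotient.factor (Ideal.map_mono hL), ?_⟩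
  have hsu : IsUnit (ι s) := IsLocalization.Away.algebraMap_isUnit s
  refine ⟨inferInstance, (Ideal.isRadical_iff_quotient_reduced _).1 (hr 𝔟 h𝔟), ?_, hsu.map q, ?_, ?_,
    ?_, Ideal.Quotient.factor_surjective _, ?_, ?_, ?_, ?_⟩
  · refine RingHom.FiniteType.comp_surjective ?_ Ideal.Quotient.mk_surjective
    exact RingHom.finiteType_algebraMap.2 inferInstance
  · exact fun l hl => Ideal.Quotient.eq_zero_iff_mem.2 (Ideal.mem_map_of_mem ι hl)
  · intro D _ v hu hv
    let v' : E →+* D := IsLocalization.Away.lift s hu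
    have hv' : ∀ b, v' (ι b) = v b := fun b => IsLocalization.Away.lift_eq s hu b
    refine ⟨Ideal.Quotient.lift _ v' fun a ha => ?_, RingHom.ext hv'⟩
    have : L.map ι ≤ RingHom.ker v' := Ideal.map_le_iff_le_comap.2 fun l hl => by
      rw [Ideal.mem_comap, RingHom.mem_ker, hv', hv l hl]
    exact this ha
  · intro a
    obtain ⟨a, rfl⟩ := Ideal.Quotient.mk_surjective a
    obtain ⟨n, b, h⟩ := IsLocalization.Away.surj s a
    refine ⟨n, b, ?_⟩
    change q (ι s) ^ n * q a = q (ι b)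
    rw [← map_pow, ← map_mul, mul_comm, ← h]
  · rw [Ideal.Quotient.factor_ker, Ideal.map_map]
  · intro b hb
    refine mem_genericElements_of_localization (E := E) hs ?_
    have h₁ : 𝔟.map ι = (⊥ : Ideal (E ⧸ 𝔟.map ι)).comap (Ideal.Quotient.mk (𝔟.map ι)) := by
      rw [← RingHom.ker_eq_comap_bot, Ideal.mk_ker]
    change ι b ∈ genericElements (𝔟.map ι)
    rw [h₁]
    exact (mem_genericElements_comap Ideal.Quotient.mk_surjective _ _).2 hb
  · intro J hJ hLJ x ⟨n, hx⟩
    obtain ⟨x, rfl⟩ := Ideal.Quotient.mk_surjective x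
    have hc : (J.map (q.comp ι)).comap q = J.map ι := by
      rw [← Ideal.map_map, Ideal.comap_map_of_surjective _ Ideal.Quotient.mk_surjective,
        ← RingHom.ker_eq_comap_bot, Ideal.mk_ker]
      exact sup_eq_left.2 (Ideal.map_mono hLJ)
    have h₁ : x ^ n ∈ (J.map (q.comp ι)).comap q := by
      rw [Ideal.mem_comap, map_pow]
      exact hx
    rw [hc] at h₁
    have h₂ : x ∈ (J.map (q.comp ι)).comap q := hc ▸ hr J hJ ⟨n, h₁⟩
    exact h₂
  · intro C _ v hv β hβ
    algebraize [v]
    have : Algebra.Etale B' C := hv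
    have i₁ : Algebra.Etale (B' ⧸ 𝔟) (E ⧸ 𝔟.map ι) := etale_quotient (C := E) 𝔟
    have i₂ : Algebra.Etale (B' ⧸ 𝔟) (C ⧸ 𝔟.map (algebraMap B' C)) := etale_quotient (C := C) 𝔟
    let _ : Algebra (E ⧸ 𝔟.map ι) (C ⧸ 𝔟.map (algebraMap B' C)) := β.toAlgebra
    have : IsScalarTower (B' ⧸ 𝔟) (E ⧸ 𝔟.map ι) (C ⧸ 𝔟.map (algebraMap B' C)) :=
      .of_algebraMap_eq fun b => by
        obtain ⟨b, rfl⟩ := Ideal.Quotient.mk_surjective b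
        exact (hβ b).symm
    exact Algebra.Etale.of_restrictScalars (B' ⧸ 𝔟) (E ⧸ 𝔟.map ι) (C ⧸ 𝔟.map (algebraMap B' C))

section
variable {B' R A Q : Type u} [CommRing B'] [CommRing R] [CommRing A] [AddCommGroup Q] [Module R Q]
  [Module Rᵐᵒᵖ Q] [IsCentralScalar R Q] [Module A Q] {𝔟 : Ideal B'} {s : B'} {L : Ideal B'}
  {r : B' →+* R} {π : R →+* A}

namespace IsGenericModel
variable (M : IsGenericModel 𝔟 s L r π)
include M

lemma exists_pow_of_mem {I : Ideal B'} {a : R} (ha : a ∈ I.map r) :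
    ∃ n, ∃ b ∈ I, r s ^ n * a = r b := by
  induction ha using Submodule.span_induction with
  | mem x hx =>
    obtain ⟨b, hb, rfl⟩ := hx
    exact ⟨0, b, hb, by simp⟩
  | zero => exact ⟨0, 0, I.zero_mem, by simp⟩
  | add x y _ _ hx hy =>
    obtain ⟨n, b, hb, h⟩ := hx
    obtain ⟨n', b', hb', h'⟩ := hy
    refine ⟨n + n', s ^ n' * b + s ^ n * b', I.add_mem (I.mul_mem_left _ hb) (I.mul_mem_left _ hb'), ?_⟩
    rw [map_add, map_mul, map_mul, ← h, ← h', map_pow, map_pow]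
    ring
  | smul a x _ hx =>
    obtain ⟨n, b, hb, h⟩ := hx
    obtain ⟨n', b', h'⟩ := M.exists_pow a
    refine ⟨n + n', b' * b, I.mul_mem_left _ hb, ?_⟩
    rw [map_mul, ← h, ← h', smul_eq_mul]
    ring

/-- Every generic element of `A` divides, up to units, the image of a generic element of `B'`. -/
lemma exists_of_mem_genericElements {a : A} (ha : a ∈ genericElements (⊥ : Ideal A)) :
    ∃ b ∈ genericElements 𝔟, ∃ n, π (r s) ^ n * a = π (r b) := by
  obtain ⟨a, rfl⟩ := M.surjective a
  obtain ⟨n, b, h⟩ := M.exists_pow a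
  have h₁ : π (r s) ^ n * π a = π (r b) := by rw [← map_pow, ← map_mul, h]
  refine ⟨b, M.generic b ?_, n, h₁⟩
  rw [← h₁]
  refine mul_mem (pow_mem (fun p hp h => ?_) n) ha
  exact hp.1.1.ne_top (Ideal.eq_top_of_isUnit_mem _ h (M.isUnit.map π))

/-- An open dense subset of `Spec A` contains the preimage of some `D(b)`, with `b` generic. -/
lemma exists_isUnit_of_isUnit {a : A} (ha : a ∈ genericElements (⊥ : Ideal A)) :
    ∃ b ∈ genericElements 𝔟, ∀ ⦃D : Type u⦄ [CommRing D] (g : A →+* D),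
      IsUnit (g (π (r b))) → IsUnit (g a) := by
  obtain ⟨b, hb, n, h⟩ := M.exists_of_mem_genericElements ha
  refine ⟨b, hb, fun D _ g hg => ?_⟩
  rw [← h, map_mul] at hg
  exact isUnit_of_mul_isUnit_right hg

/-- Every element of `R + Q` which is generic modulo the preimage of `ker π` divides, up to units,
the image of a generic element of `B'`. -/
lemma exists_isUnit_of_isUnit_inl {c : TrivSqZeroExt R Q}
    (hc : c ∈ genericElements ((RingHom.ker π).comap (TrivSqZeroExt.fstHom R R Q).toRingHom)) :
    ∃ b ∈ genericElements 𝔟, ∀ ⦃D : Type u⦄ [CommRing D] (σ : TrivSqZeroExt R Q →+* D),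
      IsUnit (σ (TrivSqZeroExt.inl (r b))) → IsUnit (σ c) := by
  have hs : Function.Surjective (TrivSqZeroExt.fstHom R R Q).toRingHom :=
    fun a => ⟨TrivSqZeroExt.inl a, rfl⟩
  rw [mem_genericElements_comap hs, RingHom.ker_eq_comap_bot,
    mem_genericElements_comap M.surjective] at hc
  change π c.fst ∈ _ at hc
  obtain ⟨n, b, h⟩ := M.exists_pow c.fst
  refine ⟨b, M.generic b ?_, fun D _ σ hσ => ?_⟩
  · rw [← h, map_mul, map_pow]
    refine mul_mem (pow_mem (fun p hp h => ?_) n) hc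
    exact hp.1.1.ne_top (Ideal.eq_top_of_isUnit_mem _ h (M.isUnit.map π))
  · rw [← h, TrivSqZeroExt.inl_mul, map_mul] at hσ
    have h₁ := isUnit_of_mul_isUnit_right hσ
    have h₂ : c * (TrivSqZeroExt.inl c.fst - TrivSqZeroExt.inr c.snd) =
        TrivSqZeroExt.inl c.fst * TrivSqZeroExt.inl c.fst := by
      refine TrivSqZeroExt.ext ?_ ?_ <;> simp
    have h₃ := h₁.mul h₁
    rw [← map_mul, ← h₂, map_mul] at h₃
    exact isUnit_of_mul_isUnit_left h₃

end IsGenericModel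

open TrivSqZeroExt in
/-- Let `L` be an ideal of `R + Q` contained in `I + Q`, and suppose that `(I + Q) ⧸ (L + I)` is
split after inverting `s`.  A homomorphism `R ⟶ D` which vanishes on `I ∩ L` and inverts `s` then
extends to a homomorphism `R + Q ⟶ D` which vanishes on `L`. -/
lemma exists_extension_of_isSplitAt {I : Ideal R} {L : Ideal (TrivSqZeroExt R Q)}
    (hQ : ∀ (a : R) (q : Q), π a • q = a • q) (hI : I ≤ RingHom.ker π)
    (hLI : L ≤ I.comap (fstHom R R Q).toRingHom)
    (hmul : (RingHom.ker π).comap (fstHom R R Q).toRingHom *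
      I.comap (fstHom R R Q).toRingHom = ⊥) {s : TrivSqZeroExt R Q}
    (hs : IsSplitAt (I.comap (fstHom R R Q).toRingHom) (L ⊔ I.map (inlHom R Q))
      ((RingHom.ker π).comap (fstHom R R Q).toRingHom) s) {D : Type u} [CommRing D] (ρ : R →+* D)
    (hρ : ∀ a ∈ I, inl a ∈ L → ρ a = 0) (hu : IsUnit (ρ s.fst)) (hsq : I.map ρ * I.map ρ = ⊥) :
    ∃ σ : TrivSqZeroExt R Q →+* D, (∀ a, σ (inl a) = ρ a) ∧ (∀ q, σ (inr q) ∈ I.map ρ) ∧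
      ∀ l ∈ L, σ l = 0 := by
  obtain ⟨n, φ, m, hm, hφ, hsplit⟩ := hs
  let I'' : Ideal (TrivSqZeroExt R Q) := I.comap (fstHom R R Q).toRingHom
  have hIQ : ∀ a ∈ I, ∀ q : Q, a • q = 0 := fun a ha q => by
    rw [← hQ, RingHom.mem_ker.1 (hI ha), zero_smul]
  -- the graph of an `R + Q`-linear map `I + Q ⟶ D`
  let P : I'' → D → Prop := fun x d => ∃ (c : Fin n → TrivSqZeroExt R Q) (l : TrivSqZeroExt R Q)
    (a : R), (∀ i, Ideal.Quotient.mk _ (c i) = φ x i) ∧ l ∈ L ∧ a ∈ I ∧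
      s * x.1 - ∑ i, c i * m i = l + inl a ∧ ρ a = d
  have hmulinl : ∀ (k : TrivSqZeroExt R Q), ∀ a ∈ I, k * inl a = inl (k.fst * a) := fun k a ha =>
    TrivSqZeroExt.ext (by simp) (by simp [hIQ a ha])
  have hex : ∀ x, ∃ d, P x d := by
    intro x
    obtain ⟨c, hc, h⟩ := hsplit x
    obtain ⟨l, hl, k, hk, h⟩ := Submodule.mem_sup.1 h
    have hk' : ∃ a ∈ I, inl a = k := by
      clear h
      induction hk using Submodule.span_induction with
      | mem k hk => exact hk
      | zero => exact ⟨0, I.zero_mem, inl_zero _⟩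
      | add x y _ _ hx hy =>
        obtain ⟨a, ha, rfl⟩ := hx
        obtain ⟨b, hb, rfl⟩ := hy
        exact ⟨a + b, I.add_mem ha hb, inl_add _ _ _⟩
      | smul b x _ hx =>
        obtain ⟨a, ha, rfl⟩ := hx
        exact ⟨b.fst * a, I.mul_mem_left _ ha, (hmulinl b a ha).symm⟩
    obtain ⟨a, ha, rfl⟩ := hk'
    exact ⟨ρ a, c, l, a, hc, hl, ha, h.symm, rfl⟩
  have huniq : ∀ x d d', P x d → P x d' → d = d' := by
    rintro x _ _ ⟨c, l, a, hc, hl, ha, h, rfl⟩ ⟨c', l', a', hc', hl', ha', h', rfl⟩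
    have h₁ : ∑ i, c i * m i = ∑ i, c' i * m i := by
      refine Finset.sum_congr rfl fun i _ => ?_
      rw [← sub_eq_zero, ← sub_mul]
      have h₂ := Ideal.mul_mem_mul (Ideal.Quotient.eq.1 ((hc i).trans (hc' i).symm)) (hm i)
      rw [hmul] at h₂
      exact h₂
    rw [h₁, h'] at h
    rw [← sub_eq_zero, ← map_sub]
    refine hρ _ (I.sub_mem ha ha') ?_
    have h₃ : (inl (a - a') : TrivSqZeroExt R Q) = l' - l := by
      rw [inl_sub]
      linear_combination -h
    rw [h₃]
    exact L.sub_mem hl' hl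
  have hadd : ∀ x y d d', P x d → P y d' → P (x + y) (d + d') := by
    rintro x y _ _ ⟨c, l, a, hc, hl, ha, h, rfl⟩ ⟨c', l', a', hc', hl', ha', h', rfl⟩
    refine ⟨c + c', l + l', a + a', fun i => ?_, L.add_mem hl hl', I.add_mem ha ha', ?_, map_add _ _ _⟩
    · rw [Pi.add_apply, map_add, map_add, Pi.add_apply, hc, hc']
    · simp only [Pi.add_apply, add_mul, Finset.sum_add_distrib, inl_add, Submodule.coe_add]
      linear_combination h + h'
  have hsmul : ∀ (k : TrivSqZeroExt R Q) x d, P x d → P (k • x) (ρ k.fst * d) := by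
    rintro k x _ ⟨c, l, a, hc, hl, ha, h, rfl⟩
    refine ⟨fun i => k * c i, k * l, k.fst * a, fun i => ?_, L.mul_mem_left _ hl,
      I.mul_mem_left _ ha, ?_, map_mul _ _ _⟩
    · rw [map_mul, hc, map_smul, Pi.smul_apply]
      rfl
    · rw [← hmulinl k a ha, ← mul_add, ← h, Submodule.coe_smul, smul_eq_mul, mul_sub, Finset.mul_sum]
      simp only [mul_assoc]
      rw [mul_left_comm]
  have hinl : ∀ a (ha : a ∈ I), P ⟨inl a, ha⟩ (ρ s.fst * ρ a) := by
    intro a ha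
    refine ⟨0, 0, s.fst * a, fun i => ?_, L.zero_mem, I.mul_mem_left _ ha, ?_, map_mul _ _ _⟩
    · rw [hφ ⟨inl a, ha⟩ (Ideal.mem_sup_right (Ideal.mem_map_of_mem (inlHom R Q) ha))]
      exact map_zero _
    · simp [hmulinl s a ha]
  have hL : ∀ l (hl : l ∈ L), P ⟨l, hLI hl⟩ 0 := by
    intro l hl
    refine ⟨0, s * l, 0, fun i => ?_, L.mul_mem_left _ hl, I.zero_mem, ?_, map_zero _⟩
    · rw [hφ ⟨l, hLI hl⟩ (Ideal.mem_sup_left hl)]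
      exact map_zero _
    · simp
  choose t ht using hex
  obtain ⟨u, hu⟩ := hu.exists_left_inv
  have hinr : ∀ q : Q, (inr q : TrivSqZeroExt R Q) ∈ I'' := fun q => I.zero_mem
  let τ : Q → D := fun q => u * t ⟨inr q, hinr q⟩
  have hτ_mem : ∀ q, τ q ∈ I.map ρ := by
    intro q
    obtain ⟨c, l, a, -, -, ha, -, h⟩ := ht ⟨inr q, hinr q⟩
    exact Ideal.mul_mem_left _ _ (h ▸ Ideal.mem_map_of_mem ρ ha)
  have hτ_add : ∀ q q', τ (q + q') = τ q + τ q' := by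
    intro q q'
    have h₁ : (⟨inr (q + q'), hinr _⟩ : I'') = ⟨inr q, hinr q⟩ + ⟨inr q', hinr q'⟩ :=
      Subtype.ext (inr_add _ _ _)
    simp only [τ]
    rw [huniq _ _ _ (ht ⟨inr (q + q'), hinr _⟩) (h₁ ▸ hadd _ _ _ _ (ht _) (ht _)), mul_add]
  have hτ_smul : ∀ a q, τ (a • q) = ρ a * τ q := by
    intro a q
    have h₁ : (⟨inr (a • q), hinr _⟩ : I'') = (inl a : TrivSqZeroExt R Q) • ⟨inr q, hinr q⟩ :=
      Subtype.ext (inl_mul_inr _ _).symm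
    simp only [τ]
    rw [huniq _ _ _ (ht ⟨inr (a • q), hinr _⟩) (h₁ ▸ hsmul _ _ _ (ht _)), fst_inl, mul_left_comm]
  have hτ_mul : ∀ q q', τ q * τ q' = 0 := by
    intro q q'
    have h₁ := Ideal.mul_mem_mul (hτ_mem q) (hτ_mem q')
    rw [hsq] at h₁
    exact h₁
  have hτ_zero : τ 0 = 0 := by simpa using hτ_add 0 0
  let σ : TrivSqZeroExt R Q →+* D :=
    { toFun := fun c => ρ c.fst + τ c.snd
      map_one' := by simp [hτ_zero]
      map_zero' := by simp [hτ_zero]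
      map_add' := fun c c' => by
        rw [fst_add, snd_add, map_add, hτ_add]
        ring
      map_mul' := fun c c' => by
        rw [fst_mul, snd_mul, map_mul, hτ_add, op_smul_eq_smul, hτ_smul, hτ_smul]
        linear_combination -hτ_mul c.snd c'.snd }
  have hσ : ∀ c, σ c = ρ c.fst + τ c.snd := fun _ => rfl
  refine ⟨σ, fun a => ?_, fun q => ?_, fun l hl => ?_⟩
  · rw [hσ, fst_inl, snd_inl, hτ_zero, add_zero]
  · rw [hσ, fst_inr, snd_inr, map_zero, zero_add]
    exact hτ_mem q
  · have hl' : l.fst ∈ I := hLI hl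
    have h₁ : (⟨l, hLI hl⟩ : I'') = ⟨inl l.fst, hl'⟩ + ⟨inr l.snd, hinr _⟩ :=
      Subtype.ext (inl_fst_add_inr_snd_eq l).symm
    have h₂ := huniq _ _ _ (hL l hl) (h₁ ▸ hadd _ _ _ _ (hinl l.fst hl') (ht _))
    rw [hσ]
    calc ρ l.fst + τ l.snd = u * ρ s.fst * ρ l.fst + u * t ⟨inr l.snd, hinr _⟩ := by rw [hu, one_mul]
      _ = u * (ρ s.fst * ρ l.fst + t ⟨inr l.snd, hinr _⟩) := by ring
      _ = 0 := by rw [← h₂, mul_zero]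

end

/-! ### Liftings for the composite -/

/-- Ideals `I ≤ J` of a Noetherian ring define an extension pair. -/
lemma isExtensionPair_factor {D : Type u} [CommRing D] [IsNoetherianRing D] {I J : Ideal D}
    (hle : I ≤ J) (hJ : IsNilpotent J) (hr : J.IsRadical) (hmul : I * J = ⊥) :
    IsExtensionPair (Ideal.Quotient.mk I) (Ideal.Quotient.factor hle) := by
  refine ⟨‹_›, Ideal.Quotient.mk_surjective, Ideal.Quotient.factor_surjective hle, ?_, ?_,
    (Ideal.isRadical_iff_quotient_reduced J).1 hr, ?_⟩
  · rw [Ideal.mk_ker]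
    exact Situation.isNilpotent_of_pow_le (n := 1) (by rw [pow_one]; exact hle) hJ
  · obtain ⟨n, hn⟩ := hJ
    refine ⟨n, ?_⟩
    rw [Ideal.Quotient.factor_ker, ← Ideal.map_pow, hn]
    exact Ideal.map_bot
  · have : (Ideal.Quotient.factor hle).comp (Ideal.Quotient.mk I) = Ideal.Quotient.mk J := rfl
    rw [this, Ideal.mk_ker, Ideal.mk_ker, hmul]

/-- If `I ⧸ K` is split at a unit, it is a projective `R ⧸ 𝔟`-module. -/
lemma IsSplitAt.projective_map {R : Type*} [CommRing R] {I K 𝔟 : Ideal R} {s : R}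
    (h : IsSplitAt I K 𝔟 s) (hs : IsUnit s) {I' : Ideal (R ⧸ K)}
    (hI' : I' = I.map (Ideal.Quotient.mk K)) [Module (R ⧸ 𝔟) I']
    (hsm : ∀ (c : R) (m : I'), Ideal.Quotient.mk 𝔟 c • m = Ideal.Quotient.mk K c • m) :
    Module.Projective (R ⧸ 𝔟) I' := by
  obtain ⟨n, φ, m, hm, hφ, hsplit⟩ := h
  obtain ⟨u, hu⟩ := hs.exists_left_inv
  have hmem : ∀ x : I', ∃ y : I, Ideal.Quotient.mk K y.1 = x := by
    intro x
    have hx : x.1 ∈ I.map (Ideal.Quotient.mk K) := hI' ▸ x.2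
    obtain ⟨y, hy, h⟩ := (Ideal.mem_map_iff_of_surjective _ Ideal.Quotient.mk_surjective).1 hx
    exact ⟨⟨y, hy⟩, h⟩
  choose g hg using hmem
  have hφg : ∀ (x : I') (y : I), Ideal.Quotient.mk K y.1 = x → φ (g x) = φ y := by
    intro x y hy
    rw [← sub_eq_zero, ← map_sub]
    refine hφ _ ?_
    exact Ideal.Quotient.eq.1 ((hg x).trans hy.symm)
  let φ' : I' →ₗ[R ⧸ 𝔟] (Fin n → R ⧸ 𝔟) :=
    { toFun := fun x => φ (g x)
      map_add' := fun x y => by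
        rw [← map_add]
        refine hφg _ _ ?_
        rw [Submodule.coe_add, map_add, hg, hg]
        rfl
      map_smul' := fun c x => by
        obtain ⟨c, rfl⟩ := Ideal.Quotient.mk_surjective c
        have h₁ : φ (g (Ideal.Quotient.mk 𝔟 c • x)) = φ (c • g x) := by
          refine hφg _ _ ?_
          rw [Submodule.coe_smul, smul_eq_mul, map_mul, hg, hsm]
          rfl
        rw [h₁, map_smul]
        rfl }
  let m' : Fin n → I' := fun i => ⟨Ideal.Quotient.mk K (m i), hI' ▸ Ideal.mem_map_of_mem _ (hm i)⟩
  let ψ : (Fin n → R ⧸ 𝔟) →ₗ[R ⧸ 𝔟] I' :=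
    Ideal.Quotient.mk 𝔟 u • Fintype.linearCombination (R ⧸ 𝔟) m'
  refine Module.Projective.of_split φ' ψ (LinearMap.ext fun x => ?_)
  obtain ⟨c, hc, h⟩ := hsplit (g x)
  have h₁ : ∑ i, φ (g x) i • m' i = Ideal.Quotient.mk K s • x := by
    refine Subtype.ext ?_
    have h₂ : ∀ i, φ (g x) i • m' i = Ideal.Quotient.mk K (c i) • m' i := fun i => by
      rw [← hc, hsm]
    simp only [h₂]
    rw [Submodule.coe_smul, ← hg x, smul_eq_mul, ← map_mul, AddSubmonoidClass.coe_finsetSum]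
    refine Eq.trans ?_ (Ideal.Quotient.eq.2 h).symm
    rw [map_sum]
    rfl
  change Ideal.Quotient.mk 𝔟 u • Fintype.linearCombination (R ⧸ 𝔟) m' (φ (g x)) = x
  rw [Fintype.linearCombination_apply, h₁, hsm, smul_smul, ← map_mul, hu, map_one, one_smul]

namespace Situation
variable {W X Y : Fibred.{v, w} S} {e : W ⟶ X} {f : X ⟶ Y}
variable {ξ : Situation (e ≫ f)} {R : Type u} [CommRing R] {r : ξ.T₂.ring →+* R} {Q : Type u}
  [AddCommGroup Q] [Module R Q] [Module Rᵐᵒᵖ Q] [IsCentralScalar R Q]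
  {A : Type u} [CommRing A] [Module A Q] {π : R →+* A}
variable [hW : ∀ U, IsGroupoid (W.obj U)] [hX : ∀ U, IsGroupoid (X.obj U)]
  [hY : ∀ U, IsGroupoid (Y.obj U)]
variable {𝔟 : Ideal ξ.T₂.ring} {s₁ b : ξ.T₂.ring} {L₁ : Ideal ξ.T₂.ring}
  {𝓡 : ξ.Refinement r Q} {s₃ s₄ : TrivSqZeroExt R Q} {L₃ : Ideal (TrivSqZeroExt R Q)}

open TrivSqZeroExt in
/-- There is a lifting for the composite wherever the part of `M` in the kernel attached to the
auxiliary situation vanishes. -/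
lemma hasLift_of_isGood (M : IsGenericModel 𝔟 s₁ L₁ r π) (hL₁ : L₁ ≤ ξ.I) (hI : ξ.I ≤ 𝔟)
    (hmul : 𝔟 * ξ.I = ⊥) (hQ : ∀ (a : R) (q : Q), π a • q = a • q)
    (h₃ : 𝓡.situation.IsGood ((RingHom.ker π).comap (fstHom R R Q).toRingHom) s₃ L₃)
    (h₄ : IsSplitAt (ξ.extIdeal r Q ξ.I) (L₃ ⊔ (ξ.I.map r).map (inlHom R Q))
      ((RingHom.ker π).comap (fstHom R R Q).toRingHom) s₄)
    (hb₃ : ∀ ⦃D : Type u⦄ [CommRing D] (σ : TrivSqZeroExt R Q →+* D),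
      IsUnit (σ (inl (r b))) → IsUnit (σ s₃))
    (hb₄ : ∀ ⦃D : Type u⦄ [CommRing D] (σ : TrivSqZeroExt R Q →+* D),
      IsUnit (σ (inl (r b))) → IsUnit (σ s₄))
    {D : Type u} [CommRing D] (v : ξ.T₂.ring →+* D) (hs : IsUnit (v s₁)) (hb : IsUnit (v b))
    (hv : ∀ m ∈ ξ.I, inl (r m) ∈ L₃ → v m = 0) : ξ.HasLift v := by
  obtain ⟨ρ, rfl⟩ := M.exists_lift v hs fun l hl => hv l (hL₁ hl) (by
    rw [M.eq_zero l hl, inl_zero]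
    exact L₃.zero_mem)
  have hρ : ∀ a ∈ ξ.I.map r, inl a ∈ L₃ → ρ a = 0 := by
    intro a ha haL
    obtain ⟨n, m, hm, h⟩ := M.exists_pow_of_mem ha
    have h₁ : ρ (r m) = 0 := hv m hm (by
      rw [← h, inl_mul]
      exact L₃.mul_mem_left _ haL)
    rw [← h, map_mul, map_pow] at h₁
    exact (hs.pow n).mul_right_eq_zero.1 h₁
  have hsq : (ξ.I.map r).map ρ * (ξ.I.map r).map ρ = ⊥ := by
    rw [← Ideal.map_mul, ← Ideal.map_mul]
    have h₁ : ξ.I * ξ.I = ⊥ := le_bot_iff.1 (hmul ▸ Ideal.mul_mono_left hI)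
    rw [h₁, Ideal.map_bot, Ideal.map_bot]
  obtain ⟨σ, hσ, hσI, hσL⟩ := exists_extension_of_isSplitAt (I := ξ.I.map r) (L := L₃) (s := s₄) hQ
    (M.ker ▸ Ideal.map_mono hI) h₃.le (Refinement.mul_eq_bot hmul hI M.ker hQ) h₄ ρ hρ
    (hb₄ (ρ.comp (fstHom R R Q).toRingHom) hb) hsq
  have hσr : σ.comp ((inlHom R Q).comp r) = ρ.comp r := RingHom.ext fun x => hσ (r x)
  have H : 𝓡.situation.HasLift σ := h₃.hasLift σ (hb₃ σ (by rw [hσ]; exact hb)) hσL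
  rw [← hσr]
  refine 𝓡.hasLift_comp σ (fun c hc => ?_) H
  rw [hσr, ← Ideal.map_map, ← inl_fst_add_inr_snd_eq c, map_add, hσ]
  exact add_mem (Ideal.mem_map_of_mem ρ hc) (hσI _)

end Situation

/-- The tensor product of an étale `B'`-algebra with a `B'`-algebra `E`. -/
lemma exists_etale_pushout {B' E C : Type u} [CommRing B'] [CommRing E] [CommRing C]
    (i : B' →+* E) (v : B' →+* C) (hv : v.Etale) :
    ∃ (P : Type u) (_ : CommRing P) (w : E →+* P) (j : C →+* P), w.Etale ∧ w.comp i = j.comp v ∧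
      (∀ N : AddSubmonoid P, (∀ a c, w a * j c ∈ N) → ∀ x, x ∈ N) ∧
      ∀ ⦃D : Type u⦄ [CommRing D] (σ : E →+* D) (τ : C →+* D), σ.comp i = τ.comp v →
        ∃ h : P →+* D, h.comp w = σ ∧ h.comp j = τ := by
  algebraize [i, v]
  have : Algebra.Etale B' C := hv
  refine ⟨E ⊗[B'] C, inferInstance, algebraMap E (E ⊗[B'] C),
    (Algebra.TensorProduct.includeRight : C →ₐ[B'] E ⊗[B'] C).toRingHom,
    RingHom.etale_algebraMap.2 inferInstance, ?_, ?_, ?_⟩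
  · refine RingHom.ext fun x => ?_
    exact (Algebra.TensorProduct.algebraMap_apply' (R := B') (A := E) (B := C) x)
  · intro N hN x
    induction x using TensorProduct.induction_on with
    | zero => exact N.zero_mem
    | add x y hx hy => exact N.add_mem hx hy
    | tmul a c =>
      have := hN a c
      change (a ⊗ₜ[B'] (1 : C)) * ((1 : E) ⊗ₜ[B'] c) ∈ N at this
      rwa [Algebra.TensorProduct.tmul_mul_tmul, mul_one, one_mul] at this
  · intro D _ σ τ h
    algebraize [σ.comp i]
    let σ' : E →ₐ[B'] D := { σ with commutes' := fun _ => rfl }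
    let τ' : C →ₐ[B'] D := { τ with commutes' := fun x => (RingHom.congr_fun h x).symm }
    refine ⟨(Algebra.TensorProduct.productMap σ' τ').toRingHom, RingHom.ext fun a => ?_,
      RingHom.ext fun c => ?_⟩
    · exact Algebra.TensorProduct.productMap_left_apply σ' τ' a
    · exact Algebra.TensorProduct.productMap_right_apply σ' τ' c

namespace Situation
variable {W X Y : Fibred.{v, w} S} {e : W ⟶ X} {f : X ⟶ Y}
variable {ξ : Situation (e ≫ f)} {R : Type u} [CommRing R] {r : ξ.T₂.ring →+* R} {Q : Type u}
  [AddCommGroup Q] [Module R Q] [Module Rᵐᵒᵖ Q] [IsCentralScalar R Q]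
  {A : Type u} [CommRing A] [Module A Q] {π : R →+* A}
variable [hW : ∀ U, IsGroupoid (W.obj U)] [hX : ∀ U, IsGroupoid (X.obj U)]
  [hY : ∀ U, IsGroupoid (Y.obj U)]
variable {𝔟 : Ideal ξ.T₂.ring} {s₁ b : ξ.T₂.ring} {L₁ : Ideal ξ.T₂.ring}
  {𝓡 : ξ.Refinement r Q} {s₃ s₄ : TrivSqZeroExt R Q} {L₃ : Ideal (TrivSqZeroExt R Q)}

/-- For a homomorphism `R + Q ⟶ D` mapping `Q` to `KD`, the ideals of `D` generated by `K` and by its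
extension to `R + Q` agree. -/
lemma map_extIdeal {K : Ideal ξ.T₂.ring} {D : Type u} [CommRing D] {σ : TrivSqZeroExt R Q →+* D}
    {v : ξ.T₂.ring →+* D} (hσ : ∀ x, σ (TrivSqZeroExt.inl (r x)) = v x)
    (hσK : ∀ q, σ (TrivSqZeroExt.inr q) ∈ K.map v) : (ξ.extIdeal r Q K).map σ = K.map v := by
  have hv : σ.comp ((TrivSqZeroExt.inlHom R Q).comp r) = v := RingHom.ext hσ
  refine le_antisymm (Ideal.map_le_iff_le_comap.2 fun c hc => ?_) ?_
  · rw [Ideal.mem_comap, ← TrivSqZeroExt.inl_fst_add_inr_snd_eq c, map_add]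
    refine add_mem ?_ (hσK _)
    have h₁ := Ideal.mem_map_of_mem (σ.comp (TrivSqZeroExt.inlHom R Q)) (show c.fst ∈ K.map r from hc)
    rwa [Ideal.map_map, RingHom.comp_assoc, hv] at h₁
  · refine Ideal.map_le_iff_le_comap.2 fun x hx => ?_
    rw [Ideal.mem_comap, ← hσ]
    exact Ideal.mem_map_of_mem σ (Ideal.mem_map_of_mem r hx)

open TrivSqZeroExt in
/-- A lifting for the auxiliary situation over a quotient `C ⧸ K` of an étale `B'`-algebra glues to
a lifting over a quotient of the étale `R + Q`-algebra induced by `C`. -/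
lemma exists_genericElement_of_hasLift_situation (hW₁ : W.S1) (hX₁ : X.S1)
    (M : IsGenericModel 𝔟 s₁ L₁ r π) (hI : ξ.I ≤ 𝔟)
    [IsNoetherianRing (TrivSqZeroExt R Q)]
    (h₃ : 𝓡.situation.IsGood ((RingHom.ker π).comap (fstHom R R Q).toRingHom) s₃ L₃)
    (hb₃ : ∀ ⦃D : Type u⦄ [CommRing D] (σ : TrivSqZeroExt R Q →+* D),
      IsUnit (σ (inl (r b))) → IsUnit (σ s₃))
    {C : Type u} [CommRing C] [IsNoetherianRing C] {v : ξ.T₂.ring →+* C} (hv : v.Etale)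
    (hs : IsUnit (v s₁)) (hb : IsUnit (v b)) {K : Ideal C} (hK : K ≤ ξ.I.map v)
    {σ : TrivSqZeroExt R Q →+* C ⧸ K} (hσ : ∀ x, σ (inl (r x)) = (Ideal.Quotient.mk K).comp v x)
    (hσI : ∀ q, σ (inr q) ∈ ξ.I.map ((Ideal.Quotient.mk K).comp v)) {J : Ideal (C ⧸ K)}
    (hle : ξ.I.map ((Ideal.Quotient.mk K).comp v) ≤ J) (hJ : IsNilpotent J) (hr : J.IsRadical)
    (hmul : ξ.I.map ((Ideal.Quotient.mk K).comp v) * J = ⊥) (H : 𝓡.situation.HasLift σ) :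
    ∃ τ ∈ genericElements (𝔟.map v), ∀ m, inl (r m) ∈ L₃ → τ * v m ∈ K := by
  let 𝔟' : Ideal (TrivSqZeroExt R Q) := (RingHom.ker π).comap (fstHom R R Q).toRingHom
  obtain ⟨P, _, w, j, hw, hwj, hind, hlift⟩ :=
    exists_etale_pushout ((inlHom R Q).comp r) v hv
  have hwj' : ∀ x, w (inl (r x)) = j (v x) := RingHom.congr_fun hwj
  obtain ⟨g, hgw, hgj⟩ := hlift σ (Ideal.Quotient.mk K) (RingHom.ext hσ)
  have hgw' : ∀ x, g (w x) = σ x := RingHom.congr_fun hgw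
  have hgj' : ∀ x, g (j x) = Ideal.Quotient.mk K x := RingHom.congr_fun hgj
  have hg : Function.Surjective g := fun d => by
    obtain ⟨c, rfl⟩ := Ideal.Quotient.mk_surjective d
    exact ⟨j c, hgj' c⟩
  have hP : IsNoetherianRing P := by
    algebraize [w]
    have : Algebra.Etale (TrivSqZeroExt R Q) P := hw
    exact Algebra.FiniteType.isNoetherianRing (TrivSqZeroExt R Q) P
  let I' : Ideal P := (ξ.extIdeal r Q ξ.I).map w
  let K' : Ideal P := RingHom.ker g ⊓ I'
  let h : P ⧸ K' →+* C ⧸ K := Ideal.Quotient.lift K' g fun a ha => ha.1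
  have hcomp : h.comp ((Ideal.Quotient.mk K').comp w) = σ := RingHom.ext hgw'
  have hIσ : 𝓡.situation.I.map (h.comp ((Ideal.Quotient.mk K').comp w)) =
      ξ.I.map ((Ideal.Quotient.mk K).comp v) := by
    rw [hcomp]
    exact map_extIdeal hσ hσI
  have H' : 𝓡.situation.HasLift ((Ideal.Quotient.mk K').comp w) := by
    refine HasLift.of_ker_inf_eq_bot hW₁ hX₁ h
      (Ideal.Quotient.lift_surjective_of_surjective _ _ hg) ?_
      (Ideal.Quotient.factor (hIσ.le.trans hle))
      (isExtensionPair_factor _ hJ hr ((congrArg (· * J) hIσ).trans hmul)) (H.of_comp_eq (RingHom.id _)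
        (fun x => (RingHom.congr_fun hcomp x).symm))
    intro x hx hx0
    have hx' : x ∈ I'.map (Ideal.Quotient.mk K') := by
      rw [Ideal.map_map]
      exact hx
    obtain ⟨y, hy, rfl⟩ :=
      (Ideal.mem_map_iff_of_surjective _ Ideal.Quotient.mk_surjective).1 hx'
    exact Ideal.Quotient.eq_zero_iff_mem.2 ⟨hx0, hy⟩
  obtain ⟨τ, hτ, hτL⟩ := h₃.etale w hw (hb₃ w (by rw [hwj']; exact hb.map j)) K' inf_le_right H'
  obtain ⟨t, ht⟩ := Ideal.Quotient.mk_surjective (g τ)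
  refine ⟨t, ?_, fun m hm => ?_⟩
  · have hKb : K ≤ 𝔟.map v := hK.trans (Ideal.map_mono hI)
    have hinl : ∀ x ∈ 𝔟, (inl (r x) : TrivSqZeroExt R Q) ∈ 𝔟' := fun x hx => by
      change r x ∈ RingHom.ker π
      rw [M.ker]
      exact Ideal.mem_map_of_mem r hx
    -- the two descriptions of `C ⧸ 𝔟C` agree
    have hbK : ((𝔟.map v).map (Ideal.Quotient.mk K)).comap (Ideal.Quotient.mk K) = 𝔟.map v := by
      rw [Ideal.comap_map_of_surjective _ Ideal.Quotient.mk_surjective, ← RingHom.ker_eq_comap_bot,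
        Ideal.mk_ker, sup_eq_left]
      exact hKb
    have hjb : 𝔟.map v ≤ (𝔟'.map w).comap j := by
      refine Ideal.map_le_iff_le_comap.2 fun x hx => ?_
      rw [Ideal.mem_comap, Ideal.mem_comap, ← hwj']
      exact Ideal.mem_map_of_mem w (hinl x hx)
    have hgen : ∀ x, ∃ c, x - j c ∈ 𝔟'.map w := by
      obtain ⟨u, hu⟩ := hs.exists_right_inv
      refine hind
        { carrier := {x | ∃ c, x - j c ∈ 𝔟'.map w}
          zero_mem' := ⟨0, by simp⟩
          add_mem' := fun {x y} ⟨c, hc⟩ ⟨c', hc'⟩ => ⟨c + c', by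
            rw [map_add, add_sub_add_comm]
            exact add_mem hc hc'⟩ } fun a c => ?_
      obtain ⟨n, x, hx⟩ := M.exists_pow a.fst
      refine ⟨v x * u ^ n * c, ?_⟩
      have h₁ : w a = w (inl a.fst) + w (inr a.snd) := by rw [← map_add, inl_fst_add_inr_snd_eq]
      have h₂ : w (inl a.fst) = j (v x * u ^ n) := by
        have h₃ : j (v s₁) ^ n * w (inl a.fst) = j (v x) := by
          rw [← hwj', ← hwj', ← map_pow, ← map_mul, inl_pow, ← inl_mul, hx]
        rw [map_mul, ← h₃, map_pow, mul_right_comm, ← mul_pow, ← map_mul, hu, map_one, one_pow,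
          one_mul]
      rw [map_mul, ← h₂, h₁, add_mul, add_sub_cancel_left]
      refine Ideal.mul_mem_right _ _ (Ideal.mem_map_of_mem w ?_)
      exact (RingHom.ker π).zero_mem
    have hmap : 𝔟'.map w ≤ ((𝔟.map v).map (Ideal.Quotient.mk K)).comap g := by
      refine Ideal.map_le_iff_le_comap.2 fun c hc => ?_
      rw [Ideal.mem_comap, Ideal.mem_comap, hgw', Ideal.map_map]
      have h₁ : (RingHom.ker π).comap (fstHom R R Q).toRingHom = ξ.extIdeal r Q 𝔟 := by
        rw [M.ker]
        rfl
      rw [← map_extIdeal (K := 𝔟) hσ fun q => Ideal.map_mono hI (hσI q), ← h₁]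
      exact Ideal.mem_map_of_mem σ hc
    have hcomap : 𝔟'.map w = ((𝔟.map v).map (Ideal.Quotient.mk K)).comap g := by
      refine le_antisymm hmap fun x hx => ?_
      obtain ⟨c, hc⟩ := hgen x
      have h₂ := sub_mem hx (hmap hc)
      rw [sub_sub_cancel, Ideal.mem_comap, hgj', ← Ideal.mem_comap, hbK] at h₂
      have h₃ := add_mem hc (hjb h₂)
      rwa [sub_add_cancel] at h₃
    rw [← hbK, mem_genericElements_comap Ideal.Quotient.mk_surjective, ht,
      ← mem_genericElements_comap hg, ← hcomap]
    exact hτ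
  · have h₁ : g (τ * w (inl (r m))) = 0 := (hτL _ hm).1
    rw [map_mul, hgw', hσ, ← ht] at h₁
    exact Ideal.Quotient.eq_zero_iff_mem.1 h₁

end Situation

lemma isRadical_map_mk {C : Type*} [CommRing C] {J K : Ideal C} (hJ : J.IsRadical) (hK : K ≤ J) :
    (J.map (Ideal.Quotient.mk K)).IsRadical := by
  have := Ideal.map_radical_of_surjective (Ideal.Quotient.mk_surjective (I := K)) (I := J)
    (by rw [Ideal.mk_ker]; exact hK)
  rw [hJ.radical] at this
  rw [this]
  exact Ideal.radical_isRadical _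

namespace Situation
open Tot
variable {W X Y : Fibred.{v, w} S} {e : W ⟶ X} {f : X ⟶ Y}
variable {ξ : Situation (e ≫ f)} {R : Type u} [CommRing R] {r : ξ.T₂.ring →+* R} {Q : Type u}
  [AddCommGroup Q] [Module R Q] [Module Rᵐᵒᵖ Q] [IsCentralScalar R Q]
  {A : Type u} [CommRing A] [Module A Q] {π : R →+* A}
variable [hW : ∀ U, IsGroupoid (W.obj U)] [hX : ∀ U, IsGroupoid (X.obj U)]
  [hY : ∀ U, IsGroupoid (Y.obj U)]
variable {𝔟 : Ideal ξ.T₂.ring} {s₁ b : ξ.T₂.ring} {L₁ : Ideal ξ.T₂.ring}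
  {𝓡 : ξ.Refinement r Q} {s₂ : A} {s₃ : TrivSqZeroExt R Q} {L₃ : Ideal (TrivSqZeroExt R Q)}

open TrivSqZeroExt in
/-- The case in which `M ⧸ K` is projective and the part of `M` in the kernel attached to the
situation over the second factor vanishes modulo `K`. -/
lemma exists_genericElement_of_isSplitAt (hW₁ : W.S1) (hX₁ : X.S1) (hY₁ : Y.S1)
    (hξ : ξ.IsAlgebraic) (h𝔟 : 𝔟.IsRadical) (hle : ξ.J ≤ 𝔟) (hmul : 𝔟 * ξ.I = ⊥)
    (M : IsGenericModel 𝔟 s₁ L₁ r π) [IsNoetherianRing (TrivSqZeroExt R Q)]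
    [IsNoetherianRing A] [IsReduced A]
    (h₃ : 𝓡.situation.IsGood ((RingHom.ker π).comap (fstHom R R Q).toRingHom) s₃ L₃)
    (hb₃ : ∀ ⦃D : Type u⦄ [CommRing D] (σ : TrivSqZeroExt R Q →+* D),
      IsUnit (σ (inl (r b))) → IsUnit (σ s₃))
    {x : X.Fib ((ξ.T₂.spec r).spec π)} (h𝓡 : 𝓡.IsVersal hX₁ hY₁ π x s₂)
    (hb₂ : ∀ ⦃D : Type u⦄ [CommRing D] (g : A →+* D), IsUnit (g (π (r b))) → IsUnit (g s₂))
    (hx : ∀ (B : Type u) [CommRing B] [Algebra A B] [Algebra.Etale A B] [IsNoetherianRing B]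
      [IsReduced B], X.DefCompatible hX₁ (U := (ξ.T₂.spec r).spec π) x A B ∧
        Y.DefCompatible hY₁ (U := (ξ.T₂.spec r).spec π) (fobj f x) A B)
    {C : Type u} [CommRing C] {v : ξ.T₂.ring →+* C} (hv : v.Etale)
    (hs : IsUnit (v s₁)) (hb : IsUnit (v b)) {K : Ideal C} (hK : K ≤ ξ.I.map v)
    (hL₁ : ∀ l ∈ L₁, v l ∈ K) {s : C} (hsu : IsUnit s)
    (hsplit : IsSplitAt (ξ.I.map v) K (𝔟.map v) s)
    (H : ξ.HasLift ((Ideal.Quotient.mk K).comp v)) :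
    ∃ τ ∈ genericElements (𝔟.map v), ∀ m, inl (r m) ∈ L₃ → τ * v m ∈ K := by
  have hB' := hξ.isNoetherianRing
  have hI : ξ.I ≤ 𝔟 := ξ.le.trans hle
  have hrad : ∀ J : Ideal ξ.T₂.ring, J.IsRadical → (J.map v).IsRadical := fun J hJ => by
    algebraize [v]
    have : Algebra.Etale ξ.T₂.ring C := hv
    exact isRadical_map_of_etale hJ
  have hC : IsNoetherianRing C := by
    algebraize [v]
    have : Algebra.Etale ξ.T₂.ring C := hv
    exact Algebra.FiniteType.isNoetherianRing ξ.T₂.ring C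
  let q : C →+* C ⧸ K := Ideal.Quotient.mk K
  obtain ⟨ρ, hρ⟩ := M.exists_lift (q.comp v) (hs.map q)
    fun l hl => Ideal.Quotient.eq_zero_iff_mem.2 (hL₁ l hl)
  have hρ' : ∀ y, ρ (r y) = q (v y) := RingHom.congr_fun hρ
  let B : Type u := C ⧸ 𝔟.map v
  let δ : C ⧸ K →+* B := Ideal.Quotient.factor (hK.trans (Ideal.map_mono hI))
  have hker : RingHom.ker π ≤ RingHom.ker (δ.comp ρ) := by
    rw [M.ker, Ideal.map_le_iff_le_comap]
    intro y hy
    rw [Ideal.mem_comap, RingHom.mem_ker, RingHom.comp_apply, hρ']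
    exact Ideal.Quotient.eq_zero_iff_mem.2 (Ideal.mem_map_of_mem v hy)
  let β : A →+* B := RingHom.liftOfSurjective π M.surjective ⟨δ.comp ρ, hker⟩
  have hβ : ∀ a, β (π a) = δ (ρ a) := fun a =>
    RingHom.liftOfRightInverse_comp_apply π _ _ ⟨δ.comp ρ, hker⟩ a
  have hβe : β.Etale := M.etale v hv β fun y => by
    rw [hβ, hρ']
    rfl
  let _ : Algebra A B := β.toAlgebra
  have : Algebra.Etale A B := hβe
  have hBr : IsReduced B := (Ideal.isRadical_iff_quotient_reduced _).1 (hrad 𝔟 h𝔟)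
  obtain ⟨hXB, hYB⟩ := hx B
  have hJr : ξ.J.IsRadical := (Ideal.isRadical_iff_quotient_reduced _).2 hξ.isReduced
  have hJ'r : (ξ.J.map (q.comp v)).IsRadical := by
    rw [← Ideal.map_map]
    exact isRadical_map_mk (hrad _ hJr) (hK.trans (Ideal.map_mono ξ.le))
  have hJ'n : IsNilpotent (ξ.J.map (q.comp v)) := by
    obtain ⟨n, hn⟩ := hξ.nilpotent
    refine ⟨n, ?_⟩
    rw [← Ideal.map_pow, hn]
    exact Ideal.map_bot
  have hJ'm : ξ.I.map (q.comp v) * ξ.J.map (q.comp v) = ⊥ := by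
    rw [← Ideal.map_mul, hξ.mul_eq_bot, Ideal.map_bot]
  have hIρ : ξ.I.map (ρ.comp r) = ξ.I.map (q.comp v) := by rw [hρ]
  have hIq : ξ.I.map (ρ.comp r) = (ξ.I.map v).map q := by rw [hIρ, Ideal.map_map]
  have hle' : ξ.I.map (q.comp v) ≤ ξ.J.map (q.comp v) := Ideal.map_mono ξ.le
  have hann : ∀ d, δ d = 0 → ∀ m ∈ ξ.I.map (ρ.comp r), d * m = 0 := by
    intro d hd m hm
    obtain ⟨c, rfl⟩ := Ideal.Quotient.mk_surjective d
    have hc : c ∈ 𝔟.map v := Ideal.Quotient.eq_zero_iff_mem.1 hd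
    have h₁ := Ideal.mul_mem_mul (Ideal.mem_map_of_mem q hc) (hIq ▸ hm)
    rw [← Ideal.map_mul, ← Ideal.map_mul, hmul, Ideal.map_bot, Ideal.map_bot] at h₁
    exact h₁
  obtain ⟨σ, hσ, hσI, Hσ⟩ := h𝓡 ρ δ (Ideal.Quotient.factor (hIρ.le.trans hle'))
    (isExtensionPair_factor _ hJ'n hJ'r (by rw [hIρ, hJ'm]))
    (Ideal.Quotient.factor_surjective _) (fun a => (hβ a).symm)
    (hb₂ β (by rw [hβ, hρ']; exact (hb.map q).map δ)) hXB hYB hann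
    (fun _ hsm => hsplit.projective_map hsu hIq fun c m => hsm (q c) m) (hρ ▸ H)
  rw [hρ] at hσI
  exact exists_genericElement_of_hasLift_situation hW₁ hX₁ M hI h₃ hb₃ hv hs hb hK
    (fun y => (hσ _).trans (hρ' y)) hσI hle' hJ'n hJ'r hJ'm Hσ

open TrivSqZeroExt in
/-- A lifting for the composite over a quotient of an étale `B'`-algebra factors, generically,
through the quotient by the part of `M` in the kernel attached to the auxiliary situation. -/
lemma exists_genericElement_of_hasLift (hW₁ : W.S1) (hX₁ : X.S1) (hY₁ : Y.S1)
    (hξ : ξ.IsAlgebraic) (h𝔟 : 𝔟.IsRadical) (hle : ξ.J ≤ 𝔟) (hmul : 𝔟 * ξ.I = ⊥)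
    (h₁ : ξ.image.IsGood 𝔟 s₁ L₁)
    (M : IsGenericModel 𝔟 s₁ L₁ r π) [IsNoetherianRing (TrivSqZeroExt R Q)]
    [IsNoetherianRing A] [IsReduced A]
    (h₃ : 𝓡.situation.IsGood ((RingHom.ker π).comap (fstHom R R Q).toRingHom) s₃ L₃)
    (hb₃ : ∀ ⦃D : Type u⦄ [CommRing D] (σ : TrivSqZeroExt R Q →+* D),
      IsUnit (σ (inl (r b))) → IsUnit (σ s₃))
    {x : X.Fib ((ξ.T₂.spec r).spec π)} (h𝓡 : 𝓡.IsVersal hX₁ hY₁ π x s₂)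
    (hb₂ : ∀ ⦃D : Type u⦄ [CommRing D] (g : A →+* D), IsUnit (g (π (r b))) → IsUnit (g s₂))
    (hx : ∀ (B : Type u) [CommRing B] [Algebra A B] [Algebra.Etale A B] [IsNoetherianRing B]
      [IsReduced B], X.DefCompatible hX₁ (U := (ξ.T₂.spec r).spec π) x A B ∧
        Y.DefCompatible hY₁ (U := (ξ.T₂.spec r).spec π) (fobj f x) A B)
    {C : Type u} [CommRing C] {v : ξ.T₂.ring →+* C} (hv : v.Etale)
    (hs : IsUnit (v s₁)) (hb : IsUnit (v b)) {K : Ideal C} (hK : K ≤ ξ.I.map v)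
    (H : ξ.HasLift ((Ideal.Quotient.mk K).comp v)) :
    ∃ τ ∈ genericElements (𝔟.map v), ∀ m, inl (r m) ∈ L₃ → τ * v m ∈ K := by
  have hB' := hξ.isNoetherianRing
  have hrad : (𝔟.map v).IsRadical := by
    algebraize [v]
    have : Algebra.Etale ξ.T₂.ring C := hv
    exact isRadical_map_of_etale h𝔟
  have hC : IsNoetherianRing C := by
    algebraize [v]
    have : Algebra.Etale ξ.T₂.ring C := hv
    exact Algebra.FiniteType.isNoetherianRing ξ.T₂.ring C
  obtain ⟨τ₁, hτ₁, hL₁⟩ := h₁.etale v hv hs K hK H.image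
  obtain ⟨τ₂, hτ₂, hsplit⟩ := exists_isSplitAt (I := ξ.I.map v) (K := K) hrad
    (by rw [← Ideal.map_mul, hmul, Ideal.map_bot]; exact bot_le)
  let E := Localization.Away (τ₁ * τ₂)
  have hEt : Algebra.Etale C E := Algebra.Etale.of_isLocalizationAway (τ₁ * τ₂)
  have hEf : Module.Flat C E := IsLocalization.flat E (Submonoid.powers (τ₁ * τ₂))
  let ι : C →+* E := algebraMap C E
  have hu : IsUnit (ι τ₁ * ι τ₂) := by
    rw [← map_mul]
    exact IsLocalization.Away.algebraMap_isUnit (τ₁ * τ₂)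
  have hsplit' := hsplit.map_of_flat (C := E) hK
  rw [Ideal.map_map, Ideal.map_map] at hsplit'
  have hK' : K.map ι ≤ ξ.I.map (ι.comp v) := by
    rw [← Ideal.map_map]
    exact Ideal.map_mono hK
  have hq : K ≤ (K.map ι).comap ι := Ideal.le_comap_map
  obtain ⟨t, ht, htL⟩ := exists_genericElement_of_isSplitAt hW₁ hX₁ hY₁ hξ h𝔟 hle hmul M h₃ hb₃ h𝓡
    hb₂ hx (v := ι.comp v)
    (RingHom.Etale.stableUnderComposition _ _ hv (RingHom.etale_algebraMap.2 hEt)) (hs.map ι)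
    (hb.map ι) hK' (fun l hl => by
      obtain ⟨w, hw⟩ := (isUnit_of_mul_isUnit_left hu).exists_left_inv
      have h₂ := (K.map ι).mul_mem_left w (Ideal.mem_map_of_mem ι (hL₁ l hl))
      rwa [map_mul, ← mul_assoc, hw, one_mul] at h₂)
    (isUnit_of_mul_isUnit_right hu) hsplit'
    (H.of_comp_eq (Ideal.quotientMap _ ι hq) fun _ => rfl)
  rw [← Ideal.map_map] at ht
  obtain ⟨c, hc, hcN⟩ := exists_genericElement_of_localization (E := E)
    (N := (L₃.comap ((inlHom R Q).comp r)).map v) (K := K) (mul_mem hτ₁ hτ₂) ht fun y hy => by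
      induction hy using Submodule.span_induction with
      | mem y hy =>
        obtain ⟨m, hm, rfl⟩ := hy
        exact htL m hm
      | zero => rw [map_zero, mul_zero]; exact zero_mem _
      | add y z _ _ hy hz => rw [map_add, mul_add]; exact add_mem hy hz
      | smul a y _ hy =>
        rw [smul_eq_mul, map_mul, mul_left_comm]
        exact Ideal.mul_mem_left _ _ hy
  exact ⟨c, hc, fun m hm => hcN _ (Ideal.mem_map_of_mem v hm)⟩

end Situation

/-- A homomorphism `g` to a field such that every element of the field is a quotient of an element of
the image by a power of one fixed element: the field is the residue field at a point of finite
type. -/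
lemma exists_residueField_equiv {A k : Type u} [CommRing A] [Field k] (g : A →+* k) {a : A}
    (ha : g a ≠ 0) (hg : ∀ y, ∃ c n, y * g a ^ n = g c) :
    ∃ (p : PrimeSpectrum A) (θ : k ≃+* p.asIdeal.ResidueField), p.asIdeal = RingHom.ker g ∧
      (∀ x, θ (g x) = algebraMap A _ x) ∧ Algebra.FiniteType A p.asIdeal.ResidueField := by
  obtain ⟨p, hp⟩ : ∃ p : PrimeSpectrum A, p.asIdeal = RingHom.ker g :=
    ⟨⟨RingHom.ker g, RingHom.ker_isPrime g⟩, rfl⟩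
  let θ : p.asIdeal.ResidueField →+* k := Ideal.ResidueField.lift p.asIdeal g hp.le
    fun x hx => isUnit_iff_ne_zero.2 fun h => hx (hp.ge h)
  have hθ : ∀ x, θ (algebraMap A _ x) = g x := Ideal.ResidueField.lift_algebraMap _ _ _ _
  have hsurj : Function.Surjective θ := fun y => by
    obtain ⟨c, n, h⟩ := hg y
    refine ⟨algebraMap A _ c * (algebraMap A _ a)⁻¹ ^ n, ?_⟩
    rw [map_mul, map_pow, map_inv₀, hθ, hθ, ← h, inv_pow, mul_assoc,
      mul_inv_cancel₀ (pow_ne_zero n ha), mul_one]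
  let Θ := RingEquiv.ofBijective θ ⟨θ.injective, hsurj⟩
  refine ⟨p, Θ.symm, hp, fun x => ?_, ?_⟩
  · rw [RingEquiv.symm_apply_eq]
    exact (hθ x).symm
  · refine Algebra.FiniteType.of_surjective
      (Polynomial.aeval (R := A) (algebraMap A p.asIdeal.ResidueField a)⁻¹) fun y => ?_
    obtain ⟨c, n, h⟩ := hg (θ y)
    refine ⟨Polynomial.C c * Polynomial.X ^ n, θ.injective ?_⟩
    rw [map_mul, map_pow, Polynomial.aeval_C, Polynomial.aeval_X, map_mul, map_pow, map_inv₀, hθ,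
      hθ, ← h, inv_pow, mul_assoc, mul_inv_cancel₀ (pow_ne_zero n ha), mul_one]

namespace Situation
open Tot
variable {W X Y : Fibred.{v, w} S} {e : W ⟶ X} {f : X ⟶ Y}
variable {ξ : Situation (e ≫ f)} {R : Type u} [CommRing R] {r : ξ.T₂.ring →+* R} {Q : Type u}
  [AddCommGroup Q] [Module R Q] [Module Rᵐᵒᵖ Q] [IsCentralScalar R Q]
  {A : Type u} [CommRing A] [Module A Q] {π : R →+* A}
variable [hW : ∀ U, IsGroupoid (W.obj U)] [hX : ∀ U, IsGroupoid (X.obj U)]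
  [hY : ∀ U, IsGroupoid (Y.obj U)]
variable {𝔟 : Ideal ξ.T₂.ring} {s₁ b : ξ.T₂.ring} {L₁ : Ideal ξ.T₂.ring}
  {𝓡 : ξ.Refinement r Q} {s₂ : A} {s₃ : TrivSqZeroExt R Q} {L₃ : Ideal (TrivSqZeroExt R Q)}

open TrivSqZeroExt in
/-- The condition at points for a composite: a lifting over a local algebra `D` comes by versality
from one for the auxiliary situation, because deformations are compatible with the passage to the
residue field of `D`; so the part of `M` in the kernel attached to that situation vanishes in `D`. -/
lemma eq_zero_of_hasLift_of_isLocalRing (hX₁ : X.S1) (hY₁ : Y.S1)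
    [IsNoetherianRing ξ.T₂.ring] (hI : ξ.I ≤ 𝔟) (hmul : 𝔟 * ξ.I = ⊥)
    (h₁ : ξ.image.IsGoodAtPoints s₁ L₁) (M : IsGenericModel 𝔟 s₁ L₁ r π)
    [IsNoetherianRing A] [IsReduced A] (h₃ : 𝓡.situation.IsGoodAtPoints s₃ L₃)
    (hb₃ : ∀ ⦃D : Type u⦄ [CommRing D] (σ : TrivSqZeroExt R Q →+* D),
      IsUnit (σ (inl (r b))) → IsUnit (σ s₃))
    {x : X.Fib ((ξ.T₂.spec r).spec π)} (h𝓡 : 𝓡.IsVersal hX₁ hY₁ π x s₂)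
    (hb₂ : ∀ ⦃D : Type u⦄ [CommRing D] (g : A →+* D), IsUnit (g (π (r b))) → IsUnit (g s₂))
    (hx : ∀ p : PrimeSpectrum A, π (r b) ∉ p.asIdeal →
      Algebra.FiniteType A p.asIdeal.ResidueField →
        X.DefCompatible hX₁ (U := (ξ.T₂.spec r).spec π) x A p.asIdeal.ResidueField ∧
        Y.DefCompatible hY₁ (U := (ξ.T₂.spec r).spec π) (fobj f x) A p.asIdeal.ResidueField)
    {D : Type u} [CommRing D] [IsLocalRing D] (v : ξ.T₂.ring →+* D)
    (hnil : IsNilpotent (IsLocalRing.maximalIdeal D))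
    (hfrac : ∃ t, IsUnit (v t) ∧ ∀ d, ∃ b n, d * v t ^ n = v b) (hs : IsUnit (v s₁))
    (hb : IsUnit (v b)) (hann : IsLocalRing.maximalIdeal D * ξ.I.map v = ⊥) (H : ξ.HasLift v)
    {m : ξ.T₂.ring} (hm : m ∈ ξ.I) (hmL : inl (r m) ∈ L₃) : v m = 0 := by
  by_cases h𝔟 : 𝔟.map v ≤ IsLocalRing.maximalIdeal D
  swap
  · -- the closed point of `Spec D` does not lie in the support of `M`
    have h₂ : 𝔟.map v = ⊤ := by
      by_contra h
      exact h𝔟 (IsLocalRing.le_maximalIdeal h)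
    have h₃ : ξ.I.map v = ⊥ := by rw [← Ideal.top_mul (ξ.I.map v), ← h₂, ← Ideal.map_mul, hmul,
      Ideal.map_bot]
    exact (Submodule.mem_bot D).1 (h₃ ▸ Ideal.mem_map_of_mem v hm)
  have hL₁ := h₁ v hnil hfrac hs hann H.image
  obtain ⟨t, ht, hfrac⟩ := hfrac
  obtain ⟨ρ, hρ⟩ := M.exists_lift v hs hL₁
  have hρ' : ∀ y, ρ (r y) = v y := RingHom.congr_fun hρ
  have hD : IsNoetherianRing D := by
    have : IsNoetherianRing (Localization.Away t) :=
      IsLocalization.isNoetherianRing (Submonoid.powers t) _ ‹_›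
    let l : Localization.Away t →+* D := IsLocalization.Away.lift t ht
    have hl : ∀ y, l (algebraMap _ _ y) = v y := IsLocalization.Away.lift_eq t ht
    refine isNoetherianRing_of_surjective _ _ l fun d => ?_
    obtain ⟨y, n, h⟩ := hfrac d
    obtain ⟨u, hu⟩ := (IsLocalization.Away.algebraMap_isUnit (S := Localization.Away t) t).exists_right_inv
    refine ⟨algebraMap _ _ y * u ^ n, ?_⟩
    have h₂ : v t * l u = 1 := by rw [← hl, ← map_mul, hu, map_one]
    rw [map_mul, hl, ← h, map_pow, mul_assoc, ← mul_pow, h₂, one_pow, mul_one]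
  let res := IsLocalRing.residue D
  have hker : RingHom.ker π ≤ RingHom.ker (res.comp ρ) := by
    rw [M.ker, Ideal.map_le_iff_le_comap]
    intro y hy
    rw [Ideal.mem_comap, RingHom.mem_ker, RingHom.comp_apply, hρ']
    exact (IsLocalRing.residue_eq_zero_iff _).2 (h𝔟 (Ideal.mem_map_of_mem v hy))
  let g : A →+* IsLocalRing.ResidueField D :=
    RingHom.liftOfSurjective π M.surjective ⟨res.comp ρ, hker⟩
  have hg : ∀ a, g (π a) = res (ρ a) := fun a =>
    RingHom.liftOfRightInverse_comp_apply π _ _ ⟨res.comp ρ, hker⟩ a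
  obtain ⟨p, θ, hp, hθ, hft⟩ := exists_residueField_equiv g (a := π (r t))
    (by rw [hg, hρ']; exact (ht.map res).ne_zero) fun y => by
      obtain ⟨d, rfl⟩ := IsLocalRing.residue_surjective y
      obtain ⟨c, n, h⟩ := hfrac d
      refine ⟨π (r c), n, ?_⟩
      rw [hg, hg, hρ', hρ', ← h, map_mul, map_pow]
  have hgb : IsUnit (g (π (r b))) := by
    rw [hg, hρ']
    exact hb.map res
  obtain ⟨hXp, hYp⟩ := hx p (fun h => hgb.ne_zero (RingHom.mem_ker.1 (hp ▸ h))) hft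
  let δ : D →+* p.asIdeal.ResidueField := θ.toRingHom.comp res
  have hδ : ∀ d, δ d = 0 → d ∈ IsLocalRing.maximalIdeal D := fun d hd =>
    (IsLocalRing.residue_eq_zero_iff d).1 (θ.injective (hd.trans (map_zero θ).symm))
  have hIρ : ξ.I.map (ρ.comp r) = ξ.I.map v := by rw [hρ]
  have hle : ξ.I.map (ρ.comp r) ≤ IsLocalRing.maximalIdeal D :=
    hIρ.le.trans ((Ideal.map_mono hI).trans h𝔟)
  obtain ⟨σ, hσ, hσI, Hσ⟩ := h𝓡 ρ δ (Ideal.Quotient.factor hle)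
    (isExtensionPair_factor hle hnil (IsLocalRing.maximalIdeal.isMaximal D).isPrime.isRadical
      (by rw [hIρ, mul_comm, hann]))
    (θ.surjective.comp IsLocalRing.residue_surjective)
    (fun a => (congrArg θ (hg a)).symm.trans (hθ _))
    (hb₂ _ (by rw [← hθ]; exact hgb.map θ)) hXp hYp
    (fun d hd m hm => by
      have h₂ := Ideal.mul_mem_mul (hδ d hd) hm
      rw [hIρ, hann] at h₂
      exact h₂)
    (fun _ _ => inferInstance) (hρ ▸ H)
  have hσ' : ∀ y, σ (inl (r y)) = v y := fun y => (hσ _).trans (hρ' y)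
  rw [hIρ] at hσI
  rw [← hσ']
  refine h₃ σ hnil ⟨inl (r t), ?_, fun d => ?_⟩ (hb₃ σ (by rw [hσ']; exact hb)) ?_ Hσ _ hmL
  · exact (congrArg IsUnit (hσ' t)).mpr ht
  · obtain ⟨c, n, h⟩ := hfrac d
    exact ⟨inl (r c), n, (congrArg (d * · ^ n) (hσ' t)).trans (h.trans (hσ' c).symm)⟩
  · exact (congrArg (IsLocalRing.maximalIdeal D * ·) (map_extIdeal hσ' hσI)).trans hann

end Situation

/-! ### The pair of a composite -/

/-- A dense open subset contains some `D(s)`, with `s` avoiding all minimal primes. -/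
lemma exists_mem_genericElements_of_dense {A : Type*} [CommRing A] [IsNoetherianRing A]
    {V : Set (PrimeSpectrum A)} (hV : IsOpen V) (hd : Dense V) :
    ∃ s ∈ genericElements (⊥ : Ideal A), ∀ p : PrimeSpectrum A, s ∉ p.asIdeal → p ∈ V := by
  obtain ⟨𝔠, h𝔠⟩ := (PrimeSpectrum.isClosed_iff_zeroLocus_ideal _).1 hV.isClosed_compl
  have hmem : ∀ p : PrimeSpectrum A, p ∈ V ↔ ¬ 𝔠 ≤ p.asIdeal := fun p => by
    rw [← not_iff_not, not_not, ← Set.mem_compl_iff, h𝔠]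
    rfl
  obtain ⟨s, hs, hsg⟩ := exists_mem_genericElements (𝔟 := (⊥ : Ideal A)) (𝔠 := 𝔠) fun p hp hle => by
    let F := {q ∈ (⊥ : Ideal A).minimalPrimes | ¬ 𝔠 ≤ q}
    have hF : F.Finite :=
      ((⊥ : Ideal A).finite_minimalPrimes_of_isNoetherianRing A).subset fun q hq => hq.1
    let Z : Set (PrimeSpectrum A) := ⋃ q ∈ F, PrimeSpectrum.zeroLocus (q : Set A)
    have hZ : IsClosed Z := hF.isClosed_biUnion fun q _ => PrimeSpectrum.isClosed_zeroLocus _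
    have hVZ : V ⊆ Z := by
      intro q hq
      obtain ⟨q', hq', hle'⟩ := Ideal.exists_minimalPrimes_le (I := ⊥) (J := q.asIdeal) bot_le
      exact Set.mem_biUnion (show q' ∈ F from ⟨hq', fun h => (hmem q).1 hq (h.trans hle')⟩) hle'
    have hpZ := hZ.closure_subset_iff.2 hVZ (hd (⟨p, hp.1.1⟩ : PrimeSpectrum A))
    obtain ⟨q, hq, hqp⟩ := Set.mem_iUnion₂.1 hpZ
    exact hq.2 (hle.trans (hp.2 hq.1.1 hqp))
  exact ⟨s, hsg, fun p hp => (hmem p).2 fun h => hp (h hs)⟩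

namespace Situation
open Tot AffOver
variable {W X Y : Fibred.{v, w} S} {e : W ⟶ X} {f : X ⟶ Y}
variable [hW : ∀ U, IsGroupoid (W.obj U)] [hX : ∀ U, IsGroupoid (X.obj U)]
  [hY : ∀ U, IsGroupoid (Y.obj U)]

/-- The reduced quotient of a generic model is an `𝒪_S`-algebra of finite type. -/
lemma IsAlgebraic.isFiniteType_of_surjective {ξ : Situation (e ≫ f)} (h : ξ.IsAlgebraic)
    {𝔟 : Ideal ξ.T₂.ring} (hle : ξ.J ≤ 𝔟) {s : ξ.T₂.ring} {L : Ideal ξ.T₂.ring} {R A : Type u}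
    [CommRing R] [CommRing A] {r : ξ.T₂.ring →+* R} {π : R →+* A} (M : IsGenericModel 𝔟 s L r π) :
    ((ξ.T₂.spec r).spec π).IsFiniteType := by
  have hJ : ∀ y ∈ ξ.J, π.comp r y = 0 := fun y hy => by
    have : r y ∈ RingHom.ker π := M.ker ▸ Ideal.mem_map_of_mem r (hle hy)
    exact this
  refine AffOver.IsFiniteType.of_hom (factor (ξ.T₂.specHom (Ideal.Quotient.mk ξ.J))
    ((ξ.T₂.spec r).specHom π ≫ ξ.T₂.specHom r) (Ideal.Quotient.lift ξ.J (π.comp r) hJ) rfl) ?_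
    h.isFiniteType
  refine RingHom.FiniteType.of_comp_finiteType (f := Ideal.Quotient.mk ξ.J) ?_
  change (π.comp r).FiniteType
  exact M.finiteType.comp_surjective M.surjective

open TrivSqZeroExt in
/-- If `e` and `f` have compatible generic extenders, a deformation situation over `e ≫ f` has a good
pair: `L` consists of the elements of `M` whose image in `R + Q` lies in the ideal `L₃` of a good pair
of the auxiliary situation over `e`. -/
theorem exists_isGood_and_isGoodAtPoints_comp (hW₁ : W.S1) (hX₁ : X.S1) (hY₁ : Y.S1)
    (hX₂ : X.S2 hX₁) (hY₂ : Y.S2 hY₁) (hXi : X.DefEtaleCompatible hX₁)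
    (hYi : Y.DefEtaleCompatible hY₁) (hXiii : X.DefResidueCompatible hX₁)
    (hYiii : Y.DefResidueCompatible hY₁) (he : HasCompatibleGenericExtenders e)
    (hf : HasCompatibleGenericExtenders f) {ξ : Situation (e ≫ f)} (h : ξ.IsAlgebraic)
    {𝔟 : Ideal ξ.T₂.ring} (h𝔟 : 𝔟.IsRadical) (hle : ξ.J ≤ 𝔟) (hmul : 𝔟 * ξ.I = ⊥) :
    ∃ s L, ξ.IsGood 𝔟 s L ∧ ξ.IsGoodAtPoints s L := by
  have hN := h.isNoetherianRing
  have hI : ξ.I ≤ 𝔟 := ξ.le.trans hle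
  obtain ⟨s₁, L₁, h₁, h₁'⟩ : ∃ (s₁ : ξ.T₂.ring) (L₁ : Ideal ξ.T₂.ring), ξ.image.IsGood 𝔟 s₁ L₁ ∧
      ξ.image.IsGoodAtPoints s₁ L₁ :=
    exists_isGood_and_isGoodAtPoints (ξ := ξ.image) (𝔟 := 𝔟) hX₁ hY₁ hf ⟨h.isExtensionPair, h.isFiniteType⟩ h𝔟 hle hmul
  have hL₁ : L₁ ≤ ξ.I := h₁.le
  obtain ⟨R, A, _, _, r, π, M⟩ := exists_isGenericModel h𝔟 h₁.mem (hL₁.trans hI)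
  have hR := M.noetherian
  have hA : IsNoetherianRing A := isNoetherianRing_of_surjective _ _ π M.surjective
  have hAr := M.reduced
  let U := (ξ.T₂.spec r).spec π
  have hUn : IsNoetherianRing U.ring := hA
  have hUr : IsReduced U.ring := hAr
  have hU : U.IsFiniteType := h.isFiniteType_of_surjective hle M
  obtain ⟨Q, _, _, _, _, _, 𝓡, x, s₂, _, hQ, hs₂, h𝓡⟩ := exists_refinement hX₁ hY₁ M.surjective
    (h₁.hasLift r M.isUnit M.eq_zero) (fun x => hX₂ U hU x U.ring) (fun y => hY₂ U hU y U.ring)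
  have hRQ : Module.Finite R Q := by
    algebraize [π]
    have : IsScalarTower R A Q := ⟨fun a c q => by
      rw [Algebra.smul_def, mul_smul]
      exact hQ a _⟩
    have : Module.Finite R A :=
      Module.Finite.of_surjective (Algebra.linearMap R A) M.surjective
    exact Module.Finite.trans A Q
  have hRn : IsNoetherianRing (TrivSqZeroExt R Q) := DefModule.isNoetherianRing_sqZero
  let 𝔟' : Ideal (TrivSqZeroExt R Q) := (RingHom.ker π).comap (fstHom R R Q).toRingHom
  have hJr : ξ.J.IsRadical := (Ideal.isRadical_iff_quotient_reduced _).2 h.isReduced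
  have hJπ : ξ.J.map r ≤ RingHom.ker π := M.ker ▸ Ideal.map_mono hle
  have h𝔟' : 𝔟'.IsRadical := by
    refine Ideal.IsRadical.comap _ ?_
    rw [RingHom.ker_eq_comap_bot]
    exact Ideal.IsRadical.comap _ ((Ideal.isRadical_iff_quotient_reduced _).2
      (isReduced_of_injective _ (RingEquiv.quotientBot A).injective))
  have hmul' : 𝔟' * ξ.extIdeal r Q ξ.I = ⊥ := Refinement.mul_eq_bot hmul hI M.ker hQ
  obtain ⟨s₃, L₃, h₃, h₃'⟩ : ∃ (s₃ : TrivSqZeroExt R Q) (L₃ : Ideal (TrivSqZeroExt R Q)),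
      𝓡.situation.IsGood 𝔟' s₃ L₃ ∧ 𝓡.situation.IsGoodAtPoints s₃ L₃ :=
    exists_isGood_and_isGoodAtPoints (ξ := 𝓡.situation) (𝔟 := 𝔟') hW₁ hX₁ he (𝓡.isAlgebraic h M.finiteType (M.radical _ hJr (hL₁.trans ξ.le)) hJπ hQ) h𝔟'
    (Ideal.comap_mono hJπ) hmul'
  -- `s₄` serves to extend homomorphisms from `R` to `R + Q`, and `s₅` makes deformations compatible
  -- with residue fields
  obtain ⟨s₄, hs₄, h₄⟩ := exists_isSplitAt (I := ξ.extIdeal r Q ξ.I)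
    (K := L₃ ⊔ (ξ.I.map r).map (inlHom R Q)) h𝔟' (hmul'.le.trans bot_le)
  obtain ⟨V, hV, hVd, hVX⟩ := hXiii U hU x U.ring
  obtain ⟨V', hV', hVd', hVY⟩ := hYiii U hU (fobj f x) U.ring
  obtain ⟨s₅, hs₅, hs₅V⟩ := exists_mem_genericElements_of_dense (A := A) (hV.inter hV')
    (hVd.inter_of_isOpen_left hVd' hV)
  -- the finitely many generic elements of `A` and of `R + Q` are replaced by elements of `B'`
  obtain ⟨b₂, hb₂, hb₂u⟩ := M.exists_isUnit_of_isUnit (mul_mem hs₂ hs₅)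
  obtain ⟨b₃, hb₃, hb₃u⟩ := M.exists_isUnit_of_isUnit_inl (Q := Q) (mul_mem h₃.mem hs₄)
  let b := b₂ * b₃
  have hbA : ∀ ⦃D : Type u⦄ [CommRing D] (g : A →+* D), IsUnit (g (π (r b))) →
      IsUnit (g s₂ * g s₅) := fun D _ g hg => by
    rw [map_mul, map_mul, map_mul] at hg
    rw [← map_mul]
    exact hb₂u g (isUnit_of_mul_isUnit_left hg)
  have hbQ : ∀ ⦃D : Type u⦄ [CommRing D] (σ : TrivSqZeroExt R Q →+* D), IsUnit (σ (inl (r b))) →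
      IsUnit (σ s₃ * σ s₄) := fun D _ σ hσ => by
    rw [map_mul, inl_mul, map_mul] at hσ
    rw [← map_mul]
    exact hb₃u σ (isUnit_of_mul_isUnit_right hσ)
  have hb₂' : ∀ ⦃D : Type u⦄ [CommRing D] (g : A →+* D), IsUnit (g (π (r b))) → IsUnit (g s₂) :=
    fun D _ g hg => isUnit_of_mul_isUnit_left (hbA g hg)
  have hb₃' : ∀ ⦃D : Type u⦄ [CommRing D] (σ : TrivSqZeroExt R Q →+* D), IsUnit (σ (inl (r b))) →
      IsUnit (σ s₃) := fun D _ σ hσ => isUnit_of_mul_isUnit_left (hbQ σ hσ)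
  have hxp : ∀ p : PrimeSpectrum A, π (r b) ∉ p.asIdeal →
      Algebra.FiniteType A p.asIdeal.ResidueField →
        X.DefCompatible hX₁ (U := (ξ.T₂.spec r).spec π) x A p.asIdeal.ResidueField ∧
        Y.DefCompatible hY₁ (U := (ξ.T₂.spec r).spec π) (fobj f x) A p.asIdeal.ResidueField := by
    intro p hp hft
    have h₅ : IsUnit (algebraMap A p.asIdeal.ResidueField s₅) :=
      isUnit_of_mul_isUnit_right (hbA _ (isUnit_iff_ne_zero.2 fun h =>
        hp (Ideal.algebraMap_residueField_eq_zero.1 h)))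
    have hpV := hs₅V p fun h => h₅.ne_zero (Ideal.algebraMap_residueField_eq_zero.2 h)
    exact ⟨hVX p hpV.1 hft, hVY p hpV.2 hft⟩
  have hsplit : ∀ {D : Type u} [CommRing D] {v : ξ.T₂.ring →+* D}, IsUnit (v (s₁ * b)) →
      IsUnit (v s₁) ∧ IsUnit (v b) := fun hu => by
    rw [map_mul] at hu
    exact ⟨isUnit_of_mul_isUnit_left hu, isUnit_of_mul_isUnit_right hu⟩
  refine ⟨s₁ * b, ξ.I ⊓ L₃.comap ((inlHom R Q).comp r),
    ⟨inf_le_left, mul_mem h₁.mem (mul_mem hb₂ hb₃), fun D _ v hu hL => ?_,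
      fun C _ v hv hu K hK H => ?_⟩, fun D _ _ v hnil hfrac hu hann H m hm => ?_⟩
  · exact hasLift_of_isGood M hL₁ hI hmul hQ h₃ h₄ hb₃'
      (fun D _ σ hσ => isUnit_of_mul_isUnit_right (hbQ σ hσ)) v (hsplit hu).1 (hsplit hu).2
      fun m hm hmL => hL m ⟨hm, hmL⟩
  · obtain ⟨τ, hτ, hτL⟩ := exists_genericElement_of_hasLift hW₁ hX₁ hY₁ h h𝔟 hle hmul h₁ M h₃ hb₃'
      h𝓡 hb₂' (fun B _ _ _ _ _ => ⟨hXi U hU x U.ring B, hYi U hU (fobj f x) U.ring B⟩) hv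
      (hsplit hu).1 (hsplit hu).2 hK H
    exact ⟨τ, hτ, fun m hm => hτL m hm.2⟩
  · exact eq_zero_of_hasLift_of_isLocalRing hX₁ hY₁ hI hmul h₁' M h₃' hb₃' h𝓡 hb₂' hxp v hnil hfrac
      (hsplit hu).1 (hsplit hu).2 hann H hm.1 hm.2

end Situation

end

end ArtinStack

theorem mainTheorem3 {S : Scheme.{u}ᵒᵖ ⥤ Type u}
    (hS : ArtinStack.IsLocallyNoetherianAlgebraicSpace S)
    {W X Y : ArtinStack.Fibred.{v, w} S}
    (hW : ArtinStack.IsStackInGroupoids W) (hX : ArtinStack.IsStackInGroupoids X)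
    (hY : ArtinStack.IsStackInGroupoids Y)
    (hW₁ : W.S1) (hX₁ : X.S1) (hY₁ : Y.S1)
    (hW₂ : W.S2 hW₁) (hX₂ : X.S2 hX₁) (hY₂ : Y.S2 hY₁)
    (hWi : W.DefEtaleCompatible hW₁) (hXi : X.DefEtaleCompatible hX₁) (hYi : Y.DefEtaleCompatible hY₁)
    (hWiii : W.DefResidueCompatible hW₁) (hXiii : X.DefResidueCompatible hX₁) (hYiii : Y.DefResidueCompatible hY₁)
    (e : W ⟶ X) (f : X ⟶ Y)
    (he : ArtinStack.HasCompatibleGenericExtenders e)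
    (hf : ArtinStack.HasCompatibleGenericExtenders f) :
    ArtinStack.HasCompatibleGenericExtenders (e ≫ f) := by
  have := hW.isGroupoid
  have := hX.isGroupoid
  have := hY.isGroupoid
  intro ξ hξ 𝔞 h𝔞 hmul
  have hle : ξ.J ≤ 𝔞.comap (Ideal.Quotient.mk ξ.J) := by
    intro a ha
    rw [Ideal.mem_comap, Ideal.Quotient.eq_zero_iff_mem.2 ha]
    exact 𝔞.zero_mem
  have hmul' : 𝔞.comap (Ideal.Quotient.mk ξ.J) * ξ.I = ⊥ := (mul_comm _ _).trans hmul
  obtain ⟨s, L, h, hp⟩ := ArtinStack.Situation.exists_isGood_and_isGoodAtPoints_comp hW₁ hX₁ hY₁ hX₂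
    hY₂ hXi hYi hXiii hYiii he hf hξ (h𝔞.comap _) hle hmul'
  exact ArtinStack.Situation.exists_compatible_of_isGood (hξ.isAdapted hle hmul') h hp (h𝔞.comap _)
    rfl
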